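/- Consider oriented link diagrams $D$ in the plane, up to isotopy of the plane. A Kauffman state $s$ of $D$ is a choice, at each crossing, of the $A$-smoothing (which joins the two regions swept out by the over-strand when it is turned counterclockwise to the under-strand) or of the $A^{-1}$-smoothing; the result is a family of disjoint circles. These circles carry a piecewise orientation induced by $D$; the points where it changes are the break points: two at each crossing that is not smoothed according to the orientation, one on each of the two strands of the smoothing. Each circle has an even number of break points. A circle is of type $d$ if half of this number is odd, and of type $h$ if half of it is even. Let $\sigma(s)$ be the number of $A$-smoothings minus the number of $A^{-1}$-smoothings, $d(s)$ the number of $d$-circles, and $c(s)$ the configuration formed by the $h$-circles only. Let $C$ be the set of configurations of finitely many (possibly zero) disjoint unoriented embedded circles in the plane up to ambient isotopy, let $\Gamma$ be the free $\mathbb Z[A,A^{-1}]$-module on $C$, and put $$\langle D\rangle_{br}=\sum_{s} A^{\sigma(s)}(-A^2-A^{-2})^{d(s)}\,c(s)\in\Gamma .$$ Let $w(D)$ be the writhe and let $Sei(D)\in C$ be the configuration of all circles of the Seifert state, in which every crossing is smoothed according to the orientation. Two diagrams are braid-like isotopic if they are related by isotopies of the plane, Reidemeister moves of type II between two strands of the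 same direction, and Reidemeister moves of type III in which the three strands do not run coherently around the triangle. They are regularly isotopic if they are related by isotopies of the plane and arbitrary Reidemeister moves of types II and III. **Theorem.** The bracket $\langle D\rangle_{br}$ does not change when all orientations of $D$ are reversed, and it is invariant under braid-like isotopy. Put $V(D)=(-A)^{-3w(D)}\langle D\rangle_{br}$. 1. $V$ satisfies the skein relation of the Jones polynomial: if $D_+,D_-,D_0$ differ only near one crossing, which is positive in $D_+$, negative in $D_-$ and smoothed according to the orientation in $D_0$, then $$A^{4}V(D_+)-A^{-4}V(D_-)=(A^{-2}-A^{2})V(D_0),$$ that is, $t\,V(D_+)-t^{-1}V(D_-)=(t^{-1/2}-t^{1/2})V(D_0)$ with $A=t^{1/4}$. It has infinitely many initial conditions: $V$ takes infinitely many values on diagrams of the trivial knot, even on those that are regularly isotopic to the diagram without crossings. 2. Let $D$ be the standard diagram of the closure of a braid word on $n\ge 0$ strands, regarded as a diagram in the annulus that is the complement of the braid axis. Then $V(D)$ is the Hoste–Przytycki invariant $$(-A)^{-3w(D)}\sum_s A^{\sigma(s)}(-A^2-A^{-2})^{p(s)}z^{q(s)}\in\mathbb Z[A,A^{-1}][z]$$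 of the closed braid in the solid torus, where $p(s)$ and $q(s)$ are the numbers of circles of $s$ that are contractible, respectively not contractible, in the annulus, and where $z^k$ is identified with the configuration of $k$ concentric circles. 3. For every diagram $D$, $\langle D\rangle_{br}=A^{w(D)}\,Sei(D)+R$, where $R$ is a linear combination of configurations that have strictly fewer circles than $Sei(D)$. -/

import Mathlib

open scoped LaurentPolynomial

/-! ## Oriented link diagrams

A link diagram in the plane is drawn in general position with respect to the height function: it is a
stack, read from bottom to top, of finitely many layers. In each layer there is exactly one local
minimum (`cup`), local maximum (`cap`) or crossing, with vertical strands to its left and to its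
right. A strand is labelled `true` where it is oriented upwards and `false` where it is oriented
downwards. -/

/-- The non-trivial part of a layer.
* `cup o`: a local minimum whose left leg has label `o` (and whose right leg has label `!o`);
* `cap o`: a local maximum whose left leg has label `o`;
* `cross a b r`: a crossing of a strand with label `a`, which goes from bottom left to top right, and
  a strand with label `b`, which goes from bottom right to top left. The first of these two is the
  over-strand if `r = true`, and the second one is the over-strand if `r = false`. -/
inductive Piece : Type
  | cup (o : Bool) : Piece
  | cap (o : Bool) : Piece
  | cross (a b r : Bool) : Piece

namespace Piece

/-- Labels of the strands at the bottom. -/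
def src : Piece → List Bool
  | cup _ => []
  | cap o => [o, !o]
  | cross a b _ => [a, b]

/-- Labels of the strands at the top. -/
def tgt : Piece → List Bool
  | cup o => [o, !o]
  | cap _ => []
  | cross a b _ => [b, a]

def isCross : Piece → Bool
  | cross _ _ _ => true
  | _ => false

/-- The sign of a crossing (`0` for a cup or a cap): a crossing is positive if the direction of the
over-strand is turned counterclockwise, by an angle less than `π`, to that of the under-strand. -/
def sign : Piece → ℤ
  | cross a b r => if r = (a == b) then 1 else -1
  | _ => 0

/-- Reversal of the orientation. -/
def reverse : Piece → Piece
  | cup o => cup (!o)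
  | cap o => cap (!o)
  | cross a b r => cross (!a) (!b) r

end Piece

/-- A layer: a piece, with vertical strands to its left and to its right. -/
structure Layer : Type where
  left : List Bool
  piece : Piece
  right : List Bool

namespace Layer

def src (l : Layer) : List Bool := l.left ++ l.piece.src ++ l.right

def tgt (l : Layer) : List Bool := l.left ++ l.piece.tgt ++ l.right

def reverse (l : Layer) : Layer :=
  ⟨l.left.map not, l.piece.reverse, l.right.map not⟩

end Layer

/-- `IsTangle s w t`: the layers of `w` can be stacked, with the labels `s` at the bottom and the
labels `t` at the top. -/
def IsTangle : List Bool → List Layer → List Bool → Prop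
  | s, [], t => s = t
  | s, l :: w, t => s = l.src ∧ IsTangle l.tgt w t

/-- A diagram of an oriented link. -/
def Diagram : Type := {w : List Layer // IsTangle [] w []}

theorem IsTangle.append {s t r : List Bool} {w w' : List Layer} (h : IsTangle s w t)
    (h' : IsTangle t w' r) : IsTangle s (w ++ w') r := by
  induction w generalizing s with
  | nil => cases h; exact h'
  | cons l w ih => exact ⟨h.1, ih h.2⟩

theorem Layer.reverse_src (l : Layer) : l.reverse.src = l.src.map not := by
  rcases l with ⟨u, p, v⟩
  cases p <;> simp [Layer.reverse, Layer.src, Piece.reverse, Piece.src]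

theorem Layer.reverse_tgt (l : Layer) : l.reverse.tgt = l.tgt.map not := by
  rcases l with ⟨u, p, v⟩
  cases p <;> simp [Layer.reverse, Layer.tgt, Piece.reverse, Piece.tgt]

theorem IsTangle.reverse {s t : List Bool} {w : List Layer} (h : IsTangle s w t) :
    IsTangle (s.map not) (w.map Layer.reverse) (t.map not) := by
  induction w generalizing s with
  | nil => cases h; rfl
  | cons l w ih =>
    refine ⟨?_, ?_⟩
    · rw [Layer.reverse_src, h.1]
    · rw [Layer.reverse_tgt]; exact ih h.2

namespace Diagram

/-- The diagram with all orientations reversed. -/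
def reverse (D : Diagram) : Diagram := ⟨D.1.map Layer.reverse, D.2.reverse⟩

/-- The writhe: the sum of the signs of the crossings. -/
def writhe (D : Diagram) : ℤ := (D.1.map fun l => l.piece.sign).sum

/-- The diagram of the trivial knot without crossings. -/
def roundCircle : Diagram :=
  ⟨[⟨[], .cup true, []⟩, ⟨[], .cap true, []⟩], rfl, rfl, rfl⟩

end Diagram

/-! ## Moves -/

/-- The local moves that generate isotopies of diagrams in the plane: two pieces that lie side by
side exchange their heights; a local minimum and a local maximum that are adjacent on a strand cancel;
a local extremum slides through a crossing. -/
inductive PlanarMove : List Layer → List Layer → Prop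
  | exchange (u v w : List Bool) (p p' : Piece) :
      PlanarMove [⟨u, p, v ++ p'.src ++ w⟩, ⟨u ++ p.tgt ++ v, p', w⟩]
        [⟨u ++ p.src ++ v, p', w⟩, ⟨u, p, v ++ p'.tgt ++ w⟩]
  | zigzag (u v : List Bool) (a : Bool) :
      PlanarMove [⟨u, .cup a, a :: v⟩, ⟨u ++ [a], .cap (!a), v⟩] []
  | zagzig (u v : List Bool) (a : Bool) :
      PlanarMove [⟨u ++ [a], .cup (!a), v⟩, ⟨u, .cap a, a :: v⟩] []
  | slideCup (u v : List Bool) (a o r : Bool) :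
      PlanarMove [⟨u, .cup o, a :: v⟩, ⟨u ++ [o], .cross (!o) a r, v⟩]
        [⟨u ++ [a], .cup o, v⟩, ⟨u, .cross a o (!r), (!o) :: v⟩]
  | slideCap (u v : List Bool) (a o r : Bool) :
      PlanarMove [⟨u ++ [o], .cross a (!o) r, v⟩, ⟨u, .cap o, a :: v⟩]
        [⟨u, .cross o a (!r), (!o) :: v⟩, ⟨u ++ [a], .cap o, v⟩]

/-- The Reidemeister moves of type II: two strands with labels `a` and `b` that overlap in a bigon are
pulled apart. The two strands have the same direction if and only if `a = b`. -/
inductive MoveII : Bool → Bool → List Layer → List Layer → Prop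
  | mk (u v : List Bool) (a b r : Bool) :
      MoveII a b [⟨u, .cross a b r, v⟩, ⟨u, .cross b a (!r), v⟩] []

/-- The Reidemeister moves of type III: three strands `x`, `y`, `z` with labels `a`, `b`, `c` (from
left to right at the bottom) cross pairwise, and `y` is moved across the crossing of `x` and `z`.
Here `rxy = true` means that `x` runs over `y`, and so on; the two excluded cases are those where
none of the three strands is above the two others. -/
inductive MoveIII : Bool → Bool → Bool → List Layer → List Layer → Prop
  | mk (u v : List Bool) (a b c rxy rxz ryz : Bool) (h : ¬ (rxy = ryz ∧ rxz ≠ rxy)) :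
      MoveIII a b c
        [⟨u, .cross a b rxy, c :: v⟩, ⟨u ++ [b], .cross a c rxz, v⟩, ⟨u, .cross b c ryz, a :: v⟩]
        [⟨u ++ [a], .cross b c ryz, v⟩, ⟨u, .cross a c rxz, b :: v⟩, ⟨u ++ [c], .cross a b rxy, v⟩]

/-- The local moves of braid-like isotopies: the isotopies of the plane, the moves of type II of
two strands with the same direction, and the moves of type III except those where the three strands
run coherently around the triangle (that is, except for the labels up-down-up and down-up-down). -/
inductive BraidLikeMove : List Layer → List Layer → Prop
  | planar {x y : List Layer} : PlanarMove x y → BraidLikeMove x y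
  | moveII {x y : List Layer} (a : Bool) : MoveII a a x y → BraidLikeMove x y
  | moveIII {x y : List Layer} (a b c : Bool) (h : a = b ∨ b = c) :
      MoveIII a b c x y → BraidLikeMove x y

/-- The local moves of regular isotopies: the isotopies of the plane and all moves of type II and
III. -/
inductive RegularMove : List Layer → List Layer → Prop
  | planar {x y : List Layer} : PlanarMove x y → RegularMove x y
  | moveII {x y : List Layer} (a b : Bool) : MoveII a b x y → RegularMove x y
  | moveIII {x y : List Layer} (a b c : Bool) : MoveIII a b c x y → RegularMove x y

namespace Diagram

/-- Two diagrams differ by one local move. -/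
def Related (M : List Layer → List Layer → Prop) (D D' : Diagram) : Prop :=
  ∃ w x y w' : List Layer, M x y ∧ D.1 = w ++ x ++ w' ∧ D'.1 = w ++ y ++ w'

/-- Braid-like isotopy: the equivalence relation generated by the braid-like moves. -/
def BraidLikeIsotopic : Diagram → Diagram → Prop := Relation.EqvGen (Related BraidLikeMove)

/-- Regular isotopy: the equivalence relation generated by the moves of type II and III. -/
def RegularlyIsotopic : Diagram → Diagram → Prop := Relation.EqvGen (Related RegularMove)

end Diagram

/-! ## Pictures of disjoint circles, and configurations -/

/-- The parts of a picture without crossings. Besides minima and maxima there are the two ways to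
smooth a crossing: `vert` consists of two vertical strands and `horiz` of a maximum below a
minimum. -/
inductive Shape : Type
  | cup : Shape
  | cap : Shape
  | vert : Shape
  | horiz : Shape

def Shape.src : Shape → ℕ
  | cup => 0
  | _ => 2

def Shape.tgt : Shape → ℕ
  | cap => 0
  | _ => 2

/-- A layer of a picture: a shape, with vertical strands to its left and to its right. -/
structure Slice : Type where
  left : ℕ
  shape : Shape
  right : ℕ

def Slice.src (sl : Slice) : ℕ := sl.left + sl.shape.src + sl.right

def Slice.tgt (sl : Slice) : ℕ := sl.left + sl.shape.tgt + sl.right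

/-- `IsFlat m W n`: the slices of `W` can be stacked, with `m` strands at the bottom and `n` strands
at the top. -/
def IsFlat : ℕ → List Slice → ℕ → Prop
  | m, [], n => m = n
  | m, sl :: W, n => m = sl.src ∧ IsFlat sl.tgt W n

theorem IsFlat.append {m n k : ℕ} {W W' : List Slice} (h : IsFlat m W n) (h' : IsFlat n W' k) :
    IsFlat m (W ++ W') k := by
  induction W generalizing m with
  | nil => cases h; exact h'
  | cons sl W ih => exact ⟨h.1, ih h.2⟩

/-- A picture of finitely many disjoint unoriented circles in the plane. -/
def Picture : Type := {W : List Slice // IsFlat 0 W 0}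

/-- The local moves that generate isotopies of such pictures in the plane. -/
inductive FlatMove : List Slice → List Slice → Prop
  | exchange (u v w : ℕ) (p p' : Shape) :
      FlatMove [⟨u, p, v + p'.src + w⟩, ⟨u + p.tgt + v, p', w⟩]
        [⟨u + p.src + v, p', w⟩, ⟨u, p, v + p'.tgt + w⟩]
  | zigzag (u v : ℕ) : FlatMove [⟨u, .cup, v + 1⟩, ⟨u + 1, .cap, v⟩] []
  | zagzig (u v : ℕ) : FlatMove [⟨u + 1, .cup, v⟩, ⟨u, .cap, v + 1⟩] []
  | vert (u v : ℕ) : FlatMove [⟨u, .vert, v⟩] []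
  | horiz (u v : ℕ) : FlatMove [⟨u, .horiz, v⟩] [⟨u, .cap, v⟩, ⟨u, .cup, v⟩]

/-- Two pictures differ by one local move. -/
def Picture.Related (P P' : Picture) : Prop :=
  ∃ W X Y W' : List Slice, FlatMove X Y ∧ P.1 = W ++ X ++ W' ∧ P'.1 = W ++ Y ++ W'

/-- Configurations of disjoint unoriented embedded circles in the plane, up to ambient isotopy,
including the empty one: pictures modulo the equivalence relation generated by the moves. -/
def Config : Type := Quot Picture.Related

/-- `Arc k sl p q`: the points `p` and `q` are joined by a strand of the slice `sl` between the levels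
`k` and `k + 1`. The point `(k, i)` is the one at level `k` that has `i` points to its left. -/
inductive Arc (k : ℕ) : Slice → ℕ × ℕ → ℕ × ℕ → Prop
  | left (u v : ℕ) (p : Shape) (j : ℕ) (h : j < u) : Arc k ⟨u, p, v⟩ (k, j) (k + 1, j)
  | right (u v : ℕ) (p : Shape) (j : ℕ) (h : j < v) :
      Arc k ⟨u, p, v⟩ (k, u + p.src + j) (k + 1, u + p.tgt + j)
  | cup (u v : ℕ) : Arc k ⟨u, .cup, v⟩ (k + 1, u) (k + 1, u + 1)
  | cap (u v : ℕ) : Arc k ⟨u, .cap, v⟩ (k, u) (k, u + 1)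
  | vertLeft (u v : ℕ) : Arc k ⟨u, .vert, v⟩ (k, u) (k + 1, u)
  | vertRight (u v : ℕ) : Arc k ⟨u, .vert, v⟩ (k, u + 1) (k + 1, u + 1)
  | horizBelow (u v : ℕ) : Arc k ⟨u, .horiz, v⟩ (k, u) (k, u + 1)
  | horizAbove (u v : ℕ) : Arc k ⟨u, .horiz, v⟩ (k + 1, u) (k + 1, u + 1)

/-- The graph on the points of a picture whose edges are the arcs. (Pairs that are not points
of the picture are isolated vertices.) -/
def arcGraph (W : List Slice) : SimpleGraph (ℕ × ℕ) :=
  SimpleGraph.fromRel fun p q => ∃ k sl, W[k]? = some sl ∧ Arc k sl p q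

/-- The points of a closed picture, at the levels `0, …, W.length - 1`. -/
def points (W : List Slice) : Set (ℕ × ℕ) :=
  {p | ∃ sl, W[p.1]? = some sl ∧ p.2 < sl.src}

/-- The connected component of a point. -/
def comp (W : List Slice) (p : ℕ × ℕ) : (arcGraph W).ConnectedComponent :=
  (arcGraph W).connectedComponentMk p

/-- The circles of a picture. -/
def circles (W : List Slice) : Set (arcGraph W).ConnectedComponent := comp W '' points W

/-- The number of circles of a configuration, counted in one of its pictures. -/
noncomputable def Config.size (c : Config) : ℕ := (circles (Quot.out c).1).ncard

/-! ### Subpictures -/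

section Subpicture

open Classical in
/-- The number of points `(k, i), …, (k, i + m - 1)` that have the property `κ`. -/
noncomputable def keptCount (κ : ℕ × ℕ → Prop) (k i m : ℕ) : ℕ :=
  ((Finset.range m).filter fun j => κ (k, i + j)).card

open Classical in
/-- What remains of a slice between the levels `k` and `k + 1` when only the strands through
points with the property `κ` are kept. -/
noncomputable def Slice.restrict (κ : ℕ × ℕ → Prop) (k : ℕ) (sl : Slice) : List Slice :=
  let u := keptCount κ k 0 sl.left
  let v := keptCount κ k (sl.left + sl.shape.src) sl.right
  match sl.shape with
  | .cup => if κ (k + 1, sl.left) then [⟨u, .cup, v⟩] else []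
  | .cap => if κ (k, sl.left) then [⟨u, .cap, v⟩] else []
  | .vert => []
  | .horiz =>
    (if κ (k, sl.left) then [⟨u, .cap, v⟩] else []) ++
      (if κ (k + 1, sl.left) then [⟨u, .cup, v⟩] else [])

/-- What remains of a stack of slices that begins at level `k`. -/
noncomputable def restrictFrom (κ : ℕ × ℕ → Prop) : ℕ → List Slice → List Slice
  | _, [] => []
  | k, sl :: W => sl.restrict κ k ++ restrictFrom κ (k + 1) W

theorem keptCount_add (κ : ℕ × ℕ → Prop) (k i m n : ℕ) :
    keptCount κ k i (m + n) = keptCount κ k i m + keptCount κ k (i + m) n := by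
  classical
  simp only [keptCount, Finset.card_filter, Finset.sum_range_add, Nat.add_assoc]

theorem keptCount_two (κ : ℕ × ℕ → Prop) (k i : ℕ) [Decidable (κ (k, i))]
    [Decidable (κ (k, i + 1))] :
    keptCount κ k i 2 = (if κ (k, i) then 1 else 0) + (if κ (k, i + 1) then 1 else 0) := by
  classical
  simp only [keptCount, Finset.card_filter, Finset.sum_range_succ, Finset.sum_range_zero]
  simp

theorem keptCount_zero (κ : ℕ × ℕ → Prop) (k i : ℕ) : keptCount κ k i 0 = 0 := by
  simp [keptCount]

theorem keptCount_congr (κ : ℕ × ℕ → Prop) {k i k' i' m : ℕ}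
    (h : ∀ j < m, κ (k, i + j) ↔ κ (k', i' + j)) : keptCount κ k i m = keptCount κ k' i' m := by
  classical
  unfold keptCount
  congr 1
  ext j
  simp only [Finset.mem_filter, Finset.mem_range]
  exact and_congr_right fun hj => h j hj

theorem Slice.restrict_isFlat (κ : ℕ × ℕ → Prop) (k : ℕ) (sl : Slice)
    (h : ∀ p q, Arc k sl p q → (κ p ↔ κ q)) :
    IsFlat (keptCount κ k 0 sl.src) (sl.restrict κ k) (keptCount κ (k + 1) 0 sl.tgt) := by
  classical
  rcases sl with ⟨u, p, v⟩
  have hl : keptCount κ (k + 1) 0 u = keptCount κ k 0 u :=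
    keptCount_congr κ fun j hj => by
      simpa using (h _ _ (Arc.left u v p j hj)).symm
  have hr : keptCount κ (k + 1) (u + p.tgt) v = keptCount κ k (u + p.src) v :=
    keptCount_congr κ fun j hj => (h _ _ (Arc.right u v p j hj)).symm
  simp only [Slice.src, Slice.tgt, keptCount_add, Nat.zero_add]
  rw [hl, hr]
  cases p with
  | cup =>
    have h1 := h _ _ (Arc.cup u v)
    by_cases hk : κ (k + 1, u) <;>
      simp [Slice.restrict, IsFlat, Shape.src, Shape.tgt, Slice.src, Slice.tgt, keptCount_two,
        keptCount_zero, ← h1, hk]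
  | cap =>
    have h1 := h _ _ (Arc.cap u v)
    by_cases hk : κ (k, u) <;>
      simp [Slice.restrict, IsFlat, Shape.src, Shape.tgt, Slice.src, Slice.tgt, keptCount_two,
        keptCount_zero, ← h1, hk]
  | vert =>
    have h1 := h _ _ (Arc.vertLeft u v)
    have h2 := h _ _ (Arc.vertRight u v)
    simp [Slice.restrict, IsFlat, Shape.src, Shape.tgt, keptCount_two, h1, h2]
  | horiz =>
    have h1 := h _ _ (Arc.horizBelow u v)
    have h2 := h _ _ (Arc.horizAbove u v)
    by_cases hk : κ (k, u) <;> by_cases hk' : κ (k + 1, u) <;>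
    simp [Slice.restrict, IsFlat, Shape.src, Shape.tgt, Slice.src, Slice.tgt, keptCount_two,
        ← h1, ← h2, hk, hk']

theorem restrictFrom_isFlat (κ : ℕ × ℕ → Prop) (W : List Slice) (m n k : ℕ) (hW : IsFlat m W n)
    (h : ∀ j sl p q, W[j]? = some sl → Arc (k + j) sl p q → (κ p ↔ κ q)) :
    IsFlat (keptCount κ k 0 m) (restrictFrom κ k W) (keptCount κ (k + W.length) 0 n) := by
  induction W generalizing m k with
  | nil => cases hW; rfl
  | cons sl W ih =>
    have h0 := sl.restrict_isFlat κ k fun p q => h 0 sl p q rfl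
    have h1 := ih sl.tgt (k + 1) hW.2 fun j sl' p q hj ha =>
      h (j + 1) sl' p q (by simpa using hj) (by rwa [Nat.add_assoc, Nat.add_comm 1 j] at ha)
    have hm : m = sl.src := hW.1
    subst hm
    have e : k + 1 + W.length = k + (sl :: W).length := by simp; omega
    rw [e] at h1
    exact h0.append h1

/-- The picture that consists of the circles of `P` that belong to `K`. -/
noncomputable def Picture.sub (P : Picture) (K : Set (arcGraph P.1).ConnectedComponent) : Picture :=
  ⟨restrictFrom (fun p => comp P.1 p ∈ K) 0 P.1, by
    have h := restrictFrom_isFlat (fun p => comp P.1 p ∈ K) P.1 0 0 0 P.2 (by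
      intro j sl p q hj ha
      rw [Nat.zero_add] at ha
      have e : comp P.1 p = comp P.1 q := by
        by_cases hpq : p = q
        · rw [hpq]
        · refine SimpleGraph.ConnectedComponent.sound (SimpleGraph.Adj.reachable ?_)
          exact (SimpleGraph.fromRel_adj _ p q).2 ⟨hpq, Or.inl ⟨j, sl, hj, ha⟩⟩
      simp only [e])
    simpa [keptCount] using h⟩

end Subpicture

/-! ## Kauffman states -/

/-- What becomes of a piece when its crossing, if there is one, is `A`-smoothed (`A = true`) or
`A⁻¹`-smoothed (`A = false`). The `A`-smoothing joins the two regions that the over-strand sweeps out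
when it is turned counterclockwise to the under-strand. -/
def Piece.smooth (A : Bool) : Piece → Shape
  | .cup _ => .cup
  | .cap _ => .cap
  | .cross _ _ r => if A = r then .vert else .horiz

/-- The smoothing of the crossing is not compatible with the orientation. Then there is a break
point on each of the two strands of the smoothing. -/
def Piece.Broken (A : Bool) : Piece → Prop
  | .cross a b r => (A = r ∧ a ≠ b) ∨ (A ≠ r ∧ a = b)
  | _ => False

def Layer.smooth (A : Bool) (l : Layer) : Slice :=
  ⟨l.left.length, l.piece.smooth A, l.right.length⟩

namespace Diagram

/-- The crossings of a diagram. -/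
def Crossing (D : Diagram) : Type := {k : Fin D.1.length // (D.1.get k).piece.isCross = true}

instance (D : Diagram) : Fintype D.Crossing :=
  inferInstanceAs (Fintype {k : Fin D.1.length // (D.1.get k).piece.isCross = true})

instance (D : Diagram) : DecidableEq D.Crossing :=
  inferInstanceAs (DecidableEq {k : Fin D.1.length // (D.1.get k).piece.isCross = true})

/-- The layer of a crossing. -/
def Crossing.layer {D : Diagram} (x : D.Crossing) : Layer := D.1.get x.1

/-- A Kauffman state: each crossing is `A`-smoothed (`true`) or `A⁻¹`-smoothed (`false`). -/
abbrev State (D : Diagram) : Type := D.Crossing → Bool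

instance (D : Diagram) : Fintype D.State := Pi.instFintype

end Diagram

theorem IsTangle.smooth {s t : List Bool} {w : List Layer} (h : IsTangle s w t)
    (f : Fin w.length → Bool) :
    IsFlat s.length (List.ofFn fun k => (w.get k).smooth (f k)) t.length := by
  induction w generalizing s with
  | nil => cases h; rfl
  | cons l w ih =>
    rw [List.ofFn_succ]
    refine ⟨?_, ?_⟩
    · rw [h.1]
      rcases l with ⟨u, p, v⟩
      cases p <;>
        simp only [Layer.src, Piece.src, Slice.src, Layer.smooth, Piece.smooth, Shape.src,
          List.get_eq_getElem, Fin.val_zero, List.getElem_cons_zero, List.length_append,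
          List.length_cons, List.length_nil]
      split_ifs <;> rfl
    · have h2 := ih h.2 fun k => f k.succ
      have e : ((l :: w).get 0 |>.smooth (f 0)).tgt = l.tgt.length := by
        rcases l with ⟨u, p, v⟩
        cases p <;>
          simp only [Layer.tgt, Piece.tgt, Slice.tgt, Layer.smooth, Piece.smooth, Shape.tgt,
            List.get_eq_getElem, Fin.val_zero, List.getElem_cons_zero, List.length_append,
            List.length_cons, List.length_nil]
        split_ifs <;> rfl
      exact e ▸ h2

namespace Diagram.State

variable {D : Diagram}

/-- The smoothing in each layer (irrelevant in layers without crossing). -/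
def choice (s : D.State) (k : Fin D.1.length) : Bool :=
  if h : (D.1.get k).piece.isCross = true then s ⟨k, h⟩ else true

/-- The picture of a state: all crossings are smoothed. -/
def picture (s : D.State) : Picture :=
  ⟨List.ofFn fun k => (D.1.get k).smooth (s.choice k), D.2.smooth s.choice⟩

/-- The circles of the state are the elements of `circles s.picture.1`. -/
abbrev Component (s : D.State) : Type := (arcGraph s.picture.1).ConnectedComponent

/-- The number of break points on a circle. If the smoothing of a crossing in the layer `k`, with
`u` strands to its left, is not compatible with the orientation, then the two break points are on the
strand through the point `(k, u)` and on the strand through the point `(k + 1, u + 1)`. -/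
noncomputable def breakPoints (s : D.State) (c : s.Component) : ℕ :=
  {x : D.Crossing | x.layer.piece.Broken (s x) ∧
      comp s.picture.1 (x.1, x.layer.left.length) = c}.ncard +
    {x : D.Crossing | x.layer.piece.Broken (s x) ∧
      comp s.picture.1 (x.1 + 1, x.layer.left.length + 1) = c}.ncard

/-- The circles of type `d`: half of the number of break points is odd. -/
def dCircles (s : D.State) : Set s.Component :=
  {c ∈ circles s.picture.1 | Odd (s.breakPoints c / 2)}

/-- The circles of type `h`: half of the number of break points is even. -/
def hCircles (s : D.State) : Set s.Component :=
  {c ∈ circles s.picture.1 | Even (s.breakPoints c / 2)}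

/-- The number of `A`-smoothings minus the number of `A⁻¹`-smoothings. -/
def sigma (s : D.State) : ℤ := ∑ x, if s x = true then 1 else -1

/-- The configuration of the circles of type `h`. -/
noncomputable def config (s : D.State) : Config := Quot.mk _ (s.picture.sub s.hCircles)

end Diagram.State

/-! ## The bracket -/

/-- The free module over the Laurent polynomials in `A` (`A ^ n` is `T n`) on the configurations. -/
abbrev Gam : Type := Config →₀ ℤ[T;T⁻¹]

open LaurentPolynomial in
/-- The Laurent polynomial `-A² - A⁻²`. -/
noncomputable def loopValue : ℤ[T;T⁻¹] := -T 2 - T (-2)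

open LaurentPolynomial in
/-- The Laurent polynomial `(-A) ^ n`. -/
noncomputable def negAPow (n : ℤ) : ℤ[T;T⁻¹] := C (((-1 : ℤˣ) ^ n : ℤˣ) : ℤ) * T n

namespace Diagram

open LaurentPolynomial in
/-- The refined bracket. -/
noncomputable def bracket (D : Diagram) : Gam :=
  ∑ s : D.State, Finsupp.single s.config (T s.sigma * loopValue ^ s.dCircles.ncard)

/-- The bracket multiplied by `(-A) ^ (-3 w)`. -/
noncomputable def normalized (D : Diagram) : Gam := negAPow (-3 * D.writhe) • D.bracket

/-- The Seifert state: all crossings are smoothed with respect to the orientation, that is, the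
positive crossings are `A`-smoothed and the negative ones are `A⁻¹`-smoothed. -/
def seifertState (D : Diagram) : D.State := fun x => decide (x.layer.piece.sign = 1)

/-- The configuration of all circles of the Seifert state. -/
def seifert (D : Diagram) : Config := Quot.mk _ D.seifertState.picture

/-- The diagrams `Dp`, `Dm`, `D0` differ only near one crossing, which is positive in `Dp`, negative
in `Dm`, and smoothed with respect to the orientation in `D0`. -/
inductive SkeinTriple (Dp Dm D0 : Diagram) : Prop
  | parallel (w w' : List Layer) (u v : List Bool) (a : Bool)
      (hp : Dp.1 = w ++ [⟨u, .cross a a true, v⟩] ++ w')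
      (hm : Dm.1 = w ++ [⟨u, .cross a a false, v⟩] ++ w')
      (h0 : D0.1 = w ++ w')
  | antiparallel (w w' : List Layer) (u v : List Bool) (a : Bool)
      (hp : Dp.1 = w ++ [⟨u, .cross a (!a) false, v⟩] ++ w')
      (hm : Dm.1 = w ++ [⟨u, .cross a (!a) true, v⟩] ++ w')
      (h0 : D0.1 = w ++ [⟨u, .cap a, v⟩, ⟨u, .cup (!a), v⟩] ++ w')

end Diagram

/-! ## Closed braids and the invariant of links in the solid torus -/

/-- The closure of a braid on `n` strands, given by a word in the generators (`(i, true)` is the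
positive crossing of the strands `i` and `i + 1`, and `(i, false)` is the negative one; `i` is counted
from `0`). The strands of the braid are the `n` strands on the left, oriented upwards; they are closed
by `n` nested arcs which return on the right. -/
def closedBraidWord (n : ℕ) (β : List (Fin (n - 1) × Bool)) : List Layer :=
  ((List.range n).map fun k => ⟨List.replicate k true, .cup true, List.replicate k false⟩) ++
  (β.map fun g => ⟨List.replicate g.1 true, .cross true true g.2,
    List.replicate (n - 2 - g.1) true ++ List.replicate n false⟩) ++
  ((List.range n).reverse.map fun k => ⟨List.replicate k true, .cap true, List.replicate k false⟩)

theorem closedBraidWord_isTangle (n : ℕ) (β : List (Fin (n - 1) × Bool)) :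
    IsTangle [] (closedBraidWord n β) [] := by
  have h1 : ∀ n : ℕ, IsTangle [] ((List.range n).map fun k =>
      (⟨List.replicate k true, .cup true, List.replicate k false⟩ : Layer))
      (List.replicate n true ++ List.replicate n false) := by
    intro n
    induction n with
    | zero => rfl
    | succ n ih =>
      rw [List.range_succ, List.map_append]
      refine ih.append ⟨?_, ?_⟩
      · simp [Layer.src, Piece.src]
      · simp [IsTangle, Layer.tgt, Piece.tgt, List.replicate_succ' (n := n) (a := true),
          List.replicate_succ (n := n) (a := false)]
  have h3 : ∀ n : ℕ, IsTangle (List.replicate n true ++ List.replicate n false)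
      ((List.range n).reverse.map fun k =>
      (⟨List.replicate k true, .cap true, List.replicate k false⟩ : Layer)) [] := by
    intro n
    induction n with
    | zero => rfl
    | succ n ih =>
      rw [List.range_succ, List.reverse_append]
      refine ⟨?_, ?_⟩
      · simp [Layer.src, Piece.src, List.replicate_succ' (n := n) (a := true),
          List.replicate_succ (n := n) (a := false)]
      · simpa [Layer.tgt, Piece.tgt] using ih
  have h2 : IsTangle (List.replicate n true ++ List.replicate n false)
      (β.map fun g => (⟨List.replicate g.1 true, .cross true true g.2,
        List.replicate (n - 2 - g.1) true ++ List.replicate n false⟩ : Layer))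
      (List.replicate n true ++ List.replicate n false) := by
    have key : ∀ i : Fin (n - 1), List.replicate n true ++ List.replicate n false =
        List.replicate i.1 true ++ [true, true] ++
          (List.replicate (n - 2 - i.1) true ++ List.replicate n false) := by
      intro i
      have hi := i.2
      have e : n = i.1 + (2 + (n - 2 - i.1)) := by omega
      have e2 : List.replicate n true =
          List.replicate i.1 true ++ ([true, true] ++ List.replicate (n - 2 - i.1) true) := by
        conv_lhs => rw [e]
        rw [List.replicate_add, List.replicate_add]
        rfl
      rw [e2]
      simp
    induction β with
    | nil => rfl
    | cons g β ih =>
      refine ⟨key g.1, ?_⟩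
      have e : Layer.tgt ⟨List.replicate g.1 true, .cross true true g.2,
          List.replicate (n - 2 - g.1) true ++ List.replicate n false⟩ =
          List.replicate n true ++ List.replicate n false := (key g.1).symm
      exact e ▸ ih
  exact ((h1 n).append h2).append (h3 n)

def closedBraid (n : ℕ) (β : List (Fin (n - 1) × Bool)) : Diagram :=
  ⟨closedBraidWord n β, closedBraidWord_isTangle n β⟩

/-! A diagram of a link in the solid torus is a diagram in the annulus, that is, a diagram in the plane
from which a point of the complement, the axis, has been removed. Here the axis is at level `k`,
between the points `(k, g - 1)` and `(k, g)`. -/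

namespace Diagram.State

variable {D : Diagram}

/-- The circles of a state that are not contractible in the annulus: they enclose the axis, that
is, they meet the horizontal ray from the axis to the right in an odd number of points. -/
def essential (s : D.State) (k g : ℕ) : Set s.Component :=
  {c ∈ circles s.picture.1 |
    Odd {i : ℕ | g ≤ i ∧ (k, i) ∈ points s.picture.1 ∧ comp s.picture.1 (k, i) = c}.ncard}

/-- The circles of a state that are contractible in the annulus. -/
def contractible (s : D.State) (k g : ℕ) : Set s.Component :=
  circles s.picture.1 \ s.essential k g

end Diagram.State

open LaurentPolynomial in
/-- The Hoste–Przytycki invariant of a link in the solid torus, with values in the polynomials over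
`ℤ[A, A⁻¹]` in one variable: the Kauffman bracket of a diagram in the annulus, in which a contractible
circle has the value `-A² - A⁻²` and any other circle is the variable, multiplied by
`(-A) ^ (-3 w)`. -/
noncomputable def Diagram.hostePrzytycki (D : Diagram) (k g : ℕ) : Polynomial ℤ[T;T⁻¹] :=
  negAPow (-3 * D.writhe) • ∑ s : D.State,
    Polynomial.monomial (s.essential k g).ncard
      (T s.sigma * loopValue ^ (s.contractible k g).ncard)

/-- `n` circles that enclose the same `m` strands on the left and on the right, each one inside the
previous one. -/
def nested : ℕ → ℕ → List Slice
  | _, 0 => []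
  | m, n + 1 => ⟨m, .cup, m⟩ :: (nested (m + 1) n ++ [⟨m, .cap, m⟩])

theorem nested_isFlat (m n : ℕ) : IsFlat (2 * m) (nested m n) (2 * m) := by
  induction n generalizing m with
  | zero => rfl
  | succ n ih =>
    refine ⟨?_, ?_⟩
    · simp [Slice.src, Shape.src]; omega
    · have e : Slice.tgt ⟨m, .cup, m⟩ = 2 * (m + 1) := by simp [Slice.tgt, Shape.tgt]; omega
      rw [e]
      refine (ih (m + 1)).append ⟨?_, ?_⟩
      · simp [Slice.src, Shape.src]; omega
      · simp [IsFlat, Slice.tgt, Shape.tgt]; omega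

/-- The configuration of `n` concentric circles. -/
def concentric (n : ℕ) : Config := Quot.mk _ ⟨nested 0 n, nested_isFlat 0 n⟩

/-- The identification of a polynomial with a combination of configurations of concentric circles: the
`n`-th power of the variable corresponds to `n` concentric circles. -/
noncomputable def ofPolynomial (f : Polynomial ℤ[T;T⁻¹]) : Gam :=
  f.sum fun n a => Finsupp.single (concentric n) a

set_option linter.unusedSectionVars false
set_option linter.unusedSimpArgs false
set_option linter.unnecessarySeqFocus false

open Classical in
noncomputable def listIf {α : Type} (p : Prop) (x : α) : List α := if p then [x] else []

open Classical in
noncomputable def valIf {M : Type} [Zero M] (p : Prop) (z : M) : M := if p then z else 0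

lemma listIf_true {α : Type} {p : Prop} (h : p) (x : α) : listIf p x = [x] := if_pos h

lemma listIf_false {α : Type} {p : Prop} (h : ¬ p) (x : α) : listIf p x = [] := if_neg h

lemma valIf_true {M : Type} [Zero M] {p : Prop} (h : p) (z : M) : valIf p z = z := if_pos h

lemma valIf_false {M : Type} [Zero M] {p : Prop} (h : ¬ p) (z : M) : valIf p z = 0 := if_neg h

/-- The non-trivial part of a letter of a marked picture; marks are elements of `M`. In `vert z` and
`horiz z` the mark `z` is put on the strand through the bottom left point and on the strand through
the top right point. -/
inductive Kind (M : Type) : Type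
  | cup : Kind M
  | cap : Kind M
  | mark (z : M) : Kind M
  | vert (z : M) : Kind M
  | horiz (z : M) : Kind M

namespace Kind

variable {M : Type}

def src : Kind M → ℕ
  | cup => 0
  | mark _ => 1
  | _ => 2

def tgt : Kind M → ℕ
  | cap => 0
  | mark _ => 1
  | _ => 2

/-- The colours `b` at the bottom and `t` at the top are constant along the strands. -/
def Const {Z : Type} (b t : ℕ → Z) : Kind M → Prop
  | cup => t 0 = t 1
  | cap => b 0 = b 1
  | mark _ => b 0 = t 0
  | vert _ => b 0 = t 0 ∧ b 1 = t 1
  | horiz _ => b 0 = b 1 ∧ t 0 = t 1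

/-- What remains when only the strands with the property `b`, `t` are kept. -/
noncomputable def res (b t : ℕ → Prop) : Kind M → List Shape
  | cup => listIf (t 0) .cup
  | cap => listIf (b 0) .cap
  | mark _ => []
  | vert _ => []
  | horiz _ => listIf (b 0) .cap ++ listIf (t 0) .cup

/-- The sum of the marks on the strands with the property `b`, `t`. -/
noncomputable def tot [AddCommMonoid M] (b t : ℕ → Prop) : Kind M → M
  | mark z => valIf (b 0) z
  | vert z => valIf (b 0) z + valIf (t 1) z
  | horiz z => valIf (b 0) z + valIf (t 1) z
  | _ => 0

end Kind

structure Letter (M : Type) : Type where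
  left : ℕ
  kind : Kind M
  right : ℕ

open Classical in
/-- The number of points `i, …, i + m - 1` that have the property `κ`. -/
noncomputable def kc (κ : ℕ → Prop) (i m : ℕ) : ℕ :=
  ((Finset.range m).filter fun j => κ (i + j)).card

lemma kc_zero (κ : ℕ → Prop) (i : ℕ) : kc κ i 0 = 0 := by simp [kc]

lemma kc_add (κ : ℕ → Prop) (i m n : ℕ) : kc κ i (m + n) = kc κ i m + kc κ (i + m) n :=
  keptCount_add (fun p => κ p.2) 0 i m n

open Classical in
lemma kc_one (κ : ℕ → Prop) (i : ℕ) : kc κ i 1 = if κ i then 1 else 0 := by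
  by_cases h : κ i <;> simp [kc, Finset.filter_singleton, h]

lemma kc_congr {κ κ' : ℕ → Prop} {i i' m : ℕ} (h : ∀ j < m, κ (i + j) = κ' (i' + j)) :
    kc κ i m = kc κ' i' m := by
  classical
  unfold kc
  congr 1
  ext j
  simp only [Finset.mem_filter, Finset.mem_range]
  exact and_congr_right fun hj => by rw [h j hj]

/-- The number of shapes at the bottom and top of a stack of shapes. -/
def ShFlat (m : ℕ) (A : List Shape) (n : ℕ) : Prop := IsFlat m (A.map fun s => ⟨0, s, 0⟩) n

namespace Letter

variable {M : Type}

def src (l : Letter M) : ℕ := l.left + l.kind.src + l.right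

def tgt (l : Letter M) : ℕ := l.left + l.kind.tgt + l.right

/-- The colours `b` at the bottom and `t` at the top are constant along the strands; there are
infinitely many vertical strands on the right. -/
def Coloring {Z : Type} (l : Letter M) (b t : ℕ → Z) : Prop :=
  (∀ j < l.left, b j = t j) ∧ (∀ j, b (l.left + l.kind.src + j) = t (l.left + l.kind.tgt + j)) ∧
    l.kind.Const (fun j => b (l.left + j)) (fun j => t (l.left + j))

noncomputable def res (b t : ℕ → Prop) (l : Letter M) : List Slice :=
  (l.kind.res (fun j => b (l.left + j)) (fun j => t (l.left + j))).map
    fun s => ⟨kc b 0 l.left, s, kc b (l.left + l.kind.src) l.right⟩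

noncomputable def tot [AddCommMonoid M] (b t : ℕ → Prop) (l : Letter M) : M :=
  l.kind.tot (fun j => b (l.left + j)) (fun j => t (l.left + j))

end Letter

section Words

variable {M : Type} {Z : Type}

/-- `Typed m W n`: the letters of `W` can be stacked, with `m` strands at the bottom and `n`
strands at the top. -/
def Typed : ℕ → List (Letter M) → ℕ → Prop
  | m, [], n => m = n
  | m, l :: W, n => m = l.src ∧ Typed l.tgt W n

lemma typed_append {m n : ℕ} {P Q : List (Letter M)} :
    Typed m (P ++ Q) n ↔ ∃ k, Typed m P k ∧ Typed k Q n := by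
  induction P generalizing m with
  | nil => simp [Typed]
  | cons l P ih => simp [Typed, ih, and_assoc]

lemma Typed.append {m n k : ℕ} {P Q : List (Letter M)} (h : Typed m P n) (h' : Typed n Q k) :
    Typed m (P ++ Q) k := typed_append.2 ⟨n, h, h'⟩

/-- A colouring: the colour `f k i` of the point `i` at level `k` is constant along the strands. -/
def Coloring : List (Letter M) → (ℕ → ℕ → Z) → Prop
  | [], _ => True
  | l :: W, f => l.Coloring (f 0) (f 1) ∧ Coloring W fun k => f (k + 1)

noncomputable def res : List (Letter M) → (ℕ → ℕ → Prop) → List Slice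
  | [], _ => []
  | l :: W, κ => l.res (κ 0) (κ 1) ++ res W fun k => κ (k + 1)

noncomputable def tot [AddCommMonoid M] : List (Letter M) → (ℕ → ℕ → Prop) → M
  | [], _ => 0
  | l :: W, κ => l.tot (κ 0) (κ 1) + tot W fun k => κ (k + 1)

lemma coloring_append {P Q : List (Letter M)} {f : ℕ → ℕ → Z} :
    Coloring (P ++ Q) f ↔ Coloring P f ∧ Coloring Q fun k => f (P.length + k) := by
  induction P generalizing f with
  | nil => simp [Coloring]
  | cons l P ih => simp [Coloring, ih, and_assoc, Nat.add_right_comm]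

lemma res_append {P Q : List (Letter M)} {f : ℕ → ℕ → Prop} :
    res (P ++ Q) f = res P f ++ res Q fun k => f (P.length + k) := by
  induction P generalizing f with
  | nil => simp [res]
  | cons l P ih => simp [res, ih, Nat.add_right_comm]

lemma tot_append [AddCommMonoid M] {P Q : List (Letter M)} {f : ℕ → ℕ → Prop} :
    tot (P ++ Q) f = tot P f + tot Q fun k => f (P.length + k) := by
  induction P generalizing f with
  | nil => simp [tot]
  | cons l P ih =>
    simp only [List.cons_append, tot, ih, add_assoc, List.length_cons, Nat.add_comm 1]

lemma Coloring.congr {W : List (Letter M)} {f g : ℕ → ℕ → Z} (h : Coloring W f)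
    (hfg : ∀ k ≤ W.length, f k = g k) : Coloring W g := by
  induction W generalizing f g with
  | nil => trivial
  | cons l W ih =>
    refine ⟨?_, ih h.2 fun k hk => hfg (k + 1) (by simpa using hk)⟩
    rw [← hfg 0 (by simp), ← hfg 1 (by simp)]
    exact h.1

lemma res_congr {W : List (Letter M)} {f g : ℕ → ℕ → Prop}
    (hfg : ∀ k ≤ W.length, f k = g k) : res W f = res W g := by
  induction W generalizing f g with
  | nil => rfl
  | cons l W ih =>
    simp only [res]
    rw [← hfg 0 (by simp), ← hfg 1 (by simp), ih fun k hk => hfg (k + 1) (by simpa using hk)]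

lemma tot_congr [AddCommMonoid M] {W : List (Letter M)} {f g : ℕ → ℕ → Prop}
    (hfg : ∀ k ≤ W.length, f k = g k) : tot W f = tot W g := by
  induction W generalizing f g with
  | nil => rfl
  | cons l W ih =>
    simp only [tot]
    rw [← hfg 0 (by simp), ← hfg 1 (by simp), ih fun k hk => hfg (k + 1) (by simpa using hk)]

lemma Coloring.map {Z' : Type} (S : Z → Z') {W : List (Letter M)} {f : ℕ → ℕ → Z} (h : Coloring W f) :
    Coloring W fun k i => S (f k i) := by
  induction W generalizing f with
  | nil => trivial
  | cons l W ih =>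
    refine ⟨⟨fun j hj => congrArg S (h.1.1 j hj), fun j => congrArg S (h.1.2.1 j), ?_⟩, ih h.2⟩
    have h3 := h.1.2.2
    rcases l with ⟨u, k, v⟩
    cases k <;> simp only [Kind.Const] at h3 ⊢
    · rw [h3]
    · rw [h3]
    · rw [h3]
    · rw [h3.1, h3.2]; trivial
    · rw [h3.1, h3.2]; trivial

/-- Points that have the same colour in all colourings. -/
def SameStrand (W : List (Letter M)) (p q : ℕ × ℕ) : Prop :=
  ∀ f : ℕ → ℕ → Prop, Coloring W f → (f p.1 p.2 = f q.1 q.2)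

def ptSetoid (W : List (Letter M)) : Setoid (ℕ × ℕ) where
  r := SameStrand W
  iseqv := ⟨fun _ _ _ => rfl, fun h f hf => (h f hf).symm, fun h h' f hf => (h f hf).trans (h' f hf)⟩

def Cp (W : List (Letter M)) : Type := Quotient (ptSetoid W)

def pt (W : List (Letter M)) (k i : ℕ) : Cp W := Quotient.mk (ptSetoid W) (k, i)

lemma pt_eq_iff {W : List (Letter M)} {k i k' i' : ℕ} :
    pt W k i = pt W k' i' ↔ SameStrand W (k, i) (k', i') := Quotient.eq

lemma coloring_of_sameStrand {W : List (Letter M)} {f : ℕ → ℕ → Z}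
    (h : ∀ p q, SameStrand W p q → f p.1 p.2 = f q.1 q.2) : Coloring W f := by
  induction W generalizing f with
  | nil => trivial
  | cons l W ih =>
    refine ⟨⟨fun j hj => h (0, j) (1, j) fun g hg => hg.1.1 j hj,
      fun j => h (0, _) (1, _) fun g hg => hg.1.2.1 j, ?_⟩,
      ih fun p q hpq => h (p.1 + 1, p.2) (q.1 + 1, q.2) fun g hg => hpq _ hg.2⟩
    rcases l with ⟨u, k, v⟩
    cases k
    · exact h (1, _) (1, _) fun g hg => hg.1.2.2
    · exact h (0, _) (0, _) fun g hg => hg.1.2.2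
    · exact h (0, _) (1, _) fun g hg => hg.1.2.2
    · exact ⟨h (0, _) (1, _) fun g hg => hg.1.2.2.1, h (0, _) (1, _) fun g hg => hg.1.2.2.2⟩
    · exact ⟨h (0, _) (0, _) fun g hg => hg.1.2.2.1, h (1, _) (1, _) fun g hg => hg.1.2.2.2⟩

lemma coloring_pt (W : List (Letter M)) : Coloring W (pt W) :=
  coloring_of_sameStrand fun _ _ h => pt_eq_iff.2 h

lemma Coloring.eq_of_sameStrand {W : List (Letter M)} {f : ℕ → ℕ → Z} (hf : Coloring W f) {p q : ℕ × ℕ}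
    (h : SameStrand W p q) : f p.1 p.2 = f q.1 q.2 := by
  have := h _ (hf.map fun z => z = f q.1 q.2)
  simpa using this

/-- A colouring as a function on the strands. -/
def Coloring.lift {W : List (Letter M)} {f : ℕ → ℕ → Z} (hf : Coloring W f) : Cp W → Z :=
  Quotient.lift (fun p : ℕ × ℕ => f p.1 p.2) fun _ _ h => hf.eq_of_sameStrand h

@[simp] lemma Coloring.lift_pt {W : List (Letter M)} {f : ℕ → ℕ → Z} (hf : Coloring W f) (k i : ℕ) :
    hf.lift (pt W k i) = f k i := rfl

lemma Cp.exists_pt {W : List (Letter M)} (c : Cp W) : ∃ k i, c = pt W k i :=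
  Quotient.inductionOn c fun p => ⟨p.1, p.2, rfl⟩

def circ (W : List (Letter M)) : Set (Cp W) :=
  {c | (∃ k ≤ W.length, ∃ i, c = pt W k i) ∧ ∀ j, c ≠ pt W 0 j}

/-- The sum of the marks on a circle. -/
noncomputable def totc [AddCommMonoid M] (W : List (Letter M)) (c : Cp W) : M :=
  tot W fun k i => pt W k i = c

/-- The number of circles on which the sum of the marks has the property `R`. -/
noncomputable def numc [AddCommMonoid M] (R : M → Prop) (W : List (Letter M)) : ℕ :=
  {c ∈ circ W | R (totc W c)}.ncard

/-- The picture with given slices. -/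
def Picture.of (W : List Slice) (h : IsFlat 0 W 0) : Picture := ⟨W, h⟩

/-- The configuration of a closed picture. -/
noncomputable def cfgL (W : List Slice) : Config :=
  open Classical in
  Quot.mk Picture.Related (if h : IsFlat 0 W 0 then Picture.of W h else Picture.of [] rfl)

lemma cfgL_eq {W : List Slice} (h : IsFlat 0 W 0) :
    cfgL W = Quot.mk Picture.Related (Picture.of W h) := by rw [cfgL, dif_pos h]

/-- The configuration of the circles on which the sum of the marks has the property `R`. -/
noncomputable def cfg [AddCommMonoid M] (R : M → Prop) (W : List (Letter M)) : Config :=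
  cfgL (res W fun k i => pt W k i ∈ circ W ∧ R (totc W (pt W k i)))

end Words

lemma isFlat_nil {m n : ℕ} : IsFlat m [] n ↔ m = n := Iff.rfl

lemma isFlat_cons {m n : ℕ} {sl : Slice} {W : List Slice} :
    IsFlat m (sl :: W) n ↔ m = sl.left + sl.shape.src + sl.right ∧
      IsFlat (sl.left + sl.shape.tgt + sl.right) W n := Iff.rfl

lemma shFlat_cons {m n : ℕ} {s : Shape} {A : List Shape} :
    ShFlat m (s :: A) n ↔ m = s.src ∧ ShFlat s.tgt A n := by
  simp [ShFlat, isFlat_cons]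

/-- `X` and `Y` represent the same tangle with `m` strands at the bottom and `n` at the top. -/
def FEq (m n : ℕ) (X Y : List Slice) : Prop :=
  IsFlat m X n ∧ IsFlat m Y n ∧ ∀ P Q, IsFlat 0 P m → IsFlat n Q 0 →
    cfgL (P ++ X ++ Q) = cfgL (P ++ Y ++ Q)

namespace FEq

variable {m n : ℕ} {X Y V : List Slice}

lemma refl (h : IsFlat m X n) : FEq m n X X := ⟨h, h, fun _ _ _ _ => rfl⟩

lemma symm (h : FEq m n X Y) : FEq m n Y X :=
  ⟨h.2.1, h.1, fun P Q hP hQ => (h.2.2 P Q hP hQ).symm⟩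

lemma trans (h : FEq m n X Y) (h' : FEq m n Y V) : FEq m n X V :=
  ⟨h.1, h'.2.1, fun P Q hP hQ => (h.2.2 P Q hP hQ).trans (h'.2.2 P Q hP hQ)⟩

lemma append {k : ℕ} {X' Y' : List Slice} (h : FEq m n X Y) (h' : FEq n k X' Y') :
    FEq m k (X ++ X') (Y ++ Y') := by
  refine ⟨h.1.append h'.1, h.2.1.append h'.2.1, fun P Q hP hQ => ?_⟩
  have h1 := h.2.2 P (X' ++ Q) hP (h'.1.append hQ)
  have h2 := h'.2.2 (P ++ Y) Q (hP.append h.2.1) hQ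
  simp only [List.append_assoc] at h1 h2 ⊢
  rw [h1, h2]

lemma of_move (h : FlatMove X Y) (hX : IsFlat m X n) (hY : IsFlat m Y n) : FEq m n X Y := by
  refine ⟨hX, hY, fun P Q hP hQ => ?_⟩
  have h1 := (hP.append hX).append hQ
  have h2 := (hP.append hY).append hQ
  rw [cfgL_eq h1, cfgL_eq h2]
  exact Quot.sound ⟨P, X, Y, Q, h, rfl, rfl⟩

lemma exchange_one (u v w : ℕ) (p p' : Shape) :
    FEq (u + p.src + v + p'.src + w) (u + p.tgt + v + p'.tgt + w)
      [⟨u, p, v + p'.src + w⟩, ⟨u + p.tgt + v, p', w⟩]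
      [⟨u + p.src + v, p', w⟩, ⟨u, p, v + p'.tgt + w⟩] := by
  refine of_move (.exchange u v w p p') ?_ ?_ <;>
    simp only [isFlat_cons, isFlat_nil, true_and, and_true] <;> omega

lemma _root_.ShFlat.isFlat (u w : ℕ) {A : List Shape} {a a' : ℕ} (h : ShFlat a A a') :
    IsFlat (u + a + w) (A.map fun s => ⟨u, s, w⟩) (u + a' + w) := by
  induction A generalizing a with
  | nil => cases h; rfl
  | cons s A ih =>
    obtain ⟨rfl, h2⟩ := shFlat_cons.1 h
    exact isFlat_cons.2 ⟨rfl, ih h2⟩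

lemma exchange (u v w : ℕ) {A B : List Shape} {a a' b b' : ℕ} (hA : ShFlat a A a')
    (hB : ShFlat b B b') :
    FEq (u + a + v + b + w) (u + a' + v + b' + w)
      (A.map (fun s => ⟨u, s, v + b + w⟩) ++ B.map fun s => ⟨u + a' + v, s, w⟩)
      ((B.map fun s => ⟨u + a + v, s, w⟩) ++ A.map fun s => ⟨u, s, v + b' + w⟩) := by
  have key : ∀ (p : Shape) {B : List Shape} {b b' : ℕ}, ShFlat b B b' →
      FEq (u + p.src + v + b + w) (u + p.tgt + v + b' + w)
        (⟨u, p, v + b + w⟩ :: B.map fun s => ⟨u + p.tgt + v, s, w⟩)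
        ((B.map fun s => ⟨u + p.src + v, s, w⟩) ++ [⟨u, p, v + b' + w⟩]) := by
    intro p B
    induction B with
    | nil =>
      intro b b' h
      cases h
      refine refl ?_
      simp only [List.map_nil, isFlat_cons, isFlat_nil]
      omega
    | cons s B ih =>
      intro b b' h
      obtain ⟨rfl, h2⟩ := shFlat_cons.1 h
      have e1 := (exchange_one u v w p s).append (refl (ShFlat.isFlat (u + p.tgt + v) w h2))
      have e2 := (refl (m := u + p.src + v + s.src + w) (n := u + p.src + v + s.tgt + w)
        (X := [⟨u + p.src + v, s, w⟩]) (isFlat_cons.2 ⟨rfl, rfl⟩)).append (ih h2)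
      exact e1.trans e2
  induction A generalizing a with
  | nil =>
    cases hA
    simpa using refl (ShFlat.isFlat _ w hB)
  | cons s A ih =>
    obtain ⟨rfl, h2⟩ := shFlat_cons.1 hA
    have e1 := (refl (m := u + s.src + v + b + w) (n := u + s.tgt + v + b + w)
        (X := [⟨u, s, v + b + w⟩]) (by
          simp only [isFlat_cons, isFlat_nil]
          omega)).append (ih h2)
    have e2 := (key s hB).append (refl (m := u + s.tgt + v + b' + w) (n := u + a' + v + b' + w)
      (X := A.map fun s => ⟨u, s, v + b' + w⟩) (by
        have := ShFlat.isFlat u (v + b' + w) h2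
        simpa [add_assoc] using this))
    exact e1.trans (by simpa using e2)

end FEq

section Local

variable {M : Type} {Z : Type}

lemma coloring_const (W : List (Letter M)) (z : Z) : Coloring W fun _ _ => z := by
  induction W with
  | nil => trivial
  | cons l W ih =>
    refine ⟨⟨fun _ _ => rfl, fun _ => rfl, ?_⟩, ih⟩
    cases l.kind <;> simp [Kind.Const]

/-- Two words with the same boundary behaviour. -/
structure LocEq [AddCommMonoid M] (m n : ℕ) (X Y : List (Letter M)) : Prop where
  typed_left : Typed m X n
  typed_right : Typed m Y n
  exists_left : ∀ {Z : Type} (g : ℕ → ℕ → Z), Coloring Y g →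
    ∃ f, Coloring X f ∧ f 0 = g 0 ∧ f X.length = g Y.length
  exists_right : ∀ {Z : Type} (f : ℕ → ℕ → Z), Coloring X f →
    ∃ g, Coloring Y g ∧ g 0 = f 0 ∧ g Y.length = f X.length
  det_left : ∀ f f' : ℕ → ℕ → Prop, Coloring X f → Coloring X f' → f 0 = f' 0 →
    f X.length = f' X.length → ∀ k ≤ X.length, f k = f' k
  det_right : ∀ f f' : ℕ → ℕ → Prop, Coloring Y f → Coloring Y f' → f 0 = f' 0 →
    f Y.length = f' Y.length → ∀ k ≤ Y.length, f k = f' k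
  tot_eq : ∀ f g : ℕ → ℕ → Prop, Coloring X f → Coloring Y g → f 0 = g 0 →
    f X.length = g Y.length → tot X f = tot Y g
  feq : ∀ f g : ℕ → ℕ → Prop, Coloring X f → Coloring Y g → f 0 = g 0 →
    f X.length = g Y.length →
    FEq (kc (f 0) 0 m) (kc (f X.length) 0 n) (res X f) (res Y g)

/-- `f` agrees with `g` below the level `a` and from the levels `a + x`, `a + y` on. -/
def Agree (a x y : ℕ) (f g : ℕ → ℕ → Z) : Prop :=
  (∀ k ≤ a, f k = g k) ∧ ∀ k, f (a + x + k) = g (a + y + k)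

lemma exists_agree_of {P X Y Q : List (Letter M)} {p : (ℕ → ℕ → Z) → Prop}
    (h : ∀ g : ℕ → ℕ → Z, Coloring Y g →
      ∃ f, Coloring X f ∧ f 0 = g 0 ∧ f X.length = g Y.length ∧ p f)
    {g : ℕ → ℕ → Z} (hg : Coloring (P ++ Y ++ Q) g) :
    ∃ f, Coloring (P ++ X ++ Q) f ∧ Agree P.length X.length Y.length f g ∧
      ∃ f', p f' ∧ ∀ k ≤ X.length, f (P.length + k) = f' k := by
  rw [coloring_append, coloring_append] at hg
  obtain ⟨⟨hP, hY⟩, hQ⟩ := hg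
  obtain ⟨f, hf, h0, h1, hp⟩ := h _ hY
  simp only [List.length_append, Nat.add_zero] at h0 h1 hQ
  let F : ℕ → ℕ → Z := fun k => if k ≤ P.length then g k else
    if k ≤ P.length + X.length then f (k - P.length) else g (k - X.length + Y.length)
  have e0 : ∀ k ≤ P.length, F k = g k := fun k hk => if_pos hk
  have e1 : ∀ k ≤ X.length, F (P.length + k) = f k := by
    intro k hk
    by_cases hk0 : k = 0
    · subst hk0; rw [h0]; exact e0 _ le_rfl
    · simp only [F]
      rw [if_neg (by omega), if_pos (by omega), Nat.add_sub_cancel_left]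
  have e2 : ∀ k, F (P.length + X.length + k) = g (P.length + Y.length + k) := by
    intro k
    by_cases hk0 : k = 0
    · subst hk0; exact (e1 _ le_rfl).trans h1
    · simp only [F]
      rw [if_neg (by omega), if_neg (by omega)]
      congr 1
      omega
  refine ⟨F, ?_, ⟨e0, e2⟩, f, hp, e1⟩
  rw [coloring_append, coloring_append]
  refine ⟨⟨hP.congr fun k hk => (e0 k hk).symm, hf.congr fun k hk => (e1 k hk).symm⟩, ?_⟩
  simp only [List.length_append]
  exact hQ.congr fun k _ => (e2 k).symm

lemma exists_agree {P X Y Q : List (Letter M)}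
    (h : ∀ g : ℕ → ℕ → Z, Coloring Y g →
      ∃ f, Coloring X f ∧ f 0 = g 0 ∧ f X.length = g Y.length)
    {g : ℕ → ℕ → Z} (hg : Coloring (P ++ Y ++ Q) g) :
    ∃ f, Coloring (P ++ X ++ Q) f ∧ Agree P.length X.length Y.length f g := by
  obtain ⟨f, h1, h2, -⟩ := exists_agree_of (p := fun _ => True)
    (fun g hg => by simpa using h g hg) hg
  exact ⟨f, h1, h2⟩

lemma agree_unique {P X Q : List (Letter M)}
    (h : ∀ f f' : ℕ → ℕ → Prop, Coloring X f → Coloring X f' → f 0 = f' 0 →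
      f X.length = f' X.length → ∀ k ≤ X.length, f k = f' k)
    {f f' : ℕ → ℕ → Z} (hf : Coloring (P ++ X ++ Q) f) (hf' : Coloring (P ++ X ++ Q) f')
    (h0 : f P.length = f' P.length)
    (h1 : f (P.length + X.length) = f' (P.length + X.length)) (k : ℕ) (hk : k ≤ X.length) :
    f (P.length + k) = f' (P.length + k) := by
  rw [coloring_append, coloring_append] at hf hf'
  funext i
  have := h _ _ (hf.1.2.map fun z => z = f (P.length + k) i)
    (hf'.1.2.map fun z => z = f (P.length + k) i)
    (by simp [h0]) (by simp [h1]) k hk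
  have := congrFun this i
  simpa [eq_comm] using this

lemma Agree.ext {a x : ℕ} {f f' : ℕ → ℕ → Z} (h : Agree a x x f f')
    (h' : ∀ k ≤ x, f (a + k) = f' (a + k)) : f = f' := by
  funext k
  rcases Nat.le_total k a with hk | hk
  · exact h.1 k hk
  · obtain ⟨j, rfl⟩ := Nat.exists_eq_add_of_le hk
    rcases Nat.le_total j x with hj | hj
    · exact h' j hj
    · obtain ⟨i, rfl⟩ := Nat.exists_eq_add_of_le hj
      rw [← Nat.add_assoc]; exact h.2 i

lemma agree_eq {P X Q : List (Letter M)}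
    (h : ∀ f f' : ℕ → ℕ → Prop, Coloring X f → Coloring X f' → f 0 = f' 0 →
      f X.length = f' X.length → ∀ k ≤ X.length, f k = f' k)
    {f f' : ℕ → ℕ → Z} (hf : Coloring (P ++ X ++ Q) f) (hf' : Coloring (P ++ X ++ Q) f')
    (hff : Agree P.length X.length X.length f f') : f = f' :=
  hff.ext (agree_unique h hf hf' (hff.1 _ le_rfl) (hff.2 0))

lemma exists_outside {P X Q : List (Letter M)}
    (h : ∀ f f' : ℕ → ℕ → Prop, Coloring X f → Coloring X f' → f 0 = f' 0 →
      f X.length = f' X.length → ∀ k ≤ X.length, f k = f' k)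
    {f : ℕ → ℕ → Z} (hf : Coloring (P ++ X ++ Q) f) (k i : ℕ)
    (hk : k ≤ (P ++ X ++ Q).length) :
    ∃ k' i', k' ≤ (P ++ X ++ Q).length ∧ f k i = f k' i' ∧
      (k' ≤ P.length ∨ ∃ j, k' = P.length + X.length + j) := by
  by_cases hk1 : k ≤ P.length
  · exact ⟨k, i, hk, rfl, Or.inl hk1⟩
  by_cases hk2 : P.length + X.length ≤ k
  · exact ⟨k, i, hk, rfl, Or.inr ⟨_, (Nat.add_sub_of_le hk2).symm⟩⟩
  by_contra! hcon
  have hl : (P ++ X ++ Q).length = P.length + X.length + Q.length := by simp [Nat.add_assoc]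
  have h0 : ∀ i', f k i ≠ f P.length i' := fun i' e =>
    absurd le_rfl (not_le.2 (hcon P.length i' (by omega) e).1)
  have h1 : ∀ i', f k i ≠ f (P.length + X.length) i' := fun i' e =>
    (hcon (P.length + X.length) i' (by omega) e).2 0 rfl
  have := agree_unique h (hf.map fun z => f k i = z) (coloring_const _ False)
    (by funext j; simp [h0 j]) (by funext j; simp [h1 j]) (k - P.length) (by omega)
  have := congrFun this i
  rw [Nat.add_sub_of_le (by omega)] at this
  simp at this

lemma Letter.res_isFlat {b t : ℕ → Prop} {l : Letter M} (h : l.Coloring b t) :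
    IsFlat (kc b 0 l.src) (l.res b t) (kc t 0 l.tgt) := by
  rcases l with ⟨u, k, v⟩
  obtain ⟨h1, h2, h3⟩ := h
  have e1 : kc t 0 u = kc b 0 u := kc_congr fun j hj => by simpa using (h1 j hj).symm
  have e2 : kc t (u + k.tgt) v = kc b (u + k.src) v := kc_congr fun j _ => (h2 j).symm
  simp only [Letter.src, Letter.tgt, kc_add, Nat.zero_add, e1, e2]
  have two : ∀ κ : ℕ → Prop, ∀ i, kc κ i 2 = kc κ i 1 + kc κ (i + 1) 1 := fun κ i => kc_add κ i 1 1
  cases k <;> simp only [Kind.Const, Nat.add_zero] at h3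
  · by_cases h : t u <;>
      simp [listIf, Letter.res, Kind.res, isFlat_cons, isFlat_nil, two, kc_one, kc_zero, Kind.src, Kind.tgt,
        Shape.src, Shape.tgt, ← h3, h]
  · by_cases h : b u <;>
      simp [listIf, Letter.res, Kind.res, isFlat_cons, isFlat_nil, two, kc_one, kc_zero, Kind.src, Kind.tgt,
        Shape.src, Shape.tgt, ← h3, h]
  · simp [listIf, Letter.res, Kind.res, isFlat_nil, kc_one, Kind.src, Kind.tgt]
    rw [h3]
  · simp [listIf, Letter.res, Kind.res, isFlat_nil, two, kc_one, Kind.src, Kind.tgt]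
    rw [h3.1, h3.2]
  · by_cases h : b u <;> by_cases h' : t u <;>
      simp [listIf, Letter.res, Kind.res, isFlat_cons, isFlat_nil, two, kc_one, Kind.src, Kind.tgt,
        Shape.src, Shape.tgt, ← h3.1, ← h3.2, h, h']

lemma res_isFlat {m n : ℕ} {W : List (Letter M)} {f : ℕ → ℕ → Prop} (h : Typed m W n)
    (hf : Coloring W f) : IsFlat (kc (f 0) 0 m) (res W f) (kc (f W.length) 0 n) := by
  induction W generalizing m f with
  | nil => cases h; rfl
  | cons l W ih =>
    obtain ⟨rfl, h2⟩ := h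
    exact (Letter.res_isFlat hf.1).append (ih h2 hf.2)

variable [AddCommMonoid M]

lemma LocEq.tot_agree {m n : ℕ} {P X Y Q : List (Letter M)} (h : LocEq m n X Y)
    {f g : ℕ → ℕ → Prop} (hf : Coloring (P ++ X ++ Q) f) (hg : Coloring (P ++ Y ++ Q) g)
    (hfg : Agree P.length X.length Y.length f g) :
    tot (P ++ X ++ Q) f = tot (P ++ Y ++ Q) g := by
  rw [coloring_append, coloring_append] at hf hg
  simp only [tot_append, List.length_append]
  rw [h.tot_eq _ _ hf.1.2 hg.1.2 (hfg.1 _ le_rfl) (hfg.2 0),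
    tot_congr fun k hk => hfg.1 k hk, funext hfg.2]

lemma LocEq.cfgL_agree {m n : ℕ} {P X Y Q : List (Letter M)} (h : LocEq m n X Y)
    (hP : Typed 0 P m) (hQ : Typed n Q 0)
    {f g : ℕ → ℕ → Prop} (hf : Coloring (P ++ X ++ Q) f) (hg : Coloring (P ++ Y ++ Q) g)
    (hfg : Agree P.length X.length Y.length f g) :
    cfgL (res (P ++ X ++ Q) f) = cfgL (res (P ++ Y ++ Q) g) := by
  rw [coloring_append, coloring_append] at hf hg
  simp only [res_append, List.length_append]
  have h1 := h.feq _ _ hf.1.2 hg.1.2 (hfg.1 _ le_rfl) (hfg.2 0)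
  have h2 := res_isFlat hP hf.1.1
  have h3 := res_isFlat hQ hf.2
  rw [kc_zero] at h2 h3
  rw [res_congr fun k hk => hfg.1 k hk] at h2 ⊢
  rw [funext fun k => hfg.2 k]
  refine h1.2.2 _ _ ?_ ?_
  · simpa [hfg.1 P.length le_rfl] using h2
  · simpa [hfg.2] using h3

lemma LocEq.exists_equiv {m n : ℕ} {P X Y Q : List (Letter M)} (h : LocEq m n X Y) :
    ∃ F : Cp (P ++ X ++ Q) → Cp (P ++ Y ++ Q), Function.Injective F ∧
      F '' circ (P ++ X ++ Q) = circ (P ++ Y ++ Q) ∧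
      (∀ c, totc _ (F c) = totc _ c) ∧
      Agree P.length X.length Y.length (fun k i => F (pt _ k i)) (pt _) := by
  obtain ⟨f, hf, hfa⟩ := exists_agree (P := P) (Q := Q) h.exists_left (coloring_pt (P ++ Y ++ Q))
  obtain ⟨g, hg, hga⟩ := exists_agree (P := P) (Q := Q) h.exists_right (coloring_pt (P ++ X ++ Q))
  have GF : (fun k i => hg.lift (f k i)) = pt (P ++ X ++ Q) := by
    refine agree_eq h.det_left (hf.map hg.lift) (coloring_pt _) ⟨fun k hk => ?_, fun k => ?_⟩
    · funext i; beta_reduce; rw [hfa.1 k hk]; exact congrFun (hga.1 k hk) i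
    · funext i
      simp only [hfa.2 k]
      exact congrFun (hga.2 k) i
  have FG : (fun k i => hf.lift (g k i)) = pt (P ++ Y ++ Q) := by
    refine agree_eq h.det_right (hg.map hf.lift) (coloring_pt _) ⟨fun k hk => ?_, fun k => ?_⟩
    · funext i; beta_reduce; rw [hga.1 k hk]; exact congrFun (hfa.1 k hk) i
    · funext i
      simp only [hga.2 k]
      exact congrFun (hfa.2 k) i
  have gf : ∀ c, hg.lift (hf.lift c) = c := by
    intro c
    obtain ⟨k, i, rfl⟩ := c.exists_pt
    exact congrFun (congrFun GF k) i
  have fg : ∀ c, hf.lift (hg.lift c) = c := by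
    intro c
    obtain ⟨k, i, rfl⟩ := c.exists_pt
    exact congrFun (congrFun FG k) i
  have inj : Function.Injective hf.lift := Function.LeftInverse.injective gf
  have lX : (P ++ X ++ Q).length = P.length + X.length + Q.length := by simp [Nat.add_assoc]
  have lY : (P ++ Y ++ Q).length = P.length + Y.length + Q.length := by simp [Nat.add_assoc]
  refine ⟨hf.lift, inj, ?_, fun c => ?_, hfa⟩
  · ext c
    constructor
    · rintro ⟨c, ⟨⟨k, hk, i, rfl⟩, hc⟩, rfl⟩
      refine ⟨?_, fun j e => hc j ?_⟩
      · obtain ⟨k', i', hk', e, ho⟩ := exists_outside h.det_left hf k i hk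
        rw [hf.lift_pt, e]
        rcases ho with ho | ⟨j, rfl⟩
        · exact ⟨k', by omega, i', by rw [hfa.1 k' ho]⟩
        · exact ⟨P.length + Y.length + j, by omega, i', by rw [hfa.2 j]⟩
      · apply inj
        rw [e, hf.lift_pt, hfa.1 0 (by omega)]
    · rintro ⟨⟨k, hk, i, rfl⟩, hc⟩
      refine ⟨hg.lift (pt _ k i), ⟨?_, fun j e => hc j ?_⟩, fg _⟩
      · obtain ⟨k', i', hk', e, ho⟩ := exists_outside h.det_right hg k i hk
        rw [hg.lift_pt, e]
        rcases ho with ho | ⟨j, rfl⟩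
        · exact ⟨k', by omega, i', by rw [hga.1 k' ho]⟩
        · exact ⟨P.length + X.length + j, by omega, i', by rw [hga.2 j]⟩
      · have := congrArg hf.lift e
        rw [fg, hf.lift_pt, hfa.1 0 (by omega)] at this
        exact this
  · refine (h.tot_agree ((coloring_pt (P ++ X ++ Q)).map fun z => z = c)
      ((coloring_pt (P ++ Y ++ Q)).map fun z => z = hf.lift c) ?_).symm
    refine ⟨fun k hk => ?_, fun k => ?_⟩
    · funext i
      beta_reduce
      rw [← hfa.1 k hk, ← hf.lift_pt]
      exact propext inj.eq_iff.symm
    · funext i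
      beta_reduce
      rw [← hfa.2 k, ← hf.lift_pt]
      exact propext inj.eq_iff.symm

/-- Closed marked pictures with the same numbers of circles with given properties and the same
configurations of circles with given properties. -/
def Eqv (U V : List (Letter M)) : Prop :=
  ∀ R : M → Prop, numc R U = numc R V ∧ cfg R U = cfg R V

lemma LocEq.eqv {m n : ℕ} {P X Y Q : List (Letter M)} (h : LocEq m n X Y)
    (hP : Typed 0 P m) (hQ : Typed n Q 0) : Eqv (P ++ X ++ Q) (P ++ Y ++ Q) := by
  obtain ⟨F, inj, him, ht, ha⟩ := h.exists_equiv (P := P) (Q := Q)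
  intro R
  constructor
  · unfold numc
    rw [← Set.ncard_image_of_injective _ inj]
    congr 1
    ext c
    constructor
    · rintro ⟨c, ⟨hc, hR⟩, rfl⟩
      exact ⟨him ▸ Set.mem_image_of_mem F hc, by rwa [ht]⟩
    · rintro ⟨hc, hR⟩
      rw [← him] at hc
      obtain ⟨c, hc, rfl⟩ := hc
      exact ⟨c, ⟨hc, by rwa [ht] at hR⟩, rfl⟩
  · have key : ∀ c, (c ∈ circ (P ++ X ++ Q) ∧ R (totc _ c)) =
        (F c ∈ circ (P ++ Y ++ Q) ∧ R (totc _ (F c))) := by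
      intro c
      rw [ht, ← him, inj.mem_set_image]
    refine h.cfgL_agree hP hQ
      ((coloring_pt (P ++ X ++ Q)).map fun c => c ∈ circ (P ++ X ++ Q) ∧ R (totc _ c))
      ((coloring_pt (P ++ Y ++ Q)).map fun c => c ∈ circ (P ++ Y ++ Q) ∧ R (totc _ c)) ?_
    refine ⟨fun k hk => ?_, fun k => ?_⟩
    · funext i
      beta_reduce
      rw [← ha.1 k hk]
      exact key _
    · funext i
      beta_reduce
      rw [← ha.2 k]
      exact key _

/-- Words that can be replaced by each other in closed marked pictures. -/
def Equ (m n : ℕ) (X Y : List (Letter M)) : Prop :=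
  Typed m X n ∧ Typed m Y n ∧ ∀ P Q, Typed 0 P m → Typed n Q 0 → Eqv (P ++ X ++ Q) (P ++ Y ++ Q)

lemma LocEq.equ {m n : ℕ} {X Y : List (Letter M)} (h : LocEq m n X Y) : Equ m n X Y :=
  ⟨h.typed_left, h.typed_right, fun _ _ hP hQ => h.eqv hP hQ⟩

lemma Eqv.trans {U V W : List (Letter M)} (h : Eqv U V) (h' : Eqv V W) : Eqv U W :=
  fun R => ⟨(h R).1.trans (h' R).1, (h R).2.trans (h' R).2⟩

lemma Eqv.symm {U V : List (Letter M)} (h : Eqv U V) : Eqv V U :=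
  fun R => ⟨(h R).1.symm, (h R).2.symm⟩

namespace Equ

variable {m n k : ℕ} {X Y V X' Y' : List (Letter M)}

lemma refl (h : Typed m X n) : Equ m n X X := ⟨h, h, fun _ _ _ _ _ => ⟨rfl, rfl⟩⟩

lemma symm (h : Equ m n X Y) : Equ m n Y X :=
  ⟨h.2.1, h.1, fun P Q hP hQ => (h.2.2 P Q hP hQ).symm⟩

lemma trans (h : Equ m n X Y) (h' : Equ m n Y V) : Equ m n X V :=
  ⟨h.1, h'.2.1, fun P Q hP hQ => (h.2.2 P Q hP hQ).trans (h'.2.2 P Q hP hQ)⟩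

lemma append (h : Equ m n X Y) (h' : Equ n k X' Y') : Equ m k (X ++ X') (Y ++ Y') := by
  refine ⟨h.1.append h'.1, h.2.1.append h'.2.1, fun P Q hP hQ => ?_⟩
  have h1 := h.2.2 P (X' ++ Q) hP (h'.1.append hQ)
  have h2 := h'.2.2 (P ++ Y) Q (hP.append h.2.1) hQ
  simp only [List.append_assoc] at h1 h2 ⊢
  exact h1.trans h2

lemma eqv (h : Equ 0 0 X Y) : Eqv X Y := by
  simpa using h.2.2 [] [] rfl rfl

end Equ

end Local

section Moves

variable {M : Type} {Z : Type}

lemma Kind.Const.congr {k : Kind M} {b t b' t' : ℕ → Z} (h : k.Const b t)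
    (hb : ∀ j < k.src, b j = b' j) (ht : ∀ j < k.tgt, t j = t' j) : k.Const b' t' := by
  cases k <;> simp only [Kind.Const, Kind.src, Kind.tgt] at *
  · rw [← ht 0 (by simp), ← ht 1 (by simp), h]
  · rw [← hb 0 (by simp), ← hb 1 (by simp), h]
  · rw [← hb 0 (by simp), ← ht 0 (by simp), h]
  · rw [← hb 0 (by simp), ← ht 0 (by simp), ← hb 1 (by simp), ← ht 1 (by simp)]; exact h
  simp_all

lemma Kind.res_congr {k : Kind M} {b t b' t' : ℕ → Prop}
    (hb : ∀ j < k.src, b j = b' j) (ht : ∀ j < k.tgt, t j = t' j) : k.res b t = k.res b' t' := by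
  cases k <;> simp only [Kind.res, Kind.src, Kind.tgt] at *
  · rw [← ht 0 (by simp)]
  · rw [← hb 0 (by simp)]
  simp_all

lemma Kind.tot_congr [AddCommMonoid M] {k : Kind M} {b t b' t' : ℕ → Prop}
    (hb : ∀ j < k.src, b j = b' j) (ht : ∀ j < k.tgt, t j = t' j) : k.tot b t = k.tot b' t' := by
  cases k <;> simp only [Kind.tot, Kind.src, Kind.tgt] at *
  · rw [← hb 0 (by simp)]
  · rw [← hb 0 (by simp), ← ht 1 (by simp)]
  simp_all

lemma Kind.res_shFlat {k : Kind M} {b t : ℕ → Prop} (h : k.Const b t) :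
    ShFlat (kc b 0 k.src) (k.res b t) (kc t 0 k.tgt) := by
  have two : ∀ κ : ℕ → Prop, ∀ i, kc κ i 2 = kc κ i 1 + kc κ (i + 1) 1 := fun κ i => kc_add κ i 1 1
  have nil : ∀ m n, ShFlat m [] n ↔ m = n := fun m n => Iff.rfl
  cases k <;> simp only [Kind.Const] at h
  · by_cases h' : t 0 <;>
      simp [listIf, Kind.res, shFlat_cons, nil, two, kc_one, kc_zero, Kind.src, Kind.tgt,
        Shape.src, Shape.tgt, ← h, h']
  · by_cases h' : b 0 <;>
      simp [listIf, Kind.res, shFlat_cons, nil, two, kc_one, kc_zero, Kind.src, Kind.tgt,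
        Shape.src, Shape.tgt, ← h, h']
  · grind [Kind.res, kc_one, Kind.src, Kind.tgt]
  · grind [Kind.res, kc_one, Kind.src, Kind.tgt]
  · by_cases h1 : b 0 <;> by_cases h2 : t 0 <;>
      simp [listIf, Kind.res, shFlat_cons, nil, two, kc_one, Kind.src, Kind.tgt,
        Shape.src, Shape.tgt, ← h.1, ← h.2, h1, h2]

lemma coloring_two {l l' : Letter M} {f : ℕ → ℕ → Z} :
    Coloring [l, l'] f ↔ l.Coloring (f 0) (f 1) ∧ l'.Coloring (f 1) (f 2) := by
  simp [Coloring]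

lemma kc_shift (κ : ℕ → Prop) (u i m : ℕ) : kc (fun j => κ (u + j)) i m = kc κ (u + i) m :=
  kc_congr fun j _ => by rw [add_assoc]

section Exchange

variable (u v w : ℕ) (p p' : Kind M)

def midColor (a b : ℕ) (f g : ℕ → Z) (j : ℕ) : Z := if j < u + a + v then f j else g (j - a + b)

lemma exchange_coloring {g : ℕ → ℕ → Z}
    (hg : Coloring [⟨u + p.src + v, p', w⟩, ⟨u, p, v + p'.tgt + w⟩] g) :
    Coloring [⟨u, p, v + p'.src + w⟩, ⟨u + p.tgt + v, p', w⟩]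
      (fun k => if k = 0 then g 0 else if k = 1 then midColor u v p.tgt p.src (g 2) (g 0) else g 2) := by
  rw [coloring_two] at hg ⊢
  obtain ⟨⟨h1, h2, h3⟩, h4, h5, h6⟩ := hg
  simp only [if_true, one_ne_zero, if_false, OfNat.ofNat_ne_zero, OfNat.ofNat_ne_one] at *
  have m1 : ∀ j < u + p.tgt + v, midColor u v p.tgt p.src (g 2) (g 0) j = g 2 j :=
    fun j hj => if_pos hj
  have m2 : ∀ j, midColor u v p.tgt p.src (g 2) (g 0) (u + p.tgt + v + j) =
      g 0 (u + p.src + v + j) := by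
    intro j
    rw [midColor, if_neg (by omega)]
    congr 1
    omega
  refine ⟨⟨fun j hj => ?_, fun j => ?_, ?_⟩, fun j hj => m1 j hj, fun j => ?_, ?_⟩
  · grind
  · by_cases hj : j < v
    · simp_all
    · obtain ⟨i, rfl⟩ := Nat.exists_eq_add_of_le (Nat.not_lt.1 hj)
      grind
  · refine h6.congr (fun j hj => (h1 _ (by omega)).symm)
      (fun j hj => (m1 _ (by omega)).symm)
  · rw [add_assoc (u + p.tgt + v), m2, ← add_assoc]
    have := h2 j
    simp only at this ⊢
    rw [this]
    have := h5 (v + p'.tgt + j)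
    grind
  · refine h3.congr (fun j hj => (m2 j).symm) (fun j hj => ?_)
    have := h5 (v + j)
    grind

lemma exchange_coloring_symm {g : ℕ → ℕ → Z}
    (hg : Coloring [⟨u, p, v + p'.src + w⟩, ⟨u + p.tgt + v, p', w⟩] g) :
    Coloring [⟨u + p.src + v, p', w⟩, ⟨u, p, v + p'.tgt + w⟩]
      (fun k => if k = 0 then g 0 else if k = 1 then midColor u v p.src p.tgt (g 0) (g 2) else g 2) := by
  rw [coloring_two] at hg ⊢
  obtain ⟨⟨h1, h2, h3⟩, h4, h5, h6⟩ := hg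
  simp only [if_true, one_ne_zero, if_false, OfNat.ofNat_ne_zero, OfNat.ofNat_ne_one] at *
  have m1 : ∀ j < u + p.src + v, midColor u v p.src p.tgt (g 0) (g 2) j = g 0 j :=
    fun j hj => if_pos hj
  have m2 : ∀ j, midColor u v p.src p.tgt (g 0) (g 2) (u + p.src + v + j) =
      g 2 (u + p.tgt + v + j) := by
    intro j
    rw [midColor, if_neg (by omega)]
    congr 1
    omega
  refine ⟨⟨fun j hj => (m1 j hj).symm, fun j => ?_, ?_⟩, fun j hj => ?_, fun j => ?_, ?_⟩
  · rw [add_assoc (u + p.src + v) p'.tgt, m2, ← add_assoc]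
    have := h5 j
    simp only at this ⊢
    rw [← this]
    have := h2 (v + p'.src + j)
    grind
  · refine h6.congr (fun j hj => ?_) (fun j hj => (m2 j).symm)
    have := h2 (v + j)
    grind
  · grind
  · by_cases hj : j < v
    · simp_all
    · obtain ⟨i, rfl⟩ := Nat.exists_eq_add_of_le (Nat.not_lt.1 hj)
      grind
  · refine h3.congr (fun j hj => (m1 _ (by omega)).symm)
      (fun j hj => h4 _ (by omega))

variable [AddCommMonoid M]

lemma exchange_locEq : LocEq (u + p.src + v + p'.src + w) (u + p.tgt + v + p'.tgt + w)
    [⟨u, p, v + p'.src + w⟩, ⟨u + p.tgt + v, p', w⟩]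
    [⟨u + p.src + v, p', w⟩, ⟨u, p, v + p'.tgt + w⟩] := by
  refine ⟨?_, ?_, fun g hg => ⟨_, exchange_coloring u v w p p' hg, rfl, rfl⟩,
    fun g hg => ⟨_, exchange_coloring_symm u v w p p' hg, rfl, rfl⟩, ?_, ?_, ?_, ?_⟩
  · simp [Typed, Letter.src, Letter.tgt]; omega
  · simp [Typed, Letter.src, Letter.tgt]; omega
  · intro f f' hf hf' h0 h2 k hk
    simp only [List.length_cons, List.length_nil] at h2 hk
    rw [coloring_two] at hf hf'
    rcases (by omega : k = 0 ∨ k = 1 ∨ k = 2) with rfl | rfl | rfl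
    · exact h0
    · funext j
      by_cases hj : j < u + p.tgt + v
      · rw [hf.2.1 j hj, hf'.2.1 j hj, h2]
      · obtain ⟨i, rfl⟩ := Nat.exists_eq_add_of_le (Nat.not_lt.1 hj)
        have e1 := hf.1.2.1 (v + i)
        have e2 := hf'.1.2.1 (v + i)
        grind
    · exact h2
  · intro f f' hf hf' h0 h2 k hk
    simp only [List.length_cons, List.length_nil] at h2 hk
    rw [coloring_two] at hf hf'
    rcases (by omega : k = 0 ∨ k = 1 ∨ k = 2) with rfl | rfl | rfl
    · exact h0
    · funext j
      by_cases hj : j < u + p.src + v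
      · rw [← hf.1.1 j hj, ← hf'.1.1 j hj, h0]
      · obtain ⟨i, rfl⟩ := Nat.exists_eq_add_of_le (Nat.not_lt.1 hj)
        have e1 := hf.2.2.1 (v + i)
        have e2 := hf'.2.2.1 (v + i)
        grind
    · exact h2
  · intro f g hf hg h0 h2
    simp only [List.length_cons, List.length_nil] at h2
    rw [coloring_two] at hf hg
    simp only [tot, Letter.tot, add_zero]
    rw [add_comm]
    congr 1
    · refine Kind.tot_congr (fun j hj => ?_) fun j hj => ?_
      · have := hf.1.2.1 (v + j)
        grind
      · have := hg.2.2.1 (v + j)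
        grind
    · refine Kind.tot_congr (fun j hj => ?_) fun j hj => ?_
      · rw [h0]; exact hg.1.1 _ (by simp only; omega)
      · have := hf.2.1 (u + j) (by simp only; omega)
        rw [this]; exact congrFun h2 _
  · intro f g hf hg h0 h2
    simp only [List.length_cons, List.length_nil, Nat.reduceAdd] at h2 ⊢
    rw [coloring_two] at hf hg
    have hA := Kind.res_shFlat hf.1.2.2
    have hB := Kind.res_shFlat hf.2.2.2
    have h := FEq.exchange (kc (f 0) 0 u) (kc (f 0) (u + p.src) v)
      (kc (f 0) (u + p.src + v + p'.src) w) hA hB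
    simp only [kc_shift, add_zero] at h
    have a1 : ∀ j < v, f 0 (u + p.src + j) = f 2 (u + p.tgt + j) := fun j hj =>
      (hf.1.2.1 j).trans (hf.2.1 _ (by simp only; omega))
    have a2 : ∀ j, f 0 (u + p.src + v + j) = f 1 (u + p.tgt + v + j) := fun j => by
      have := hf.1.2.1 (v + j); simpa only [← add_assoc] using this
    have a3 : ∀ j, f 0 (u + p.src + v + p'.src + j) = f 2 (u + p.tgt + v + p'.tgt + j) := fun j => by
      rw [add_assoc _ p'.src, a2, ← add_assoc]
      exact hf.2.2.1 j
    have a4 : ∀ j < u + p.tgt + v, f 1 j = f 2 j := hf.2.1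
    have a5 : ∀ j < u, f 0 j = f 2 j := fun j hj => (hf.1.1 j hj).trans (a4 _ (by omega))
    have b1 : ∀ j < u + p.src + v, f 0 j = g 1 j := by rw [h0]; exact hg.1.1
    have b2 : ∀ j, f 2 (u + p.tgt + v + j) = g 1 (u + p.src + v + j) := fun j => by
      have := hg.2.2.1 (v + j); grind
    have c1 : kc (f 1) (u + p.tgt + v) p'.src = kc (f 0) (u + p.src + v) p'.src :=
      kc_congr fun j _ => (a2 j).symm
    have c2 : kc (f 1) u p.tgt = kc (f 2) u p.tgt := kc_congr fun j hj => a4 _ (by omega)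
    have c3 : kc (f 0) (u + p.src) v = kc (f 2) (u + p.tgt) v := kc_congr a1
    have c4 : kc (f 0) (u + p.src + v + p'.src) w = kc (f 2) (u + p.tgt + v + p'.tgt) w :=
      kc_congr fun j _ => a3 j
    have c5 : kc (f 0) 0 u = kc (f 2) 0 u := kc_congr fun j hj => by simpa using a5 j hj
    have c6 : kc (f 1) 0 (u + p.tgt + v) = kc (f 0) 0 u + kc (f 1) u p.tgt + kc (f 0) (u + p.src) v := by
      simp only [kc_add, zero_add, c2, c3, c5]
      grind [kc_congr]
    have c7 : kc (g 1) 0 u = kc (f 0) 0 u := kc_congr fun j hj => by simpa using (b1 j (by omega)).symm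
    have c8 : kc (f 1) (u + p.tgt + v + p'.src) w = kc (f 0) (u + p.src + v + p'.src) w :=
      kc_congr fun j _ => by rw [add_assoc, ← a2, ← add_assoc]
    have c9 : kc (g 1) (u + p.src) (v + p'.tgt + w) = kc (f 0) (u + p.src) v +
        kc (f 2) (u + p.tgt + v) p'.tgt + kc (f 0) (u + p.src + v + p'.src) w := by
      rw [kc_add, kc_add, c4]
      congr 1
      · congr 1
        · exact kc_congr fun j hj => (b1 _ (by omega)).symm
        · exact kc_congr fun j hj => (b2 _).symm
      · exact kc_congr fun j hj => by
          rw [show u + p.src + (v + p'.tgt) + j = u + p.src + v + (p'.tgt + j) by omega,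
            ← b2, ← add_assoc]
    have r1 : p'.res (fun j => f 1 (u + p.tgt + v + j)) (fun j => f 2 (u + p.tgt + v + j)) =
        p'.res (fun j => g 0 (u + p.src + v + j)) (fun j => g 1 (u + p.src + v + j)) :=
      Kind.res_congr (fun j _ => by rw [← h0]; exact (a2 j).symm) fun j _ => b2 j
    have r2 : p.res (fun j => f 0 (u + j)) (fun j => f 1 (u + j)) =
        p.res (fun j => g 1 (u + j)) (fun j => g 2 (u + j)) :=
      Kind.res_congr (fun j _ => b1 _ (by omega)) fun j _ => by grind
    have e0 : kc (f 0) 0 (u + p.src + v + p'.src + w) = kc (f 0) 0 u + kc (f 0) u p.src +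
        kc (f 0) (u + p.src) v + kc (f 1) (u + p.tgt + v) p'.src +
          kc (f 0) (u + p.src + v + p'.src) w := by
      simp only [kc_add, zero_add, c1]
    have e2 : kc (f 2) 0 (u + p.tgt + v + p'.tgt + w) = kc (f 0) 0 u + kc (f 1) u p.tgt +
        kc (f 0) (u + p.src) v + kc (f 2) (u + p.tgt + v) p'.tgt +
          kc (f 0) (u + p.src + v + p'.src) w := by
      simp only [kc_add, zero_add, c2, c3, c4, c5]
    rw [e0, e2]
    simp only [res, Letter.res, List.append_nil, c6, c7, c8, c9]
    rw [← r1, ← r2, ← h0]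
    convert h using 2
    · rw [kc_add, kc_add, ← add_assoc (u + p.src), c1]
    · congr 2
      simp only [kc_add, zero_add]

lemma exchange_equ : Equ (u + p.src + v + p'.src + w) (u + p.tgt + v + p'.tgt + w)
    [⟨u, p, v + p'.src + w⟩, ⟨u + p.tgt + v, p', w⟩]
    [⟨u + p.src + v, p', w⟩, ⟨u, p, v + p'.tgt + w⟩] := (exchange_locEq u v w p p').equ

end Exchange
end Moves

section Moves2

variable {M : Type} {Z : Type}

/-- Letters that consist of vertical strands. -/
def Letter.IsId (l : Letter M) : Prop := (∃ z, l.kind = .mark z) ∨ ∃ z, l.kind = .vert z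

lemma Letter.IsId.coloring {l : Letter M} (h : l.IsId) {b t : ℕ → Z} :
    l.Coloring b t ↔ b = t := by
  rcases l with ⟨u, k, v⟩
  constructor
  · rintro ⟨h1, h2, h3⟩
    funext j
    by_cases hj : j < u
    · exact h1 j hj
    obtain ⟨i, rfl⟩ := Nat.exists_eq_add_of_le (Nat.not_lt.1 hj)
    rcases h with ⟨z, rfl⟩ | ⟨z, rfl⟩
    · rcases i with _ | i
      · exact h3
      · simpa [Kind.src, Kind.tgt, Nat.add_right_comm, ← add_assoc] using h2 i
    · rcases i with _ | _ | i
      · exact h3.1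
      · exact h3.2
      · simpa [Kind.src, Kind.tgt, Nat.add_right_comm, ← add_assoc] using h2 i
  · rintro rfl
    rcases h with ⟨z, rfl⟩ | ⟨z, rfl⟩ <;>
      exact ⟨fun _ _ => rfl, fun _ => rfl, by simp [Kind.Const]⟩

lemma Letter.IsId.res {l : Letter M} (h : l.IsId) {b t : ℕ → Prop} : l.res b t = [] := by
  rcases l with ⟨u, k, v⟩
  rcases h with ⟨z, rfl⟩ | ⟨z, rfl⟩ <;> rfl

lemma coloring_id {X : List (Letter M)} (h : ∀ l ∈ X, l.IsId) {f : ℕ → ℕ → Z} :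
    Coloring X f ↔ ∀ k ≤ X.length, f k = f 0 := by
  induction X generalizing f with
  | nil => simp [Coloring]
  | cons l X ih =>
    simp only [Coloring, (h l (by simp)).coloring, ih fun l hl => h l (by simp [hl]),
      List.length_cons]
    constructor
    · rintro ⟨h0, h1⟩ k hk
      rcases k with _ | k
      · rfl
      · rw [h1 k (by omega), ← h0]
    · intro h1
      exact ⟨(h1 1 (by omega)).symm, fun k hk => (h1 (k + 1) (by omega)).trans (h1 1 (by omega)).symm⟩

lemma res_id {X : List (Letter M)} (h : ∀ l ∈ X, l.IsId) {f : ℕ → ℕ → Prop} : res X f = [] := by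
  induction X generalizing f with
  | nil => rfl
  | cons l X ih => rw [res, (h l (by simp)).res, ih fun l hl => h l (by simp [hl])]; rfl

lemma mark_isId (u v : ℕ) (z : M) : (⟨u, .mark z, v⟩ : Letter M).IsId := Or.inl ⟨z, rfl⟩

lemma vert_isId (u v : ℕ) (z : M) : (⟨u, .vert z, v⟩ : Letter M).IsId := Or.inr ⟨z, rfl⟩

lemma cup_coloring {u v : ℕ} {b t : ℕ → Z} : (⟨u, .cup, v⟩ : Letter M).Coloring b t ↔
    (∀ j < u, b j = t j) ∧ (∀ j, b (u + j) = t (u + 2 + j)) ∧ t u = t (u + 1) := Iff.rfl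

lemma cap_coloring {u v : ℕ} {b t : ℕ → Z} : (⟨u, .cap, v⟩ : Letter M).Coloring b t ↔
    (∀ j < u, b j = t j) ∧ (∀ j, b (u + 2 + j) = t (u + j)) ∧ b u = b (u + 1) := Iff.rfl

lemma horiz_coloring {u v : ℕ} {z : M} {b t : ℕ → Z} :
    (⟨u, .horiz z, v⟩ : Letter M).Coloring b t ↔
    (∀ j < u, b j = t j) ∧ (∀ j, b (u + 2 + j) = t (u + 2 + j)) ∧ b u = b (u + 1) ∧
      t u = t (u + 1) := Iff.rfl

lemma coloring_cons {l : Letter M} {W : List (Letter M)} {f : ℕ → ℕ → Z} :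
    Coloring (l :: W) f ↔ l.Coloring (f 0) (f 1) ∧ Coloring W fun k => f (k + 1) := Iff.rfl

lemma coloring_nil {f : ℕ → ℕ → Z} : Coloring ([] : List (Letter M)) f ↔ True := Iff.rfl

variable [AddCommMonoid M]

lemma locEq_of_id {m n : ℕ} {X Y : List (Letter M)} (tX : Typed m X n) (tY : Typed m Y n)
    (hX : ∀ l ∈ X, l.IsId) (hY : ∀ l ∈ Y, l.IsId)
    (h : ∀ S : ℕ → Prop, tot X (fun _ => S) = tot Y fun _ => S) : LocEq m n X Y := by
  have hmn : m = n := by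
    clear h tY hY
    induction X generalizing m with
    | nil => exact tX
    | cons l X ih =>
      have := ih tX.2 fun l hl => hX l (by simp [hl])
      rw [tX.1, ← this]
      rcases hX l (by simp) with ⟨z, hz⟩ | ⟨z, hz⟩ <;>
        simp [Letter.src, Letter.tgt, Kind.src, Kind.tgt, hz]
  subst hmn
  refine ⟨tX, tY,
    fun g hg => ⟨fun _ => g 0, (coloring_id hX).2 fun _ _ => rfl, rfl, ((coloring_id hY).1 hg _ le_rfl).symm⟩,
    fun g hg => ⟨fun _ => g 0, (coloring_id hY).2 fun _ _ => rfl, rfl, ((coloring_id hX).1 hg _ le_rfl).symm⟩,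
    fun f f' hf hf' h0 _ k hk => ?_, fun f f' hf hf' h0 _ k hk => ?_, fun f g hf hg h0 _ => ?_,
    fun f g hf hg h0 _ => ?_⟩
  · rw [(coloring_id hX).1 hf k hk, (coloring_id hX).1 hf' k hk, h0]
  · rw [(coloring_id hY).1 hf k hk, (coloring_id hY).1 hf' k hk, h0]
  · rw [tot_congr ((coloring_id hX).1 hf), tot_congr ((coloring_id hY).1 hg), h0, h]
  · rw [(coloring_id hX).1 hf _ le_rfl, res_id hX, res_id hY]
    exact FEq.refl rfl

lemma mark_zero (u v : ℕ) : Equ (u + 1 + v) (u + 1 + v) [⟨u, .mark (0 : M), v⟩] [] := by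
  refine LocEq.equ (locEq_of_id ⟨rfl, rfl⟩ rfl (by simp [mark_isId]) (by simp) fun S => ?_)
  simp [tot, Letter.tot, Kind.tot, valIf]

lemma mark_add (u v : ℕ) (a b : M) : Equ (u + 1 + v) (u + 1 + v)
    [⟨u, .mark a, v⟩, ⟨u, .mark b, v⟩] [⟨u, .mark (a + b), v⟩] := by
  refine LocEq.equ (locEq_of_id ⟨rfl, rfl, rfl⟩ ⟨rfl, rfl⟩ (by simp [mark_isId]) (by simp [mark_isId])
    fun S => ?_)
  by_cases h : S u <;> simp [tot, Letter.tot, Kind.tot, valIf, h]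

lemma vert_equ (u v : ℕ) (z : M) : Equ (u + 2 + v) (u + 2 + v) [⟨u, .vert z, v⟩]
    [⟨u + 1, .mark z, v⟩, ⟨u, .mark z, v + 1⟩] := by
  refine LocEq.equ (locEq_of_id ⟨rfl, rfl⟩ ?_ (by simp [vert_isId]) (by simp [mark_isId]) fun S => ?_)
  · simp only [Typed, Letter.src, Letter.tgt, Kind.src, Kind.tgt, and_true, true_and]; omega
  · simp [tot, Letter.tot, Kind.tot, valIf, add_comm]

lemma vert_zero (u v : ℕ) : Equ (u + 2 + v) (u + 2 + v) [⟨u, .vert (0 : M), v⟩] [] := by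
  refine LocEq.equ (locEq_of_id ⟨rfl, rfl⟩ rfl (by simp [vert_isId]) (by simp) fun S => ?_)
  simp [tot, Letter.tot, Kind.tot, valIf]

lemma cup_mark (u v : ℕ) (z : M) : Equ (u + v) (u + 2 + v)
    [⟨u, .cup, v⟩, ⟨u, .mark z, v + 1⟩] [⟨u, .cup, v⟩, ⟨u + 1, .mark z, v⟩] := by
  have key : ∀ {Z : Type} (u' v' : ℕ) (f : ℕ → ℕ → Z),
      Coloring [⟨u, .cup, v⟩, (⟨u', .mark z, v'⟩ : Letter M)] f ↔
      (⟨u, .cup, v⟩ : Letter M).Coloring (f 0) (f 1) ∧ f 1 = f 2 := fun u' v' f => by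
    rw [coloring_two, (mark_isId u' v' z).coloring]
  refine LocEq.equ ⟨?_, ?_, fun g hg => ⟨g, by rwa [key] at hg ⊢, rfl, rfl⟩,
    fun g hg => ⟨g, by rwa [key] at hg ⊢, rfl, rfl⟩, ?_, ?_, ?_, ?_⟩
  iterate 2 · simp only [Typed, Letter.src, Letter.tgt, Kind.src, Kind.tgt, and_true, true_and]; omega
  iterate 2
    · intro f f' hf hf' h0 h1 k hk
      rw [key] at hf hf'
      obtain rfl | rfl | rfl : k = 0 ∨ k = 1 ∨ k = 2 := by simp at hk; omega
      exacts [h0, by rw [hf.2, hf'.2, show f 2 = f' 2 from h1], h1]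
  · intro f g hf hg h0 h1
    simp only [List.length_cons, List.length_nil, Nat.reduceAdd] at h1
    rw [key] at hf hg
    simp only [tot, Letter.tot, Kind.tot, add_zero]
    rw [hf.2, hg.2, h1, ← hg.2, (cup_coloring.1 hg.1).2.2]
  · intro f g hf hg h0 h1
    simp only [List.length_cons, List.length_nil, Nat.reduceAdd] at h1 ⊢
    rw [key] at hf hg
    simp only [res, (mark_isId _ _ _).res, List.append_nil]
    rw [h0, hf.2, h1, ← hg.2]
    have := Letter.res_isFlat hg.1
    simpa [Letter.src, Letter.tgt, Kind.src, Kind.tgt] using FEq.refl this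

lemma mark_cap (u v : ℕ) (z : M) : Equ (u + 2 + v) (u + v)
    [⟨u, .mark z, v + 1⟩, ⟨u, .cap, v⟩] [⟨u + 1, .mark z, v⟩, ⟨u, .cap, v⟩] := by
  have key : ∀ {Z : Type} (u' v' : ℕ) (f : ℕ → ℕ → Z),
      Coloring [(⟨u', .mark z, v'⟩ : Letter M), ⟨u, .cap, v⟩] f ↔
      f 0 = f 1 ∧ (⟨u, .cap, v⟩ : Letter M).Coloring (f 1) (f 2) := fun u' v' f => by
    rw [coloring_two, (mark_isId u' v' z).coloring]
  refine LocEq.equ ⟨?_, ?_, fun g hg => ⟨g, by rwa [key] at hg ⊢, rfl, rfl⟩,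
    fun g hg => ⟨g, by rwa [key] at hg ⊢, rfl, rfl⟩, ?_, ?_, ?_, ?_⟩
  iterate 2 · simp only [Typed, Letter.src, Letter.tgt, Kind.src, Kind.tgt, and_true, true_and]; omega
  iterate 2
    · intro f f' hf hf' h0 h1 k hk
      rw [key] at hf hf'
      obtain rfl | rfl | rfl : k = 0 ∨ k = 1 ∨ k = 2 := by simp at hk; omega
      exacts [h0, by rw [← hf.1, ← hf'.1, h0], h1]
  · intro f g hf hg h0 h1
    rw [key] at hf hg
    simp only [tot, Letter.tot, Kind.tot, add_zero]
    rw [h0, hg.1, (cap_coloring.1 hg.2).2.2]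
  · intro f g hf hg h0 h1
    simp only [List.length_cons, List.length_nil, Nat.reduceAdd] at h1 ⊢
    rw [key] at hf hg
    simp only [res, (mark_isId _ _ _).res, List.append_nil, List.nil_append]
    rw [← hf.1, h0, hg.1, h1]
    have := Letter.res_isFlat hg.2
    simpa [Letter.src, Letter.tgt, Kind.src, Kind.tgt] using FEq.refl this

lemma horiz_equ (u v : ℕ) (z : M) : Equ (u + 2 + v) (u + 2 + v) [⟨u, .horiz z, v⟩]
    [⟨u, .mark z, v + 1⟩, ⟨u, .cap, v⟩, ⟨u, .cup, v⟩, ⟨u + 1, .mark z, v⟩] := by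
  have key : ∀ {Z : Type} (f : ℕ → ℕ → Z),
      Coloring [(⟨u, .mark z, v + 1⟩ : Letter M), ⟨u, .cap, v⟩, ⟨u, .cup, v⟩, ⟨u + 1, .mark z, v⟩] f ↔
      f 0 = f 1 ∧ (⟨u, .cap, v⟩ : Letter M).Coloring (f 1) (f 2) ∧
        (⟨u, .cup, v⟩ : Letter M).Coloring (f 2) (f 3) ∧ f 3 = f 4 := fun f => by
    simp only [coloring_cons, coloring_nil, (mark_isId _ _ z).coloring, and_true, Nat.reduceAdd]
  have one : ∀ {Z : Type} (f : ℕ → ℕ → Z), Coloring [(⟨u, .horiz z, v⟩ : Letter M)] f ↔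
      (⟨u, .horiz z, v⟩ : Letter M).Coloring (f 0) (f 1) := fun f => by
    simp only [coloring_cons, coloring_nil, and_true]
  have kab : ∀ (f : ℕ → ℕ → Prop), (⟨u, .cap, v⟩ : Letter M).Coloring (f 1) (f 2) →
      kc (f 2) 0 u = kc (f 1) 0 u ∧ kc (f 2) u v = kc (f 1) (u + 2) v := fun f hf =>
    ⟨kc_congr fun j hj => by simpa using (hf.1 j hj).symm, kc_congr fun j _ => (hf.2.1 j).symm⟩
  refine LocEq.equ ⟨?_, ?_, fun {Z} g hg => ⟨fun k => if k = 0 then g 0 else g 4, ?_, rfl, rfl⟩,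
    fun {Z} g hg => ⟨fun k => if k ≤ 1 then g 0 else if k = 2 then
      (fun j => if j < u then g 0 j else g 0 (j + 2)) else g 1, ?_, rfl, rfl⟩, ?_, ?_, ?_, ?_⟩
  · simp only [Typed, Letter.src, Letter.tgt, Kind.src, Kind.tgt, and_true, true_and]
  · simp only [Typed, Letter.src, Letter.tgt, Kind.src, Kind.tgt, and_true, true_and]; omega
  · rw [key] at hg
    obtain ⟨h0, h1, h2, h3⟩ := hg
    rw [one, horiz_coloring]
    rw [cap_coloring, ← h0] at h1
    rw [cup_coloring, h3] at h2
    exact ⟨fun j hj => (h1.1 j hj).trans (h2.1 j hj), fun j => (h1.2.1 j).trans (h2.2.1 j),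
      h1.2.2, h2.2.2⟩
  · rw [one, horiz_coloring] at hg
    rw [key]
    refine ⟨rfl, cap_coloring.2 ⟨fun j hj => ?_, fun j => ?_, hg.2.2.1⟩,
      cup_coloring.2 ⟨fun j hj => ?_, fun j => ?_, hg.2.2.2⟩, rfl⟩
    · simp [hj]
    · simp [Nat.add_right_comm]
    · simpa [hj] using hg.1 j hj
    · simpa [Nat.add_right_comm] using hg.2.1 j
  · intro f f' hf hf' h0 h1 k hk
    simp only [List.length_cons, List.length_nil] at h1 hk
    rcases (by omega : k = 0 ∨ k = 1) with rfl | rfl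
    · exact h0
    · exact h1
  · intro f f' hf hf' h0 h1 k hk
    simp only [List.length_cons, List.length_nil] at h1 hk
    rw [key] at hf hf'
    have e1 : f 1 = f' 1 := by rw [← hf.1, ← hf'.1, h0]
    rcases (by omega : k = 0 ∨ k = 1 ∨ k = 2 ∨ k = 3 ∨ k = 4) with rfl | rfl | rfl | rfl | rfl
    · exact h0
    · exact e1
    · funext j
      by_cases hj : j < u
      · rw [← hf.2.1.1 j hj, ← hf'.2.1.1 j hj, e1]
      · obtain ⟨i, rfl⟩ := Nat.exists_eq_add_of_le (Nat.not_lt.1 hj)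
        exact (hf.2.1.2.1 i).symm.trans ((congrFun e1 _).trans (hf'.2.1.2.1 i))
    · rw [hf.2.2.2, hf'.2.2.2, h1]
    · exact h1
  · intro f g hf hg h0 h1
    simp only [List.length_cons, List.length_nil, Nat.reduceAdd] at h1
    rw [key] at hg
    rw [one] at hf
    simp only [tot, Letter.tot, Kind.tot, add_zero, zero_add, Nat.reduceAdd]
    rw [h0, h1, ← hg.2.2.2]
  · intro f g hf hg h0 h1
    simp only [List.length_cons, List.length_nil, Nat.reduceAdd] at h1 ⊢
    rw [key] at hg
    rw [one] at hf
    have hk := kab _ hg.2.1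
    have e : res [(⟨u, .horiz z, v⟩ : Letter M)] f = res [(⟨u, .mark z, v + 1⟩ : Letter M),
        ⟨u, .cap, v⟩, ⟨u, .cup, v⟩, ⟨u + 1, .mark z, v⟩] g := by
      simp only [res, List.append_nil, List.nil_append, Letter.res, Kind.res, List.map_nil,
        add_zero, Kind.src, Nat.reduceAdd, hk.1, hk.2, h0, h1, ← hg.1, hg.2.2.2, List.map_append]
    rw [← e]
    have := res_isFlat (m := u + 2 + v) (n := u + 2 + v) (W := [(⟨u, .horiz z, v⟩ : Letter M)])
      ⟨rfl, rfl⟩ ((one f).2 hf)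
    exact FEq.refl this

lemma zig_aux {u v : ℕ} {f : ℕ → ℕ → Z}
    (h : Coloring [(⟨u, .cup, v + 1⟩ : Letter M), ⟨u + 1, .cap, v⟩] f) :
    f 0 = f 2 ∧ (∀ j < u, f 1 j = f 0 j) ∧ (∀ j < 2, f 1 (u + j) = f 0 u) ∧
      ∀ j, f 1 (u + 2 + j) = f 0 (u + j) := by
  rw [coloring_two, cup_coloring, cap_coloring] at h
  obtain ⟨⟨h1, h2, h3⟩, h4, h5, h6⟩ := h
  have e1 : f 1 (u + 1) = f 0 u := h6.trans (h2 0).symm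
  refine ⟨funext fun j => ?_, fun j hj => (h1 j hj).symm, fun j hj => ?_, fun j => (h2 j).symm⟩
  · rcases lt_trichotomy j u with hj | rfl | hj
    · rw [h1 j hj, h4 j (by omega)]
    · rw [← h4 j (by omega), h3, e1]
    · obtain ⟨i, rfl⟩ := Nat.exists_eq_add_of_lt hj
      have := h2 (i + 1)
      grind
  · grind

lemma zag_aux {u v : ℕ} {f : ℕ → ℕ → Z}
    (h : Coloring [(⟨u + 1, .cup, v⟩ : Letter M), ⟨u, .cap, v + 1⟩] f) :
    f 0 = f 2 ∧ (∀ j < u, f 1 j = f 0 j) ∧ (∀ j < 2, f 1 (u + j) = f 0 u) ∧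
      ∀ j, f 1 (u + 2 + j) = f 0 (u + j) := by
  rw [coloring_two, cup_coloring, cap_coloring] at h
  obtain ⟨⟨h1, h2, h3⟩, h4, h5, h6⟩ := h
  have e1 : f 1 (u + 1) = f 0 u := h6.symm.trans (h1 u (by omega)).symm
  have e2 : ∀ j, f 1 (u + 2 + j) = f 0 (u + j) := by
    rintro (_ | j)
    · exact h3.symm.trans e1
    · grind
  refine ⟨funext fun j => ?_, fun j hj => (h1 j (by omega)).symm, fun j hj => ?_, e2⟩
  · by_cases hj : j < u
    · grind
    · obtain ⟨i, rfl⟩ := Nat.exists_eq_add_of_le (Nat.not_lt.1 hj)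
      rw [← e2, h5]
  · grind

def zigColor (u : ℕ) (f : ℕ → Z) (j : ℕ) : Z :=
  if j < u then f j else if j < u + 2 then f u else f (j - 2)

lemma zig_locEq {u v : ℕ} {X : List (Letter M)} (tX : Typed (u + 1 + v) X (u + 1 + v))
    (hl : X.length = 2)
    (h1 : ∀ {Z : Type} (g : ℕ → Z), Coloring X fun k => if k = 1 then zigColor u g else g)
    (h2 : ∀ {Z : Type} (f : ℕ → ℕ → Z), Coloring X f →
      f 0 = f 2 ∧ (∀ j < u, f 1 j = f 0 j) ∧ (∀ j < 2, f 1 (u + j) = f 0 u) ∧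
      ∀ j, f 1 (u + 2 + j) = f 0 (u + j))
    (h3 : ∀ f, tot X f = 0)
    (h4 : ∀ f, Coloring X f → FEq (kc (f 0) 0 (u + 1 + v)) (kc (f 0) 0 (u + 1 + v)) (res X f) []) :
    LocEq (u + 1 + v) (u + 1 + v) X [] := by
  refine ⟨tX, rfl, fun g _ => ⟨_, h1 (g 0), rfl, by simp [hl]⟩,
    fun f hf => ⟨fun _ => f 0, trivial, rfl, by rw [(h2 f hf).1, hl]⟩, ?_, ?_, ?_, ?_⟩
  · intro f f' hf hf' h0 h1 k hk
    rw [hl] at h1 hk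
    obtain ⟨-, a1, a2, a3⟩ := h2 f hf
    obtain ⟨-, b1, b2, b3⟩ := h2 f' hf'
    rcases (by omega : k = 0 ∨ k = 1 ∨ k = 2) with rfl | rfl | rfl
    · exact h0
    · funext j
      by_cases hj : j < u
      · rw [a1 j hj, b1 j hj, h0]
      · obtain ⟨i, rfl⟩ := Nat.exists_eq_add_of_le (Nat.not_lt.1 hj)
        by_cases hi : i < 2
        · rw [a2 i hi, b2 i hi, h0]
        · obtain ⟨i, rfl⟩ := Nat.exists_eq_add_of_le (Nat.not_lt.1 hi)
          rw [← add_assoc, a3, b3, h0]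
    · exact h1
  · intro f f' _ _ h0 _ k hk
    simp only [List.length_nil, Nat.le_zero] at hk
    rw [hk, h0]
  · intro f g _ _ _ _
    rw [h3]; rfl
  · intro f g hf hg _ _
    have := h4 f hf
    rw [hl, ← (h2 f hf).1]
    exact this

lemma zig_left (u v : ℕ) {g : ℕ → Z} :
    Coloring [(⟨u, .cup, v + 1⟩ : Letter M), ⟨u + 1, .cap, v⟩]
      fun k => if k = 1 then zigColor u g else g := by
  rw [coloring_two, cup_coloring, cap_coloring]
  simp only [zero_ne_one, if_false, if_true, OfNat.ofNat_ne_one, zigColor]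
  grind

lemma zag_left (u v : ℕ) {g : ℕ → Z} :
    Coloring [(⟨u + 1, .cup, v⟩ : Letter M), ⟨u, .cap, v + 1⟩]
      fun k => if k = 1 then zigColor u g else g := by
  rw [coloring_two, cup_coloring, cap_coloring]
  simp only [zero_ne_one, if_false, if_true, OfNat.ofNat_ne_one, zigColor]
  grind

lemma kc_split (κ : ℕ → Prop) (u v : ℕ) : kc κ u (v + 1) = kc κ u 1 + kc κ (u + 1) v := by
  rw [Nat.add_comm v, kc_add]

lemma zigzag_equ (u v : ℕ) : Equ (u + 1 + v) (u + 1 + v)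
    [(⟨u, .cup, v + 1⟩ : Letter M), ⟨u + 1, .cap, v⟩] [] := by
  refine LocEq.equ (zig_locEq (u := u) ?_ rfl (fun g => zig_left u v) (fun f hf => zig_aux hf) ?_ ?_)
  · simp only [Typed, Letter.src, Letter.tgt, Kind.src, Kind.tgt, and_true, true_and]; omega
  · intro f; simp [tot, Letter.tot, Kind.tot, valIf]
  · intro f hf
    have hF := res_isFlat (m := u + 1 + v) (n := u + 1 + v) (by
      simp only [Typed, Letter.src, Letter.tgt, Kind.src, Kind.tgt, and_true, true_and]; omega) hf
    obtain ⟨h0, h1, h2, h3⟩ := zig_aux hf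
    have k1 : kc (f 1) 0 (u + 1) = kc (f 0) 0 u + kc (f 0) u 1 := by
      rw [kc_add]
      congr 1
      · exact kc_congr fun j hj => by simpa using h1 j hj
      · exact kc_congr fun j hj => by
          rw [Nat.lt_one_iff.1 hj]; simpa using h2 0 (by omega)
    have k2 : kc (f 1) (u + 1 + 2) v = kc (f 0) (u + 1) v := kc_congr fun j hj => by
      rw [show u + 1 + 2 + j = u + 2 + (1 + j) by omega, h3]; congr 1; omega
    have a1 := h2 0 (by omega)
    have a2 := h2 1 (by omega)
    simp only [List.length_cons, List.length_nil, Nat.reduceAdd, ← h0] at hF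
    simp only [res, Letter.res, Kind.res, Kind.src, add_zero, k1, k2, List.append_nil] at hF ⊢
    rw [a2] at hF ⊢
    rw [add_zero] at a1
    rw [a1] at hF ⊢
    rw [kc_split (f 0) u v] at hF ⊢
    rw [kc_one] at hF ⊢
    by_cases hu : f 0 u
    · simp only [hu, listIf_true, if_true, List.map_cons, List.map_nil, List.singleton_append, add_comm 1] at hF ⊢
      exact FEq.of_move (.zigzag _ _) hF rfl
    · simp only [hu, listIf_false, not_false_eq_true, if_false, List.map_nil, List.append_nil]
      exact FEq.refl rfl

lemma zagzig_equ (u v : ℕ) : Equ (u + 1 + v) (u + 1 + v)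
    [(⟨u + 1, .cup, v⟩ : Letter M), ⟨u, .cap, v + 1⟩] [] := by
  refine LocEq.equ (zig_locEq (u := u) ?_ rfl (fun g => zag_left u v) (fun f hf => zag_aux hf) ?_ ?_)
  · simp only [Typed, Letter.src, Letter.tgt, Kind.src, Kind.tgt, and_true, true_and]; omega
  · intro f; simp [tot, Letter.tot, Kind.tot, valIf]
  · intro f hf
    have hF := res_isFlat (m := u + 1 + v) (n := u + 1 + v) (by
      simp only [Typed, Letter.src, Letter.tgt, Kind.src, Kind.tgt, and_true, true_and]; omega) hf
    obtain ⟨h0, h1, h2, h3⟩ := zag_aux hf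
    have k1 : kc (f 1) 0 u = kc (f 0) 0 u := kc_congr fun j hj => by simpa using h1 j hj
    have k2 : kc (f 1) (u + 2) (v + 1) = kc (f 0) u (v + 1) := kc_congr fun j hj => by
      rw [h3]
    have a1 := h2 0 (by omega)
    have a2 := h2 1 (by omega)
    simp only [List.length_cons, List.length_nil, Nat.reduceAdd, ← h0] at hF
    simp only [res, Letter.res, Kind.res, Kind.src, add_zero, k1, k2, List.append_nil] at hF ⊢
    rw [a2] at hF ⊢
    rw [add_zero] at a1
    rw [a1] at hF ⊢
    rw [kc_add (f 0) 0 u 1, kc_split (f 0) u v, zero_add] at hF ⊢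
    rw [kc_one] at hF ⊢
    by_cases hu : f 0 u
    · simp only [hu, listIf_true, if_true, List.map_cons, List.map_nil, List.singleton_append, add_comm 1] at hF ⊢
      exact FEq.of_move (.zagzig _ _) hF rfl
    · simp only [hu, listIf_false, not_false_eq_true, if_false, List.map_nil, List.append_nil]
      exact FEq.refl rfl

end Moves2

section Loop

variable {M : Type} {Z : Type}

lemma Coloring.outer {m n : ℕ} {W : List (Letter M)} (h : Typed m W n) {f : ℕ → ℕ → Z}
    (hf : Coloring W f) (k : ℕ) (hk : k ≤ W.length) : ∃ w, ∀ j, f k (w + j) = f 0 (m + j) := by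
  induction W generalizing m f k with
  | nil =>
    aesop
  | cons l W ih =>
    rcases k with _ | k
    · exact ⟨m, fun j => rfl⟩
    · obtain ⟨w, hw⟩ := ih h.2 hf.2 k (by simpa using hk)
      refine ⟨w, fun j => (hw j).trans ?_⟩
      have := hf.1.2.1 (l.right + j)
      simp only [← add_assoc] at this
      rw [h.1]
      exact this.symm

lemma circ_finite {n : ℕ} {W : List (Letter M)} (h : Typed 0 W n) : (circ W).Finite := by
  choose! w hw using (coloring_pt W).outer h
  refine Set.Finite.subset (Set.Finite.biUnion (Set.finite_Iic W.length)
    (t := fun k => pt W k '' Set.Iio (w k)) fun k _ => (Set.finite_Iio _).image _) ?_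
  rintro c ⟨⟨k, hk, i, rfl⟩, hc⟩
  simp only [Set.mem_iUnion]
  refine ⟨k, hk, i, ?_, rfl⟩
  by_contra hi
  obtain ⟨j, rfl⟩ := Nat.exists_eq_add_of_le (Nat.not_lt.1 hi)
  exact hc j (by rw [hw k hk j, zero_add])

variable [AddCommMonoid M]

lemma tot_false (W : List (Letter M)) : tot W (fun _ _ => False) = 0 := by
  induction W with
  | nil => rfl
  | cons l W ih =>
    rw [tot, ih, Letter.tot]
    cases l.kind <;> simp [Kind.tot, valIf]

def loopWord (u v v' : ℕ) (z : M) : List (Letter M) :=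
  [⟨u, .cup, v⟩, ⟨u, .mark z, v'⟩, ⟨u, .cap, v⟩]

lemma loop_coloring {u v v' : ℕ} {z : M} {f : ℕ → ℕ → Z} :
    Coloring (loopWord u v v' z) f ↔
      f 0 = f 3 ∧ f 1 = f 2 ∧ (∀ j < u, f 1 j = f 0 j) ∧ (∀ j, f 1 (u + 2 + j) = f 0 (u + j)) ∧
        f 1 u = f 1 (u + 1) := by
  simp only [loopWord, coloring_cons, (mark_isId _ _ z).coloring, coloring_nil, cup_coloring, cap_coloring,
    Nat.reduceAdd, zero_add, and_true]
  constructor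
  · rintro ⟨⟨h1, h2, h3⟩, h4, h5, h6, h7⟩
    refine ⟨funext fun j => ?_, h4, fun j hj => (h1 j hj).symm, fun j => (h2 j).symm, h3⟩
    by_cases hj : j < u
    · rw [h1 j hj, h4, h5 j hj]
    · obtain ⟨i, rfl⟩ := Nat.exists_eq_add_of_le (Nat.not_lt.1 hj)
      rw [h2, h4, h6]
  aesop

lemma loop_exists {u v v' : ℕ} {z : M} (P Q : List (Letter M)) :
    let X := loopWord u v v' z
    ∃ (G : Cp (P ++ [] ++ Q) → Cp (P ++ X ++ Q)), Function.Injective G ∧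
      Agree P.length 0 3 (fun k i => G (pt _ k i)) (pt _) ∧
      (∀ c, G c ≠ pt (P ++ X ++ Q) (P.length + 1) u) ∧
      circ (P ++ X ++ Q) = insert (pt (P ++ X ++ Q) (P.length + 1) u) (G '' circ (P ++ [] ++ Q)) ∧
      (∀ c, totc _ (G c) = totc _ c) ∧ totc _ (pt (P ++ X ++ Q) (P.length + 1) u) = z := by
  intro X
  have hlen : X.length = 3 := rfl
  obtain ⟨g, hg, hga⟩ := exists_agree (X := []) (P := P) (Q := Q)
    (fun g (hg : Coloring X g) => ⟨fun _ => g 0, trivial, rfl, (loop_coloring.1 hg).1⟩)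
    (coloring_pt (P ++ X ++ Q))
  obtain ⟨f, hf, hfa, f', hf', hff⟩ := exists_agree_of (X := X) (P := P) (Q := Q) (Y := [])
    (p := fun f => f 1 u = none)
    (fun (g : ℕ → ℕ → Option (Cp (P ++ [] ++ Q))) _ =>
      ⟨fun k => if k = 1 ∨ k = 2 then
        (fun j => if j < u then g 0 j else if j < u + 2 then none else g 0 (j - 2)) else g 0,
      by
        rw [loop_coloring]
        grind, by simp, by simp [hlen], by simp⟩)
    ((coloring_pt (P ++ [] ++ Q)).map some)
  rw [hlen] at hfa hga hff
  set ℓ := pt (P ++ X ++ Q) (P.length + 1) u with hℓ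
  have Fℓ : hf.lift ℓ = none := by simp_all
  have FG : ∀ c, hf.lift (hg.lift c) = some c := by
    intro c
    obtain ⟨k, i, rfl⟩ := c.exists_pt
    have : (fun k i => hf.lift (g k i)) = fun k i => some (pt (P ++ [] ++ Q) k i) := by
      refine Agree.ext (a := P.length) (x := 0) ⟨fun k hk => ?_, fun k => ?_⟩ fun k hk => ?_
      · funext i; beta_reduce; rw [hga.1 k hk]; exact congrFun (hfa.1 k hk) i
      · funext i; exact (congrArg hf.lift (congrFun (hga.2 k) i)).trans (congrFun (hfa.2 k) i)
      · obtain rfl := Nat.le_zero.1 hk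
        funext i; rw [add_zero, hga.1 _ le_rfl]; exact congrFun (hfa.1 _ le_rfl) i
    exact congrFun (congrFun this k) i
  have inj : Function.Injective hg.lift := fun a b h => by grind
  have ne : ∀ c, hg.lift c ≠ ℓ := fun c h => by grind
  have hX := (coloring_append.1 (coloring_append.1 (coloring_pt (P ++ X ++ Q))).1).2
  rw [loop_coloring] at hX
  simp only [add_zero] at hX
  have lU : (P ++ X ++ Q).length = P.length + 3 + Q.length := by simp [X, loopWord]; omega
  have lV : (P ++ [] ++ Q).length = P.length + Q.length := by simp
  have pts : ∀ k ≤ (P ++ X ++ Q).length, ∀ i, pt (P ++ X ++ Q) k i = ℓ ∨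
      ∃ k' ≤ (P ++ [] ++ Q).length, ∃ i', pt (P ++ X ++ Q) k i = hg.lift (pt _ k' i') := by
    intro k hk i
    have low : ∀ k ≤ P.length, ∀ i, ∃ k' ≤ (P ++ [] ++ Q).length, ∃ i',
        pt (P ++ X ++ Q) k i = hg.lift (pt _ k' i') := fun k hk i =>
      ⟨k, by omega, i, by rw [hg.lift_pt, hga.1 k hk]⟩
    by_cases h1 : k ≤ P.length
    · exact Or.inr (low k h1 i)
    by_cases h2 : P.length + 3 ≤ k
    · obtain ⟨j, rfl⟩ := Nat.exists_eq_add_of_le h2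
      refine Or.inr ⟨P.length + 0 + j, by omega, i, ?_⟩
      rw [hg.lift_pt]
      exact (congrFun (hga.2 j) i).symm
    have : pt (P ++ X ++ Q) k i = pt (P ++ X ++ Q) (P.length + 1) i := by
      rcases (by omega : k = P.length + 1 ∨ k = P.length + 2) with rfl | rfl
      · rfl
      · exact (congrFun hX.2.1 i).symm
    rw [this]
    rcases (by omega : i < u ∨ i = u ∨ i = u + 1 ∨ u + 2 ≤ i) with hi | rfl | rfl | hi
    · rw [hX.2.2.1 i hi]; exact Or.inr (low _ le_rfl _)
    · exact Or.inl rfl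
    · exact Or.inl hX.2.2.2.2.symm
    · obtain ⟨j, rfl⟩ := Nat.exists_eq_add_of_le hi
      rw [hX.2.2.2.1]; exact Or.inr (low _ le_rfl _)
  have zero : ∀ j, pt (P ++ X ++ Q) 0 j = hg.lift (pt _ 0 j) := fun j => by
    rw [hg.lift_pt, hga.1 0 (Nat.zero_le _)]
  refine ⟨hg.lift, inj, hga, ne, ?_, fun c => ?_, ?_⟩
  · ext c
    constructor
    · rintro ⟨⟨k, hk, i, rfl⟩, hc⟩
      rcases pts k hk i with e | ⟨k', hk', i', e⟩
      · exact Or.inl e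
      · refine Or.inr ⟨_, ⟨⟨k', hk', i', rfl⟩, fun j hj => hc j ?_⟩, e.symm⟩
        rw [e, hj, zero]
    · rintro (rfl | ⟨c, ⟨⟨k, hk, i, rfl⟩, hc⟩, rfl⟩)
      · exact ⟨⟨_, by omega, u, rfl⟩, fun j hj => ne _ ((zero j).symm.trans hj.symm)⟩
      · refine ⟨?_, fun j hj => hc j (inj (hj.trans (zero j)))⟩
        rw [hg.lift_pt]
        rcases Nat.le_total k P.length with h | h
        · exact ⟨k, by omega, i, by rw [hga.1 k h]⟩
        · obtain ⟨j, rfl⟩ := Nat.exists_eq_add_of_le h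
          exact ⟨P.length + 3 + j, by omega, i, congrFun (hga.2 j) i⟩
  · unfold totc
    have e1 : ∀ k i, (pt (P ++ [] ++ Q) k i = c) = (g k i = hg.lift c) := fun k i => by
      rw [← hg.lift_pt, inj.eq_iff]
    simp only [e1, tot_append, List.length_append, hlen, List.length_nil]
    have t1 : tot X (fun k i => pt (P ++ X ++ Q) (P.length + k) i = hg.lift c) = 0 := by
      grind [loopWord, tot, Letter.tot, Kind.tot, valIf_false]
    rw [t1]
    have t2 : tot P (fun k i => pt (P ++ X ++ Q) k i = hg.lift c) =
        tot P fun k i => g k i = hg.lift c :=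
      tot_congr fun k hk => by funext i; rw [hga.1 k hk]
    have t3 : (fun k i => pt (P ++ X ++ Q) (P.length + 3 + k) i = hg.lift c) =
        fun k i => g (P.length + 0 + k) i = hg.lift c := by
      funext k i
      exact congrArg (· = hg.lift c) (congrFun (hga.2 k) i).symm
    rw [t2, t3]
    rfl
  · unfold totc
    simp only [tot_append, List.length_append, hlen]
    have t2 : tot P (fun k i => pt (P ++ X ++ Q) k i = ℓ) = 0 := by
      rw [← tot_false P]
      refine tot_congr fun k hk => ?_
      funext i
      rw [← hga.1 k hk]
      exact eq_false (ne (pt _ k i))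
    have t3 : (fun k i => pt (P ++ X ++ Q) (P.length + 3 + k) i = ℓ) = fun _ _ => False := by
      funext k i
      rw [← congrFun (hga.2 k) i]
      exact eq_false (ne (pt _ _ i))
    rw [t2, t3, tot_false]
    grind [loopWord, tot, Letter.tot, Kind.tot, valIf_true]

open Classical in
lemma numc_loop {u v v' m : ℕ} {z : M} {P Q : List (Letter M)} (hP : Typed 0 P m)
    (hQ : Typed m Q 0) (R : M → Prop) :
    numc R (P ++ loopWord u v v' z ++ Q) =
      numc R (P ++ Q) + if R z then 1 else 0 := by
  obtain ⟨G, inj, -, ne, hc, ht, hz⟩ := loop_exists (u := u) (v := v) (v' := v') (z := z) P Q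
  have fin : (circ (P ++ Q)).Finite := circ_finite (hP.append hQ)
  have e0 : P ++ [] ++ Q = P ++ Q := by simp
  rw [← e0] at fin ⊢
  unfold numc
  rw [← Set.ncard_image_of_injective _ inj]
  have e1 : G '' {c ∈ circ (P ++ [] ++ Q) | R (totc _ c)} =
      {c ∈ G '' circ (P ++ [] ++ Q) | R (totc _ c)} := by
    ext c
    constructor
    · rintro ⟨c, ⟨h1, h2⟩, rfl⟩
      exact ⟨⟨c, h1, rfl⟩, by rwa [ht]⟩
    · rintro ⟨⟨c, h1, rfl⟩, h2⟩
      exact ⟨c, ⟨h1, by rwa [ht] at h2⟩, rfl⟩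
  have fin2 := (fin.image G).subset (fun c hc => hc.1 : {c ∈ G '' circ (P ++ [] ++ Q) |
    R (totc _ c)} ⊆ G '' circ (P ++ [] ++ Q))
  rw [e1, hc]
  by_cases hR : R z
  · rw [if_pos hR, ← Set.ncard_insert_of_notMem (a := pt _ (P.length + 1) u) (hs := fin2)]
    · congr 1
      ext c
      constructor
      · rintro ⟨rfl | h1, h2⟩
        · exact Or.inl rfl
        · exact Or.inr ⟨h1, h2⟩
      · rintro (rfl | ⟨h1, h2⟩)
        · exact ⟨Or.inl rfl, by rwa [hz]⟩
        · exact ⟨Or.inr h1, h2⟩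
    · rintro ⟨⟨c, -, h⟩, -⟩
      exact ne c h
  grind

lemma res_loop {u v v' : ℕ} {z : M} {κ : ℕ → ℕ → Prop} (h1 : ¬ κ 1 u) (h2 : ¬ κ 2 u) :
    res (loopWord u v v' z) κ = [] := by
  simp only [loopWord, res, Letter.res, Kind.res, add_zero, zero_add, Nat.reduceAdd, List.map_nil]
  rw [listIf_false h1, listIf_false h2]
  rfl

lemma cfg_loop {u v v' : ℕ} {z : M} (P Q : List (Letter M)) {R : M → Prop} (hR : ¬ R z) :
    cfg R (P ++ loopWord u v v' z ++ Q) = cfg R (P ++ Q) := by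
  have e0 : P ++ [] ++ Q = P ++ Q := by simp
  rw [← e0]
  unfold cfg
  congr 1
  obtain ⟨G, inj, ha, ne, hc, ht, hz⟩ := loop_exists (u := u) (v := v) (v' := v') (z := z) P Q
  have hlen : (loopWord u v v' z).length = 3 := rfl
  have hX := (coloring_append.1 (coloring_append.1 (coloring_pt (P ++ loopWord u v v' z ++ Q))).1).2
  rw [loop_coloring] at hX
  simp only [add_zero] at hX
  have key : ∀ c, (c ∈ circ (P ++ [] ++ Q) ∧ R (totc _ c)) =
      (G c ∈ circ (P ++ loopWord u v v' z ++ Q) ∧ R (totc _ (G c))) := fun c => by grind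
  simp only [key, res_append, List.length_append, hlen, List.length_nil]
  have t1 : res (loopWord u v v' z) (fun k i => pt (P ++ loopWord u v v' z ++ Q) (P.length + k) i ∈ circ (P ++ loopWord u v v' z ++ Q) ∧
      R (totc (P ++ loopWord u v v' z ++ Q) (pt (P ++ loopWord u v v' z ++ Q) (P.length + k) i))) = [] := by
    have a1 : ¬ (pt (P ++ loopWord u v v' z ++ Q) (P.length + 1) u ∈ circ (P ++ loopWord u v v' z ++ Q) ∧
      R (totc _ (pt (P ++ loopWord u v v' z ++ Q) (P.length + 1) u))) := fun h => hR (hz ▸ h.2)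
    exact res_loop a1 (by rwa [hX.2.1] at a1)
  rw [t1]
  congr 1
  · congr 1
    exact res_congr fun k hk => by
      funext i
      rw [← ha.1 k hk]
  · congr 1
    funext k i
    rw [← ha.2 k]

end Loop

section Flexible

variable {M : Type} {Z : Type} [AddCommMonoid M]

lemma Equ.ctx {k m n l : ℕ} {X Y : List (Letter M)} (P Q : List (Letter M)) (h : Equ m n X Y)
    (hP : Typed k P m := by
      simp only [List.cons_append, List.nil_append, Typed, Letter.src, Letter.tgt, Kind.src, Kind.tgt,
        and_true, true_and] <;> omega)
    (hQ : Typed n Q l := by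
      simp only [List.cons_append, List.nil_append, Typed, Letter.src, Letter.tgt, Kind.src, Kind.tgt,
        and_true, true_and] <;> omega) :
    Equ k l (P ++ X ++ Q) (P ++ Y ++ Q) :=
  ((Equ.refl hP).append h).append (Equ.refl hQ)

lemma Equ.step {k m n l : ℕ} {X Y Z : List (Letter M)} (P Q : List (Letter M)) (h : Equ m n X Y)
    (h' : Equ k l (P ++ Y ++ Q) Z)
    (hP : Typed k P m := by
      simp only [List.cons_append, List.nil_append, Typed, Letter.src, Letter.tgt, Kind.src, Kind.tgt,
        and_true, true_and] <;> omega)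
    (hQ : Typed n Q l := by
      simp only [List.cons_append, List.nil_append, Typed, Letter.src, Letter.tgt, Kind.src, Kind.tgt,
        and_true, true_and] <;> omega) : Equ k l (P ++ X ++ Q) Z :=
  (h.ctx P Q hP hQ).trans h'

lemma Equ.cast {m n m' n' : ℕ} {X Y : List (Letter M)} (h : Equ m n X Y)
    (hm : m = m' := by omega) (hn : n = n' := by omega) : Equ m' n' X Y := hm ▸ hn ▸ h

lemma exch {p p' : Kind M} {i a j b j' a' : ℕ}
    (h1 : i + p.tgt ≤ j := by simp only [Kind.src, Kind.tgt] <;> omega)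
    (h2 : j' + p.tgt = j + p.src := by simp only [Kind.src, Kind.tgt] <;> omega)
    (h3 : i + p.tgt + a = j + p'.src + b := by simp only [Kind.src, Kind.tgt] <;> omega)
    (h4 : i + p.tgt + a' = j + p'.tgt + b := by simp only [Kind.src, Kind.tgt] <;> omega) :
    Equ (i + p.src + a) (j + p'.tgt + b) [⟨i, p, a⟩, ⟨j, p', b⟩] [⟨j', p', b⟩, ⟨i, p, a'⟩] := by
  obtain ⟨v, rfl⟩ := Nat.exists_eq_add_of_le h1
  obtain rfl : j' = i + p.src + v := by omega
  obtain rfl : a = v + p'.src + b := by omega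
  obtain rfl : a' = v + p'.tgt + b := by omega
  have := exchange_equ i v b p p'
  simpa only [← add_assoc] using this

lemma zigzag {u v a : ℕ} (ha : a = v + 1 := by omega) : Equ (u + 1 + v) (u + 1 + v)
    [(⟨u, .cup, a⟩ : Letter M), ⟨u + 1, .cap, v⟩] [] := ha ▸ zigzag_equ u v

lemma zagzig {u v a : ℕ} (ha : a = v + 1 := by omega) : Equ (u + 1 + v) (u + 1 + v)
    [(⟨u + 1, .cup, v⟩ : Letter M), ⟨u, .cap, a⟩] [] := ha ▸ zagzig_equ u v

lemma marks_equ {m : ℕ} {X Y : List (Letter M)} (hX : ∀ l ∈ X, l.IsId) (hY : ∀ l ∈ Y, l.IsId)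
    (h : ∀ S : ℕ → Prop, tot X (fun _ => S) = tot Y fun _ => S)
    (tX : Typed m X m := by
      simp only [List.cons_append, List.nil_append, Typed, Letter.src, Letter.tgt, Kind.src, Kind.tgt,
        and_true, true_and] <;> omega)
    (tY : Typed m Y m := by
      simp only [List.cons_append, List.nil_append, Typed, Letter.src, Letter.tgt, Kind.src, Kind.tgt,
        and_true, true_and] <;> omega) :
    Equ m m X Y := (locEq_of_id tX tY hX hY h).equ

end Flexible

section Thick

variable {M : Type} {Z : Type}

/-- The kind of a letter without the marks. -/
def Kind.erase [Zero M] : Kind M → Kind M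
  | .vert _ => .vert 0
  | .horiz _ => .horiz 0
  | .mark _ => .mark 0
  | k => k

def Kind.isId : Kind M → Bool
  | .vert _ => true
  | .mark _ => true
  | _ => false

lemma Letter.isId_of {l : Letter M} (h : l.kind.isId = true) : l.IsId := by
  rcases l with ⟨u, k, v⟩
  cases k
  · cases h
  · cases h
  · exact Or.inl ⟨_, rfl⟩
  · exact Or.inr ⟨_, rfl⟩
  · cases h

/-- The letters that are not vertical strands, without marks. -/
def skel [Zero M] : List (Letter M) → List (Letter M)
  | [] => []
  | l :: W => bif l.kind.isId then skel W else ⟨l.left, l.kind.erase, l.right⟩ :: skel W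

/-- The level of the skeleton that corresponds to a level of a word. -/
def skelLevel : List (Letter M) → ℕ → ℕ
  | [], _ => 0
  | _ :: _, 0 => 0
  | l :: W, k + 1 => bif l.kind.isId then skelLevel W k else skelLevel W k + 1

lemma skelLevel_zero (W : List (Letter M)) : skelLevel W 0 = 0 := by cases W <;> rfl

lemma skelLevel_length [Zero M] (W : List (Letter M)) : skelLevel W W.length = (skel W).length := by
  induction W with
  | nil => rfl
  | cons l W ih => cases h : l.kind.isId <;> simp [skelLevel, skel, h, ih]

lemma skelLevel_le [Zero M] (W : List (Letter M)) (k : ℕ) : skelLevel W k ≤ (skel W).length := by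
  induction W generalizing k with
  | nil => rfl
  | cons l W ih =>
    rcases k with _ | k
    · exact Nat.zero_le _
    · cases h : l.kind.isId <;> simp [skelLevel, skel, h, ih]

lemma erase_coloring [Zero M] {l : Letter M} {b t : ℕ → Z} :
    (⟨l.left, l.kind.erase, l.right⟩ : Letter M).Coloring b t ↔ l.Coloring b t := by
  rcases l with ⟨u, k, v⟩
  cases k <;> exact Iff.rfl

lemma erase_res [Zero M] {l : Letter M} {b t : ℕ → Prop} :
    (⟨l.left, l.kind.erase, l.right⟩ : Letter M).res b t = l.res b t := by
  rcases l with ⟨u, k, v⟩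
  cases k <;> rfl

lemma coloring_skel [Zero M] {W : List (Letter M)} {g : ℕ → ℕ → Z} :
    Coloring W (fun k => g (skelLevel W k)) ↔ Coloring (skel W) g := by
  induction W generalizing g with
  | nil => exact Iff.rfl
  | cons l W ih =>
    cases h : l.kind.isId
    · simp only [skel, h, cond_false, coloring_cons, erase_coloring, skelLevel, skelLevel_zero]
      exact and_congr_right fun _ => ih (g := fun k => g (k + 1))
    · simp only [skel, h, cond_true, coloring_cons, skelLevel, skelLevel_zero,
        (Letter.isId_of h).coloring, true_and]
      exact ih

lemma exists_skel [Zero M] {W : List (Letter M)} {f : ℕ → ℕ → Z} (hf : Coloring W f) :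
    ∃ g : ℕ → ℕ → Z, Coloring (skel W) g ∧ ∀ k ≤ W.length, f k = g (skelLevel W k) := by
  induction W generalizing f with
  | nil => exact ⟨f, trivial, fun k hk => by rw [Nat.le_zero.1 hk]; rfl⟩
  | cons l W ih =>
    obtain ⟨g, hg, hfg⟩ := ih hf.2
    cases h : l.kind.isId
    · refine ⟨fun k => if k = 0 then f 0 else g (k - 1), ?_, fun k hk => ?_⟩
      · simp only [skel, h, cond_false, coloring_cons, erase_coloring]
        refine ⟨?_, hg⟩
        have := hfg 0 (Nat.zero_le _)
        rw [skelLevel_zero] at this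
        simpa [← this] using hf.1
      · rcases k with _ | k
        · rfl
        · simpa [skelLevel, h] using hfg k (by simpa using hk)
    · refine ⟨g, ?_, fun k hk => ?_⟩
      · simpa only [skel, h, cond_true] using hg
      · rcases k with _ | k
        · have := hfg 0 (Nat.zero_le _)
          rw [skelLevel_zero] at this
          rw [(Letter.isId_of h).coloring.1 hf.1]
          exact this
        · simpa [skelLevel, h] using hfg k (by simpa using hk)

lemma res_skel [Zero M] {W : List (Letter M)} {g : ℕ → ℕ → Prop} :
    res W (fun k => g (skelLevel W k)) = res (skel W) g := by
  induction W generalizing g with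
  | nil => rfl
  | cons l W ih =>
    cases h : l.kind.isId
    · simp only [skel, h, cond_false, res, erase_res, skelLevel, skelLevel_zero]
      rw [ih (g := fun k => g (k + 1))]
    · simp only [skel, h, cond_true, res, skelLevel, skelLevel_zero, (Letter.isId_of h).res, ih,
        List.nil_append]

/-- The colours at the boundary determine all colours. -/
def Determined (W : List (Letter M)) : Prop :=
  ∀ f f' : ℕ → ℕ → Prop, Coloring W f → Coloring W f' → f 0 = f' 0 →
    f W.length = f' W.length → ∀ k ≤ W.length, f k = f' k

variable [AddCommMonoid M]

lemma thick_aux {X Y : List (Letter M)} (h : skel X = skel Y) {f : ℕ → ℕ → Z}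
    (hf : Coloring Y f) : ∃ g, Coloring X g ∧ g 0 = f 0 ∧ g X.length = f Y.length := by
  obtain ⟨g, hg, hfg⟩ := exists_skel hf
  refine ⟨fun k => g (skelLevel X k), coloring_skel.2 (h ▸ hg), ?_, ?_⟩
  · beta_reduce; rw [hfg 0 (Nat.zero_le _), skelLevel_zero, skelLevel_zero]
  · beta_reduce; rw [hfg _ le_rfl, skelLevel_length, skelLevel_length, h]

lemma thick_det {X : List (Letter M)} (h : Determined (skel X)) : Determined X := by
  intro f f' hf hf' h0 h1 k hk
  obtain ⟨g, hg, hfg⟩ := exists_skel hf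
  obtain ⟨g', hg', hfg'⟩ := exists_skel hf'
  rw [hfg k hk, hfg' k hk]
  refine h g g' hg hg' ?_ ?_ _ (skelLevel_le X k)
  · have := hfg 0 (Nat.zero_le _)
    have := hfg' 0 (Nat.zero_le _)
    simp_all [skelLevel_zero]
  · have := hfg _ le_rfl
    have := hfg' _ le_rfl
    simp_all [skelLevel_length]

lemma thick_equ {m n : ℕ} {X Y : List (Letter M)} (h : skel X = skel Y)
    (hd : Determined (skel X))
    (ht : ∀ g : ℕ → ℕ → Prop, Coloring (skel X) g →
      tot X (fun k => g (skelLevel X k)) = tot Y fun k => g (skelLevel Y k))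
    (tX : Typed m X n := by
      simp only [List.cons_append, List.nil_append, Typed, Letter.src, Letter.tgt, Kind.src, Kind.tgt,
        and_true, true_and] <;> omega)
    (tY : Typed m Y n := by
      simp only [List.cons_append, List.nil_append, Typed, Letter.src, Letter.tgt, Kind.src, Kind.tgt,
        and_true, true_and] <;> omega) :
    Equ m n X Y := by
  have key : ∀ f g : ℕ → ℕ → Prop, Coloring X f → Coloring Y g → f 0 = g 0 →
      f X.length = g Y.length → ∃ c, Coloring (skel X) c ∧
      (∀ k ≤ X.length, f k = c (skelLevel X k)) ∧ ∀ k ≤ Y.length, g k = c (skelLevel Y k) := by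
    intro f g hf hg h0 h1
    obtain ⟨c, hc, hfc⟩ := exists_skel hf
    obtain ⟨d, hd', hgd⟩ := exists_skel hg
    have e := hd c d hc (h ▸ hd') (by
      have a := hfc 0 (Nat.zero_le _)
      have b := hgd 0 (Nat.zero_le _)
      rw [skelLevel_zero] at a b
      rw [← a, ← b, h0]) (by
      have a := hfc _ le_rfl
      have b := hgd _ le_rfl
      rw [skelLevel_length] at a b
      rw [← a, h, ← b, h1])
    exact ⟨c, hc, hfc, fun k hk => by rw [hgd k hk, e _ (h ▸ skelLevel_le Y k)]⟩
  refine LocEq.equ ⟨tX, tY, fun g hg => thick_aux h hg, fun g hg => thick_aux h.symm hg,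
    thick_det hd, thick_det (h ▸ hd), ?_, ?_⟩
  · intro f g hf hg h0 h1
    obtain ⟨c, hc, hfc, hgc⟩ := key f g hf hg h0 h1
    rw [tot_congr hfc, tot_congr hgc, ht c hc]
  · intro f g hf hg h0 h1
    obtain ⟨c, hc, hfc, hgc⟩ := key f g hf hg h0 h1
    have := res_isFlat tX hf
    rw [res_congr hgc, res_skel, ← h, ← res_skel, ← res_congr hfc]
    exact FEq.refl this

end Thick

section Smoothings

lemma determined_one {M : Type} (l : Letter M) : Determined [l] := by
  intro f f' _ _ h0 h1 k hk
  simp only [List.length_cons, List.length_nil] at h1 hk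
  rcases (by omega : k = 0 ∨ k = 1) with rfl | rfl
  · exact h0
  · exact h1

lemma determined_two {M : Type} (l l' : Letter M)
    (h : ∀ b m m' t : ℕ → Prop, l.Coloring b m → l.Coloring b m' → l'.Coloring m t →
      l'.Coloring m' t → m = m') : Determined [l, l'] := by
  intro f f' hf hf' h0 h1 k hk
  simp only [List.length_cons, List.length_nil, Nat.reduceAdd] at h1 hk
  rw [coloring_two] at hf hf'
  rcases (by omega : k = 0 ∨ k = 1 ∨ k = 2) with rfl | rfl | rfl
  · exact h0
  · exact h (f 0) _ _ (f 2) hf.1 (h0 ▸ hf'.1) hf.2 (h1 ▸ hf'.2)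
  · exact h1

variable {M : Type}

lemma mid_left {u v w : ℕ} {z z' : M} {Z : Type} {b m t : ℕ → Z}
    (h1 : (⟨u, .horiz z, v⟩ : Letter M).Coloring b m)
    (h2 : (⟨u + 1, .horiz z', w⟩ : Letter M).Coloring m t) :
    m = fun j => if j = u ∨ j = u + 1 then b (u + 2) else b j := by
  obtain ⟨a1, a2, a3, a4⟩ := horiz_coloring.1 h1
  obtain ⟨b1, b2, b3, b4⟩ := horiz_coloring.1 h2
  have e1 : m (u + 1) = b (u + 2) := b3.trans (a2 0).symm
  funext j
  by_cases hj : j = u ∨ j = u + 1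
  · rw [if_pos hj]
    rcases hj with rfl | rfl
    · rw [a4, e1]
    · exact e1
  · rw [if_neg hj]
    by_cases h : j < u
    · exact (a1 j h).symm
    · obtain ⟨i, rfl⟩ := Nat.exists_eq_add_of_le (by omega : u + 2 ≤ j)
      exact (a2 i).symm

lemma mid_right {u v w : ℕ} {z z' : M} {Z : Type} {b m t : ℕ → Z}
    (h1 : (⟨u + 1, .horiz z, v⟩ : Letter M).Coloring b m)
    (h2 : (⟨u, .horiz z', w⟩ : Letter M).Coloring m t) :
    m = fun j => if j = u + 1 ∨ j = u + 2 then b u else b j := by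
  obtain ⟨a1, a2, a3, a4⟩ := horiz_coloring.1 h1
  obtain ⟨b1, b2, b3, b4⟩ := horiz_coloring.1 h2
  have e1 : m (u + 1) = b u := b3.symm.trans (a1 u (by omega)).symm
  funext j
  by_cases hj : j = u + 1 ∨ j = u + 2
  · rw [if_pos hj]
    rcases hj with rfl | rfl
    · exact e1
    · rw [← e1]; exact a4.symm
  · rw [if_neg hj]
    by_cases h : j < u + 1
    · exact (a1 j h).symm
    · obtain ⟨i, rfl⟩ := Nat.exists_eq_add_of_le (by omega : u + 1 + 2 ≤ j)
      exact (a2 i).symm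

lemma determined_left (u v w : ℕ) (z z' : M) :
    Determined [⟨u, .horiz z, v⟩, (⟨u + 1, .horiz z', w⟩ : Letter M)] :=
  determined_two _ _ fun _ _ _ _ h1 h1' h2 h2' => (mid_left h1 h2).trans (mid_left h1' h2').symm

lemma determined_right (u v w : ℕ) (z z' : M) :
    Determined [⟨u + 1, .horiz z, v⟩, (⟨u, .horiz z', w⟩ : Letter M)] :=
  determined_two _ _ fun _ _ _ _ h1 h1' h2 h2' => (mid_right h1 h2).trans (mid_right h1' h2').symm

lemma determined_three {l1 l2 l3 : Letter M}
    (h12 : ∀ b m t m' t' : ℕ → Prop, l1.Coloring b m → l2.Coloring m t → l1.Coloring b m' →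
      l2.Coloring m' t' → m = m') (h23 : Determined [l2, l3]) : Determined [l1, l2, l3] := by
  intro f f' hf hf' h0 h1 k hk
  rw [coloring_cons] at hf hf'
  have e1 : f 1 = f' 1 := h12 (f 0) _ (f 2) _ (f' 2) hf.1 hf.2.1 (h0 ▸ hf'.1) hf'.2.1
  rcases k with _ | k
  · exact h0
  · exact h23 _ _ hf.2 hf'.2 e1 h1 k (Nat.le_of_succ_le_succ hk)

variable (u v : ℕ) (a b c : ZMod 4)

lemma VVH_equ (h : a + c = 1 + b) : (Equ (u + 3 + v) (u + 3 + v)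
    [⟨u, .horiz a, v + 1⟩, ⟨u + 1, .vert (1 - b), v⟩, ⟨u, .vert (1 - c), v + 1⟩]
    [⟨u + 1, .vert (1 - c), v⟩, ⟨u, .horiz b, v + 1⟩, ⟨u + 1, .vert (1 - a), v⟩] ∧
    Equ (u + 3 + v) (u + 3 + v)
    [⟨u, .vert (1 - a), v + 1⟩, ⟨u + 1, .vert (1 - b), v⟩, ⟨u, .horiz c, v + 1⟩]
    [⟨u + 1, .vert (1 - c), v⟩, ⟨u, .horiz b, v + 1⟩, ⟨u + 1, .vert (1 - a), v⟩]) ∧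
    Equ (u + 3 + v) (u + 3 + v)
    [⟨u + 1, .horiz c, v⟩, ⟨u, .vert (1 - b), v + 1⟩, ⟨u + 1, .vert (1 - a), v⟩]
    [⟨u, .vert (1 - a), v + 1⟩, ⟨u + 1, .horiz b, v⟩, ⟨u, .vert (1 - c), v + 1⟩] ∧
    Equ (u + 3 + v) (u + 3 + v)
    [⟨u + 1, .vert (1 - c), v⟩, ⟨u, .vert (1 - b), v + 1⟩, ⟨u + 1, .horiz a, v⟩]
    [⟨u, .vert (1 - a), v + 1⟩, ⟨u + 1, .horiz b, v⟩, ⟨u, .vert (1 - c), v + 1⟩] := by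
  obtain rfl : b = a + c - 1 := by rw [h]; ring
  refine ⟨⟨?_, ?_⟩, ?_, ?_⟩
  all_goals
    refine thick_equ rfl (determined_one _) fun g hg => ?_
    simp only [skel, Kind.isId, Kind.erase, cond_true, cond_false, coloring_cons, coloring_nil,
      horiz_coloring, Nat.reduceAdd] at hg
    simp only [tot, Letter.tot, Kind.tot, skelLevel, Kind.isId, cond_true, cond_false, add_zero,
      add_assoc, Nat.reduceAdd, zero_add]
    have e1 := hg.1.2.2.1
    have e2 := hg.1.2.2.2
  iterate 2
    have e3 := hg.1.2.1 0
    simp only [add_zero, add_assoc, Nat.reduceAdd] at e1 e2 e3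
    simp only [← e1, ← e2, ← e3]
    unfold valIf
    clear * -
    split_ifs <;> revert a c <;> decide
  iterate 2
    have e3 := hg.1.1 u (by omega)
    simp only [add_zero, add_assoc, Nat.reduceAdd] at e1 e2 e3
    simp only [← e1, ← e2, ← e3]
    unfold valIf
    clear * -
    split_ifs <;> revert a c <;> decide

lemma VHH_equ (h : a + c = 1 + b) : Equ (u + 3 + v) (u + 3 + v)
    [⟨u, .horiz a, v + 1⟩, ⟨u + 1, .horiz b, v⟩, ⟨u, .vert (1 - c), v + 1⟩]
    [⟨u + 1, .vert (1 - c), v⟩, ⟨u, .horiz b, v + 1⟩, ⟨u + 1, .horiz a, v⟩] ∧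
    Equ (u + 3 + v) (u + 3 + v)
    [⟨u, .vert (1 - a), v + 1⟩, ⟨u + 1, .horiz b, v⟩, ⟨u, .horiz c, v + 1⟩]
    [⟨u + 1, .horiz c, v⟩, ⟨u, .horiz b, v + 1⟩, ⟨u + 1, .vert (1 - a), v⟩] := by
  obtain rfl : b = a + c - 1 := by rw [h]; ring
  constructor
  on_goal 1 => refine thick_equ rfl (determined_left _ _ _ _ _) fun g hg => ?_
  on_goal 2 => refine thick_equ rfl (determined_right _ _ _ _ _) fun g hg => ?_
  all_goals
    simp only [skel, Kind.isId, Kind.erase, cond_true, cond_false, coloring_cons, coloring_nil,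
      horiz_coloring, Nat.reduceAdd] at hg
    simp only [tot, Letter.tot, Kind.tot, skelLevel, Kind.isId, cond_true, cond_false, add_zero,
      add_assoc, Nat.reduceAdd, zero_add]
    have e1 := hg.1.2.2.1
    have e2 := hg.1.2.2.2
    have e4 := hg.2.1.2.2.1
    have e5 := hg.2.1.2.2.2
    simp only [add_zero, add_assoc, Nat.reduceAdd] at e1 e2 e4 e5
  · have e3 := hg.1.2.1 0
    have e6 := hg.2.1.1 u (by omega)
    simp only [add_zero, add_assoc, Nat.reduceAdd] at e3 e6
    simp only [← e5, ← e6, ← e4, ← e2, ← e1, e3]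
    unfold valIf
    clear * -
    split_ifs <;> revert a c <;> decide
  · have e3 := hg.1.1 u (by omega)
    have e6 := hg.2.1.2.1 0
    simp only [add_zero, add_assoc, Nat.reduceAdd] at e3 e6
    simp only [← e5, ← e6, ← e4, ← e2, ← e1, e3]
    unfold valIf
    clear * -
    split_ifs <;> revert a c <;> decide

end Smoothings

section Smoothings2

lemma valIf_zero {M : Type} [Zero M] (p : Prop) : valIf p (0 : M) = 0 := by
  by_cases h : p
  · exact valIf_true h 0
  · exact valIf_false h 0

lemma horiz_zero {M : Type} [AddCommMonoid M] (u v : ℕ) : Equ (u + 2 + v) (u + 2 + v)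
    [⟨u, .horiz (0 : M), v⟩] [⟨u, .cap, v⟩, ⟨u, .cup, v⟩] := by
  have h1 := horiz_equ u v (0 : M)
  have h2 := Equ.ctx (k := u + 2 + v) (l := u + 2 + v) [] [⟨u, .cap, v⟩, ⟨u, .cup, v⟩, ⟨u + 1, .mark (0 : M), v⟩]
    (mark_zero u (v + 1))
  have h3 := Equ.ctx (k := u + 2 + v) (l := u + 2 + v) [⟨u, .cap, v⟩, ⟨u, .cup, v⟩] []
    (mark_zero (M := M) (u + 1) v)
  exact h1.trans (h2.trans h3)

lemma horiz_three_left {M : Type} [AddCommMonoid M] (u v : ℕ) : Equ (u + 3 + v) (u + 3 + v)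
    [⟨u, .horiz (0 : M), v + 1⟩, ⟨u + 1, .horiz 0, v⟩, ⟨u, .horiz 0, v + 1⟩]
    [⟨u, .horiz 0, v + 1⟩] := by
  have h := ((horiz_zero (M := M) u (v + 1)).append (((horiz_zero (M := M) (u + 1) v).ctx
    (k := u + 2 + (v + 1)) (l := u + 2 + (v + 1)) [] []).append (horiz_zero (M := M) u (v + 1))))
  have h2 := Equ.ctx (k := u + 2 + (v + 1)) (l := u + 2 + (v + 1)) [⟨u, .cap, v + 1⟩]
    [⟨u + 1, .cup, v⟩, ⟨u, .cap, v + 1⟩, ⟨u, .cup, v + 1⟩] (zigzag (M := M) (u := u) (v := v) (a := v + 1))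
  have h3 := Equ.ctx (k := u + 2 + (v + 1)) (l := u + 2 + (v + 1)) [⟨u, .cap, v + 1⟩]
    [⟨u, .cup, v + 1⟩] (zagzig (M := M) (u := u) (v := v) (a := v + 1))
  have := (h.trans (h2.trans h3)).trans (horiz_zero (M := M) u (v + 1)).symm
  exact this.cast

lemma horiz_three_right {M : Type} [AddCommMonoid M] (u v : ℕ) : Equ (u + 3 + v) (u + 3 + v)
    [⟨u + 1, .horiz (0 : M), v⟩, ⟨u, .horiz 0, v + 1⟩, ⟨u + 1, .horiz 0, v⟩]
    [⟨u + 1, .horiz 0, v⟩] := by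
  have h := ((horiz_zero (M := M) (u + 1) v).append (((horiz_zero (M := M) u (v + 1)).ctx
    (k := u + 1 + 2 + v) (l := u + 1 + 2 + v) [] []).append (horiz_zero (M := M) (u + 1) v)))
  have h2 := Equ.ctx (k := u + 1 + 2 + v) (l := u + 1 + 2 + v) [⟨u + 1, .cap, v⟩]
    [⟨u, .cup, v + 1⟩, ⟨u + 1, .cap, v⟩, ⟨u + 1, .cup, v⟩] (zagzig (M := M) (u := u) (v := v) (a := v + 1))
  have h3 := Equ.ctx (k := u + 1 + 2 + v) (l := u + 1 + 2 + v) [⟨u + 1, .cap, v⟩]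
    [⟨u + 1, .cup, v⟩] (zigzag (M := M) (u := u) (v := v) (a := v + 1))
  have := (h.trans (h2.trans h3)).trans (horiz_zero (M := M) (u + 1) v).symm
  exact this.cast

lemma determined_lrl (u v w x : ℕ) {M : Type} (z z' z'' : M) :
    Determined [⟨u, .horiz z, v⟩, (⟨u + 1, .horiz z', w⟩ : Letter M), ⟨u, .horiz z'', x⟩] :=
  determined_three (fun _ _ _ _ _ h1 h2 h1' h2' => (mid_left h1 h2).trans (mid_left h1' h2').symm)
    (determined_right _ _ _ _ _)

lemma determined_rlr (u v w x : ℕ) {M : Type} (z z' z'' : M) :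
    Determined [⟨u + 1, .horiz z, v⟩, (⟨u, .horiz z', w⟩ : Letter M), ⟨u + 1, .horiz z'', x⟩] :=
  determined_three (fun _ _ _ _ _ h1 h2 h1' h2' => (mid_right h1 h2).trans (mid_right h1' h2').symm)
    (determined_left _ _ _ _ _)

variable (u v : ℕ) (a b c : ZMod 4)

lemma VVV_equ (h : a + c = 1 + b) : Equ (u + 3 + v) (u + 3 + v)
    [⟨u, .vert (1 - a), v + 1⟩, ⟨u + 1, .vert (1 - b), v⟩, ⟨u, .vert (1 - c), v + 1⟩]
    [⟨u + 1, .vert (1 - c), v⟩, ⟨u, .vert (1 - b), v + 1⟩, ⟨u + 1, .vert (1 - a), v⟩] := by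
  obtain rfl : b = a + c - 1 := by rw [h]; ring
  refine marks_equ (by simp [vert_isId]) (by simp [vert_isId]) fun S => ?_
  simp only [tot, Letter.tot, Kind.tot, add_zero, add_assoc, Nat.reduceAdd]
  simp only [valIf]
  clear * -
  split_ifs <;> revert a c <;> decide

lemma HHH_equ (h : a + c = 1 + b) : Equ (u + 3 + v) (u + 3 + v)
    [⟨u, .horiz a, v + 1⟩, ⟨u + 1, .horiz b, v⟩, ⟨u, .horiz c, v + 1⟩]
    [⟨u + 1, .vert (1 - c), v⟩, ⟨u, .horiz b, v + 1⟩, ⟨u + 1, .vert (1 - a), v⟩] := by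
  obtain rfl : b = a + c - 1 := by rw [h]; ring
  have h1 : Equ (u + 3 + v) (u + 3 + v)
    [⟨u, .horiz a, v + 1⟩, ⟨u + 1, .horiz (a + c - 1), v⟩, ⟨u, .horiz c, v + 1⟩]
    [⟨u + 1, .vert (1 - c), v⟩, ⟨u, .mark (a + c - 1), v + 2⟩, ⟨u, .horiz 0, v + 1⟩,
      ⟨u + 1, .horiz 0, v⟩, ⟨u, .horiz 0, v + 1⟩,
      ⟨u + 1, .mark (a + c - 1), v + 1⟩, ⟨u + 1, .vert (1 - a), v⟩] := by
    refine thick_equ rfl (determined_lrl _ _ _ _ _ _ _) fun g hg => ?_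
    simp only [skel, Kind.isId, Kind.erase, cond_false, coloring_cons, horiz_coloring] at hg
    simp only [tot, Letter.tot, Kind.tot, skelLevel, Kind.isId, cond_true, cond_false, add_zero, add_assoc,
      Nat.reduceAdd, zero_add]
    obtain ⟨⟨-, e3, e1, e2⟩, ⟨e6, -, e4, e5⟩, ⟨-, e9, e7, e8⟩, -⟩ := hg
    have e3 := e3 0
    have e6 := e6 u (by omega)
    have e9 := e9 0
    simp only [add_zero, add_assoc, Nat.reduceAdd] at e1 e2 e3 e4 e5 e6 e7 e8 e9
    have f1 : g 2 (u + 2) = g 0 (u + 2) := by rw [← e5, ← e7, ← e6, e2, e4, ← e3]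
    have f2 : g 2 u = g 0 (u + 2) := by rw [e7, e5, f1]
    have f3 : g 1 (u + 1) = g 0 (u + 2) := by rw [e4, ← e3]
    have f4 : g 1 u = g 0 (u + 2) := by rw [e2, f3]
    simp only [← e9, f1, f2, ← e8, ← e1, ← e7, ← e3, f3, f4]
    simp only [valIf]
    clear * -
    split_ifs <;> revert a c <;> decide
  refine h1.trans ?_
  refine .step [⟨u + 1, .vert (1 - c), v⟩, ⟨u, .mark (a + c - 1), v + 2⟩] [⟨u + 1, .mark (a + c - 1), v + 1⟩, ⟨u + 1, .vert (1 - a), v⟩]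
    (horiz_three_left (M := ZMod 4) u v) ?_
  exact thick_equ rfl (determined_one _) fun g hg => by
    simp [tot, Letter.tot, Kind.tot, skelLevel, Kind.isId, valIf_zero, add_assoc]

lemma HHH_equ_right (h : a + c = 1 + b) : Equ (u + 3 + v) (u + 3 + v)
    [⟨u + 1, .horiz c, v⟩, ⟨u, .horiz b, v + 1⟩, ⟨u + 1, .horiz a, v⟩]
    [⟨u, .vert (1 - a), v + 1⟩, ⟨u + 1, .horiz b, v⟩, ⟨u, .vert (1 - c), v + 1⟩] := by
  obtain rfl : b = a + c - 1 := by rw [h]; ring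
  have h1 : Equ (u + 3 + v) (u + 3 + v)
    [⟨u + 1, .horiz c, v⟩, ⟨u, .horiz (a + c - 1), v + 1⟩, ⟨u + 1, .horiz a, v⟩]
    [⟨u, .vert (1 - a), v + 1⟩, ⟨u + 1, .mark (a + c - 1), v + 1⟩, ⟨u + 1, .horiz 0, v⟩,
      ⟨u, .horiz 0, v + 1⟩, ⟨u + 1, .horiz 0, v⟩,
      ⟨u + 2, .mark (a + c - 1), v⟩, ⟨u, .vert (1 - c), v + 1⟩] := by
    refine thick_equ rfl (determined_rlr _ _ _ _ _ _ _) fun g hg => ?_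
    simp only [skel, Kind.isId, Kind.erase, cond_false, coloring_cons, horiz_coloring] at hg
    simp only [tot, Letter.tot, Kind.tot, skelLevel, Kind.isId, cond_true, cond_false, add_zero, add_assoc,
      Nat.reduceAdd, zero_add]
    obtain ⟨⟨e3, -, e1, e2⟩, ⟨-, e6, e4, e5⟩, ⟨e9, -, e7, e8⟩, -⟩ := hg
    have e3 := e3 u (by omega)
    have e6 := e6 0
    have e9 := e9 u (by omega)
    simp only [add_zero, add_assoc, Nat.reduceAdd] at e1 e2 e3 e4 e5 e6 e7 e8 e9
    have f1 : g 1 (u + 1) = g 0 u := by rw [← e4, ← e3]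
    have f2 : g 1 (u + 2) = g 0 u := by rw [← e2, f1]
    have f3 : g 2 (u + 2) = g 0 u := by rw [← e6, f2]
    have f4 : g 2 (u + 1) = g 0 u := by rw [e7, f3]
    have f5 : g 3 u = g 0 u := by rw [← e9, e5, f4]
    have f6 : g 1 u = g 0 u := e3.symm
    simp only [f1, f2, f3, f4, f5, f6, ← e8, ← e1]
    simp only [valIf]
    clear * -
    split_ifs <;> revert a c <;> decide
  refine h1.trans ?_
  refine .step [⟨u, .vert (1 - a), v + 1⟩, ⟨u + 1, .mark (a + c - 1), v + 1⟩] [⟨u + 2, .mark (a + c - 1), v⟩, ⟨u, .vert (1 - c), v + 1⟩]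
    (horiz_three_right (M := ZMod 4) u v) ?_
  exact thick_equ rfl (determined_one _) fun g hg => by
    simp [tot, Letter.tot, Kind.tot, skelLevel, Kind.isId, valIf_zero, add_assoc]

lemma HVH_loop (h : a + c = 1 + b) : Equ (u + 3 + v) (u + 3 + v)
    [⟨u, .horiz a, v + 1⟩, ⟨u + 1, .vert (1 - b), v⟩, ⟨u, .horiz c, v + 1⟩]
    ([⟨u, .mark a, v + 2⟩, ⟨u, .cap, v + 1⟩] ++ loopWord u (v + 1) (v + 2) 2 ++
      [⟨u, .mark (1 - b), v⟩, ⟨u, .cup, v + 1⟩, ⟨u + 1, .mark c, v + 1⟩]) := by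
  obtain rfl : b = a + c - 1 := by rw [h]; ring
  refine .step [] [⟨u + 1, .vert (1 - (a + c - 1)), v⟩, ⟨u, .horiz c, v + 1⟩]
    (horiz_equ u (v + 1) a) ?_
  refine .step [⟨u, .mark a, v + 2⟩, ⟨u, .cap, v + 1⟩, ⟨u, .cup, v + 1⟩, ⟨u + 1, .mark a, v + 1⟩, ⟨u + 1, .vert (1 - (a + c - 1)), v⟩] []
    (horiz_equ u (v + 1) c) ?_
  refine .step [⟨u, .mark a, v + 2⟩, ⟨u, .cap, v + 1⟩, ⟨u, .cup, v + 1⟩] [⟨u, .cap, v + 1⟩, ⟨u, .cup, v + 1⟩, ⟨u + 1, .mark c, v + 1⟩]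
    (marks_equ (m := u + 3 + v) (X := [⟨u + 1, .mark a, v + 1⟩, ⟨u + 1, .vert (1 - (a + c - 1)), v⟩, ⟨u, .mark c, v + 2⟩]) (Y := [⟨u, .mark c, v + 2⟩, ⟨u + 1, .mark (2 - c), v + 1⟩, ⟨u + 2, .mark (1 - (a + c - 1)), v⟩]) (by simp [mark_isId, vert_isId]) (by simp [mark_isId]) fun S => by
      simp only [tot, Letter.tot, Kind.tot, add_zero, add_assoc, Nat.reduceAdd, valIf]
      clear * -
      split_ifs <;> revert a c <;> decide) ?_
  refine .step [⟨u, .mark a, v + 2⟩, ⟨u, .cap, v + 1⟩, ⟨u, .cup, v + 1⟩, ⟨u, .mark c, v + 2⟩, ⟨u + 1, .mark (2 - c), v + 1⟩] [⟨u, .cup, v + 1⟩, ⟨u + 1, .mark c, v + 1⟩]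
    ((exch (M := ZMod 4) (p := .cap) (p' := .mark (1 - (a + c - 1))) (i := u) (j := u) (a := v + 1) (b := v) (j' := u + 2) (a' := v + 1)).symm) ?_
  refine .step [⟨u, .mark a, v + 2⟩, ⟨u, .cap, v + 1⟩, ⟨u, .cup, v + 1⟩, ⟨u, .mark c, v + 2⟩] [⟨u, .mark (1 - (a + c - 1)), v⟩, ⟨u, .cup, v + 1⟩, ⟨u + 1, .mark c, v + 1⟩]
    ((mark_cap u (v + 1) (2 - c)).symm) ?_
  have h5 := (mark_add u (v + 2) c (2 - c)).ctx
    (k := u + 3 + v) (l := u + 3 + v) [⟨u, .mark a, v + 2⟩, ⟨u, .cap, v + 1⟩, ⟨u, .cup, v + 1⟩]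
    [⟨u, .cap, v + 1⟩, ⟨u, .mark (1 - (a + c - 1)), v⟩, ⟨u, .cup, v + 1⟩, ⟨u + 1, .mark c, v + 1⟩]
  rw [add_sub_cancel] at h5
  exact h5

lemma HVH_rest (h : a + c = 1 + b) : Equ (u + 3 + v) (u + 3 + v)
    ([⟨u, .mark a, v + 2⟩, ⟨u, .cap, v + 1⟩] ++
      [⟨u, .mark (1 - b), v⟩, ⟨u, .cup, v + 1⟩, ⟨u + 1, .mark c, v + 1⟩])
    [⟨u + 1, .vert (1 - c), v⟩, ⟨u, .horiz b, v + 1⟩, ⟨u + 1, .vert (1 - a), v⟩] := by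
  obtain rfl : b = a + c - 1 := by rw [h]; ring
  refine .step [⟨u, .mark a, v + 2⟩] [⟨u, .cup, v + 1⟩, ⟨u + 1, .mark c, v + 1⟩]
    (exch (M := ZMod 4) (p := .cap) (p' := .mark (1 - (a + c - 1))) (i := u) (j := u) (a := v + 1) (b := v) (j' := u + 2) (a' := v + 1)) ?_
  refine .step [⟨u, .mark a, v + 2⟩, ⟨u + 2, .mark (1 - (a + c - 1)), v⟩] [⟨u + 1, .mark c, v + 1⟩]
    ((horiz_zero (M := ZMod 4) u (v + 1)).symm) ?_
  refine thick_equ rfl (determined_one _) fun g hg => ?_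
  simp only [List.cons_append, List.nil_append, skel, Kind.isId, Kind.erase, cond_true, cond_false,
    coloring_cons, horiz_coloring] at hg
  simp only [List.cons_append, List.nil_append, tot, Letter.tot, Kind.tot, skelLevel, Kind.isId,
    cond_true, cond_false, add_zero, add_assoc, Nat.reduceAdd, zero_add]
  obtain ⟨⟨-, e3, e1, e2⟩, -⟩ := hg
  have e3 := e3 0
  simp only [add_zero, add_assoc, Nat.reduceAdd] at e1 e2 e3
  simp only [← e1, ← e2, ← e3]
  simp only [valIf]
  clear * -
  split_ifs <;> revert a c <;> decide

lemma HVH_loop_right (h : a + c = 1 + b) : Equ (u + 3 + v) (u + 3 + v)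
    [⟨u + 1, .horiz c, v⟩, ⟨u, .vert (1 - b), v + 1⟩, ⟨u + 1, .horiz a, v⟩]
    ([⟨u + 1, .mark c, v + 1⟩, ⟨u + 1, .cap, v⟩, ⟨u, .mark (1 - b), v⟩] ++
      loopWord (u + 1) v (v + 1) 2 ++
      [⟨u + 1, .cup, v⟩, ⟨u + 2, .mark a, v⟩]) := by
  obtain rfl : b = a + c - 1 := by rw [h]; ring
  refine .step [] [⟨u, .vert (1 - (a + c - 1)), v + 1⟩, ⟨u + 1, .horiz a, v⟩]
    (horiz_equ (u + 1) v c) ?_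
  refine .step [⟨u + 1, .mark c, v + 1⟩, ⟨u + 1, .cap, v⟩, ⟨u + 1, .cup, v⟩, ⟨u + 2, .mark c, v⟩, ⟨u, .vert (1 - (a + c - 1)), v + 1⟩] []
    (horiz_equ (u + 1) v a) ?_
  refine .step [⟨u + 1, .mark c, v + 1⟩, ⟨u + 1, .cap, v⟩, ⟨u + 1, .cup, v⟩] [⟨u + 1, .cap, v⟩, ⟨u + 1, .cup, v⟩, ⟨u + 2, .mark a, v⟩]
    (marks_equ (m := u + 3 + v) (X := [⟨u + 2, .mark c, v⟩, ⟨u, .vert (1 - (a + c - 1)), v + 1⟩, ⟨u + 1, .mark a, v + 1⟩]) (Y := [⟨u, .mark (1 - (a + c - 1)), v + 2⟩, ⟨u + 1, .mark (2 - c), v + 1⟩, ⟨u + 2, .mark c, v⟩]) (by simp [mark_isId, vert_isId]) (by simp [mark_isId]) fun S => by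
      simp only [tot, Letter.tot, Kind.tot, add_zero, add_assoc, Nat.reduceAdd, valIf]
      clear * -
      split_ifs <;> revert a c <;> decide) ?_
  refine .step [⟨u + 1, .mark c, v + 1⟩, ⟨u + 1, .cap, v⟩] [⟨u + 1, .mark (2 - c), v + 1⟩, ⟨u + 2, .mark c, v⟩, ⟨u + 1, .cap, v⟩, ⟨u + 1, .cup, v⟩, ⟨u + 2, .mark a, v⟩]
    ((exch (M := ZMod 4) (p := .mark (1 - (a + c - 1))) (p' := .cup) (i := u) (j := u + 1) (a := v) (b := v) (j' := u + 1) (a' := v + 2)).symm) ?_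
  refine .step [⟨u + 1, .mark c, v + 1⟩, ⟨u + 1, .cap, v⟩, ⟨u, .mark (1 - (a + c - 1)), v⟩, ⟨u + 1, .cup, v⟩, ⟨u + 1, .mark (2 - c), v + 1⟩] [⟨u + 1, .cup, v⟩, ⟨u + 2, .mark a, v⟩]
    ((mark_cap (u + 1) v c).symm) ?_
  have h5 := (mark_add (u + 1) (v + 1) (2 - c) c).ctx
    (k := u + 3 + v) (l := u + 3 + v) [⟨u + 1, .mark c, v + 1⟩, ⟨u + 1, .cap, v⟩,
      ⟨u, .mark (1 - (a + c - 1)), v⟩, ⟨u + 1, .cup, v⟩]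
    [⟨u + 1, .cap, v⟩, ⟨u + 1, .cup, v⟩, ⟨u + 2, .mark a, v⟩]
  rw [sub_add_cancel] at h5
  exact h5

lemma HVH_rest_right (h : a + c = 1 + b) : Equ (u + 3 + v) (u + 3 + v)
    ([⟨u + 1, .mark c, v + 1⟩, ⟨u + 1, .cap, v⟩, ⟨u, .mark (1 - b), v⟩] ++
      [⟨u + 1, .cup, v⟩, ⟨u + 2, .mark a, v⟩])
    [⟨u, .vert (1 - a), v + 1⟩, ⟨u + 1, .horiz b, v⟩, ⟨u, .vert (1 - c), v + 1⟩] := by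
  obtain rfl : b = a + c - 1 := by rw [h]; ring
  refine .step [⟨u + 1, .mark c, v + 1⟩] [⟨u + 1, .cup, v⟩, ⟨u + 2, .mark a, v⟩]
    ((exch (M := ZMod 4) (p := .mark (1 - (a + c - 1))) (p' := .cap) (i := u) (j := u + 1) (a := v + 2) (b := v) (j' := u + 1) (a' := v)).symm) ?_
  refine .step [⟨u + 1, .mark c, v + 1⟩, ⟨u, .mark (1 - (a + c - 1)), v + 2⟩] [⟨u + 2, .mark a, v⟩]
    ((horiz_zero (M := ZMod 4) (u + 1) v).symm) ?_
  refine thick_equ rfl (determined_one _) fun g hg => ?_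
  simp only [List.cons_append, List.nil_append, skel, Kind.isId, Kind.erase, cond_true, cond_false,
    coloring_cons, horiz_coloring] at hg
  simp only [List.cons_append, List.nil_append, tot, Letter.tot, Kind.tot, skelLevel, Kind.isId,
    cond_true, cond_false, add_zero, add_assoc, Nat.reduceAdd, zero_add]
  obtain ⟨⟨e3, -, e1, e2⟩, -⟩ := hg
  have e3 := e3 u (by omega)
  simp only [add_zero, add_assoc, Nat.reduceAdd] at e1 e2 e3
  simp only [← e1, ← e2, ← e3]
  simp only [valIf]
  clear * -
  split_ifs <;> revert a c <;> decide

end Smoothings2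

section Slides

variable {M : Type} [AddCommMonoid M] (u v : ℕ) (z : M)

lemma mark_comm (u v u' v' : ℕ) (z : M) (h : u + 1 + v = u' + 1 + v' := by omega) :
    Equ (u + 1 + v) (u + 1 + v) [⟨u, .mark z, v⟩, ⟨u', .mark z, v'⟩] [⟨u', .mark z, v'⟩, ⟨u, .mark z, v⟩] :=
  marks_equ (by simp [mark_isId]) (by simp [mark_isId]) (fun S => by simp [tot, Letter.tot, Kind.tot, add_comm])

lemma cup_vert : Equ (u + 1 + v) (u + 3 + v) [⟨u, .cup, v + 1⟩, ⟨u + 1, .vert z, v⟩]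
    [⟨u + 1, .cup, v⟩, ⟨u, .horiz z, v + 1⟩] := by
  refine .step [⟨u, .cup, v + 1⟩] [] (vert_equ (u + 1) v z) ?_
  refine .step [] [⟨u + 1, .mark z, v + 1⟩]
    (exch (p := .cup) (p' := .mark z) (i := u) (a := v + 1) (j := u + 2) (b := v) (j' := u) (a' := v + 1)) ?_
  refine .step [⟨u, .mark z, v⟩] [⟨u, .cup, v + 1⟩, ⟨u + 1, .mark z, v + 1⟩]
    (zagzig (M := M) (u := u) (v := v) (a := v + 1)).symm ?_
  refine .step [] [⟨u, .cap, v + 1⟩, ⟨u, .cup, v + 1⟩, ⟨u + 1, .mark z, v + 1⟩]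
    (exch (p := .mark z) (p' := .cup) (i := u) (a := v) (j := u + 1) (b := v) (j' := u + 1) (a' := v + 2)) ?_
  exact (horiz_equ u (v + 1) z).symm.ctx [⟨u + 1, .cup, v⟩] []

lemma cup_horiz : Equ (u + 1 + v) (u + 3 + v) [⟨u, .cup, v + 1⟩, ⟨u + 1, .horiz z, v⟩]
    [⟨u + 1, .cup, v⟩, ⟨u, .vert z, v + 1⟩] := by
  refine .step [⟨u, .cup, v + 1⟩] [] (horiz_equ (u + 1) v z) ?_
  refine .step [] [⟨u + 1, .cap, v⟩, ⟨u + 1, .cup, v⟩, ⟨u + 2, .mark z, v⟩]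
    (cup_mark u (v + 1) z).symm ?_
  refine .step [⟨u, .cup, v + 1⟩] [⟨u + 1, .cup, v⟩, ⟨u + 2, .mark z, v⟩]
    (exch (p := .mark z) (p' := .cap) (i := u) (a := v + 2) (j := u + 1) (b := v) (j' := u + 1) (a' := v)) ?_
  refine .step [] [⟨u, .mark z, v⟩, ⟨u + 1, .cup, v⟩, ⟨u + 2, .mark z, v⟩]
    (zigzag (M := M) (u := u) (v := v) (a := v + 1)) ?_
  refine .step [] [⟨u + 2, .mark z, v⟩]
    (exch (p := .mark z) (p' := .cup) (i := u) (a := v) (j := u + 1) (b := v) (j' := u + 1) (a' := v + 2)) ?_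
  refine .step [⟨u + 1, .cup, v⟩] [] (mark_comm u (v + 2) (u + 2) v z) ?_
  refine .step [] [⟨u, .mark z, v + 2⟩] (cup_mark (u + 1) v z).symm ?_
  exact (vert_equ u (v + 1) z).symm.ctx [⟨u + 1, .cup, v⟩] []

lemma vert_cap : Equ (u + 3 + v) (u + 1 + v) [⟨u + 1, .vert z, v⟩, ⟨u, .cap, v + 1⟩]
    [⟨u, .horiz z, v + 1⟩, ⟨u + 1, .cap, v⟩] := by
  refine .step [] [⟨u, .cap, v + 1⟩] (vert_equ (u + 1) v z) ?_
  refine .step [⟨u + 2, .mark z, v⟩] [] (mark_cap u (v + 1) z).symm ?_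
  refine .step [] [⟨u, .cap, v + 1⟩] (mark_comm (u + 2) v u (v + 2) z) ?_
  refine .step [⟨u, .mark z, v + 2⟩] []
    (exch (p := .cap) (p' := .mark z) (i := u) (j := u) (a := v + 1) (b := v) (j' := u + 2) (a' := v + 1)).symm ?_
  refine .step [⟨u, .mark z, v + 2⟩, ⟨u, .cap, v + 1⟩, ⟨u, .mark z, v⟩] []
    (zigzag (M := M) (u := u) (v := v) (a := v + 1)).symm ?_
  refine .step [⟨u, .mark z, v + 2⟩, ⟨u, .cap, v + 1⟩] [⟨u + 1, .cap, v⟩]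
    (exch (p := .cup) (p' := .mark z) (i := u) (a := v + 1) (j := u + 2) (b := v) (j' := u) (a' := v + 1)).symm ?_
  refine .step [⟨u, .mark z, v + 2⟩, ⟨u, .cap, v + 1⟩, ⟨u, .cup, v + 1⟩] []
    (mark_cap (u + 1) v z).symm ?_
  exact (horiz_equ u (v + 1) z).symm.ctx [] [⟨u + 1, .cap, v⟩]

lemma horiz_cap : Equ (u + 3 + v) (u + 1 + v) [⟨u + 1, .horiz z, v⟩, ⟨u, .cap, v + 1⟩]
    [⟨u, .vert z, v + 1⟩, ⟨u + 1, .cap, v⟩] := by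
  refine .step [] [⟨u, .cap, v + 1⟩] (horiz_equ (u + 1) v z) ?_
  refine .step [⟨u + 1, .mark z, v + 1⟩, ⟨u + 1, .cap, v⟩, ⟨u + 1, .cup, v⟩] []
    (exch (p := .cap) (p' := .mark z) (i := u) (j := u) (a := v + 1) (b := v) (j' := u + 2) (a' := v + 1)).symm ?_
  refine .step [⟨u + 1, .mark z, v + 1⟩, ⟨u + 1, .cap, v⟩] [⟨u, .mark z, v⟩]
    (zagzig (M := M) (u := u) (v := v) (a := v + 1)) ?_
  refine .step [⟨u + 1, .mark z, v + 1⟩] []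
    (exch (p := .mark z) (p' := .cap) (i := u) (a := v + 2) (j := u + 1) (b := v) (j' := u + 1) (a' := v)).symm ?_
  exact (vert_equ u (v + 1) z).symm.ctx [] [⟨u + 1, .cap, v⟩]

lemma horiz_horiz : Equ (u + 2 + v) (u + 2 + v) [⟨u, .horiz z, v⟩, ⟨u, .horiz z, v⟩]
    ([⟨u, .mark z, v + 1⟩, ⟨u, .cap, v⟩] ++ loopWord u v (v + 1) (z + z) ++
      [⟨u, .cup, v⟩, ⟨u + 1, .mark z, v⟩]) := by
  refine .trans ((horiz_equ u v z).append (horiz_equ u v z)) ?_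
  refine .step [⟨u, .mark z, v + 1⟩, ⟨u, .cap, v⟩, ⟨u, .cup, v⟩] [⟨u, .cap, v⟩, ⟨u, .cup, v⟩, ⟨u + 1, .mark z, v⟩]
    (mark_comm (u + 1) v u (v + 1) z) ?_
  refine .step [⟨u, .mark z, v + 1⟩, ⟨u, .cap, v⟩, ⟨u, .cup, v⟩, ⟨u, .mark z, v + 1⟩] [⟨u, .cup, v⟩, ⟨u + 1, .mark z, v⟩]
    (mark_cap u v z).symm ?_
  exact (mark_add u (v + 1) z z).ctx
    [⟨u, .mark z, v + 1⟩, ⟨u, .cap, v⟩, ⟨u, .cup, v⟩] [⟨u, .cap, v⟩, ⟨u, .cup, v⟩, ⟨u + 1, .mark z, v⟩]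

end Slides

section Bracket

/-- A circle with marks `z` modulo `4` is of type `h`. -/
def HType (z : ZMod 4) : Prop := z = 0 ∨ z = 1

noncomputable def ev (W : List (Letter (ZMod 4))) : Gam :=
  Finsupp.single (cfg HType W) (loopValue ^ numc (fun z => ¬ HType z) W)

/-- The mark of a smoothing: `1` if it is not compatible with the orientation. -/
def markOf (b : Bool) : ZMod 4 := if b = true then 1 else 0

/-- The exponent of the vertical smoothing. -/
def vexp (r : Bool) : ℤ := if r = true then 1 else -1

open LaurentPolynomial in
/-- The bracket of a stack of layers on top of a marked picture. -/
noncomputable def br : List Layer → List (Letter (ZMod 4)) → Gam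
  | [], acc => ev acc
  | ⟨u, .cup _, v⟩ :: L, acc => br L (acc ++ [⟨u.length, .cup, v.length⟩])
  | ⟨u, .cap _, v⟩ :: L, acc => br L (acc ++ [⟨u.length, .cap, v.length⟩])
  | ⟨u, .cross a b r, v⟩ :: L, acc =>
    (T (vexp r) : ℤ[T;T⁻¹]) • br L (acc ++ [⟨u.length, .vert (markOf (a != b)), v.length⟩]) +
      (T (-vexp r) : ℤ[T;T⁻¹]) • br L (acc ++ [⟨u.length, .horiz (markOf (a == b)), v.length⟩])

lemma typed_one {m n : ℕ} {l : Letter (ZMod 4)} : Typed m [l] n ↔ m = l.src ∧ l.tgt = n := Iff.rfl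

lemma typed_cup (u v : List Bool) (o : Bool) : Typed (Layer.src ⟨u, .cup o, v⟩).length
    [(⟨u.length, .cup, v.length⟩ : Letter (ZMod 4))] (Layer.tgt ⟨u, .cup o, v⟩).length := by
  simp [typed_one, Layer.src, Layer.tgt, Piece.src, Piece.tgt, Letter.src, Letter.tgt, Kind.src, Kind.tgt]; omega

lemma typed_cap (u v : List Bool) (o : Bool) : Typed (Layer.src ⟨u, .cap o, v⟩).length
    [(⟨u.length, .cap, v.length⟩ : Letter (ZMod 4))] (Layer.tgt ⟨u, .cap o, v⟩).length := by
  simp [typed_one, Layer.src, Layer.tgt, Piece.src, Piece.tgt, Letter.src, Letter.tgt, Kind.src, Kind.tgt]; omega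

lemma typed_vert (u v : List Bool) (a b r : Bool) (z : ZMod 4) :
    Typed (Layer.src ⟨u, .cross a b r, v⟩).length [⟨u.length, .vert z, v.length⟩]
      (Layer.tgt ⟨u, .cross a b r, v⟩).length := by
  simp [typed_one, Layer.src, Layer.tgt, Piece.src, Piece.tgt, Letter.src, Letter.tgt, Kind.src, Kind.tgt]; omega

lemma typed_horiz (u v : List Bool) (a b r : Bool) (z : ZMod 4) :
    Typed (Layer.src ⟨u, .cross a b r, v⟩).length [⟨u.length, .horiz z, v.length⟩]
      (Layer.tgt ⟨u, .cross a b r, v⟩).length := by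
  simp [typed_one, Layer.src, Layer.tgt, Piece.src, Piece.tgt, Letter.src, Letter.tgt, Kind.src, Kind.tgt]; omega

lemma br_cons_smul {l : Layer} {L L' : List Layer} {acc acc' : List (Letter (ZMod 4))} (c : ℤ[T;T⁻¹])
    (h : ∀ x, Typed l.src.length [x] l.tgt.length → br L (acc ++ [x]) = c • br L' (acc' ++ [x])) :
    br (l :: L) acc = c • br (l :: L') acc' := by
  rcases l with ⟨u, p, v⟩
  cases p with
  | cup o => exact h _ (typed_cup u v o)
  | cap o => exact h _ (typed_cap u v o)
  | cross a b r =>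
    rw [br, br, h _ (typed_vert u v a b r _), h _ (typed_horiz u v a b r _), smul_add, smul_comm c, smul_comm c]

lemma br_cons_congr {l : Layer} {L L' : List Layer} {acc acc' : List (Letter (ZMod 4))}
    (h : ∀ x, Typed l.src.length [x] l.tgt.length → br L (acc ++ [x]) = br L' (acc' ++ [x])) :
    br (l :: L) acc = br (l :: L') acc' := by
  simpa using br_cons_smul 1 (by simpa using h)

lemma br_congr {s : List Bool} {L : List Layer} (hL : IsTangle s L []) {m : ℕ}
    {acc X Y : List (Letter (ZMod 4))} (hacc : Typed 0 acc m) (h : Equ m s.length X Y) :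
    br L (acc ++ X) = br L (acc ++ Y) := by
  induction L generalizing s X Y with
  | nil =>
    cases hL
    have := (Equ.refl hacc).append h
    have := this.eqv
    simp only [br, ev]
    rw [(this _).1, (this _).2]
  | cons l L ih =>
    obtain ⟨rfl, h2⟩ := hL
    refine br_cons_congr fun x hx => ?_
    simpa using ih h2 (h.append (Equ.refl hx))

lemma ev_loop {u v v' m : ℕ} {z : ZMod 4} (hz : ¬ HType z) {P Q : List (Letter (ZMod 4))}
    (hP : Typed 0 P m) (hQ : Typed m Q 0) :
    ev (P ++ loopWord u v v' z ++ Q) = loopValue • ev (P ++ Q) := by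
  rw [ev, ev, cfg_loop P Q hz, numc_loop hP hQ, if_pos hz, Finsupp.smul_single, pow_succ',
    smul_eq_mul]

lemma br_loop {s : List Bool} {L : List Layer} (hL : IsTangle s L []) {m u v v' : ℕ} {z : ZMod 4}
    (hz : ¬ HType z) {acc Y : List (Letter (ZMod 4))} (hacc : Typed 0 acc m)
    (hY : Typed m Y s.length) :
    br L (acc ++ (loopWord u v v' z ++ Y)) = loopValue • br L (acc ++ Y) := by
  induction L generalizing s Y with
  | nil =>
    cases hL
    simp only [br]
    rw [← List.append_assoc, ev_loop hz hacc hY]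
  | cons l L ih =>
    obtain ⟨rfl, h2⟩ := hL
    refine br_cons_smul _ fun x hx => ?_
    simpa using ih h2 (hY.append hx)

lemma IsTangle.split {s t : List Bool} {w w' : List Layer} (h : IsTangle s (w ++ w') t) :
    ∃ r, IsTangle s w r ∧ IsTangle r w' t := by
  induction w generalizing s with
  | nil => exact ⟨s, rfl, h⟩
  | cons l w ih =>
    obtain ⟨r, h1, h2⟩ := ih h.2
    exact ⟨r, ⟨h.1, h1⟩, h2⟩

lemma br_prefix {s t : List Bool} {P L L' : List Layer} (hP : IsTangle s P t)
    (h : ∀ acc, Typed 0 acc t.length → br L acc = br L' acc) (acc : List (Letter (ZMod 4)))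
    (hacc : Typed 0 acc s.length) : br (P ++ L) acc = br (P ++ L') acc := by
  induction P generalizing s acc with
  | nil => cases hP; exact h acc hacc
  | cons l P ih =>
    obtain ⟨rfl, h2⟩ := hP
    exact br_cons_congr fun x hx => ih h2 _ (hacc.append hx)

lemma br_reverse (L : List Layer) (acc : List (Letter (ZMod 4))) :
    br (L.map Layer.reverse) acc = br L acc := by
  induction L generalizing acc with
  | nil => rfl
  | cons l L ih =>
    rcases l with ⟨u, p, v⟩
    have e (a b : Bool) : ((!a) == !b) = (a == b) := by cases a <;> cases b <;> rfl
    cases p <;> simp [Layer.reverse, Piece.reverse, br, ih, e]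

end Bracket

section Invariance

open LaurentPolynomial

/-- The stacks `X` and `Y`, with `m` strands at the bottom and `n` strands at the top, have the same
brackets in all diagrams. -/
def BrEq (m n : ℕ) (X Y : List Layer) : Prop :=
  ∀ (s : List Bool) (L : List Layer) (acc : List (Letter (ZMod 4))), IsTangle s L [] → s.length = n →
    Typed 0 acc m → br (X ++ L) acc = br (Y ++ L) acc

lemma br_congr_of {s : List Bool} {L : List Layer} {m n : ℕ} {acc X Y : List (Letter (ZMod 4))}
    (h : Equ m n X Y) (hL : IsTangle s L []) (hs : s.length = n) (hacc : Typed 0 acc m) :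
    br L (acc ++ X) = br L (acc ++ Y) := br_congr hL hacc (hs ▸ h)

lemma coeff_moveII (r : Bool) : (T (vexp r) : ℤ[T;T⁻¹]) * T (vexp (!r)) = 1 ∧
    T (-vexp r) * T (vexp (!r)) + T (vexp r) * T (-vexp (!r)) +
      T (-vexp r) * T (-vexp (!r)) * loopValue = (0 : ℤ[T;T⁻¹]) := by
  have h : (T 1 : ℤ[T;T⁻¹]) * T (-1) = 1 := by rw [← T_add]; simp
  have e2 : (T 2 : ℤ[T;T⁻¹]) = T 1 * T 1 := by rw [← T_add]; rfl
  have e3 : (T (-2) : ℤ[T;T⁻¹]) = T (-1) * T (-1) := by rw [← T_add]; rfl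
  cases r <;> simp only [vexp, Bool.not_true, Bool.not_false, if_true, if_false, Bool.false_eq_true,
    neg_neg, loopValue, e2, e3] <;> refine ⟨?_, ?_⟩ <;> grind

lemma coeff_moveIII {x y z : Bool} (h : ¬ (x = z ∧ y ≠ x)) :
    (T (-vexp x) * T (vexp y) * T (vexp z) + T (vexp x) * T (vexp y) * T (-vexp z) +
      T (-vexp x) * T (-vexp y) * T (-vexp z) + T (-vexp x) * T (vexp y) * T (-vexp z) * loopValue :
      ℤ[T;T⁻¹]) = T (vexp x) * T (-vexp y) * T (vexp z) := by
  have h1 : (T 1 : ℤ[T;T⁻¹]) * T (-1) = 1 := by rw [← T_add]; simp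
  have e2 : (T 2 : ℤ[T;T⁻¹]) = T 1 * T 1 := by rw [← T_add]; rfl
  have e3 : (T (-2) : ℤ[T;T⁻¹]) = T (-1) * T (-1) := by rw [← T_add]; rfl
  revert h
  cases x <;> cases y <;> cases z <;> intro h <;>
  first
  | exact absurd (by decide) h
  | simp only [vexp, Bool.not_true, Bool.not_false, if_true, if_false, Bool.false_eq_true,
      neg_neg, loopValue, e2, e3]; grind

lemma vexp_not (r : Bool) : vexp (!r) = -vexp r := by cases r <;> rfl

lemma brEq_exchange (u v w : List Bool) (p p' : Piece) :
    BrEq (u.length + p.src.length + v.length + p'.src.length + w.length)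
      (u.length + p.tgt.length + v.length + p'.tgt.length + w.length)
      [⟨u, p, v ++ p'.src ++ w⟩, ⟨u ++ p.tgt ++ v, p', w⟩]
      [⟨u ++ p.src ++ v, p', w⟩, ⟨u, p, v ++ p'.tgt ++ w⟩] := by
  intro s L acc hL hs hacc
  have key (k k' : Kind (ZMod 4)) (h1 : k.src = p.src.length := by rfl) (h2 : k.tgt = p.tgt.length := by rfl)
      (h3 : k'.src = p'.src.length := by rfl) (h4 : k'.tgt = p'.tgt.length := by rfl) :
      br L (acc ++ [⟨u.length, k, v.length + k'.src + w.length⟩,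
        ⟨u.length + k.tgt + v.length, k', w.length⟩]) =
      br L (acc ++ [⟨u.length + k.src + v.length, k', w.length⟩,
        ⟨u.length, k, v.length + k'.tgt + w.length⟩]) :=
    br_congr_of (exchange_equ _ _ _ k k') hL (by rw [hs, h2, h4]) (by rw [h1, h3]; exact hacc)
  change br (_ :: _ :: L) acc = br (_ :: _ :: L) acc
  cases p <;> cases p' <;> simp only [br, List.length_append, Piece.src, Piece.tgt, List.length_cons,
      List.length_nil, Nat.zero_add, Nat.reduceAdd, Nat.add_zero] <;>
    simp only [List.append_assoc, List.cons_append, List.nil_append, smul_add, smul_smul]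
  · exact key .cup .cup
  · exact key .cup .cap
  · congr 2; exacts [key .cup (.vert _), key .cup (.horiz _)]
  · exact key .cap .cup
  · exact key .cap .cap
  · congr 2; exacts [key .cap (.vert _), key .cap (.horiz _)]
  · congr 2; exacts [key (.vert _) .cup, key (.horiz _) .cup]
  · congr 2; exacts [key (.vert _) .cap, key (.horiz _) .cap]
  · rename_i a b r a' b' r'
    have e1 := key (.vert (markOf (a != b))) (.vert (markOf (a' != b')))
    have e2 := key (.vert (markOf (a != b))) (.horiz (markOf (a' == b')))
    have e3 := key (.horiz (markOf (a == b))) (.vert (markOf (a' != b')))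
    have e4 := key (.horiz (markOf (a == b))) (.horiz (markOf (a' == b')))
    simp only [Kind.src, Kind.tgt] at e1 e2 e3 e4
    rw [e1, e2, e3, e4]
    module

lemma brEq_zigzag (u v : List Bool) (a : Bool) : BrEq (u.length + 1 + v.length) (u.length + 1 + v.length)
    [⟨u, .cup a, a :: v⟩, ⟨u ++ [a], .cap (!a), v⟩] [] := by
  intro s L acc hL hs hacc
  have := br_congr_of (zigzag (u := u.length) (v := v.length) (a := v.length + 1)) hL hs hacc
  simpa [br] using this

lemma brEq_zagzig (u v : List Bool) (a : Bool) : BrEq (u.length + 1 + v.length) (u.length + 1 + v.length)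
    [⟨u ++ [a], .cup (!a), v⟩, ⟨u, .cap a, a :: v⟩] [] := by
  intro s L acc hL hs hacc
  have := br_congr_of (zagzig (u := u.length) (v := v.length) (a := v.length + 1)) hL hs hacc
  simpa [br] using this

lemma brEq_slideCup (u v : List Bool) (a o r : Bool) :
    BrEq (u.length + 1 + v.length) (u.length + 3 + v.length)
      [⟨u, .cup o, a :: v⟩, ⟨u ++ [o], .cross (!o) a r, v⟩]
      [⟨u ++ [a], .cup o, v⟩, ⟨u, .cross a o (!r), (!o) :: v⟩] := by
  intro s L acc hL hs hacc
  have e1 : ((!o) != a) = (a == o) := by cases o <;> cases a <;> rfl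
  have e2 : ((!o) == a) = (a != o) := by cases o <;> cases a <;> rfl
  have h1 := br_congr_of (cup_vert u.length v.length (markOf (a == o))) hL hs hacc
  have h2 := br_congr_of (cup_horiz u.length v.length (markOf (a != o))) hL hs hacc
  simp only [List.cons_append, List.nil_append, br, List.append_assoc, List.length_append,
    List.length_cons, List.length_nil, e1, e2, Nat.zero_add, vexp_not, neg_neg]
  rw [h1, h2, add_comm]

lemma brEq_slideCap (u v : List Bool) (a o r : Bool) :
    BrEq (u.length + 3 + v.length) (u.length + 1 + v.length)
      [⟨u ++ [o], .cross a (!o) r, v⟩, ⟨u, .cap o, a :: v⟩]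
      [⟨u, .cross o a (!r), (!o) :: v⟩, ⟨u ++ [a], .cap o, v⟩] := by
  intro s L acc hL hs hacc
  have e1 : (a != (!o)) = (o == a) := by cases o <;> cases a <;> rfl
  have e2 : (a == (!o)) = (o != a) := by cases o <;> cases a <;> rfl
  have h1 := br_congr_of (vert_cap u.length v.length (markOf (o == a))) hL hs hacc
  have h2 := br_congr_of (horiz_cap u.length v.length (markOf (o != a))) hL hs hacc
  simp only [List.cons_append, List.nil_append, br, List.append_assoc, List.length_append,
    List.length_cons, List.length_nil, e1, e2, Nat.zero_add, vexp_not, neg_neg]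
  rw [h1, h2, add_comm]

lemma not_hType_two : ¬ HType 2 := by unfold HType; decide

lemma brEq_moveII (u v : List Bool) (a r : Bool) :
    BrEq (u.length + 2 + v.length) (u.length + 2 + v.length)
      [⟨u, .cross a a r, v⟩, ⟨u, .cross a a (!r), v⟩] [] := by
  intro s L acc hL hs hacc
  have hV := vert_zero (M := ZMod 4) u.length v.length
  have hH : Equ (u.length + 2 + v.length) (u.length + 2 + v.length)
      [(⟨u.length, .horiz 1, v.length⟩ : Letter (ZMod 4))] [⟨u.length, .horiz 1, v.length⟩] :=
    Equ.refl (by simp [Typed, Letter.src, Letter.tgt, Kind.src, Kind.tgt])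
  have h1 := br_congr_of (hV.append hV) hL hs hacc
  have h2 := br_congr_of (hV.append hH) hL hs hacc
  have h3 := br_congr_of (hH.append hV) hL hs hacc
  have h4 := br_congr_of (horiz_horiz u.length v.length (1 : ZMod 4)) hL hs hacc
  have h5 := br_loop (u := u.length) (v := v.length) (v' := v.length + 1) hL not_hType_two
    (acc := acc ++ [⟨u.length, .mark 1, v.length + 1⟩, ⟨u.length, .cap, v.length⟩])
    (Y := [⟨u.length, .cup, v.length⟩, ⟨u.length + 1, .mark 1, v.length⟩]) (m := u.length + v.length)
    (hacc.append (k := u.length + v.length) (by simp [Typed, Letter.src, Letter.tgt, Kind.src, Kind.tgt, hs] <;> omega))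
    (by simp [Typed, Letter.src, Letter.tgt, Kind.src, Kind.tgt, hs])
  have h6 := br_congr_of (horiz_equ u.length v.length (1 : ZMod 4)) hL hs hacc
  rw [show (1 + 1 : ZMod 4) = 2 from rfl] at h4
  simp only [List.cons_append, List.nil_append, List.append_assoc] at h1 h2 h3 h4 h5 h6
  simp only [List.cons_append, List.nil_append, br, List.append_assoc, bne_self_eq_false, BEq.rfl,
    markOf, if_true, if_false, Bool.false_eq_true]
  rw [h1, h2, h3, h4, h5, ← h6, List.append_nil]
  obtain ⟨c1, c2⟩ := coeff_moveII r
  calc _ = (T (vexp r) * T (vexp (!r)) : ℤ[T;T⁻¹]) • br L acc +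
      (T (-vexp r) * T (vexp (!r)) + T (vexp r) * T (-vexp (!r)) +
      T (-vexp r) * T (-vexp (!r)) * loopValue : ℤ[T;T⁻¹]) •
        br L (acc ++ [⟨u.length, .horiz 1, v.length⟩]) := by module
    _ = _ := by rw [c1, c2, one_smul, zero_smul, add_zero]

lemma markOf_bne (a b : Bool) : markOf (a != b) = 1 - markOf (a == b) := by
  cases a <;> cases b <;> rfl

lemma markOf_add {a b c : Bool} (h : a = b ∨ b = c) :
    markOf (a == b) + markOf (b == c) = 1 + markOf (a == c) := by
  cases a <;> cases b <;> cases c <;> first | rfl | simp at h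

lemma brEq_moveIII (u v : List Bool) (a b c x y z : Bool) (hc : a = b ∨ b = c)
    (h : ¬ (x = z ∧ y ≠ x)) :
    BrEq (u.length + 3 + v.length) (u.length + 3 + v.length)
        [⟨u, .cross a b x, c :: v⟩, ⟨u ++ [b], .cross a c y, v⟩, ⟨u, .cross b c z, a :: v⟩]
        [⟨u ++ [a], .cross b c z, v⟩, ⟨u, .cross a c y, b :: v⟩, ⟨u ++ [c], .cross a b x, v⟩] := by
  intro s L acc hL hs hacc
  have hm := markOf_add hc
  have ck := coeff_moveIII h
  simp only [List.cons_append, List.nil_append, br, List.append_assoc, markOf_bne, List.length_append,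
    List.length_cons, List.length_nil, Nat.zero_add]
  generalize markOf (a == b) = α at *
  generalize markOf (a == c) = β at *
  generalize markOf (b == c) = γ at *
  generalize u.length = m at *
  generalize v.length = n at *
  have H : ∀ {X Y}, Equ (m + 3 + n) (m + 3 + n) X Y → br L (acc ++ X) = br L (acc ++ Y) := fun h => br_congr_of h hL hs hacc
  have e5 := H (HVH_loop m n α β γ hm)
  have e5' := H (HVH_rest m n α β γ hm)
  have f5 := H (HVH_loop_right m n α β γ hm)
  have f5' := H (HVH_rest_right m n α β γ hm)
  have l5 := br_loop (u := m) (v := n + 1) (v' := n + 2) hL not_hType_two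
    (acc := acc ++ [⟨m, .mark α, n + 2⟩, ⟨m, .cap, n + 1⟩])
    (Y := [⟨m, .mark (1 - β), n⟩, ⟨m, .cup, n + 1⟩, ⟨m + 1, .mark γ, n + 1⟩]) (m := m + (n + 1))
    (hacc.append (k := m + (n + 1)) (by simp [Typed, Letter.src, Letter.tgt, Kind.src, Kind.tgt, hs] <;> omega))
    (by simp [Typed, Letter.src, Letter.tgt, Kind.src, Kind.tgt, hs] <;> omega)
  have k5 := br_loop (u := m + 1) (v := n) (v' := n + 1) hL not_hType_two
    (acc := acc ++ [⟨m + 1, .mark γ, n + 1⟩, ⟨m + 1, .cap, n⟩, ⟨m, .mark (1 - β), n⟩])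
    (Y := [⟨m + 1, .cup, n⟩, ⟨m + 2, .mark α, n⟩]) (m := m + 1 + n)
    (hacc.append (k := m + 1 + n) (by simp [Typed, Letter.src, Letter.tgt, Kind.src, Kind.tgt, hs] <;> omega))
    (by simp [Typed, Letter.src, Letter.tgt, Kind.src, Kind.tgt, hs])
  simp only [List.cons_append, List.nil_append, List.append_assoc] at e5 e5' f5 f5' l5 k5
  obtain ⟨⟨v1, v2⟩, v3, v4⟩ := VVH_equ m n α β γ hm
  obtain ⟨w1, w2⟩ := VHH_equ m n α β γ hm
  rw [H (VVV_equ m n α β γ hm), H v1, H v2, H (HHH_equ m n α β γ hm), e5, H w1, H w2, l5, e5', H v3, H v4,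
    H (HHH_equ_right m n α β γ hm), f5, k5, f5']
  generalize br L (acc ++ [⟨m + 1, .vert (1 - γ), n⟩, ⟨m, .horiz β, n + 1⟩, ⟨m + 1, .vert (1 - α), n⟩]) = Y
  generalize br L (acc ++ [⟨m, .vert (1 - α), n + 1⟩, ⟨m + 1, .horiz β, n⟩, ⟨m, .vert (1 - γ), n + 1⟩]) = X
  linear_combination (norm := module) ck • Y - ck • X

end Invariance

section Diagrams

open LaurentPolynomial

lemma BrEq.eq {m n : ℕ} {x y : List Layer} (h : BrEq m n x y) {D D' : Diagram} {w w' : List Layer}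
    (hD : D.1 = w ++ x ++ w') (hD' : D'.1 = w ++ y ++ w')
    (hx : ∀ s t, IsTangle s x t → s.length = m ∧ t.length = n) : br D.1 [] = br D'.1 [] := by
  have h0 := D.2
  rw [hD, List.append_assoc] at h0
  obtain ⟨s, h1, h2⟩ := h0.split
  obtain ⟨t, h3, h4⟩ := h2.split
  rw [hD, hD', List.append_assoc, List.append_assoc]
  exact br_prefix h1 (fun acc hacc => h t w' acc h4 (hx s t h3).2 ((hx s t h3).1 ▸ hacc)) [] rfl

lemma br_braidLikeMove {D D' : Diagram} (h : Diagram.Related BraidLikeMove D D') :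
    br D.1 [] = br D'.1 [] := by
  obtain ⟨w, x, y, w', hm, hD, hD'⟩ := h
  have aux (l : Layer) (x : List Layer) (t' : List Bool) (m n : ℕ) (h1 : l.src.length = m) (h2 : t'.length = n)
      (h3 : IsTangle l.src (l :: x) t') (s t) (h4 : IsTangle s (l :: x) t) : s.length = m ∧ t.length = n := by
    obtain ⟨rfl, h5⟩ := h4
    have (x : List Layer) (r t t' : List Bool) : IsTangle r x t → IsTangle r x t' → t = t' := by
      induction x generalizing r with
      | nil => exact fun h h' => h.symm.trans h'
      | cons l x ih => exact fun h h' => ih _ h.2 h'.2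
    exact ⟨h1, by rw [this _ _ _ _ h5 h3.2, h2]⟩
  rcases hm with (⟨u, v, w, p, p'⟩ | ⟨u, v, a⟩ | ⟨u, v, a⟩ | ⟨u, v, a, o, r⟩ | ⟨u, v, a, o, r⟩) | ⟨a, hm⟩ |
    ⟨a, b, c, hc, hm⟩
  · refine (brEq_exchange u v w p p').eq hD hD' (aux _ _ (u ++ p.tgt ++ v ++ p'.tgt ++ w) _ _ ?_ ?_ ?_) <;>
      simp [IsTangle, Layer.src, Layer.tgt] <;> omega
  · refine (brEq_zigzag u v a).eq hD hD' (aux _ _ (u ++ a :: v) _ _ ?_ ?_ ?_) <;>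
      simp [IsTangle, Layer.src, Layer.tgt, Piece.src, Piece.tgt] <;> omega
  · refine (brEq_zagzig u v a).eq hD hD' (aux _ _ (u ++ a :: v) _ _ ?_ ?_ ?_) <;>
      simp [IsTangle, Layer.src, Layer.tgt, Piece.src, Piece.tgt] <;> omega
  · refine (brEq_slideCup u v a o r).eq hD hD' (aux _ _ (u ++ [o, a, !o] ++ v) _ _ ?_ ?_ ?_) <;>
      simp [IsTangle, Layer.src, Layer.tgt, Piece.src, Piece.tgt] <;> omega
  · refine (brEq_slideCap u v a o r).eq hD hD' (aux _ _ (u ++ a :: v) _ _ ?_ ?_ ?_) <;>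
      simp [IsTangle, Layer.src, Layer.tgt, Piece.src, Piece.tgt] <;> omega
  · cases hm with | mk u v _ _ r =>
    refine (brEq_moveII u v a r).eq hD hD' (aux _ _ (u ++ [a, a] ++ v) _ _ ?_ ?_ ?_) <;>
      simp [IsTangle, Layer.src, Layer.tgt, Piece.src, Piece.tgt] <;> omega
  · cases hm with | mk u v _ _ _ x y z h =>
    refine (brEq_moveIII u v a b c x y z hc h).eq hD hD' (aux _ _ (u ++ [c, b, a] ++ v) _ _ ?_ ?_ ?_) <;>
      simp [IsTangle, Layer.src, Layer.tgt, Piece.src, Piece.tgt] <;> omega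

lemma br_prefix_relation {s t : List Bool} {P L₁ L₂ L₃ : List Layer} (hP : IsTangle s P t)
    (c₁ c₂ c₃ : ℤ[T;T⁻¹])
    (h : ∀ acc, Typed 0 acc t.length → c₁ • br L₁ acc + c₂ • br L₂ acc = c₃ • br L₃ acc)
    (acc : List (Letter (ZMod 4))) (hacc : Typed 0 acc s.length) :
    c₁ • br (P ++ L₁) acc + c₂ • br (P ++ L₂) acc = c₃ • br (P ++ L₃) acc := by
  induction P generalizing s acc with
  | nil => cases hP; exact h acc hacc
  | cons l P ih =>
    obtain ⟨rfl, h2⟩ := hP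
    rcases l with ⟨u, p, v⟩
    cases p <;> simp only [List.cons_append, br]
    · exact ih h2 _ (hacc.append (typed_cup u v _))
    · exact ih h2 _ (hacc.append (typed_cap u v _))
    rename_i a b r
    have e1 := ih h2 _ (hacc.append (typed_vert u v a b r (markOf (a != b))))
    have e2 := ih h2 _ (hacc.append (typed_horiz u v a b r (markOf (a == b))))
    linear_combination (norm := module) (T (vexp r) : ℤ[T;T⁻¹]) • e1 + (T (-vexp r) : ℤ[T;T⁻¹]) • e2

lemma br_skein_local {u v t : List Bool} {L : List Layer} {a : Bool} (hL : IsTangle t L [])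
    {m : ℕ} (ht : t.length = m) (hm : m = u.length + 2 + v.length)
    (acc : List (Letter (ZMod 4))) (hacc : Typed 0 acc m) :
    ((T 1 : ℤ[T;T⁻¹]) • br (⟨u, .cross a a true, v⟩ :: L) acc +
      (-T (-1) : ℤ[T;T⁻¹]) • br (⟨u, .cross a a false, v⟩ :: L) acc =
      (T 2 - T (-2) : ℤ[T;T⁻¹]) • br L acc) ∧
    ((T 1 : ℤ[T;T⁻¹]) • br (⟨u, .cross a (!a) false, v⟩ :: L) acc +
      (-T (-1) : ℤ[T;T⁻¹]) • br (⟨u, .cross a (!a) true, v⟩ :: L) acc =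
      (T 2 - T (-2) : ℤ[T;T⁻¹]) • br (⟨u, .cap a, v⟩ :: ⟨u, .cup (!a), v⟩ :: L) acc) := by
  subst hm
  have e2 : (T 2 : ℤ[T;T⁻¹]) = T 1 * T 1 := by rw [← T_add]; rfl
  have e3 : (T (-2) : ℤ[T;T⁻¹]) = T (-1) * T (-1) := by rw [← T_add]; rfl
  constructor
  · have hV := br_congr_of (vert_zero (M := ZMod 4) u.length v.length) hL ht hacc
    simp only [br, vexp, markOf, bne_self_eq_false, if_true, if_false, Bool.false_eq_true, neg_neg]
    rw [hV, List.append_nil, e2, e3]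
    module
  · have hV := br_congr_of (horiz_zero u.length v.length) hL ht hacc
    have e : (a == !a) = false := by cases a <;> rfl
    simp only [br, vexp, markOf, e, if_true, if_false, Bool.false_eq_true, neg_neg,
      List.append_assoc, List.cons_append, List.nil_append]
    rw [hV, e2, e3]
    module

lemma negAPow_add (m n : ℤ) : negAPow (m + n) = negAPow m * negAPow n := by
  simp only [negAPow, zpow_add, Units.val_mul, map_mul, T_add]
  ring

lemma negAPow_three : negAPow 3 = -T 3 ∧ negAPow (-3) = -T (-3) := by
  have h : (((-1 : ℤˣ) ^ (3 : ℤ) : ℤˣ) : ℤ) = -1 ∧ (((-1 : ℤˣ) ^ (-3 : ℤ) : ℤˣ) : ℤ) = -1 := by decide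
  simp [negAPow, h]

lemma writhe_eq {D D₀ : Diagram} {w w' x y : List Layer} (h : D.1 = w ++ x ++ w')
    (h₀ : D₀.1 = w ++ y ++ w') :
    D.writhe = D₀.writhe + ((x.map fun l => l.piece.sign).sum - (y.map fun l => l.piece.sign).sum) := by
  simp only [Diagram.writhe, h, h₀, List.map_append, List.sum_append]
  ring

lemma br_skein {Dp Dm D0 : Diagram} (h : Diagram.SkeinTriple Dp Dm D0) :
    (T 4 : ℤ[T;T⁻¹]) • negAPow (-3 * Dp.writhe) • br Dp.1 [] -
      (T (-4) : ℤ[T;T⁻¹]) • negAPow (-3 * Dm.writhe) • br Dm.1 [] =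
      (T (-2) - T 2 : ℤ[T;T⁻¹]) • negAPow (-3 * D0.writhe) • br D0.1 [] := by
  have key : Dp.writhe = D0.writhe + 1 ∧ Dm.writhe = D0.writhe - 1 ∧
      (T 1 : ℤ[T;T⁻¹]) • br Dp.1 [] + (-T (-1) : ℤ[T;T⁻¹]) • br Dm.1 [] =
        (T 2 - T (-2) : ℤ[T;T⁻¹]) • br D0.1 [] := by
    have hp2 := Dp.2
    rcases h with ⟨w, w', u, v, a, hp, hm, h0⟩ | ⟨w, w', u, v, a, hp, hm, h0⟩ <;>
      rw [hp, List.append_assoc] at hp2 <;> obtain ⟨s, h1, h2⟩ := hp2.split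
    · have h0' : D0.1 = w ++ [] ++ w' := by simpa using h0
      refine ⟨by simp [writhe_eq hp h0', Piece.sign], by simp [writhe_eq hm h0', Piece.sign]; ring, ?_⟩
      rw [hp, hm, h0, List.append_assoc, List.append_assoc]
      refine br_prefix_relation h1 _ _ _ (fun acc hacc => ?_) [] rfl
      obtain ⟨rfl, h3⟩ := h2
      refine (br_skein_local (u := u) (v := v) (a := a) h3 ?_ ?_ acc hacc).1 <;>
        simp [Layer.src, Layer.tgt, Piece.src, Piece.tgt] <;> omega
    · refine ⟨by cases a <;> simp [writhe_eq hp h0, Piece.sign],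
        by cases a <;> simp [writhe_eq hm h0, Piece.sign] <;> ring, ?_⟩
      rw [hp, hm, h0, List.append_assoc, List.append_assoc, List.append_assoc]
      refine br_prefix_relation h1 _ _ _ (fun acc hacc => ?_) [] rfl
      obtain ⟨rfl, h3⟩ := h2
      refine (br_skein_local (u := u) (v := v) (a := a) h3 ?_ ?_ acc hacc).2 <;>
        simp [Layer.src, Layer.tgt, Piece.src, Piece.tgt] <;> omega
  obtain ⟨h1, h2, h3⟩ := key
  have e1 : -3 * Dp.writhe = -3 * D0.writhe + -3 := by rw [h1]; ring
  have e2 : -3 * Dm.writhe = -3 * D0.writhe + 3 := by rw [h2]; ring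
  have e3 : (T 4 : ℤ[T;T⁻¹]) * T (-3) = T 1 := by rw [← T_add]; rfl
  have e4 : (T (-4) : ℤ[T;T⁻¹]) * T 3 = T (-1) := by rw [← T_add]; rfl
  rw [e1, e2, negAPow_add, negAPow_add, negAPow_three.1, negAPow_three.2]
  generalize negAPow (-3 * D0.writhe) = N
  calc _ = (-N) • ((T 4 * T (-3) : ℤ[T;T⁻¹]) • br Dp.1 [] + (-(T (-4) * T 3) : ℤ[T;T⁻¹]) • br Dm.1 []) := by
        module
    _ = _ := by rw [e3, e4, h3]; module

end Diagrams

section Slices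

variable {M : Type} {Z : Type}

def Kind.shape : Kind M → Shape
  | cup => .cup
  | cap => .cap
  | mark _ => .vert
  | vert _ => .vert
  | horiz _ => .horiz

/-- The kind is that of a slice. -/
def Kind.IsShape : Kind M → Prop
  | mark _ => False
  | _ => True

def Letter.slice (l : Letter M) : Slice := ⟨l.left, l.kind.shape, l.right⟩

def slices (W : List (Letter M)) : List Slice := W.map Letter.slice

lemma Kind.shape_src {k : Kind M} (h : k.IsShape) : k.shape.src = k.src := by
  cases k <;> first | rfl | exact h.elim

lemma Kind.shape_tgt {k : Kind M} (h : k.IsShape) : k.shape.tgt = k.tgt := by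
  cases k <;> first | rfl | exact h.elim

lemma Letter.slice_src {l : Letter M} (h : l.kind.IsShape) : l.slice.src = l.src := by
  rw [Slice.src, Letter.src, Letter.slice, Kind.shape_src h]

lemma Letter.slice_tgt {l : Letter M} (h : l.kind.IsShape) : l.slice.tgt = l.tgt := by
  rw [Slice.tgt, Letter.tgt, Letter.slice, Kind.shape_tgt h]

lemma Letter.Coloring.arc {l : Letter M} {k : ℕ} {f : ℕ → ℕ → Z} {p q : ℕ × ℕ}
    (hl : l.kind.IsShape) (h : l.Coloring (f k) (f (k + 1))) (ha : Arc k l.slice p q) :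
    f p.1 p.2 = f q.1 q.2 := by
  rcases l with ⟨u, s, v⟩
  obtain ⟨h1, h2, h3⟩ := h
  cases s <;> cases ha <;>
    first | exact hl.elim | exact h1 _ ‹_› | exact h2 _ | exact h3 | exact h3.1 | exact h3.2

lemma Letter.coloring_of_arc {l : Letter M} {k : ℕ} {f : ℕ → ℕ → Z} (hl : l.kind.IsShape)
    (h : ∀ p q, Arc k l.slice p q → f p.1 p.2 = f q.1 q.2)
    (hout : ∀ j, f k (l.src + j) = f (k + 1) (l.tgt + j)) : l.Coloring (f k) (f (k + 1)) := by
  rcases l with ⟨u, s, v⟩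
  refine ⟨fun j hj => h _ _ (.left u v _ j hj), fun j => ?_, ?_⟩
  · by_cases hj : j < v
    · have := h _ _ (.right u v _ j hj)
      rwa [Kind.shape_src hl, Kind.shape_tgt hl] at this
    · obtain ⟨i, rfl⟩ := Nat.exists_eq_add_of_le (Nat.not_lt.1 hj)
      have := hout i
      grind [Letter.src, Letter.tgt]
  · cases s with
    | mark z => exact hl.elim
    | cup => exact h _ _ (.cup u v)
    | cap => exact h _ _ (.cap u v)
    | vert z => exact ⟨h _ _ (.vertLeft u v), h _ _ (.vertRight u v)⟩
    | horiz z => exact ⟨h _ _ (.horizBelow u v), h _ _ (.horizAbove u v)⟩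

lemma coloring_iff {W : List (Letter M)} {f : ℕ → ℕ → Z} :
    Coloring W f ↔ ∀ (k : ℕ) (l : Letter M), W[k]? = some l → l.Coloring (f k) (f (k + 1)) := by
  induction W generalizing f with
  | nil => simp [Coloring]
  | cons l W ih =>
    rw [Coloring, ih]
    grind

variable {W : List (Letter M)}

lemma mem_points_iff (hW : ∀ l ∈ W, l.kind.IsShape) {k i : ℕ} :
    (k, i) ∈ points (slices W) ↔ ∃ l, W[k]? = some l ∧ i < l.src := by
  simp only [points, slices, Set.mem_ofPred_eq, List.getElem?_map, Option.map_eq_some_iff]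
  constructor
  · rintro ⟨_, ⟨l, hl, rfl⟩, hi⟩
    grind [Letter.slice_src]
  · rintro ⟨l, hl, hi⟩
    exact ⟨_, ⟨l, hl, rfl⟩, by rwa [Letter.slice_src (hW l (List.mem_of_getElem? hl))]⟩

lemma mem_points_succ {m : ℕ} (hW : ∀ l ∈ W, l.kind.IsShape) (ht : Typed m W 0) {k i : ℕ} {l : Letter M}
    (hk : W[k]? = some l) : (k + 1, i) ∈ points (slices W) ↔ i < l.tgt := by
  rw [mem_points_iff hW]
  clear hW
  induction W generalizing m k with
  | nil => simp at hk
  | cons l' W ih =>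
    rcases k with _ | k
    · obtain rfl : l' = l := by simpa using hk
      have h2 := ht.2
      cases W with
      | nil =>
        have : l'.tgt = 0 := h2
        simp [this]
      | cons l'' W =>
        rw [h2.1]
        simp
    · simpa using ih ht.2 (by simpa using hk)

lemma adj_iff {p q : ℕ × ℕ} : (arcGraph (slices W)).Adj p q ↔ p ≠ q ∧
    ((∃ k l, W[k]? = some l ∧ Arc k l.slice p q) ∨ ∃ k l, W[k]? = some l ∧ Arc k l.slice q p) := by
  have : ∀ p q, (∃ k sl, (slices W)[k]? = some sl ∧ Arc k sl p q) ↔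
      ∃ k l, W[k]? = some l ∧ Arc k l.slice p q := by
    intro p q
    simp only [slices, List.getElem?_map, Option.map_eq_some_iff]
    simp_all
  rw [arcGraph, SimpleGraph.fromRel_adj, this, this]

lemma sameStrand_of_comp_eq (hW : ∀ l ∈ W, l.kind.IsShape) {p q : ℕ × ℕ}
    (h : comp (slices W) p = comp (slices W) q) : SameStrand W p q := by
  intro f hf
  have hf' := coloring_iff.1 hf
  obtain ⟨w⟩ := SimpleGraph.ConnectedComponent.exact h
  induction w with
  | nil => rfl
  | cons ha w ih =>
    refine Eq.trans ?_ (ih (SimpleGraph.ConnectedComponent.sound ⟨w⟩))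
    rcases (adj_iff.1 ha).2 with ⟨k, l, hk, h⟩ | ⟨k, l, hk, h⟩
    · exact (hf' k l hk).arc (hW l (List.mem_of_getElem? hk)) h
    · exact ((hf' k l hk).arc (hW l (List.mem_of_getElem? hk)) h).symm

lemma arc_comp_eq {k : ℕ} {l : Letter M} (hk : W[k]? = some l) {p q : ℕ × ℕ} (h : Arc k l.slice p q) :
    comp (slices W) p = comp (slices W) q := by
  by_cases hpq : p = q
  · rw [hpq]
  · exact SimpleGraph.ConnectedComponent.sound
      (SimpleGraph.Adj.reachable (adj_iff.2 ⟨hpq, Or.inl ⟨k, l, hk, h⟩⟩))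

lemma arc_mem_points (hW : ∀ l ∈ W, l.kind.IsShape) {m : ℕ} (ht : Typed m W 0) {k : ℕ} {l : Letter M}
    (hk : W[k]? = some l) {p q : ℕ × ℕ} (h : Arc k l.slice p q) :
    p ∈ points (slices W) ∧ q ∈ points (slices W) := by
  have h1 : ∀ i, (k, i) ∈ points (slices W) ↔ i < l.src := fun i => by
    rw [mem_points_iff hW, hk]; simp
  have h2 : ∀ i, (k + 1, i) ∈ points (slices W) ↔ i < l.tgt := fun i => mem_points_succ hW ht hk
  have hl := hW l (List.mem_of_getElem? hk)
  rcases l with ⟨u, s, v⟩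
  simp only [Letter.src, Letter.tgt] at h1 h2
  cases s <;> first | exact hl.elim | skip
  all_goals
    cases h <;> simp only [h1, h2, Kind.src, Kind.tgt, Kind.shape, Shape.src, Shape.tgt] <;>
      (try dsimp only at *) <;> omega

lemma coloring_points (hW : ∀ l ∈ W, l.kind.IsShape) {m : ℕ} (ht : Typed m W 0)
    (R : (arcGraph (slices W)).ConnectedComponent → Prop) :
    Coloring W fun k i => (k, i) ∈ points (slices W) ∧ R (comp _ (k, i)) := by
  rw [coloring_iff]
  intro k l hk
  refine Letter.coloring_of_arc (f := fun k i => (k, i) ∈ points (slices W) ∧ R (comp _ (k, i)))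
    (hW l (List.mem_of_getElem? hk)) (fun p q ha => ?_) fun j => ?_
  · simp only [Prod.mk.eta, arc_mem_points hW ht hk ha, arc_comp_eq hk ha]
  · have h1 : (k, l.src + j) ∉ points (slices W) := by simp [mem_points_iff hW, hk]
    have h2 : (k + 1, l.tgt + j) ∉ points (slices W) := by simp [mem_points_succ hW ht hk]
    simp only [h1, h2, false_and]

lemma comp_eq_iff (hW : ∀ l ∈ W, l.kind.IsShape) {m : ℕ} (ht : Typed m W 0) {p q : ℕ × ℕ}
    (hp : p ∈ points (slices W)) : comp (slices W) p = comp (slices W) q ↔ SameStrand W p q := by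
  refine ⟨sameStrand_of_comp_eq hW, fun h => ?_⟩
  have := h _ (coloring_points hW ht (comp (slices W) p = ·))
  simp_all

lemma mem_points_of_sameStrand (hW : ∀ l ∈ W, l.kind.IsShape) {m : ℕ} (ht : Typed m W 0) {p q : ℕ × ℕ}
    (h : SameStrand W p q) : p ∈ points (slices W) ↔ q ∈ points (slices W) := by
  simpa using h _ (coloring_points hW ht fun _ => True)

lemma Coloring.outer_src {m n : ℕ} (ht : Typed m W n) {f : ℕ → ℕ → Z} (hf : Coloring W f) :
    (∀ (k : ℕ) (l : Letter M), W[k]? = some l → ∀ j, f k (l.src + j) = f 0 (m + j)) ∧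
      ∀ j, f W.length (n + j) = f 0 (m + j) := by
  induction W generalizing m f with
  | nil => cases ht; simp_all
  | cons l W ih =>
    have h0 : ∀ j, f 1 (l.tgt + j) = f 0 (m + j) := fun j => by
      have := hf.1.2.1 (l.right + j)
      simp only [← add_assoc] at this
      rw [ht.1]
      exact this.symm
    obtain ⟨h1, h2⟩ := ih ht.2 hf.2
    refine ⟨fun k l' hk j => ?_, fun j => (h2 j).trans (h0 j)⟩
    rcases k with _ | k
    · obtain rfl : l = l' := by simpa using hk
      rw [ht.1]
    grind

lemma pt_mem_circ_iff (hW : ∀ l ∈ W, l.kind.IsShape) (ht : Typed 0 W 0) {k i : ℕ} (hk : k ≤ W.length) :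
    pt W k i ∈ circ W ↔ (k, i) ∈ points (slices W) := by
  have h0 : ∀ j, (0, j) ∉ points (slices W) := by
    intro j
    rw [mem_points_iff hW]
    cases W with
    | nil => simp
    | cons l W =>
      have : l.src = 0 := ht.1.symm
      simp [this]
  constructor
  · rintro ⟨-, h⟩
    by_contra hp
    obtain ⟨h1, h2⟩ := (coloring_pt W).outer_src ht
    rcases hk.lt_or_eq with hk' | rfl
    · have hl : W[k]? = some W[k] := List.getElem?_eq_getElem hk'
      have hi : ¬ i < W[k].src := fun hi => hp ((mem_points_iff hW).2 ⟨_, hl, hi⟩)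
      obtain ⟨j, rfl⟩ := Nat.exists_eq_add_of_le (Nat.not_lt.1 hi)
      exact h _ (h1 k _ hl j)
    · exact h _ (by simpa using h2 i)
  · intro hp
    refine ⟨⟨k, hk, i, rfl⟩, fun j hj => h0 j ?_⟩
    exact (mem_points_of_sameStrand hW ht (pt_eq_iff.1 hj)).1 hp

lemma exists_strand (hW : ∀ l ∈ W, l.kind.IsShape) (ht : Typed 0 W 0) :
    ∃ F : (arcGraph (slices W)).ConnectedComponent → Cp W, (∀ p, F (comp _ p) = pt W p.1 p.2) ∧
      Set.InjOn F (circles (slices W)) ∧ F '' circles (slices W) = circ W := by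
  have hF : ∃ F : (arcGraph (slices W)).ConnectedComponent → Cp W, ∀ p, F (comp _ p) = pt W p.1 p.2 := by
    choose g hg using fun c : (arcGraph (slices W)).ConnectedComponent => c.exists_rep
    exact ⟨fun c => pt W (g c).1 (g c).2, fun p => pt_eq_iff.2 (sameStrand_of_comp_eq hW (hg (comp _ p)))⟩
  obtain ⟨F, hF⟩ := hF
  refine ⟨F, hF, ?_, ?_⟩
  · rintro _ ⟨p, hp, rfl⟩ _ ⟨q, hq, rfl⟩ h
    grind [comp_eq_iff, pt_eq_iff]
  · have hlen : ∀ p ∈ points (slices W), p.1 ≤ W.length := by grind [mem_points_iff]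
    ext c
    constructor
    · rintro ⟨_, ⟨p, hp, rfl⟩, rfl⟩
      rw [hF]
      exact (pt_mem_circ_iff hW ht (hlen p hp)).2 hp
    · intro hc
      have hc' := hc
      obtain ⟨⟨k, hk, i, rfl⟩, -⟩ := hc'
      exact ⟨_, ⟨(k, i), (pt_mem_circ_iff hW ht hk).1 hc, rfl⟩, hF _⟩

lemma restrictFrom_slices (hW : ∀ l ∈ W, l.kind.IsShape) (κ : ℕ × ℕ → Prop) (k : ℕ) :
    restrictFrom κ k (slices W) = res W fun j i => κ (k + j, i) := by
  induction W generalizing k with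
  | nil => rfl
  | cons l W ih =>
    have hl := hW l List.mem_cons_self
    have := ih (fun l' h' => hW l' (List.mem_cons_of_mem _ h')) (k + 1)
    simp only [slices, List.map_cons, restrictFrom] at this ⊢
    rw [this, res]
    simp only [Nat.add_assoc, Nat.add_comm 1]
    congr 1
    rcases l with ⟨u, s, v⟩
    cases s <;> first | exact hl.elim | skip
    all_goals
      by_cases h1 : κ (k, u) <;> by_cases h2 : κ (k + 1, u) <;>
        simp [Slice.restrict, Letter.slice, Kind.shape, Letter.res, Kind.res, listIf, keptCount, kc,
          Shape.src, Kind.src, h1, h2] <;> rfl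

variable [AddCommMonoid M]

lemma numc_eq (hW : ∀ l ∈ W, l.kind.IsShape) (ht : Typed 0 W 0) (R : M → Prop) {P : Picture}
    (hP : P.1 = slices W) {K : Set (arcGraph P.1).ConnectedComponent} (hK : K ⊆ circles P.1)
    (h : ∀ p ∈ points P.1, comp _ p ∈ K ↔ R (totc W (pt W p.1 p.2))) : numc R W = K.ncard := by
  obtain ⟨P, hflat⟩ := P
  subst hP
  obtain ⟨F, hF, inj, him⟩ := exists_strand hW ht
  rw [numc, ← (inj.mono hK).ncard_image]
  congr 1
  ext c
  simp only [← him, Set.mem_image, Set.mem_sep_iff]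
  constructor
  · rintro ⟨⟨_, ⟨p, hp, rfl⟩, rfl⟩, hR⟩
    grind
  · rintro ⟨c, hc, rfl⟩
    obtain ⟨p, hp, rfl⟩ := hK hc
    grind

lemma cfg_eq (hW : ∀ l ∈ W, l.kind.IsShape) (ht : Typed 0 W 0) (R : M → Prop)
    {P : Picture} (hP : P.1 = slices W) {K : Set (arcGraph P.1).ConnectedComponent} (hK : K ⊆ circles P.1)
    (h : ∀ p ∈ points P.1, comp _ p ∈ K ↔ R (totc W (pt W p.1 p.2))) :
    cfg R W = Quot.mk _ (P.sub K) := by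
  obtain ⟨P, hflat⟩ := P
  subst hP
  have e : restrictFrom (fun p => comp (slices W) p ∈ K) 0 (slices W) =
      res W fun k i => pt W k i ∈ circ W ∧ R (totc W (pt W k i)) := by
    rw [restrictFrom_slices hW]
    refine res_congr fun k hk => funext fun i => ?_
    rw [Nat.zero_add, pt_mem_circ_iff hW ht hk]
    refine propext ⟨fun hc => ?_, fun hc => (h _ hc.1).2 hc.2⟩
    obtain ⟨p, hp, e⟩ := hK hc
    grind [mem_points_of_sameStrand, sameStrand_of_comp_eq]
  have hflat' := (Picture.sub ⟨slices W, hflat⟩ K).2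
  change IsFlat 0 (restrictFrom (fun p => comp (slices W) p ∈ K) 0 (slices W)) 0 at hflat'
  rw [cfg, ← e, cfgL_eq hflat']
  rfl

end Slices

section States

open LaurentPolynomial

/-- The marked picture of a smoothed layer. -/
def Layer.letter (A : Bool) (l : Layer) : Letter (ZMod 4) :=
  ⟨l.left.length, match l.piece with
    | .cup _ => .cup
    | .cap _ => .cap
    | .cross a b r => if A = r then .vert (markOf (a != b)) else .horiz (markOf (a == b)), l.right.length⟩

lemma Layer.letter_isShape (A : Bool) (l : Layer) : (l.letter A).kind.IsShape := by
  rcases l with ⟨u, p, v⟩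
  cases p <;> simp only [Layer.letter] <;> try split_ifs
  all_goals trivial

lemma Layer.letter_slice (A : Bool) (l : Layer) : (l.letter A).slice = l.smooth A := by
  rcases l with ⟨u, p, v⟩
  cases p <;> simp only [Layer.letter, Letter.slice, Layer.smooth, Piece.smooth]
  all_goals first | rfl | (split_ifs <;> rfl)

lemma Layer.letter_tot (A : Bool) (l : Layer) (b t : ℕ → Prop) : (l.letter A).tot b t =
    valIf (l.piece.Broken A ∧ b l.left.length) 1 + valIf (l.piece.Broken A ∧ t (l.left.length + 1)) 1 := by
  rcases l with ⟨u, p, v⟩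
  cases p <;> simp only [Layer.letter, Letter.tot, Kind.tot, Piece.Broken]
  iterate 2 simp [valIf]
  grind [valIf_zero, valIf_false, markOf]

/-- The contribution of a layer to the exponent of a state. -/
def Layer.expo (A : Bool) (l : Layer) : ℤ :=
  if l.piece.isCross = true then (if A = true then 1 else -1) else 0

open Classical in
lemma br_eq_sum (w : List Layer) (acc : List (Letter (ZMod 4))) :
    br w acc = ∑ f : Fin w.length → Bool,
      if ∀ k, (w.get k).piece.isCross = false → f k = true then
        (T (∑ k, (w.get k).expo (f k)) : ℤ[T;T⁻¹]) • ev (acc ++ List.ofFn fun k => (w.get k).letter (f k))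
      else 0 := by
  induction w generalizing acc with
  | nil => simp [br]
  | cons l w ih =>
    have e : ∀ g : (Fin (l :: w).length → Bool) → Gam, ∑ f, g f =
        ∑ A : Bool, ∑ f : Fin w.length → Bool, g (Fin.cons A f) := fun g =>
      ((Fintype.sum_equiv (Fin.consEquiv (n := w.length) fun _ => Bool) (fun x => g (Fin.cons x.1 x.2)) g
        fun x => rfl).symm).trans (Fintype.sum_prod_type _)
    rw [e, Fintype.sum_bool]
    have e1 : ∀ A f, (∀ k, ((l :: w).get k).piece.isCross = false →
        (Fin.cons A f : Fin (l :: w).length → Bool) k = true) ↔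
        (l.piece.isCross = false → A = true) ∧ ∀ k, (w.get k).piece.isCross = false → f k = true :=
      fun A f => Fin.forall_fin_succ
    have e2 : ∀ A f, ∑ k, ((l :: w).get k).expo ((Fin.cons A f : Fin (l :: w).length → Bool) k) =
        l.expo A + ∑ k, (w.get k).expo (f k) := fun A f => Fin.sum_univ_succ _
    have e3 : ∀ A f, (List.ofFn fun k => ((l :: w).get k).letter ((Fin.cons A f : Fin (l :: w).length → Bool) k)) =
        [l.letter A] ++ List.ofFn fun k => (w.get k).letter (f k) := fun A f => List.ofFn_succ
    simp only [e1, e2, e3, ite_and, T_add, mul_smul, ← List.append_assoc]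
    rcases l with ⟨u, p, v⟩
    cases p with
    | cup o | cap o =>
      simp only [br, Layer.expo, Piece.isCross, T_zero, one_smul, forall_const, if_true,
        Bool.false_eq_true, if_false, Finset.sum_const_zero, add_zero]
      exact ih _
    | cross a b r =>
      have e4 : Layer.expo true ⟨u, .cross a b r, v⟩ = 1 := rfl
      have e5 : Layer.expo false ⟨u, .cross a b r, v⟩ = -1 := rfl
      have e6 : Piece.isCross (.cross a b r) = true := rfl
      simp only [br, e4, e5, e6, reduceCtorEq, false_imp_iff, if_true, ih, Finset.smul_sum, smul_ite, smul_zero]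
      cases r
      · exact add_comm _ _
      · rfl

lemma tot_ofFn {M : Type} [AddCommMonoid M] {n : ℕ} (g : Fin n → Letter M) (κ : ℕ → ℕ → Prop) :
    tot (List.ofFn g) κ = ∑ k, (g k).tot (κ k) (κ (k + 1)) := by
  induction n generalizing κ with
  | zero => simp [tot]
  | succ n ih =>
    rw [List.ofFn_succ, tot, ih, Fin.sum_univ_succ]
    rfl

variable {D : Diagram} (s : D.State)

def Diagram.State.word : List (Letter (ZMod 4)) :=
  List.ofFn fun k => (D.1.get k).letter (s.choice k)

lemma Diagram.State.word_isShape : ∀ l ∈ s.word, l.kind.IsShape := by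
  intro l hl
  obtain ⟨k, rfl⟩ := (List.mem_ofFn' _ _).1 hl
  exact Layer.letter_isShape _ _

lemma Diagram.State.slices_word : s.picture.1 = slices s.word := by
  simp only [slices, word, List.map_ofFn, picture]
  congr 1
  funext k
  exact (Layer.letter_slice _ _).symm

lemma Diagram.State.typed_word : Typed 0 s.word 0 := by
  have : ∀ (W : List (Letter (ZMod 4))) (m : ℕ), (∀ l ∈ W, l.kind.IsShape) → IsFlat m (slices W) 0 →
      Typed m W 0 := by
    intro W
    induction W with
    | nil => exact fun m _ h => h
    | cons l W ih => grind [IsFlat, Typed, slices, Letter.slice_src, Letter.slice_tgt]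
  exact this _ _ s.word_isShape (s.slices_word ▸ s.picture.2)

lemma Diagram.State.choice_crossing (x : D.Crossing) : s.choice x.1 = s x := dif_pos x.2

lemma Diagram.Crossing.ncard_eq (Q : Fin D.1.length → Prop)
    (hQ : ∀ k, Q k → (D.1.get k).piece.isCross = true) :
    (({x : D.Crossing | Q x.1}.ncard : ℕ) : ZMod 4) = ∑ k, valIf (Q k) 1 := by
  classical
  have e : (fun x : D.Crossing => x.1) '' {x : D.Crossing | Q x.1} = {k | Q k} := by
    ext k
    constructor
    · rintro ⟨x, hx, rfl⟩; exact hx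
    · intro hk; exact ⟨⟨k, hQ k hk⟩, hk, rfl⟩
  have inj : Function.Injective (fun x : D.Crossing => x.1) := fun a b h => Subtype.ext h
  rw [← Set.ncard_image_of_injective _ inj, e, Set.ncard_eq_toFinset_card']
  simp only [valIf, Finset.sum_ite, Finset.sum_const_zero, add_zero, Finset.sum_const, nsmul_eq_mul, mul_one]
  congr 2
  ext k
  simp

lemma Diagram.State.breakPoints_eq {p : ℕ × ℕ} (hp : p ∈ points s.picture.1) :
    ((s.breakPoints (comp _ p) : ℕ) : ZMod 4) = totc s.word (pt s.word p.1 p.2) := by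
  have hQ : ∀ k, (D.1.get k).piece.Broken (s.choice k) → (D.1.get k).piece.isCross = true := by
    intro k h
    cases hk : (D.1.get k).piece <;> simp_all [Piece.Broken, Piece.isCross]
  have key : ∀ q : ℕ × ℕ, comp s.picture.1 q = comp s.picture.1 p ↔ pt s.word q.1 q.2 = pt s.word p.1 p.2 := by
    intro q
    rw [eq_comm, @eq_comm _ (pt _ _ _), pt_eq_iff]
    have := comp_eq_iff s.word_isShape s.typed_word (p := p) (q := q) (s.slices_word ▸ hp)
    rw [← s.slices_word] at this
    exact this
  have h1 := Diagram.Crossing.ncard_eq (D := D) (fun k => (D.1.get k).piece.Broken (s.choice k) ∧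
    pt s.word k (D.1.get k).left.length = pt s.word p.1 p.2) fun k h => hQ k h.1
  have h2 := Diagram.Crossing.ncard_eq (D := D) (fun k => (D.1.get k).piece.Broken (s.choice k) ∧
    pt s.word (k + 1) ((D.1.get k).left.length + 1) = pt s.word p.1 p.2) fun k h => hQ k h.1
  simp only [s.choice_crossing] at h1 h2
  rw [breakPoints]
  simp only [key]
  rw [Nat.cast_add, totc]
  refine (congrArg₂ (· + ·) h1 h2).trans ?_
  have : ∀ κ, tot s.word κ = _ := fun κ => tot_ofFn (fun k => (D.1.get k).letter (s.choice k)) κ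
  rw [this, ← Finset.sum_add_distrib]
  exact Finset.sum_congr rfl fun k _ => (Layer.letter_tot (s.choice k) (D.1.get k)
    (fun i => pt s.word k i = pt s.word p.1 p.2) fun i => pt s.word (k + 1) i = pt s.word p.1 p.2).symm

lemma hType_iff (n : ℕ) : HType (n : ZMod 4) ↔ Even (n / 2) := by
  have h1 : (n : ZMod 4) = ((n % 4 : ℕ) : ZMod 4) := by simp
  have h2 : n / 2 % 2 = n % 4 / 2 := by omega
  rw [h1, Nat.even_iff, h2]
  have : n % 4 < 4 := Nat.mod_lt _ (by norm_num)
  generalize n % 4 = r at *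
  unfold HType
  interval_cases r <;> decide

lemma Diagram.State.ev_word : ev s.word = Finsupp.single s.config (loopValue ^ s.dCircles.ncard) := by
  rw [ev]
  congr 1
  · refine cfg_eq s.word_isShape s.typed_word _ s.slices_word (fun c hc => hc.1) fun p hp => ?_
    rw [← s.breakPoints_eq hp, hType_iff]
    exact ⟨fun h => h.2, fun h => ⟨⟨p, hp, rfl⟩, h⟩⟩
  · congr 1
    refine numc_eq s.word_isShape s.typed_word _ s.slices_word (fun c hc => hc.1) fun p hp => ?_
    rw [← s.breakPoints_eq hp, hType_iff, Nat.not_even_iff_odd]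
    exact ⟨fun h => h.2, fun h => ⟨⟨p, hp, rfl⟩, h⟩⟩

lemma Diagram.State.sigma_eq : s.sigma = ∑ k, (D.1.get k).expo (s.choice k) := by
  have e : ∀ k : Fin D.1.length, (D.1.get k).expo (s.choice k) =
      if (D.1.get k).piece.isCross = true then (if s.choice k = true then 1 else -1) else 0 := fun k => rfl
  simp only [e, ← Finset.sum_filter]
  refine Eq.trans ?_ (Finset.sum_subtype (p := fun k => (D.1.get k).piece.isCross = true)
    (F := inferInstanceAs (Fintype D.Crossing)) _
    (fun k => by simp_all) _).symm
  exact Fintype.sum_congr _ _ fun x => by rw [← s.choice_crossing x]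

lemma Diagram.bracket_eq_br (D : Diagram) : D.bracket = br D.1 [] := by
  classical
  rw [br_eq_sum, ← Finset.sum_filter, bracket]
  refine Finset.sum_nbij' (fun s => s.choice) (fun f x => f x.1) (fun s _ => ?_) (fun f _ => Finset.mem_univ _)
    (fun s _ => funext fun x => s.choice_crossing x) (fun f hf => funext fun k => ?_) fun s _ => ?_
  · simp only [Finset.mem_filter, Finset.mem_univ, true_and]
    intro k hk
    exact dif_neg fun h => absurd (hk.symm.trans h) Bool.false_ne_true
  · simp only [Finset.mem_filter, Finset.mem_univ, true_and] at hf
    by_cases hk : (D.1.get k).piece.isCross = true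
    · exact dif_pos hk
    · rw [hf k (by simpa using hk)]
      exact dif_neg hk
  · rw [List.nil_append, ← s.sigma_eq]
    change _ = _ • ev s.word
    rw [s.ev_word, Finsupp.smul_single, smul_eq_mul]

end States

section Main
open LaurentPolynomial

lemma bracket_reverse (D : Diagram) : D.reverse.bracket = D.bracket := by
  rw [Diagram.bracket_eq_br, Diagram.bracket_eq_br]
  exact br_reverse D.1 []

lemma bracket_of_braidLikeIsotopic {D D' : Diagram} (h : D.BraidLikeIsotopic D') :
    D.bracket = D'.bracket := by
  induction h with
  | rel D D' h => rw [D.bracket_eq_br, D'.bracket_eq_br]; exact br_braidLikeMove h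
  | refl D => rfl
  | symm D D' _ ih => exact ih.symm
  | trans D D' D'' _ _ ih ih' => exact ih.trans ih'

lemma normalized_skein {Dp Dm D0 : Diagram} (h : Diagram.SkeinTriple Dp Dm D0) :
    (T 4 : ℤ[T;T⁻¹]) • Dp.normalized - (T (-4) : ℤ[T;T⁻¹]) • Dm.normalized =
      (T (-2) - T 2 : ℤ[T;T⁻¹]) • D0.normalized := by
  simp only [Diagram.normalized, Diagram.bracket_eq_br]
  exact br_skein h

end Main

section Orbits

open Equiv

variable {E : Type} [Finite E] [DecidableEq E]

def orb (s : Perm E) (x : E) : Set E := {y | s.SameCycle x y}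

def orbits (s : Perm E) : Set (Set E) := Set.range (orb s)

lemma mem_orb_self (s : Perm E) (x : E) : x ∈ orb s x := Perm.SameCycle.refl s x

lemma orb_eq_iff {s : Perm E} {x y : E} : orb s x = orb s y ↔ s.SameCycle x y := by
  constructor
  · grind [orb, mem_orb_self]
  · intro h
    ext z
    exact ⟨fun h' => h.symm.trans h', fun h' => h.trans h'⟩

lemma orb_eq_of_mem {s : Perm E} {x y : E} (h : y ∈ orb s x) : orb s y = orb s x :=
  (orb_eq_iff.2 h).symm

lemma orb_subset {s : Perm E} {S : Set E} (h : ∀ z ∈ S, s z ∈ S) {x : E} (hx : x ∈ S) : orb s x ⊆ S := by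
  intro y hy
  obtain ⟨n, -, rfl⟩ := Perm.SameCycle.exists_pow_eq' (show s.SameCycle x y from hy)
  clear hy
  induction n with
  | zero => exact hx
  | succ n ih => rw [pow_succ', Perm.mul_apply]; exact h _ ih

lemma apply_mem_orb {s : Perm E} {x z : E} (h : z ∈ orb s x) : s z ∈ orb s x :=
  Perm.SameCycle.trans h (Perm.SameCycle.refl s z).apply_right

lemma orb_const {s : Perm E} {Z : Type} (f : E → Z) {x : E} (h : ∀ z ∈ orb s x, f (s z) = f z) {y : E}
    (hy : y ∈ orb s x) : f y = f x := by
  have := orb_subset (s := s) (S := {z | z ∈ orb s x ∧ f z = f x})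
    (fun z hz => ⟨apply_mem_orb hz.1, (h z hz.1).trans hz.2⟩) ⟨mem_orb_self s x, rfl⟩ hy
  exact this.2

lemma orb_swap_of_not_mem {s : Perm E} {x y : E} (h : ¬ s.SameCycle x y) :
    orb (s * swap x y) x = orb s x ∪ orb s y := by
  have hxy : x ≠ y := fun e => h (e ▸ Perm.SameCycle.refl s x)
  have ex : (s * swap x y) x = s y := by simp
  have ey : (s * swap x y) y = s x := by simp
  have ez : ∀ z, z ≠ x → z ≠ y → (s * swap x y) z = s z := fun z h1 h2 => by aesop
  apply Set.Subset.antisymm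
  · refine orb_subset (fun z hz => ?_) (Or.inl (mem_orb_self s x))
    by_cases h1 : z = x
    · rw [h1, ex]; exact Or.inr (apply_mem_orb (mem_orb_self s y))
    by_cases h2 : z = y
    · rw [h2, ey]; exact Or.inl (apply_mem_orb (mem_orb_self s x))
    rw [ez z h1 h2]
    exact hz.imp apply_mem_orb apply_mem_orb
  · set S := orb (s * swap x y) x
    have hS : ∀ z ∈ S, (s * swap x y) z ∈ S := fun z hz => apply_mem_orb hz
    have sy : s y ∈ S := ex ▸ hS x (mem_orb_self _ x)
    have oy : orb s y ⊆ S := by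
      have := orb_subset (s := s) (S := S ∩ orb s y) (x := s y) (fun z hz => ⟨?_, apply_mem_orb hz.2⟩)
        ⟨sy, apply_mem_orb (mem_orb_self s y)⟩
      · grind [orb_eq_of_mem, mem_orb_self]
      · by_cases h2 : z = y
        · rw [h2]; exact sy
        have h1 : z ≠ x := fun e => h (e ▸ hz.2).symm
        exact ez z h1 h2 ▸ hS z hz.1
    have sx : s x ∈ S := ey ▸ hS y (oy (mem_orb_self _ y))
    have ox : orb s x ⊆ S := by
      have := orb_subset (s := s) (S := S ∩ orb s x) (x := s x) (fun z hz => ⟨?_, apply_mem_orb hz.2⟩)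
        ⟨sx, apply_mem_orb (mem_orb_self s x)⟩
      · grind [orb_eq_of_mem, mem_orb_self]
      · by_cases h1 : z = x
        · rw [h1]; exact sx
        have h2 : z ≠ y := fun e => h (e ▸ hz.2)
        exact ez z h1 h2 ▸ hS z hz.1
    exact Set.union_subset ox oy

lemma orb_swap_of_ne {s : Perm E} {x y z : E} (h1 : z ∉ orb s x) (h2 : z ∉ orb s y) :
    orb (s * swap x y) z = orb s z := by
  have key : ∀ w ∈ orb s z, (s * swap x y) w = s w := fun w hw => by
    rw [Perm.mul_apply, swap_apply_of_ne_of_ne]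
    · rintro rfl; exact h1 (Perm.SameCycle.symm hw)
    · rintro rfl; exact h2 (Perm.SameCycle.symm hw)
  apply Set.Subset.antisymm
  · grind [orb_subset, apply_mem_orb, mem_orb_self]
  · have := orb_subset (s := s) (S := orb (s * swap x y) z ∩ orb s z) (x := z)
      (fun w hw => ⟨key w hw.2 ▸ apply_mem_orb hw.1, apply_mem_orb hw.2⟩)
      ⟨mem_orb_self _ z, mem_orb_self s z⟩
    exact fun w hw => (this hw).1

lemma orbits_swap {s : Perm E} {x y : E} (h : ¬ s.SameCycle x y) :
    ∃ R : Set (Set E), orbits s = insert (orb s x) (insert (orb s y) R) ∧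
      orbits (s * swap x y) = insert (orb s x ∪ orb s y) R ∧ orb s x ∉ insert (orb s y) R ∧ orb s y ∉ R ∧
      orb s x ∪ orb s y ∉ R ∧ ∀ O ∈ R, x ∉ O ∧ y ∉ O := by
  refine ⟨{O | ∃ z, z ∉ orb s x ∧ z ∉ orb s y ∧ O = orb s z}, ?_, ?_, ?_, ?_, ?_, ?_⟩
  · ext O
    constructor
    · rintro ⟨z, rfl⟩
      by_cases h1 : z ∈ orb s x
      · exact Or.inl (orb_eq_of_mem h1)
      by_cases h2 : z ∈ orb s y
      · exact Or.inr (Or.inl (orb_eq_of_mem h2))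
      grind
    · rintro (rfl | rfl | ⟨z, -, -, rfl⟩)
      exacts [⟨_, rfl⟩, ⟨_, rfl⟩, ⟨_, rfl⟩]
  · ext O
    constructor
    · rintro ⟨z, rfl⟩
      by_cases h1 : z ∈ orb s x ∪ orb s y
      · rw [← orb_swap_of_not_mem h] at h1 ⊢
        exact Or.inl (orb_eq_of_mem h1)
      · rw [Set.mem_union, not_or] at h1
        exact Or.inr ⟨z, h1.1, h1.2, orb_swap_of_ne h1.1 h1.2⟩
    · rintro (rfl | ⟨z, h1, h2, rfl⟩)
      · exact ⟨x, orb_swap_of_not_mem h⟩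
      · exact ⟨z, orb_swap_of_ne h1 h2⟩
  · grind [orb_eq_iff, mem_orb_self]
  · grind [mem_orb_self]
  · rintro ⟨z, h1, -, h2⟩
    have : x ∈ orb s z := h2 ▸ Or.inl (mem_orb_self s x)
    exact h1 (Perm.SameCycle.symm this)
  · rintro _ ⟨z, h1, h2, rfl⟩
    exact ⟨fun hx => h1 (Perm.SameCycle.symm hx), fun hy => h2 (Perm.SameCycle.symm hy)⟩

lemma not_sameCycle_swap {s : Perm E} {x y : E} (h : s.SameCycle x y) (hxy : x ≠ y) :
    ¬ (s * swap x y).SameCycle x y := by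
  classical
  have hex : ∃ n, (s ^ n) x = y := by
    obtain ⟨n, -, hn⟩ := h.exists_pow_eq'
    exact ⟨n, hn⟩
  set n := Nat.find hex
  have e1 : (s ^ n) x = y := Nat.find_spec hex
  have e2 : ∀ j < n, (s ^ j) x ≠ y := fun j hj => Nat.find_min hex hj
  have e3 : ∀ j, 0 < j → j ≤ n → (s ^ j) x ≠ x := by
    intro j h0 hj he
    rcases hj.lt_or_eq with hj | rfl
    · refine e2 (n - j) (by omega) ?_
      have : n = n - j + j := by omega
      rw [this, pow_add, Perm.mul_apply, he] at e1
      exact e1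
    · exact hxy (he.symm.trans e1)
  have n0 : 0 < n := by
    rcases Nat.eq_zero_or_pos n with h0 | h0
    · rw [h0] at e1; exact absurd e1 hxy
    · exact h0
  intro hc
  have := orb_subset (s := s * swap x y) (S := {z | ∃ j, 0 < j ∧ j ≤ n ∧ (s ^ j) x = z}) (x := y) ?_
    ⟨n, n0, le_rfl, e1⟩ (show x ∈ orb _ y from hc.symm)
  · grind
  · rintro z ⟨j, h0, hj, rfl⟩
    rcases hj.lt_or_eq with hj | rfl
    · refine ⟨j + 1, by omega, hj, ?_⟩
      rw [Perm.mul_apply, swap_apply_of_ne_of_ne (e3 j h0 hj.le) (e2 j hj), pow_succ', Perm.mul_apply]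
    grind [Perm.mul_apply, pow_one]

lemma swap_swap_cancel (s : Perm E) (x y : E) : s * swap x y * swap x y = s := by
  rw [mul_assoc, swap_mul_self, mul_one]

/-- The number of orbits with an even number of elements of `K`. -/
noncomputable def evenCount (s : Perm E) (K : Set E) : ℕ := {O ∈ orbits s | Even (O ∩ K).ncard}.ncard

noncomputable def orbCount (s : Perm E) : ℕ := (orbits s).ncard

lemma ncard_sep_insert {α : Type} [Finite α] {R : Set α} {a : α} (h : a ∉ R) (P : α → Prop)
    [Decidable (P a)] :
    {O ∈ insert a R | P O}.ncard = {O ∈ R | P O}.ncard + if P a then 1 else 0 := by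
  by_cases hp : P a
  · have : {O ∈ insert a R | P O} = insert a {O ∈ R | P O} := by
      ext O; simp only [Set.mem_insert_iff, Set.mem_sep_iff]
      constructor
      · rintro ⟨rfl | h, h'⟩
        · exact Or.inl rfl
        · exact Or.inr ⟨h, h'⟩
      · rintro (rfl | ⟨h, h'⟩)
        · exact ⟨Or.inl rfl, hp⟩
        · exact ⟨Or.inr h, h'⟩
    rw [this, Set.ncard_insert_of_notMem (fun h' => h h'.1), if_pos hp]
  grind

lemma orbCount_swap {s : Perm E} {x y : E} (h : ¬ s.SameCycle x y) :
    orbCount s = orbCount (s * swap x y) + 1 := by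
  obtain ⟨R, h1, h2, h3, h4, h5, -⟩ := orbits_swap h
  rw [orbCount, orbCount, h1, h2, Set.ncard_insert_of_notMem h3, Set.ncard_insert_of_notMem h4,
    Set.ncard_insert_of_notMem h5]

lemma evenCount_swap {s : Perm E} {x y : E} (h : ¬ s.SameCycle x y) {K K' : Set E}
    (hK : ∀ z, z ∉ orb s x → z ∉ orb s y → (z ∈ K ↔ z ∈ K')) :
    ∃ r, evenCount s K = r + (if Even (orb s y ∩ K).ncard then 1 else 0) +
        (if Even (orb s x ∩ K).ncard then 1 else 0) ∧
      evenCount (s * swap x y) K' = r + if Even ((orb s x ∪ orb s y) ∩ K').ncard then 1 else 0 := by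
  obtain ⟨R, h1, h2, h3, h4, h5, h6⟩ := orbits_swap h
  refine ⟨{O ∈ R | Even (O ∩ K).ncard}.ncard, ?_, ?_⟩
  · rw [evenCount, h1, ncard_sep_insert h3, ncard_sep_insert h4]
  · rw [evenCount, h2, ncard_sep_insert h5]
    congr 2
    ext O
    simp only [Set.mem_sep_iff]
    refine and_congr_right fun hO => ?_
    have : O ∈ orbits s := by rw [h1]; exact Or.inr (Or.inr hO)
    obtain ⟨z, rfl⟩ := this
    have e : orb s z ∩ K = orb s z ∩ K' := by
      ext w
      refine and_congr_right fun hw => hK w ?_ ?_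
      · intro hx
        exact (h6 _ hO).1 (by rw [← orb_eq_of_mem hw, orb_eq_of_mem hx]; exact mem_orb_self s x)
      · intro hy
        exact (h6 _ hO).2 (by rw [← orb_eq_of_mem hw, orb_eq_of_mem hy]; exact mem_orb_self s y)
    rw [e]

end Orbits

open Equiv in
/-- A directed graph that is drawn on a surface, together with a checkerboard colouring. Its vertices
have one edge that comes in and one that goes out, or two of each, adjacent to each other. The edge `σ e`
goes out of the head of `e`, on the same side; the two edges that go out of a vertex are exchanged by `τ`,
and `isL` tells which of them is on the left. -/
structure FlatMap (E : Type) where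
  σ : Perm E
  τ : E → E
  col : E → Bool
  isL : E → Bool
  τ_τ : ∀ e, τ (τ e) = e
  col_σ : ∀ e, col (σ e) = col e
  col_τ : ∀ e, τ e ≠ e → col (τ e) = !col e
  isL_τ : ∀ e, τ e ≠ e → isL (τ e) = !isL e

namespace FlatMap

open Equiv

variable {E : Type} (M : FlatMap E)

def Flow (J : E → ZMod 2) : Prop :=
  ∀ n, (M.τ n = n → J (M.σ.symm n) = J n) ∧
    (M.τ n ≠ n → J (M.σ.symm n) + J (M.σ.symm (M.τ n)) = J n + J (M.τ n))

/-- The cycle `J` bounds a union of faces: `χ` is the indicator function of this union on the left side of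
the edges, and `χ + J` is the one on the right side. -/
def Region (J χ : E → ZMod 2) : Prop :=
  ∀ n, (M.τ n = n ∨ M.isL n = true → χ (M.σ.symm n) = χ n) ∧
    (M.τ n ≠ n → M.isL n = true → χ (M.σ.symm (M.τ n)) = χ (M.σ.symm n) + J (M.σ.symm n) ∧
      χ (M.τ n) = χ n + J n)

def Planar : Prop := ∀ J, M.Flow J → ∃ χ, M.Region J χ

/-- The same graph with the opposite colours. -/
def flip : FlatMap E where
  σ := M.σ
  τ := M.τ
  col e := !M.col e
  isL := M.isL
  τ_τ := M.τ_τ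
  col_σ e := by rw [M.col_σ]
  col_τ e h := by rw [M.col_τ e h]
  isL_τ := M.isL_τ

variable {M}

lemma Region.add {J χ J' χ' : E → ZMod 2} (h : M.Region J χ) (h' : M.Region J' χ') :
    M.Region (J + J') (χ + χ') := fun n => by
  refine ⟨fun hn => ?_, fun h1 h2 => ?_⟩
  · simp only [Pi.add_apply, (h n).1 hn, (h' n).1 hn]
  · obtain ⟨a, b⟩ := (h n).2 h1 h2
    obtain ⟨a', b'⟩ := (h' n).2 h1 h2
    grind [Pi.add_apply]

lemma Region.mul {J χ J' χ' : E → ZMod 2} (h : M.Region J χ) (h' : M.Region J' χ') :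
    M.Region (χ * J' + J * χ' + J * J') (χ * χ') := fun n => by
  refine ⟨fun hn => ?_, fun h1 h2 => ?_⟩
  · simp only [Pi.mul_apply, (h n).1 hn, (h' n).1 hn]
  · obtain ⟨a, b⟩ := (h n).2 h1 h2
    obtain ⟨a', b'⟩ := (h' n).2 h1 h2
    grind [Pi.add_apply, Pi.mul_apply]

lemma Region.add_one {J χ : E → ZMod 2} (h : M.Region J χ) : M.Region J (χ + 1) := by
  have h1 : M.Region 0 1 := fun n => ⟨fun _ => rfl, fun _ _ => ⟨rfl, rfl⟩⟩
  simpa using h.add h1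

lemma Flow.add {J J' : E → ZMod 2} (h : M.Flow J) (h' : M.Flow J') : M.Flow (J + J') := fun n => by
  refine ⟨fun hn => ?_, fun hn => ?_⟩
  · simp only [Pi.add_apply, (h n).1 hn, (h' n).1 hn]
  · have a := (h n).2 hn
    have a' := (h' n).2 hn
    simp only [Pi.add_apply]
    linear_combination a + a'

lemma col_symm (e : E) : M.col (M.σ.symm e) = M.col e := by
  rw [← M.col_σ, Equiv.apply_symm_apply]

lemma τ_ne {e : E} (h : M.τ e ≠ e) : M.τ (M.τ e) ≠ M.τ e := by
  rw [M.τ_τ]; exact h.symm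

variable [DecidableEq E] (M)

/-- The edge that follows `e` when the crossings are smoothed against the orientation; an edge is
traversed along its direction if its colour is `true`. -/
def step (e : E) : E :=
  if M.col e = true then if M.τ (M.σ e) = M.σ e then M.σ e else M.σ.symm (M.τ (M.σ e))
  else if M.τ e = e then M.σ.symm e else M.τ e

variable {M}

lemma step_black_plain {e : E} (h : M.col e = true) (h' : M.τ (M.σ e) = M.σ e) : M.step e = M.σ e := by
  rw [step, if_pos h, if_pos h']

lemma step_black_cross {e : E} (h : M.col e = true) (h' : M.τ (M.σ e) ≠ M.σ e) :
    M.step e = M.σ.symm (M.τ (M.σ e)) := by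
  rw [step, if_pos h, if_neg h']

lemma step_white_plain {e : E} (h : M.col e = false) (h' : M.τ e = e) : M.step e = M.σ.symm e := by
  rw [step, if_neg (by simp [h]), if_pos h']

lemma step_white_cross {e : E} (h : M.col e = false) (h' : M.τ e ≠ e) : M.step e = M.τ e := by
  rw [step, if_neg (by simp [h]), if_neg h']

lemma flip_step_step (e : E) : M.flip.step (M.step e) = e := by
  cases hc : M.col e with
  | true =>
    by_cases hp : M.τ (M.σ e) = M.σ e
    · rw [step_black_plain hc hp, step_white_plain (M := M.flip) (by simp [flip, M.col_σ, hc]) hp]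
      exact M.σ.symm_apply_apply e
    grind [step_black_cross, flip]
  | false =>
    by_cases hp : M.τ e = e
    · rw [step_white_plain hc hp, step_black_plain (M := M.flip)]
      · simp [flip]
      · simp [flip, col_symm, hc]
      · simpa [flip] using hp
    grind [step_white_cross, flip]

lemma flip_flip : M.flip.flip = M := by
  cases M; simp [flip]

variable (M)

/-- The permutation of the edges whose orbits are the circles that result from smoothing the crossings
against the orientation. -/
def fwd : Perm E where
  toFun := M.step
  invFun := M.flip.step
  left_inv := flip_step_step
  right_inv e := by grind [flip_step_step, flip_flip]

lemma flip_fwd : M.flip.fwd = M.fwd⁻¹ := by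
  ext e; rfl

/-- The edges of colour `true` that go out of a crossing. -/
def marks : Set E := {p | M.col p = true ∧ M.τ p ≠ p}

variable {M}

lemma fwd_apply (e : E) : M.fwd e = M.step e := rfl

lemma fwd_rel {R : E → E → Prop} (hs : ∀ a b, R a b → R b a) (h1 : ∀ n, M.τ n = n → R (M.σ.symm n) n)
    (h2 : ∀ n, M.τ n ≠ n → M.isL n = true → R n (M.τ n))
    (h3 : ∀ n, M.τ n ≠ n → M.isL n = true → R (M.σ.symm n) (M.σ.symm (M.τ n))) (e : E) :
    R e (M.fwd e) := by
  rw [fwd_apply]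
  have h2' : ∀ n, M.τ n ≠ n → R n (M.τ n) := fun n hn => by
    cases hl : M.isL n with
    | true => exact h2 n hn hl
    | false => have := hs _ _ (h2 _ (τ_ne hn) (by rw [M.isL_τ n hn, hl]; rfl)); rwa [M.τ_τ] at this
  have h3' : ∀ n, M.τ n ≠ n → R (M.σ.symm n) (M.σ.symm (M.τ n)) := fun n hn => by
    cases hl : M.isL n with
    | true => exact h3 n hn hl
    | false => have := hs _ _ (h3 _ (τ_ne hn) (by rw [M.isL_τ n hn, hl]; rfl)); rwa [M.τ_τ] at this
  cases hc : M.col e with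
  | true =>
    by_cases hp : M.τ (M.σ e) = M.σ e
    · rw [step_black_plain hc hp]; simpa using h1 _ hp
    · rw [step_black_cross hc hp]; simpa using h3' _ hp
  | false =>
    by_cases hp : M.τ e = e
    · rw [step_white_plain hc hp]; exact hs _ _ (h1 _ hp)
    · rw [step_white_cross hc hp]; exact h2' _ hp

variable [Finite E]

lemma orb_fwd_symm (x : E) : orb M.flip.fwd x = orb M.fwd x := by
  ext y; rw [flip_fwd]; exact Perm.sameCycle_inv

lemma sameCycle_plain {n : E} (h : M.τ n = n) : M.fwd.SameCycle (M.σ.symm n) n := by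
  cases hc : M.col n with
  | true =>
    have : M.fwd (M.σ.symm n) = n := by grind [fwd_apply, step_black_plain, col_symm]
    have h2 := (Perm.SameCycle.refl M.fwd (M.σ.symm n)).apply_right
    rwa [this] at h2
  | false =>
    have : M.fwd n = M.σ.symm n := by rw [fwd_apply, step_white_plain hc h]
    have h2 := (Perm.SameCycle.refl M.fwd n).apply_left
    rwa [this] at h2

lemma sameCycle_out {n : E} (h : M.τ n ≠ n) : M.fwd.SameCycle n (M.τ n) := by
  cases hc : M.col n with
  | true =>
    have : M.fwd (M.τ n) = n := by
      rw [fwd_apply, step_white_cross (by rw [M.col_τ n h, hc]; rfl) (τ_ne h), M.τ_τ]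
    have h2 := (Perm.SameCycle.refl M.fwd (M.τ n)).apply_left
    rwa [this] at h2
  | false =>
    have : M.fwd n = M.τ n := by rw [fwd_apply, step_white_cross hc h]
    have h2 := (Perm.SameCycle.refl M.fwd n).apply_right
    rwa [this] at h2

lemma sameCycle_in {n : E} (h : M.τ n ≠ n) : M.fwd.SameCycle (M.σ.symm n) (M.σ.symm (M.τ n)) := by
  cases hc : M.col n with
  | true =>
    have : M.fwd (M.σ.symm n) = M.σ.symm (M.τ n) := by grind [fwd_apply, step_black_cross, col_symm]
    have h2 := (Perm.SameCycle.refl M.fwd (M.σ.symm n)).apply_right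
    rwa [this] at h2
  | false =>
    have : M.fwd (M.σ.symm (M.τ n)) = M.σ.symm n := by
      rw [fwd_apply, step_black_cross (by rw [col_symm, M.col_τ n h, hc]; rfl) (by simpa using τ_ne h)]
      simp [M.τ_τ]
    have h2 := (Perm.SameCycle.refl M.fwd (M.σ.symm (M.τ n))).apply_left
    rwa [this] at h2

lemma mem_orb_congr {s : Perm E} {x a b : E} (h : s.SameCycle a b) : a ∈ orb s x ↔ b ∈ orb s x :=
  ⟨fun h' => h'.trans h, fun h' => h'.trans h.symm⟩

noncomputable def ind (S : Set E) : E → ZMod 2 := S.indicator 1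

lemma ind_of_mem {S : Set E} {e : E} (h : e ∈ S) : ind S e = 1 := Set.indicator_of_mem h 1

lemma ind_of_not_mem {S : Set E} {e : E} (h : e ∉ S) : ind S e = 0 := Set.indicator_of_notMem h 1

lemma ind_congr {S : Set E} {e e' : E} (h : e ∈ S ↔ e' ∈ S) : ind S e = ind S e' := by
  grind [ind_of_mem, ind_of_not_mem]

lemma flow_orb (x : E) : M.Flow (ind (orb M.fwd x)) := fun n => by
  grind [ind_congr, mem_orb_congr, sameCycle_plain, sameCycle_in, sameCycle_out]

end FlatMap

section Orbits

open Equiv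

variable {E : Type} [Finite E] [DecidableEq E]

lemma orb_subset_orb {s t : Perm E} (h : ∀ e, t.SameCycle e (s e)) (x : E) : orb s x ⊆ orb t x :=
  orb_subset (fun z hz => Perm.SameCycle.trans hz (h z)) (mem_orb_self t x)

lemma ncard_union_inter {s : Perm E} {x y : E} (h : ¬ s.SameCycle x y) (K : Set E) :
    ((orb s x ∪ orb s y) ∩ K).ncard = (orb s x ∩ K).ncard + (orb s y ∩ K).ncard := by
  rw [Set.union_inter_distrib_right, Set.ncard_union_eq]
  rw [Set.disjoint_left]
  rintro z ⟨h1, -⟩ ⟨h2, -⟩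
  exact h (Perm.SameCycle.trans h1 (Perm.SameCycle.symm h2))

lemma orbCount_le (s : Perm E) : orbCount s ≤ Nat.card E := by
  rw [orbCount, orbits, ← Set.image_univ, ← Set.ncard_univ]
  exact Set.ncard_image_le

end Orbits

namespace FlatMap

open Equiv

variable {E : Type} [DecidableEq E] (M : FlatMap E)

/-- The crossing from which `p` goes out is smoothed with respect to the orientation. -/
def delete (p : E) : FlatMap E where
  σ := M.σ
  τ e := if e = p ∨ e = M.τ p then e else M.τ e
  col := M.col
  isL := M.isL
  τ_τ e := by
    by_cases h : e = p ∨ e = M.τ p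
    · simp only [if_pos h]
    · rw [if_neg h, if_neg, M.τ_τ]
      rintro (h' | h')
      · exact h (Or.inr (by rw [← h', M.τ_τ]))
      · exact h (Or.inl (by rw [← M.τ_τ e, h', M.τ_τ]))
  col_σ := M.col_σ
  col_τ e := by
    by_cases h : e = p ∨ e = M.τ p
    · simp_all
    · rw [if_neg h]; exact M.col_τ e
  isL_τ e := by
    by_cases h : e = p ∨ e = M.τ p
    · simp_all
    · rw [if_neg h]; exact M.isL_τ e

variable {M} {p : E}

lemma delete_τ_of (h : e = p ∨ e = M.τ p) : (M.delete p).τ e = e := if_pos h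

lemma delete_τ_of_not (h : ¬ (e = p ∨ e = M.τ p)) : (M.delete p).τ e = M.τ e := if_neg h

lemma step_congr {M M' : FlatMap E} {e : E} (hc : M'.col e = M.col e)
    (hb : M.col e = true → M'.σ e = M.σ e ∧ M'.τ (M.σ e) = M.τ (M.σ e) ∧
      (M.τ (M.σ e) ≠ M.σ e → M'.σ.symm (M.τ (M.σ e)) = M.σ.symm (M.τ (M.σ e))))
    (hw : M.col e = false → M'.τ e = M.τ e ∧ M'.σ.symm e = M.σ.symm e) : M'.step e = M.step e := by
  cases h : M.col e with
  | true =>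
    obtain ⟨h1, h2, h3⟩ := hb h
    by_cases hp : M.τ (M.σ e) = M.σ e
    · rw [step_black_plain h hp, step_black_plain (hc.trans h) (by rw [h1, h2, hp]), h1]
    grind [step_black_cross]
  | false =>
    obtain ⟨h1, h2⟩ := hw h
    by_cases hp : M.τ e = e
    · rw [step_white_plain h hp, step_white_plain (hc.trans h) (h1.trans hp), h2]
    grind [step_white_cross]

lemma delete_fwd (hp : p ∈ M.marks) : (M.delete p).fwd = M.fwd * swap (M.σ.symm p) (M.τ p) := by
  obtain ⟨hc, ht⟩ := hp
  have hq : M.col (M.τ p) = false := by rw [M.col_τ p ht, hc]; rfl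
  ext e
  rw [Perm.mul_apply, fwd_apply, fwd_apply]
  by_cases h1 : e = M.σ.symm p
  · subst h1
    rw [swap_apply_left, step_white_cross hq (τ_ne ht), M.τ_τ, step_black_plain (M := M.delete p)]
    · exact M.σ.apply_symm_apply p
    · exact (M.col_symm p).trans hc
    · exact delete_τ_of (Or.inl (M.σ.apply_symm_apply p))
  by_cases h2 : e = M.τ p
  · subst h2
    rw [swap_apply_right, step_black_cross (e := M.σ.symm p) (by rw [col_symm, hc]) (by simpa using ht),
      step_white_plain (M := M.delete p) hq (delete_τ_of (Or.inr rfl)), M.σ.apply_symm_apply]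
    rfl
  rw [swap_apply_of_ne_of_ne h1 h2]
  refine step_congr rfl (fun he => ⟨rfl, delete_τ_of_not ?_, fun _ => rfl⟩) (fun he => ⟨delete_τ_of_not ?_, rfl⟩)
  · rintro (h | h)
    · exact h1 (by rw [← h]; exact (M.σ.symm_apply_apply e).symm)
    · have := congrArg M.col h
      rw [hq] at this
      exact absurd ((M.col_σ e).symm.trans this) (by simp [he])
  grind

lemma delete_marks (hp : p ∈ M.marks) : (M.delete p).marks = M.marks \ {p} := by
  obtain ⟨hc, ht⟩ := hp
  have hq : M.col (M.τ p) = false := by rw [M.col_τ p ht, hc]; rfl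
  ext e
  by_cases h : e = p ∨ e = M.τ p
  · simp only [marks, Set.mem_ofPred_eq, Set.mem_sdiff, Set.mem_singleton_iff, delete_τ_of h, ne_eq,
      not_true, and_false, false_iff]
    grind
  · simp only [marks, Set.mem_ofPred_eq, Set.mem_sdiff, Set.mem_singleton_iff, delete_τ_of_not h]
    aesop

lemma Flow.of_delete (hp : M.τ p ≠ p) {J : E → ZMod 2} (h : (M.delete p).Flow J) : M.Flow J := fun n => by
  have hpq : ∀ n, n = p ∨ n = M.τ p → J (M.σ.symm n) = J n := fun n hn => (h n).1 (delete_τ_of hn)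
  by_cases hn : n = p ∨ n = M.τ p
  · have hn' : M.τ n = p ∨ M.τ n = M.τ p := by
      rcases hn with rfl | rfl
      · exact Or.inr rfl
      · exact Or.inl (M.τ_τ p)
    grind
  · have := h n
    rw [delete_τ_of_not hn] at this
    exact this

lemma Region.delete (hp : M.τ p ≠ p) {J χ : E → ZMod 2} (h : (M.delete p).Flow J) (h' : M.Region J χ) :
    (M.delete p).Region J χ := fun n => by
  have hpq : ∀ n, n = p ∨ n = M.τ p → J (M.σ.symm n) = J n := fun n hn => (h n).1 (delete_τ_of hn)
  by_cases hn : n = p ∨ n = M.τ p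
  · refine ⟨fun _ => ?_, fun h1 => absurd (delete_τ_of hn) h1⟩
    have hn' : M.τ n = p ∨ M.τ n = M.τ p := by
      rcases hn with rfl | rfl
      · exact Or.inr rfl
      · exact Or.inl (M.τ_τ p)
    have ht : M.τ n ≠ n := by
      rcases hn with rfl | rfl
      · exact hp
      · exact τ_ne hp
    cases hl : M.isL n with
    | true => exact (h' n).1 (Or.inr hl)
    | false =>
      have hl' : M.isL (M.τ n) = true := by rw [M.isL_τ n ht, hl]; rfl
      obtain ⟨a, b⟩ := (h' (M.τ n)).2 (τ_ne ht) hl'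
      rw [M.τ_τ] at a b
      show χ (M.σ.symm n) = χ n
      rw [a, b, (h' _).1 (Or.inr hl'), hpq _ hn']
  · have := h' n
    rw [← delete_τ_of_not hn] at this
    exact this

lemma Planar.delete (hp : M.τ p ≠ p) (h : M.Planar) : (M.delete p).Planar := fun J hJ => by
  obtain ⟨χ, hχ⟩ := h J (hJ.of_delete hp)
  exact ⟨χ, hχ.delete hp hJ⟩

variable [Finite E]

lemma exists_mark {x : E} (h : M.τ (M.σ x) ≠ M.σ x) : ∃ p ∈ M.marks, p ∈ orb M.fwd x := by
  have key : ∀ x, M.τ (M.σ x) ≠ M.σ x → M.col x = true → ∃ p ∈ M.marks, p ∈ orb M.fwd x := by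
    intro x h hc
    by_contra! hno
    have h1 := orb_subset (s := M.fwd) (S := {z | z ∈ orb M.fwd x ∧ M.col z = false}) (x := M.fwd x) ?_ ?_
      (show x ∈ orb M.fwd (M.fwd x) from (Perm.SameCycle.refl M.fwd x).apply_left)
    · simp_all
    · rintro z ⟨hz, hcz⟩
      have hm := apply_mem_orb hz
      refine ⟨hm, ?_⟩
      rw [fwd_apply] at hm ⊢
      by_cases ht : M.τ z = z
      · rw [step_white_plain hcz ht, col_symm, hcz]
      · rw [step_white_cross hcz ht] at hm
        exact absurd hm (hno _ ⟨by rw [M.col_τ z ht, hcz]; rfl, τ_ne ht⟩)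
    · refine ⟨apply_mem_orb (mem_orb_self _ x), ?_⟩
      rw [fwd_apply, step_black_cross hc h, col_symm, M.col_τ _ h, M.col_σ, hc]; rfl
  cases hc : M.col x with
  | true => exact key x h hc
  | false =>
    obtain ⟨p, hp, hx⟩ := key (M.σ.symm (M.τ (M.σ x))) (by simpa using τ_ne h)
      (by rw [col_symm, M.col_τ _ h, M.col_σ, hc]; rfl)
    refine ⟨p, hp, ?_⟩
    have := sameCycle_in h
    rw [Equiv.symm_apply_apply] at this
    exact this.trans hx

lemma tau_mem_orb {n x : E} (h : M.τ n ≠ n) : n ∈ orb M.fwd x ↔ M.τ n ∈ orb M.fwd x :=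
  mem_orb_congr (sameCycle_out h)

lemma symm_ne (hp : p ∈ M.marks) : M.σ.symm p ≠ M.τ p := fun h => by
  have := congrArg M.col h
  rw [col_symm, M.col_τ p hp.2, hp.1] at this
  exact absurd this (by simp)

lemma evenCount_le_delete (hp : p ∈ M.marks) (h : ¬ (¬ M.fwd.SameCycle (M.σ.symm p) (M.τ p) ∧
    Even (orb M.fwd (M.σ.symm p) ∩ M.marks).ncard ∧ Even (orb M.fwd (M.τ p) ∩ M.marks).ncard)) :
    evenCount M.fwd M.marks ≤ evenCount (M.delete p).fwd (M.delete p).marks := by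
  have hf := delete_fwd hp
  have hm := delete_marks hp
  by_cases hs : M.fwd.SameCycle (M.σ.symm p) (M.τ p)
  · have hn : ¬ (M.delete p).fwd.SameCycle (M.σ.symm p) (M.τ p) := by
      rw [hf]; exact not_sameCycle_swap hs (symm_ne hp)
    have hpx : p ∈ orb (M.delete p).fwd (M.σ.symm p) := by
      have : (M.delete p).fwd (M.σ.symm p) = p := by
        rw [hf, Perm.mul_apply, swap_apply_left, fwd_apply,
          step_white_cross (by rw [M.col_τ p hp.2, hp.1]; rfl) (τ_ne hp.2), M.τ_τ]
      have h2 := apply_mem_orb (mem_orb_self (M.delete p).fwd (M.σ.symm p))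
      rwa [this] at h2
    have hcount : ((orb (M.delete p).fwd (M.σ.symm p) ∪ orb (M.delete p).fwd (M.τ p)) ∩ M.marks).ncard =
        (orb (M.delete p).fwd (M.σ.symm p) ∩ (M.delete p).marks).ncard +
          (orb (M.delete p).fwd (M.τ p) ∩ (M.delete p).marks).ncard + 1 := by
      rw [← ncard_union_inter hn]
      rw [hm, ← Set.inter_sdiff_assoc, Set.ncard_sdiff_singleton_add_one]
      exact ⟨Or.inl hpx, hp⟩
    obtain ⟨r, e1, e2⟩ := evenCount_swap hn (K := (M.delete p).marks) (K' := M.marks) (fun z hz _ => by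
      rw [hm]
      have : z ≠ p := fun e => hz (e ▸ hpx)
      simp [this])
    grind [swap_swap_cancel]
  · have hpx : p ∈ orb M.fwd (M.τ p) := (sameCycle_out hp.2).symm
    have hcount : ((orb M.fwd (M.σ.symm p) ∪ orb M.fwd (M.τ p)) ∩ (M.delete p).marks).ncard + 1 =
        (orb M.fwd (M.σ.symm p) ∩ M.marks).ncard + (orb M.fwd (M.τ p) ∩ M.marks).ncard := by
      rw [← ncard_union_inter hs]
      rw [hm, ← Set.inter_sdiff_assoc, Set.ncard_sdiff_singleton_add_one]
      exact ⟨Or.inr hpx, hp⟩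
    obtain ⟨r, e1, e2⟩ := evenCount_swap hs (K := M.marks) (K' := (M.delete p).marks) (fun z _ hz => by
      rw [hm]
      have : z ≠ p := fun e => hz (e ▸ hpx)
      simp [this])
    grind

lemma evenCount_of_trivial (h : ∀ e, M.τ e = e) : evenCount M.fwd M.marks = orbCount M.σ := by
  have hm : M.marks = ∅ := by
    ext e; simp [marks, h e]
  have ho : orb M.fwd = orb M.σ := by
    funext x
    apply Set.Subset.antisymm
    · refine orb_subset_orb (fun e => fwd_rel (fun a b h => h.symm) (fun n _ => ?_) (fun n hn => absurd (h n) hn)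
        (fun n hn => absurd (h n) hn) e) x
      aesop
    · refine orb_subset_orb (fun e => ?_) x
      have := sameCycle_plain (M := M) (h (M.σ e))
      rwa [Equiv.symm_apply_apply] at this
  rw [evenCount, orbCount, orbits, orbits, ho, hm]
  congr 1
  ext O; simp

lemma evenCount_lt_of_last (hp : p ∈ M.marks) (h : ∀ e, (M.delete p).τ e = e) :
    evenCount M.fwd M.marks < orbCount M.σ := by
  have hf := delete_fwd hp
  have hm := delete_marks hp
  have hm0 : (M.delete p).marks = ∅ := by
    ext e; simp [marks, h e]
  have hmp : M.marks = {p} := by grind [Set.sdiff_eq_empty]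
  have hs : M.fwd.SameCycle (M.σ.symm p) (M.τ p) := by
    obtain ⟨p', h1, h2⟩ := exists_mark (M := M) (x := M.σ.symm p) (by simpa using hp.2)
    rw [hmp, Set.mem_singleton_iff] at h1
    subst h1
    exact Perm.SameCycle.trans h2 (sameCycle_out hp.2)
  have hn : ¬ (M.delete p).fwd.SameCycle (M.σ.symm p) (M.τ p) := by
    rw [hf]; exact not_sameCycle_swap hs (symm_ne hp)
  have hpx : p ∈ orb (M.delete p).fwd (M.σ.symm p) := by
    have : (M.delete p).fwd (M.σ.symm p) = p := by
      rw [hf, Perm.mul_apply, swap_apply_left, fwd_apply,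
        step_white_cross (by rw [M.col_τ p hp.2, hp.1]; rfl) (τ_ne hp.2), M.τ_τ]
    grind [apply_mem_orb, mem_orb_self]
  obtain ⟨r, e1, e2⟩ := evenCount_swap hn (K := (M.delete p).marks) (K' := M.marks) (fun z hz _ => by
    grind)
  rw [hf, swap_swap_cancel, ← hf] at e2
  have h3 : ((orb (M.delete p).fwd (M.σ.symm p) ∪ orb (M.delete p).fwd (M.τ p)) ∩ M.marks).ncard = 1 := by
    simp_all
  rw [h3, if_neg (by decide)] at e2
  have e3 := evenCount_of_trivial h
  rw [e1, hm0] at e3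
  simp only [Set.inter_empty, Set.ncard_empty, Even.zero, if_true] at e3
  rw [e2]
  show r + 0 < orbCount (M.delete p).σ
  omega

lemma ncard_delete_lt (hp : M.τ p ≠ p) :
    {e | (M.delete p).τ e ≠ e}.ncard < {e | M.τ e ≠ e}.ncard := by
  refine Set.ncard_lt_ncard ⟨fun e he => ?_, fun hsub => ?_⟩ (Set.toFinite _)
  · grind [delete_τ_of, delete_τ_of_not]
  · exact hsub (show p ∈ {e | M.τ e ≠ e} from hp) (delete_τ_of (Or.inl rfl))

end FlatMap

namespace FlatMap

open Equiv

variable {E : Type} [DecidableEq E] [Finite E] {M : FlatMap E}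

lemma zmod_two_cases (a : ZMod 2) : a = 0 ∨ a = 1 := by revert a; decide

lemma Region.const {J χ : E → ZMod 2} (h : M.Region J χ) {x y : E} (hJ : ∀ e ∈ orb M.fwd x, J e = 0)
    (hy : y ∈ orb M.fwd x) : χ y = χ x := by
  refine orb_const χ (fun z hz => ?_) hy
  have := fwd_rel (M := M) (R := fun a b => J a = 0 → J b = 0 → χ a = χ b)
    (fun a b h h1 h2 => (h h2 h1).symm) (fun n hn _ _ => (h n).1 (Or.inl hn))
    (fun n hn hl h1 _ => by rw [((h n).2 hn hl).2, h1, add_zero])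
    (fun n hn hl h1 _ => by rw [((h n).2 hn hl).1, h1, add_zero]) z
  exact (this (hJ z hz) (hJ _ (apply_mem_orb hz))).symm

/-- The circle `c` bounds a region such that no crossing on `c` is attached to it from the inside. -/
structure IsFace (M : FlatMap E) (c : Set E) (χ : E → ZMod 2) : Prop where
  region : M.Region (ind c) χ
  side : ∀ n, M.τ n ≠ n → M.isL n = true → n ∈ c ∨ M.σ.symm n ∈ c → χ n = 0

lemma exists_face (hpl : M.Planar) (hred : ∀ n, M.τ n ≠ n → ¬ M.fwd.SameCycle (M.σ.symm n) n)
    (hex : ∃ n, M.τ n ≠ n) : ∃ x χ, M.IsFace (orb M.fwd x) χ ∧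
      ∃ n, M.τ n ≠ n ∧ (n ∈ orb M.fwd x ∨ M.σ.symm n ∈ orb M.fwd x) := by
  have key : ∀ N x χ, {e | e ∉ orb M.fwd x ∧ χ e = 1}.ncard = N → M.Region (ind (orb M.fwd x)) χ →
      (∃ n, M.τ n ≠ n ∧ (n ∈ orb M.fwd x ∨ M.σ.symm n ∈ orb M.fwd x)) →
      ∃ x χ, M.IsFace (orb M.fwd x) χ ∧
        ∃ n, M.τ n ≠ n ∧ (n ∈ orb M.fwd x ∨ M.σ.symm n ∈ orb M.fwd x) := by
    intro N
    induction N using Nat.strong_induction_on with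
    | _ N ih =>
    intro x χ hN hreg ht
    by_cases hside : ∀ n, M.τ n ≠ n → M.isL n = true → n ∈ orb M.fwd x ∨ M.σ.symm n ∈ orb M.fwd x → χ n = 0
    · exact ⟨x, χ, ⟨hreg, hside⟩, ht⟩
    push Not at hside
    obtain ⟨n, hn, hl, hmem, hne⟩ := hside
    have h1 : χ n = 1 := (zmod_two_cases _).resolve_left hne
    have h1' : χ (M.σ.symm n) = 1 := ((hreg n).1 (Or.inr hl)).trans h1
    obtain ⟨a, b, ha, hb, hχb, htb⟩ : ∃ a b, a ∈ orb M.fwd x ∧ b ∉ orb M.fwd x ∧ χ b = 1 ∧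
        (n = b ∨ M.σ.symm n = b) := by
      rcases hmem with h | h
      · exact ⟨n, _, h, fun h' => hred n hn (Perm.SameCycle.trans (Perm.SameCycle.symm h') h), h1', Or.inr rfl⟩
      · exact ⟨_, n, h, fun h' => hred n hn (Perm.SameCycle.trans (Perm.SameCycle.symm h) h'), h1, Or.inl rfl⟩
    have hdis : ∀ e ∈ orb M.fwd b, e ∉ orb M.fwd x := fun e he he' =>
      hb (Perm.SameCycle.trans he' (Perm.SameCycle.symm he))
    obtain ⟨χ', hreg', ha'⟩ : ∃ χ', M.Region (ind (orb M.fwd b)) χ' ∧ χ' a = 0 := by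
      obtain ⟨χ', h'⟩ := hpl _ (flow_orb b)
      rcases zmod_two_cases (χ' a) with h0 | h0
      · exact ⟨χ', h', h0⟩
      · exact ⟨χ' + 1, h'.add_one, by simp only [Pi.add_apply, h0, Pi.one_apply]; decide⟩
    have hχ : ∀ e ∈ orb M.fwd b, χ e = 1 := fun e he =>
      (hreg.const (fun z hz => ind_of_not_mem (hdis z hz)) he).trans hχb
    have hχ' : ∀ e ∈ orb M.fwd x, χ' e = 0 := fun e he => by
      rw [← orb_eq_of_mem ha] at he
      refine (hreg'.const (fun z hz => ind_of_not_mem fun hz' => ?_) he).trans ha'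
      rw [orb_eq_of_mem ha] at hz
      exact hdis z hz' hz
    have hprod := hreg.mul hreg'
    have hJ : χ * ind (orb M.fwd b) + ind (orb M.fwd x) * χ' + ind (orb M.fwd x) * ind (orb M.fwd b) =
        ind (orb M.fwd b) := by grind [Pi.add_apply, Pi.mul_apply, orb, ind_of_not_mem]
    rw [hJ] at hprod
    refine ih _ ?_ b _ rfl hprod ⟨n, hn, ?_⟩
    · rw [← hN]
      refine Set.ncard_lt_ncard ⟨?_, fun hsub => ?_⟩ (Set.toFinite _)
      · rintro e ⟨-, he2⟩
        simp only [Pi.mul_apply] at he2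
        refine ⟨fun he => ?_, ?_⟩
        · grind [absurd]
        · rcases zmod_two_cases (χ e) with h0 | h0
          · rw [h0, zero_mul] at he2; exact absurd he2 (by decide)
          · exact h0
      · exact (hsub (show b ∈ {e | e ∉ orb M.fwd x ∧ χ e = 1} from ⟨hb, hχb⟩)).1 (mem_orb_self _ b)
    · rcases htb with rfl | rfl
      · exact Or.inl (mem_orb_self _ _)
      · exact Or.inr (mem_orb_self _ _)
  obtain ⟨n, hn⟩ := hex
  obtain ⟨χ, hχ⟩ := hpl _ (flow_orb n)
  exact key _ n χ rfl hχ ⟨n, hn, Or.inl (mem_orb_self _ n)⟩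

namespace IsFace

variable {x : E} {χ : E → ZMod 2}

lemma eq_out (h : M.IsFace (orb M.fwd x) χ) {n : E} (hn : M.τ n ≠ n) (hm : n ∈ orb M.fwd x) :
    χ n = if M.isL n = true then 0 else 1 := by
  split_ifs with hl
  · exact h.side n hn hl (Or.inl hm)
  · have hl' : M.isL (M.τ n) = true := by rw [M.isL_τ n hn]; simpa using hl
    have h1 := ((h.region _).2 (τ_ne hn) hl').2
    rw [M.τ_τ, h.side _ (τ_ne hn) hl' (Or.inl ((tau_mem_orb hn).1 hm)), ind_of_mem ((tau_mem_orb hn).1 hm)] at h1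
    rw [h1, zero_add]

lemma eq_in (h : M.IsFace (orb M.fwd x) χ) {n : E} (hn : M.τ n ≠ n) (hm : M.σ.symm n ∈ orb M.fwd x) :
    χ (M.σ.symm n) = if M.isL n = true then 0 else 1 := by
  split_ifs with hl
  · rw [(h.region n).1 (Or.inr hl)]; exact h.side n hn hl (Or.inr hm)
  · have hl' : M.isL (M.τ n) = true := by rw [M.isL_τ n hn]; simpa using hl
    have h1 := ((h.region _).2 (τ_ne hn) hl').1
    have hm' := (mem_orb_congr (x := x) (sameCycle_in hn)).1 hm
    rw [M.τ_τ, (h.region _).1 (Or.inr hl'), h.side _ (τ_ne hn) hl' (Or.inr hm'), ind_of_mem hm'] at h1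
    rw [h1, zero_add]

lemma col_const (h : M.IsFace (orb M.fwd x) χ) {y z : E} (hy : y ∈ orb M.fwd x) (hz : z ∈ orb M.fwd x)
    (hc : M.col y = M.col z) : χ y = χ z := by
  have key : ∀ y ∈ orb M.fwd x, χ y + (if M.col y = true then 0 else 1) = χ x + (if M.col x = true then 0 else 1) := by
    intro y hy
    refine orb_const (fun y => χ y + (if M.col y = true then 0 else 1)) (fun z hz => ?_) hy
    have := fwd_rel (M := M) (R := fun a b => a ∈ orb M.fwd x → b ∈ orb M.fwd x →
        χ a + (if M.col a = true then 0 else 1) = χ b + (if M.col b = true then 0 else 1))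
      (fun a b h h1 h2 => (h h2 h1).symm)
      (fun n hn _ _ => by rw [(h.region n).1 (Or.inl hn), col_symm])
      (fun n hn hl h1 h2 => by
        rw [h.eq_out hn h1, h.eq_out (τ_ne hn) h2, M.isL_τ n hn, M.col_τ n hn, hl]
        cases M.col n <;> decide)
      (fun n hn hl h1 h2 => by
        rw [h.eq_in hn h1, h.eq_in (τ_ne hn) h2, M.isL_τ n hn, col_symm, col_symm, M.col_τ n hn, hl]
        cases M.col n <;> decide) z
    exact (this hz (apply_mem_orb hz)).symm
  grind

lemma inner_const (h : M.IsFace (orb M.fwd x) χ) {J χ' : E → ZMod 2} (hJ : M.Flow J) (h' : M.Region J χ')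
    {y z : E} (hy : y ∈ orb M.fwd x) (hz : z ∈ orb M.fwd x) : χ' y + (1 + χ y) * J y = χ' z + (1 + χ z) * J z := by
  have key : ∀ y ∈ orb M.fwd x, χ' y + (1 + χ y) * J y = χ' x + (1 + χ x) * J x := by
    intro y hy
    refine orb_const (fun y => χ' y + (1 + χ y) * J y) (fun z hz => ?_) hy
    have := fwd_rel (M := M) (R := fun a b => a ∈ orb M.fwd x → b ∈ orb M.fwd x →
        χ' a + (1 + χ a) * J a = χ' b + (1 + χ b) * J b)
      (fun a b h h1 h2 => (h h2 h1).symm)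
      (fun n hn _ _ => by rw [(h.region n).1 (Or.inl hn), (h' n).1 (Or.inl hn), (hJ n).1 hn])
      (fun n hn hl h1 h2 => by
        rw [h.eq_out hn h1, h.eq_out (τ_ne hn) h2, M.isL_τ n hn, hl, ((h' n).2 hn hl).2]
        grind)
      (fun n hn hl h1 h2 => by
        rw [h.eq_in hn h1, h.eq_in (τ_ne hn) h2, M.isL_τ n hn, hl, ((h' n).2 hn hl).1]
        grind) z
    exact (this hz (apply_mem_orb hz)).symm
  exact (key y hy).trans (key z hz).symm

end IsFace

end FlatMap

namespace FlatMap

open Equiv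

variable {E : Type} [DecidableEq E] (M : FlatMap E)

/-- The edges `p` and `p'`, of the same colour, are cut and glued to each other. -/
def saddle (p p' : E) (h : M.col p = M.col p') : FlatMap E where
  σ := M.σ * swap p p'
  τ := M.τ
  col := M.col
  isL := M.isL
  τ_τ := M.τ_τ
  col_σ e := by
    rw [Perm.mul_apply, M.col_σ]
    grind
  col_τ := M.col_τ
  isL_τ := M.isL_τ

/-- The marked edges `p` and `p'` follow each other on a circle. -/
def Consec (p p' : E) : Prop := ∃ N, 0 < N ∧ (M.fwd ^ N) p = p' ∧ ∀ j, 0 < j → j < N → (M.fwd ^ j) p ∉ M.marks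

variable {M} {p p' : E}

lemma saddle_symm (h : M.col p = M.col p') (n : E) :
    (M.saddle p p' h).σ.symm n = swap p p' (M.σ.symm n) := by aesop

lemma saddle_fwd (hp : M.col p = true) (hp' : M.col p' = true) :
    (M.saddle p p' (hp.trans hp'.symm)).fwd = M.fwd * swap p p' := by
  have hs : ∀ n, M.col n = false → (M.saddle p p' (hp.trans hp'.symm)).σ.symm n = M.σ.symm n := fun n hn => by
    rw [saddle_symm, swap_apply_of_ne_of_ne] <;> intro e <;> have := congrArg M.col e <;>
      rw [col_symm, hn] at this
    · rw [hp] at this; exact absurd this (by simp)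
    simp_all
  have key : ∀ e, (M.saddle p p' (hp.trans hp'.symm)).step e = M.step (swap p p' e) := fun e => by
    cases hc : M.col e with
    | true =>
      have hc' : M.col (swap p p' e) = true := by aesop
      by_cases hx : M.τ (M.σ (swap p p' e)) = M.σ (swap p p' e)
      · rw [step_black_plain hc' hx, step_black_plain (M := M.saddle p p' _) hc hx]; rfl
      · rw [step_black_cross hc' hx, step_black_cross (M := M.saddle p p' _) hc hx, ← hs]
        · rfl
        · rw [M.col_τ _ hx, M.col_σ, hc']; rfl
    | false =>
      rw [swap_apply_of_ne_of_ne]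
      · exact step_congr rfl (fun h => by rw [hc] at h; exact absurd h (by simp)) (fun _ => ⟨rfl, hs e hc⟩)
      · rintro rfl; rw [hp] at hc; exact absurd hc (by simp)
      grind
  ext e
  exact key e

lemma saddle_marks (h : M.col p = M.col p') : (M.saddle p p' h).marks = M.marks := rfl

variable [Finite E]

lemma consec_orb (hc : M.Consec p p') {s : Perm E} (h : ∀ z, z ∉ M.marks → s z = M.fwd z)
    (hp' : s p' = M.fwd p) {z : E} (hz : z ∈ orb s p') (hm : z ∈ M.marks) : z = p' := by
  obtain ⟨N, h0, hN, hj⟩ := hc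
  have := orb_subset (s := s) (S := {z | ∃ j, 0 < j ∧ j ≤ N ∧ (M.fwd ^ j) p = z}) (x := p') ?_
    ⟨N, h0, le_rfl, hN⟩ hz
  · grind
  · rintro _ ⟨j, h1, h2, rfl⟩
    rcases h2.lt_or_eq with h2 | rfl
    · exact ⟨j + 1, by omega, h2, by rw [pow_succ', Perm.mul_apply, h _ (hj j h1 h2)]⟩
    · exact ⟨1, one_pos, h0, by rw [hN, hp', pow_one]⟩

lemma Consec.ne (hc : M.Consec p p') (hp : p ∈ M.marks) (he : Even (orb M.fwd p ∩ M.marks).ncard) :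
    p ≠ p' := by
  rintro rfl
  have : orb M.fwd p ∩ M.marks = {p} := by
    ext z
    constructor
    · rintro ⟨h1, h2⟩; exact consec_orb hc (fun _ _ => rfl) rfl h1 h2
    · rintro rfl; exact ⟨mem_orb_self _ _, hp⟩
  simp_all

lemma Consec.mem (hc : M.Consec p p') : p' ∈ orb M.fwd p := by
  obtain ⟨N, -, rfl, -⟩ := hc
  exact ⟨N, rfl⟩

lemma saddle_orb (hc : M.Consec p p') (hp : p ∈ M.marks) (hp' : p' ∈ M.marks) {z : E}
    (hz : z ∈ orb (M.saddle p p' (hp.1.trans hp'.1.symm)).fwd p') (hm : z ∈ M.marks) : z = p' := by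
  refine consec_orb hc (s := (M.saddle p p' (hp.1.trans hp'.1.symm)).fwd) (fun w hw => ?_) ?_ hz hm
  · rw [saddle_fwd hp.1 hp'.1, Perm.mul_apply, swap_apply_of_ne_of_ne] <;> rintro rfl <;> exact hw (by assumption)
  · rw [saddle_fwd hp.1 hp'.1, Perm.mul_apply, swap_apply_right]

lemma saddle_count (hc : M.Consec p p') (hp : p ∈ M.marks) (hp' : p' ∈ M.marks)
    (he : Even (orb M.fwd p ∩ M.marks).ncard) :
    evenCount M.fwd M.marks = evenCount (M.saddle p p' (hp.1.trans hp'.1.symm)).fwd M.marks + 1 ∧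
      orbCount (M.saddle p p' (hp.1.trans hp'.1.symm)).fwd = orbCount M.fwd + 1 := by
  have hne := hc.ne hp he
  set M' := M.saddle p p' (hp.1.trans hp'.1.symm) with hM'
  have hf : M'.fwd = M.fwd * swap p p' := saddle_fwd hp.1 hp'.1
  have hf' : M'.fwd * swap p p' = M.fwd := by rw [hf, swap_swap_cancel]
  have hn : ¬ M'.fwd.SameCycle p p' := fun h => hne (saddle_orb hc hp hp' h.symm hp)
  have h1 : (orb M'.fwd p' ∩ M.marks).ncard = 1 := by
    rw [Set.ncard_eq_one]
    refine ⟨p', ?_⟩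
    ext z
    constructor
    · rintro ⟨h1, h2⟩; exact saddle_orb hc hp hp' h1 h2
    · rintro rfl; exact ⟨mem_orb_self _ _, hp'⟩
  have h2 : orb M'.fwd p ∪ orb M'.fwd p' = orb M.fwd p := by
    rw [← orb_swap_of_not_mem hn, hf']
  have h3 := ncard_union_inter hn M.marks
  rw [h2, h1] at h3
  constructor
  · obtain ⟨r, e1, e2⟩ := evenCount_swap hn (K := M.marks) (K' := M.marks) (fun _ _ _ => Iff.rfl)
    grind
  · rw [orbCount_swap hn, hf']

lemma Planar.saddle {x : E} {χ : E → ZMod 2} (hpl : M.Planar) (hface : M.IsFace (orb M.fwd x) χ)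
    (hc : M.Consec p p') (hp : p ∈ M.marks) (hp' : p' ∈ M.marks) (hpx : p ∈ orb M.fwd x)
    (he : Even (orb M.fwd p ∩ M.marks).ncard) : (M.saddle p p' (hp.1.trans hp'.1.symm)).Planar := by
  have hcol := hp.1.trans hp'.1.symm
  have hne := hc.ne hp he
  have hp'x : p' ∈ orb M.fwd x := Perm.SameCycle.trans hpx hc.mem
  have hχ : χ p = χ p' := hface.col_const hpx hp'x hcol
  set M' := M.saddle p p' hcol with hM'
  have hsy : ∀ n, M'.σ.symm n = swap p p' (M.σ.symm n) := fun n => saddle_symm hcol n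
  have hinv : ∀ {f : E → ZMod 2}, f p = f p' → ∀ n, f (M'.σ.symm n) = f (M.σ.symm n) := by grind
  have key : ∀ J, M'.Flow J → J p = J p' → ∃ χ', M'.Region J χ' := by
    intro J hJ hpp
    have hJ' : M.Flow J := fun n => by
      have := hJ n
      rw [hinv hpp, hinv hpp] at this
      exact this
    obtain ⟨χ', h'⟩ := hpl J hJ'
    have h1 : χ' p = χ' p' := by
      have := hface.inner_const hJ' h' hpx hp'x
      simp_all
    refine ⟨χ', fun n => ?_⟩
    have := h' n
    rw [← hinv hpp, ← hinv h1, ← hinv h1] at this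
    exact this
  have hn : p ∉ orb M'.fwd p' := fun h => hne (saddle_orb hc hp hp' h hp)
  have hsub : orb M'.fwd p' ⊆ orb M.fwd x := by
    have hf : M'.fwd = M.fwd * swap p p' := saddle_fwd hp.1 hp'.1
    have h2 : orb M'.fwd p ∪ orb M'.fwd p' = orb M.fwd p := by
      rw [← orb_swap_of_not_mem (fun h => hn h.symm), hf, swap_swap_cancel]
    grind [orb_eq_of_mem]
  have hmem : ∀ n, M'.σ.symm n ∈ orb M'.fwd p' → M.σ.symm n ∈ orb M.fwd x := fun n h => by grind
  have hO : M'.Region (ind (orb M'.fwd p')) (ind (orb M'.fwd p') * χ) := fun n => by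
    have hL : M.τ n ≠ n → M.isL n = true → (ind (orb M'.fwd p') * χ) (M'.σ.symm n) = 0 ∧
        (ind (orb M'.fwd p') * χ) n = 0 := fun hn hl => by
      constructor
      · simp only [Pi.mul_apply]
        by_cases h : M'.σ.symm n ∈ orb M'.fwd p'
        · rw [hinv hχ, (hface.region n).1 (Or.inr hl), hface.side n hn hl (Or.inr (hmem n h)), mul_zero]
        · rw [ind_of_not_mem h, zero_mul]
      · simp only [Pi.mul_apply]
        by_cases h : n ∈ orb M'.fwd p'
        · rw [hface.side n hn hl (Or.inl (hsub h)), mul_zero]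
        · rw [ind_of_not_mem h, zero_mul]
    refine ⟨fun h => ?_, fun h hl => ?_⟩
    · by_cases ht : M.τ n = n
      · simp only [Pi.mul_apply]
        rw [hinv hχ, (hface.region n).1 (Or.inl ht),
          ind_congr (mem_orb_congr (sameCycle_plain (M := M') ht))]
      · have hl := h.resolve_left ht
        rw [(hL ht hl).1, (hL ht hl).2]
    · have ht : M.τ n ≠ n := h
      have hl' : ¬ M.isL (M'.τ n) = true := by
        show ¬ M.isL (M.τ n) = true
        rw [M.isL_τ n ht, show M.isL n = true from hl]; simp
      rw [(hL ht hl).1, (hL ht hl).2, zero_add, zero_add]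
      constructor
      · rw [ind_congr (mem_orb_congr (sameCycle_in (M := M') ht))]
        simp only [Pi.mul_apply]
        by_cases hm : M'.σ.symm (M'.τ n) ∈ orb M'.fwd p'
        · rw [hinv hχ, hface.eq_in (n := M'.τ n) (τ_ne ht) (hmem _ hm), if_neg hl', mul_one]
        · rw [ind_of_not_mem hm, zero_mul]
      · rw [ind_congr (mem_orb_congr (sameCycle_out (M := M') ht))]
        simp only [Pi.mul_apply]
        by_cases hm : M'.τ n ∈ orb M'.fwd p'
        · rw [hface.eq_out (n := M'.τ n) (τ_ne ht) (hsub hm), if_neg hl', mul_one]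
        · rw [ind_of_not_mem hm, zero_mul]
  intro J hJ
  by_cases hpp : J p = J p'
  · exact key J hJ hpp
  · obtain ⟨χ', h'⟩ := key (J + ind (orb M'.fwd p')) (hJ.add (flow_orb p')) (by
      simp only [Pi.add_apply]
      rw [ind_of_not_mem hn, ind_of_mem (mem_orb_self _ _)]
      revert hpp; generalize J p = a; generalize J p' = b; revert a b; decide)
    refine ⟨χ' + ind (orb M'.fwd p') * χ, ?_⟩
    have := h'.add hO
    rwa [add_assoc, show ind (orb M'.fwd p') + ind (orb M'.fwd p') = 0 from
      funext fun e => CharTwo.add_self_eq_zero _, add_zero] at this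

end FlatMap

namespace FlatMap

open Equiv

variable {E : Type} [DecidableEq E] {M : FlatMap E}

/-- The mod 2 sum of the edges `a`, `σ a`, …, `σ ^ (N - 1) a`. -/
def path (σ : Perm E) (a : E) (N : ℕ) (e : E) : ZMod 2 := ∑ i ∈ Finset.range N, if (σ ^ i) a = e then 1 else 0

lemma path_add_symm (σ : Perm E) (a : E) (N : ℕ) (n : E) :
    path σ a N n + path σ a N (σ.symm n) = (if a = n then 1 else 0) + if (σ ^ N) a = n then 1 else 0 := by
  induction N with
  | zero => simp [path, CharTwo.add_self_eq_zero]
  | succ N ih =>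
    grind [path, Finset.sum_range_succ, pow_succ', Perm.mul_apply, Equiv.eq_symm_apply]

lemma path_eq_zero {σ : Perm E} {a : E} {N : ℕ} {e : E} (h : ∀ i < N, (σ ^ i) a ≠ e) : path σ a N e = 0 :=
  Finset.sum_eq_zero fun i hi => if_neg (h i (Finset.mem_range.1 hi))

lemma col_pow (i : ℕ) (e : E) : M.col ((M.σ ^ i) e) = M.col e := by
  induction i with
  | zero => rfl
  | succ i ih => rw [pow_succ', Perm.mul_apply, M.col_σ, ih]

lemma Region.right {J χ : E → ZMod 2} (hJ : M.Flow J) (h : M.Region J χ) {n : E} (hn : M.τ n ≠ n)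
    (hl : ¬ M.isL n = true) : χ (M.σ.symm n) + J (M.σ.symm n) = χ n + J n := by
  have hl' : M.isL (M.τ n) = true := by rw [M.isL_τ n hn]; simpa using hl
  obtain ⟨h1, h2⟩ := (h (M.τ n)).2 (τ_ne hn) hl'
  rw [M.τ_τ] at h1 h2
  rw [h1, h2, (h _).1 (Or.inr hl')]
  linear_combination (hJ n).2 hn

variable [Finite E]

lemma exists_first {σ : Perm E} {S : Set E} {p : E} (hp : p ∈ S) :
    ∃ i, (σ ^ (i + 1)) p ∈ S ∧ ∀ j < i, (σ ^ (j + 1)) p ∉ S := by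
  classical
  have hex : ∃ i, (σ ^ (i + 1)) p ∈ S := by
    refine ⟨orderOf σ - 1, ?_⟩
    rw [Nat.sub_add_cancel (orderOf_pos σ), pow_orderOf_eq_one]
    exact hp
  exact ⟨Nat.find hex, Nat.find_spec hex, fun j hj => Nat.find_min hex hj⟩

lemma exists_next {p : E} (hp : p ∈ M.marks) : ∃ x q m, M.σ.SameCycle p x ∧ M.τ (M.σ x) ≠ M.σ x ∧
    M.col x = true ∧ M.col q = false ∧ M.τ q ≠ q ∧ (M.σ ^ (m + 1)) q = M.τ (M.σ x) ∧
    (∀ i, 0 < i → i ≤ m → M.τ ((M.σ ^ i) q) = (M.σ ^ i) q) ∧ M.Consec p (M.τ q) ∧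
    M.σ.symm (M.τ (M.σ x)) ∈ orb M.fwd p := by
  obtain ⟨i, hi, hi'⟩ := exists_first (σ := M.σ) (S := {e | M.τ e ≠ e}) hp.2
  have hx : M.τ (M.σ ((M.σ ^ i) p)) ≠ M.σ ((M.σ ^ i) p) := by
    rw [← Perm.mul_apply, ← pow_succ']; exact hi
  obtain ⟨m, hm, hm'⟩ := exists_first (σ := M.σ⁻¹) (S := {e | M.τ e ≠ e})
    (p := M.τ (M.σ ((M.σ ^ i) p))) (τ_ne hx)
  simp only [Set.mem_ofPred_eq, not_not] at hi' hm'
  have hc : ∀ j, M.col ((M.σ ^ j) p) = true := fun j => (col_pow j p).trans hp.1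
  set x := (M.σ ^ i) p with hxdef
  set z := M.τ (M.σ x) with hz
  have hzc : M.col z = false := by rw [hz, M.col_τ _ hx, M.col_σ, hxdef, hc]; rfl
  have hcz : ∀ j, M.col ((M.σ⁻¹ ^ j) z) = false := fun j => by
    have := col_pow (M := M) j ((M.σ⁻¹ ^ j) z)
    simp_all
  have f1 : ∀ j ≤ i, (M.fwd ^ j) p = (M.σ ^ j) p := by
    intro j hj
    induction j with
    | zero => rfl
    | succ j ih =>
      grind [pow_succ', Perm.mul_apply, fwd_apply, step_black_plain]
  have f2 : ∀ j ≤ m, (M.fwd ^ (i + 1 + j)) p = (M.σ⁻¹ ^ (j + 1)) z := by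
    intro j hj
    induction j with
    | zero =>
      rw [add_zero, pow_succ', Perm.mul_apply, f1 i le_rfl, fwd_apply, step_black_cross (hc i) hx]
      rfl
    | succ j ih =>
      rw [← add_assoc, pow_succ', Perm.mul_apply, ih (by omega), fwd_apply,
        step_white_plain (hcz (j + 1)) (hm' j (by omega)), pow_succ' _ (j + 1), Perm.mul_apply]
      rfl
  refine ⟨x, (M.σ⁻¹ ^ (m + 1)) z, m, ⟨i, rfl⟩, hx, hc i, hcz _, hm, ?_, ?_, ⟨i + 1 + m + 1, by omega, ?_, ?_⟩, ?_⟩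
  · simp_all
  · intro j h0 hj
    have : (M.σ ^ j) ((M.σ⁻¹ ^ (m + 1)) z) = (M.σ⁻¹ ^ (m - j + 1)) z := by
      have e : m + 1 = j + (m - j + 1) := by omega
      rw [e, pow_add, ← Perm.mul_apply, ← mul_assoc, inv_pow M.σ j, mul_inv_cancel, one_mul]
    rw [this]
    exact hm' _ (by omega)
  · rw [pow_succ', Perm.mul_apply, f2 m le_rfl, fwd_apply, step_white_cross (hcz _) hm]
  · intro j h0 hj hmk
    rcases Nat.lt_or_ge i j with h | h
    · obtain ⟨k, rfl⟩ : ∃ k, j = i + 1 + k := ⟨j - (i + 1), by omega⟩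
      rw [f2 k (by omega)] at hmk
      have := hmk.1
      grind
    · rw [f1 j h] at hmk
      obtain ⟨k, rfl⟩ : ∃ k, j = k + 1 := ⟨j - 1, by omega⟩
      exact hmk.2 (hi' k (by omega))
  · refine ⟨(i + 1 + 0 : ℕ), ?_⟩
    rw [zpow_natCast, f2 0 (Nat.zero_le _)]; rfl

lemma IsFace.not_sameCycle {y : E} {χ : E → ZMod 2} (hpl : M.Planar) (h : M.IsFace (orb M.fwd y) χ)
    {p x q q' : E} {m : ℕ} (hpx : M.σ.SameCycle p x) (hx : M.τ (M.σ x) ≠ M.σ x) (hxc : M.col x = true)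
    (hqc : M.col q = false) (hq : M.τ q ≠ q) (hqz : (M.σ ^ (m + 1)) q = M.τ (M.σ x))
    (hm : ∀ i, 0 < i → i ≤ m → M.τ ((M.σ ^ i) q) = (M.σ ^ i) q) (hqy : q ∈ orb M.fwd y)
    (hxy : M.σ.symm (M.τ (M.σ x)) ∈ orb M.fwd y) (hq'c : M.col q' = false) (hq' : M.τ q' ≠ q') (hne : q ≠ q')
    (hq'y : q' ∈ orb M.fwd y) (h1 : M.σ.SameCycle p (M.τ q)) : ¬ M.σ.SameCycle q q' := by
  intro h2
  obtain ⟨N, -, hN⟩ := Perm.SameCycle.exists_pow_eq' (show M.σ.SameCycle (M.σ x) (M.τ q) from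
    (Perm.SameCycle.trans hpx.symm h1).apply_left)
  obtain ⟨J, hJdef⟩ : ∃ J : E → ZMod 2, J = path M.σ (M.σ x) N + path M.σ q (m + 1) := ⟨_, rfl⟩
  have hd : ∀ n, J n + J (M.σ.symm n) = ((if M.σ x = n then 1 else 0) + if M.τ q = n then 1 else 0) +
      ((if q = n then 1 else 0) + if M.τ (M.σ x) = n then 1 else 0) := fun n => by
    have a := path_add_symm M.σ (M.σ x) N n
    have b := path_add_symm M.σ q (m + 1) n
    rw [hN] at a
    rw [hqz] at b
    rw [← a, ← b, hJdef, Pi.add_apply, Pi.add_apply]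
    ring
  have hJ : M.Flow J := fun n => by
    constructor
    · intro hn
      have := hd n
      rw [if_neg, if_neg, if_neg, if_neg] at this
      · rw [← sub_eq_zero, CharTwo.sub_eq_add, add_comm, this]; rfl
      · rintro rfl; exact τ_ne hx hn
      · rintro rfl; exact hq hn
      · rintro rfl; exact τ_ne hq hn
      · rintro rfl; exact hx hn
    · intro hn
      have e : ∀ a : E, (a = M.τ n) ↔ (M.τ a = n) := fun a =>
        ⟨fun h => by rw [h, M.τ_τ], fun h => by rw [← h, M.τ_τ]⟩
      have a := hd n
      have b := hd (M.τ n)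
      simp only [e, M.τ_τ] at b
      have c := CharTwo.add_self_eq_zero (J n + J (M.σ.symm n))
      rw [← sub_eq_zero, CharTwo.sub_eq_add]
      have : J n + J (M.σ.symm n) = J (M.τ n) + J (M.σ.symm (M.τ n)) := by rw [a, b]; ring
      linear_combination c - this
  obtain ⟨χ', h'⟩ := hpl J hJ
  have hs : ∀ n, M.τ n ≠ n → (χ q = if M.isL n = true then 0 else 1) →
      χ' n + χ q * J n = χ' (M.σ.symm n) + χ q * J (M.σ.symm n) := by
    intro n hn e
    by_cases hl : M.isL n = true
    · rw [e, if_pos hl, (h' n).1 (Or.inr hl), zero_mul, zero_mul]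
    · rw [e, if_neg hl, one_mul, one_mul, h'.right hJ hn hl]
  have hconst : χ' q' + χ q * J q' = χ' q + χ q * J q := by
    refine orb_const (s := M.σ) (fun e => χ' e + χ q * J e) (fun z hz => ?_) h2
    have hzc : M.col (M.σ z) = false := by
      have := orb_const (s := M.σ) M.col (fun w _ => M.col_σ w) hz
      rw [M.col_σ, this, hqc]
    by_cases hzq : M.σ z = q
    · have := hs q hq (h.eq_out hq hqy)
      rw [← hzq, Equiv.symm_apply_apply] at this
      rw [← hzq]; exact this
    by_cases hzx : M.σ z = M.τ (M.σ x)
    · have := hs (M.τ (M.σ x)) (τ_ne hx) (by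
        rw [← h.eq_in (τ_ne hx) hxy]
        exact h.col_const hqy hxy (by rw [hqc, col_symm, M.col_τ _ hx, M.col_σ, hxc]; rfl))
      rw [← hzx, Equiv.symm_apply_apply] at this
      exact this
    have hd0 : J (M.σ z) = J z := by
      have := hd (M.σ z)
      rw [if_neg, if_neg, if_neg (Ne.symm hzq), if_neg (Ne.symm hzx), Equiv.symm_apply_apply] at this
      · rw [← sub_eq_zero, CharTwo.sub_eq_add, this]; rfl
      · intro e; rw [← e, M.col_τ q hq, hqc] at hzc; exact absurd hzc (by simp)
      · intro e; rw [← e, M.col_σ, hxc] at hzc; exact absurd hzc (by simp)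
    have : χ' (M.σ z) = χ' z := by
      by_cases hc : M.τ (M.σ z) = M.σ z ∨ M.isL (M.σ z) = true
      · have := (h' (M.σ z)).1 hc
        rwa [Equiv.symm_apply_apply, eq_comm] at this
      · push Not at hc
        have := h'.right hJ hc.1 hc.2
        rw [Equiv.symm_apply_apply, hd0] at this
        exact (add_right_cancel this).symm
    simp only [hd0, this]
  have hblack : ∀ e, M.col e = false → path M.σ (M.σ x) N e = 0 := fun e he =>
    path_eq_zero fun i _ hi => by
      have := congrArg M.col hi
      rw [col_pow, M.col_σ, hxc, he] at this
      exact absurd this (by simp)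
  have hJq : J q = 1 := by
    rw [hJdef, Pi.add_apply, hblack q hqc, zero_add, path, Finset.sum_range_succ', pow_zero,
      Perm.one_apply, if_pos rfl, Finset.sum_eq_zero, zero_add]
    intro i hi
    refine if_neg fun e => hq ?_
    have := hm (i + 1) (by omega) (by have := Finset.mem_range.1 hi; omega)
    rwa [e] at this
  have hJq' : J q' = 0 := by
    rw [hJdef, Pi.add_apply, hblack q' hq'c, zero_add]
    refine path_eq_zero fun i hi e => ?_
    rcases Nat.eq_zero_or_pos i with rfl | h0
    · exact hne e
    · have := hm i h0 (by omega)
      rw [e] at this; exact hq' this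
  have hin := h.inner_const hJ h' hqy hq'y
  grind [absurd]

lemma Consec.flip {q q' : E} (hq : M.col q = false) (hqt : M.τ q ≠ q) (hq' : M.col q' = false) (hqt' : M.τ q' ≠ q')
    (h : M.Consec (M.τ q) (M.τ q')) : M.flip.Consec q' q := by
  obtain ⟨N, h0, hN, hj⟩ := h
  have e1 : M.fwd q = M.τ q := by rw [fwd_apply, step_white_cross hq hqt]
  have e2 : M.fwd q' = M.τ q' := by rw [fwd_apply, step_white_cross hq' hqt']
  have e3 : (M.fwd ^ N) q = q' := by
    apply M.fwd.injective
    rw [e2, ← hN, ← e1, ← Perm.mul_apply, ← Perm.mul_apply, ← pow_succ', ← pow_succ]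
  refine ⟨N, h0, ?_, fun j h1 h2 hm => ?_⟩
  · rw [flip_fwd, ← e3, ← Perm.mul_apply, inv_pow, inv_mul_cancel]; rfl
  · have e4 : (M.flip.fwd ^ j) q' = (M.fwd ^ (N - j)) q := by
      rw [flip_fwd, ← e3, ← Perm.mul_apply, show N = j + (N - j) by omega, pow_add, ← mul_assoc, inv_pow,
        inv_mul_cancel, one_mul, Nat.add_sub_cancel_left]
    rw [e4] at hm
    have hm1 : M.col ((M.fwd ^ (N - j)) q) = false := by simpa [FlatMap.flip] using hm.1
    refine hj (N - j) (by omega) (by omega) ?_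
    rw [← e1, ← Perm.mul_apply, ← pow_succ, pow_succ', Perm.mul_apply, fwd_apply, step_white_cross hm1 hm.2]
    exact ⟨by rw [M.col_τ _ hm.2, hm1]; rfl, τ_ne hm.2⟩

lemma flip_marks_ncard (x : E) : (orb M.flip.fwd x ∩ M.flip.marks).ncard = (orb M.fwd x ∩ M.marks).ncard := by
  rw [orb_fwd_symm]
  refine Set.ncard_congr (fun e _ => M.τ e) ?_ ?_ ?_
  · rintro e ⟨h1, h2, h3⟩
    have h3' : M.τ e ≠ e := h3
    exact ⟨(tau_mem_orb h3').1 h1, by rw [M.col_τ e h3']; exact h2, τ_ne h3'⟩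
  · intro a b _ _ h
    rw [← M.τ_τ a, h, M.τ_τ]
  · rintro e ⟨h1, h2, h3⟩
    exact ⟨M.τ e, ⟨(tau_mem_orb h3).1 h1, by simp [FlatMap.flip, M.col_τ e h3, h2], τ_ne h3⟩, M.τ_τ e⟩

lemma flip_evenCount : evenCount M.flip.fwd M.flip.marks = evenCount M.fwd M.marks := by
  have h : orbits M.flip.fwd = orbits M.fwd := by
    rw [orbits, orbits]; congr 1; funext x; exact orb_fwd_symm x
  rw [evenCount, evenCount, h]
  congr 1
  ext O
  simp only [Set.mem_ofPred_eq]
  refine and_congr_right fun hO => ?_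
  obtain ⟨x, rfl⟩ := hO
  rw [← orb_fwd_symm, flip_marks_ncard, orb_fwd_symm]

lemma flip_orbCount : orbCount M.flip.fwd = orbCount M.fwd := by
  rw [orbCount, orbCount, orbits, orbits]; congr 2; funext x; exact orb_fwd_symm x

lemma evenCount_lt (hpl : M.Planar) (hex : ∃ e, M.τ e ≠ e) : evenCount M.fwd M.marks < orbCount M.σ := by
  have key : ∀ k l (M : FlatMap E), M.Planar → {e | M.τ e ≠ e}.ncard = k → Nat.card E - orbCount M.fwd = l →
      (∃ e, M.τ e ≠ e) → evenCount M.fwd M.marks < orbCount M.σ := by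
    intro k
    induction k using Nat.strong_induction_on with
    | _ k ihk =>
    intro l
    induction l using Nat.strong_induction_on with
    | _ l ihl =>
    intro M hpl hk hl hex
    by_cases hred : ∀ p ∈ M.marks, ¬ M.fwd.SameCycle (M.σ.symm p) (M.τ p) ∧
        Even (orb M.fwd (M.σ.symm p) ∩ M.marks).ncard ∧ Even (orb M.fwd (M.τ p) ∩ M.marks).ncard
    · have hsad : ∀ M' : FlatMap E, M'.Planar → {e | M'.τ e ≠ e}.ncard = k → Nat.card E - orbCount M'.fwd = l →
          (∃ e, M'.τ e ≠ e) → ∀ (x p p' : E) (χ : E → ZMod 2), M'.IsFace (orb M'.fwd x) χ → M'.Consec p p' →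
          p ∈ M'.marks → p' ∈ M'.marks → p ∈ orb M'.fwd x → Even (orb M'.fwd p ∩ M'.marks).ncard →
          ¬ M'.σ.SameCycle p p' → evenCount M'.fwd M'.marks < orbCount M'.σ := by
        intro M' hpl' hk' hl' hex' x p p' χ hf hc hp hp' hpx he hs
        obtain ⟨e1, e2⟩ := saddle_count hc hp hp' he
        have e3 := orbCount_le (M'.saddle p p' (hp.1.trans hp'.1.symm)).fwd
        have e4 := ihl _ (by omega) (M'.saddle p p' (hp.1.trans hp'.1.symm))
          (hpl'.saddle hf hc hp hp' hpx he) hk' rfl hex'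
        rw [saddle_marks] at e4
        have e5 := orbCount_swap hs
        have e6 : (M'.saddle p p' (hp.1.trans hp'.1.symm)).σ = M'.σ * swap p p' := rfl
        rw [e6] at e4
        omega
      have hred' : ∀ n, M.τ n ≠ n → ¬ M.fwd.SameCycle (M.σ.symm n) n := fun n hn hsc => by
        cases hc : M.col n with
        | true => exact (hred n ⟨hc, hn⟩).1 (hsc.trans (sameCycle_out hn))
        | false =>
          refine (hred (M.τ n) ⟨by rw [M.col_τ n hn, hc]; rfl, τ_ne hn⟩).1 ?_
          rw [M.τ_τ]
          exact (sameCycle_in hn).symm.trans hsc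
      have heven : ∀ p ∈ M.marks, Even (orb M.fwd p ∩ M.marks).ncard := fun p hp => by
        rw [orb_eq_of_mem (show p ∈ orb M.fwd (M.τ p) from (sameCycle_out hp.2).symm)]
        exact (hred p hp).2.2
      obtain ⟨y, χ, hf, n, hn, hny⟩ := exists_face hpl hred' hex
      obtain ⟨p, hp, hpy⟩ : ∃ p ∈ M.marks, p ∈ orb M.fwd y := by
        rcases hny with h | h
        · cases hc : M.col n with
          | true => exact ⟨n, ⟨hc, hn⟩, h⟩
          | false => exact ⟨M.τ n, ⟨by rw [M.col_τ n hn, hc]; rfl, τ_ne hn⟩, (tau_mem_orb hn).1 h⟩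
        · obtain ⟨p, h1, h2⟩ := exists_mark (M := M) (x := M.σ.symm n) (by simpa using hn)
          exact ⟨p, h1, Perm.SameCycle.trans h h2⟩
      obtain ⟨x, q, m, a1, a2, a3, a4, a5, a6, a7, a8, a9⟩ := exists_next hp
      have hq : M.τ q ∈ M.marks := ⟨by rw [M.col_τ q a5, a4]; rfl, τ_ne a5⟩
      have hqy : M.τ q ∈ orb M.fwd y := Perm.SameCycle.trans hpy a8.mem
      obtain ⟨-, q', -, -, -, -, b4, b5, -, -, b8, -⟩ := exists_next hq
      have hq' : M.τ q' ∈ M.marks := ⟨by rw [M.col_τ q' b5, b4]; rfl, τ_ne b5⟩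
      have hq'y : M.τ q' ∈ orb M.fwd y := Perm.SameCycle.trans hqy b8.mem
      by_cases hs : M.σ.SameCycle p (M.τ q)
      · have hne : q ≠ q' := fun e => b8.ne hq (heven _ hq) (by rw [e])
        have hs' := hf.not_sameCycle hpl a1 a2 a3 a4 a5 a6 a7 ((tau_mem_orb a5).2 hqy)
          (Perm.SameCycle.trans hpy a9) b4 b5 hne ((tau_mem_orb b5).2 hq'y) hs
        have h3 : evenCount M.flip.fwd M.flip.marks < orbCount M.flip.σ := by
          refine hsad M.flip hpl hk (by rw [flip_orbCount, hl]) hex y q' q χ ?_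
            (b8.flip a4 a5 b4 b5) ⟨by simp [FlatMap.flip, b4], b5⟩ ⟨by simp [FlatMap.flip, a4], a5⟩ ?_ ?_ (fun h => hs' h.symm)
          · rw [orb_fwd_symm]; exact ⟨hf.region, hf.side⟩
          · rw [orb_fwd_symm]; exact (tau_mem_orb b5).2 hq'y
          · rw [flip_marks_ncard, orb_eq_of_mem (show q' ∈ orb M.fwd (M.τ q') from (sameCycle_out b5).symm)]
            exact heven _ hq'
        rw [flip_evenCount] at h3
        exact h3
      grind
    · push Not at hred
      obtain ⟨p, hp, hbad⟩ := hred
      by_cases hex' : ∃ e, (M.delete p).τ e ≠ e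
      · refine (evenCount_le_delete hp fun h => ?_).trans_lt (ihk _ ?_ _ (M.delete p) (hpl.delete hp.2) rfl rfl hex')
        · exact hbad h.1 h.2.1 h.2.2
        · rw [← hk]; exact ncard_delete_lt hp.2
      · push Not at hex'
        exact evenCount_lt_of_last hp hex'
  exact key _ _ M hpl rfl rfl hex

end FlatMap

def Shape.ends (s : Shape) (b : Bool) : ℕ := if b = true then s.tgt else s.src

/-- The other end of the strand of a shape that begins at the end `j` at the top (`b = true`) or at the
bottom. -/
def Shape.mate : Shape → Bool × ℕ → Bool × ℕ
  | .vert, (b, j) => (!b, j)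
  | _, (b, j) => (b, 1 - j)

namespace Slice

def ends (sl : Slice) (b : Bool) : ℕ := sl.left + sl.shape.ends b + sl.right

def mate (sl : Slice) (h : Bool × ℕ) : Bool × ℕ :=
  if h.2 < sl.left then (!h.1, h.2) else
  if h.2 < sl.left + sl.shape.ends h.1 then
    ((sl.shape.mate (h.1, h.2 - sl.left)).1, sl.left + (sl.shape.mate (h.1, h.2 - sl.left)).2)
  else (!h.1, sl.left + sl.shape.ends (!h.1) + (h.2 - (sl.left + sl.shape.ends h.1)))

variable {sl : Slice}

lemma mate_left {b : Bool} {i : ℕ} (h : i < sl.left) : sl.mate (b, i) = (!b, i) := if_pos h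

lemma mate_mid {b : Bool} {j : ℕ} (h : j < sl.shape.ends b) :
    sl.mate (b, sl.left + j) = ((sl.shape.mate (b, j)).1, sl.left + (sl.shape.mate (b, j)).2) := by
  rw [mate, if_neg (by simp), if_pos (by simpa using h), Nat.add_sub_cancel_left]

lemma mate_right (b : Bool) (j : ℕ) :
    sl.mate (b, sl.left + sl.shape.ends b + j) = (!b, sl.left + sl.shape.ends (!b) + j) := by
  rw [mate, if_neg (by simp only; omega), if_neg (by simp only; omega)]
  simp only [Nat.add_sub_cancel_left]

lemma end_cases {b : Bool} {i : ℕ} (h : i < sl.ends b) : i < sl.left ∨ (∃ j < sl.shape.ends b, i = sl.left + j) ∨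
    ∃ j < sl.right, i = sl.left + sl.shape.ends b + j := by
  simp only [ends] at h
  by_cases h1 : i < sl.left
  · exact Or.inl h1
  by_cases h2 : i < sl.left + sl.shape.ends b
  · exact Or.inr (Or.inl ⟨i - sl.left, by omega, by omega⟩)
  · exact Or.inr (Or.inr ⟨i - (sl.left + sl.shape.ends b), by omega, by omega⟩)

lemma _root_.Shape.ends_cases {s : Shape} {b : Bool} {j : ℕ} (h : j < s.ends b) : s.ends b = 2 ∧ (j = 0 ∨ j = 1) := by
  cases s <;> cases b <;> simp [Shape.ends, Shape.src, Shape.tgt] at h ⊢ <;> omega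

lemma _root_.Shape.mate_lt {s : Shape} {b : Bool} {j : ℕ} (h : j < s.ends b) :
    (s.mate (b, j)).2 < s.ends (s.mate (b, j)).1 := by
  obtain ⟨-, rfl | rfl⟩ := Shape.ends_cases h <;> cases s <;> cases b <;>
    simp_all [Shape.ends, Shape.src, Shape.tgt, Shape.mate]

lemma _root_.Shape.mate_mate {s : Shape} {b : Bool} {j : ℕ} (h : j < s.ends b) :
    s.mate (s.mate (b, j)) = (b, j) := by
  obtain ⟨-, rfl | rfl⟩ := Shape.ends_cases h <;> cases s <;> cases b <;> simp [Shape.mate]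

lemma mate_lt {h : Bool × ℕ} (hh : h.2 < sl.ends h.1) : (sl.mate h).2 < sl.ends (sl.mate h).1 := by
  rcases h with ⟨b, i⟩
  rcases end_cases (b := b) (i := i) hh with h1 | ⟨j, hj, rfl⟩ | ⟨j, hj, rfl⟩
  · rw [mate_left h1]; simp only [ends]; omega
  · grind [mate_mid, Shape.mate_lt, ends]
  · rw [mate_right]; simp only [ends]; omega

lemma mate_mate {h : Bool × ℕ} (hh : h.2 < sl.ends h.1) : sl.mate (sl.mate h) = h := by
  rcases h with ⟨b, i⟩
  rcases end_cases (b := b) (i := i) hh with h1 | ⟨j, hj, rfl⟩ | ⟨j, hj, rfl⟩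
  · rw [mate_left h1, mate_left h1, Bool.not_not]
  · rw [mate_mid hj, mate_mid (Shape.mate_lt hj), Shape.mate_mate hj]
  · rw [mate_right, mate_right, Bool.not_not]

lemma mate_of_arc {k : ℕ} {p q : ℕ × ℕ} (h : Arc k sl p q) : ∃ e : Bool × ℕ,
    e.2 < sl.ends e.1 ∧ p = (k + e.1.toNat, e.2) ∧ q = (k + (sl.mate e).1.toNat, (sl.mate e).2) := by
  have mid : ∀ (u v : ℕ) (s : Shape) (b : Bool) (j : ℕ), j < s.ends b → ∃ e : Bool × ℕ,
      e.2 < Slice.ends ⟨u, s, v⟩ e.1 ∧ (k + b.toNat, u + j) = (k + e.1.toNat, e.2) ∧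
      (k + (s.mate (b, j)).1.toNat, u + (s.mate (b, j)).2) =
        (k + (Slice.mate ⟨u, s, v⟩ e).1.toNat, (Slice.mate ⟨u, s, v⟩ e).2) := fun u v s b j hj =>
    ⟨(b, u + j), by simp only [ends]; omega, rfl, by rw [mate_mid (sl := ⟨u, s, v⟩) hj]⟩
  cases h with
  | left u v s j hj => exact ⟨(false, j), by simp only [ends]; omega, rfl, by rw [mate_left (sl := ⟨u, s, v⟩) hj]; rfl⟩
  | right u v s j hj =>
    exact ⟨(false, u + s.src + j), by simp [ends, Shape.ends]; omega, rfl, by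
      have := mate_right (sl := ⟨u, s, v⟩) false j
      simp only [Shape.ends, Bool.not_false, if_true, Bool.false_eq_true, if_false] at this
      rw [this]; rfl⟩
  | cup u v => exact mid u v .cup true 0 (by decide)
  | cap u v => exact mid u v .cap false 0 (by decide)
  | vertLeft u v => exact mid u v .vert false 0 (by decide)
  | vertRight u v => exact mid u v .vert false 1 (by decide)
  | horizBelow u v => exact mid u v .horiz false 0 (by decide)
  | horizAbove u v => exact mid u v .horiz true 0 (by decide)

lemma arc_mate (k : ℕ) {e : Bool × ℕ} (h : e.2 < sl.ends e.1) :
    Arc k sl (k + e.1.toNat, e.2) (k + (sl.mate e).1.toNat, (sl.mate e).2) ∨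
      Arc k sl (k + (sl.mate e).1.toNat, (sl.mate e).2) (k + e.1.toNat, e.2) := by
  rcases sl with ⟨u, s, v⟩
  rcases e with ⟨b, i⟩
  rcases end_cases (b := b) (i := i) h with h1 | ⟨j, hj, rfl⟩ | ⟨j, hj, rfl⟩
  · rw [mate_left h1]
    cases b
    · exact Or.inl (Arc.left u v s i h1)
    · exact Or.inr (Arc.left u v s i h1)
  · rw [mate_mid hj]
    obtain ⟨-, rfl | rfl⟩ := Shape.ends_cases hj <;> cases s <;> cases b <;>
      simp [Shape.ends, Shape.src, Shape.tgt] at hj <;> first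
        | exact Or.inl (Arc.cup _ _)
        | exact Or.inr (Arc.cup _ _)
        | exact Or.inl (Arc.cap _ _)
        | exact Or.inr (Arc.cap _ _)
        | exact Or.inl (Arc.vertLeft _ _)
        | exact Or.inr (Arc.vertLeft _ _)
        | exact Or.inl (Arc.vertRight _ _)
        | exact Or.inr (Arc.vertRight _ _)
        | exact Or.inl (Arc.horizBelow _ _)
        | exact Or.inr (Arc.horizBelow _ _)
        | exact Or.inl (Arc.horizAbove _ _)
        | exact Or.inr (Arc.horizAbove _ _)
  · rw [mate_right]
    cases b
    · exact Or.inl (Arc.right u v s j hj)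
    · exact Or.inr (Arc.right u v s j hj)

end Slice

namespace Layer

def _root_.Piece.ends (p : Piece) (b : Bool) : List Bool := if b = true then p.tgt else p.src

def ends (l : Layer) (b : Bool) : List Bool := l.left ++ l.piece.ends b ++ l.right

def lab (l : Layer) (h : Bool × ℕ) : Bool := (l.ends h.1).getD h.2 false

/-- The smoothing that respects the orientation. -/
def seifert (l : Layer) : Slice := l.smooth (decide (l.piece.sign = 1))

lemma _root_.Piece.ends_smooth (p : Piece) (A b : Bool) : (p.smooth A).ends b = (p.ends b).length := by
  cases p <;> cases b <;> simp only [Piece.smooth, Shape.ends, Piece.ends] <;> (try split_ifs) <;> rfl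

lemma ends_smooth (l : Layer) (A b : Bool) : (l.smooth A).ends b = (l.ends b).length := by
  simp only [smooth, Slice.ends, ends, List.length_append, Piece.ends_smooth]

variable {l : Layer} {b : Bool}

lemma lab_left {i : ℕ} (h : i < l.left.length) : l.lab (b, i) = l.left.getD i false := by
  rw [lab, ends, List.append_assoc, List.getD_append _ _ _ _ h]

lemma lab_mid {j : ℕ} (h : j < (l.piece.ends b).length) :
    l.lab (b, l.left.length + j) = (l.piece.ends b).getD j false := by grind [lab, ends]

lemma lab_right (b : Bool) (j : ℕ) :
    l.lab (b, l.left.length + (l.piece.ends b).length + j) = l.right.getD j false := by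
  grind [lab, ends]

lemma bodd_ends (p : Piece) (b : Bool) : (p.ends b).length.bodd = false := by
  cases p <;> cases b <;> simp [Piece.ends, Piece.src, Piece.tgt]

lemma _root_.bne_xor_congr {a b c d : Bool} (x : Bool) (h : (a != c) = (b != d)) :
    (a != (x ^^ c)) = (b != (x ^^ d)) := by
  revert a b c d x; decide

lemma _root_.bne_xor_congr_not {a b c d : Bool} (x : Bool) (h : (a != c) = !(b != d)) :
    (a != (x ^^ c)) = !(b != (x ^^ d)) := by
  revert a b c d x; decide

lemma _root_.Piece.ends_cases {p : Piece} {j : ℕ} (h : j < (p.ends b).length) : j = 0 ∨ j = 1 := by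
  cases p <;> cases b <;> simp [Piece.ends, Piece.src, Piece.tgt] at h <;> omega

/-- The label of an end of a piece. -/
def _root_.Piece.lab (p : Piece) (h : Bool × ℕ) : Bool := (p.ends h.1).getD h.2 false

lemma _root_.Piece.lab_seifert (p : Piece) {j : ℕ} (h : j < (p.ends b).length) {h' : Bool × ℕ}
    (e : (p.smooth (decide (p.sign = 1))).mate (b, j) = h') :
    (p.lab h' != h'.1) = !(p.lab (b, j) != b) ∧ (p.lab h' != h'.2.bodd) = (p.lab (b, j) != j.bodd) := by
  subst e
  cases p with
  | cup o => obtain rfl | rfl := Piece.ends_cases h <;> cases o <;> cases b <;> first | decide | exact absurd h (by decide)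
  | cap o => obtain rfl | rfl := Piece.ends_cases h <;> cases o <;> cases b <;> first | decide | exact absurd h (by decide)
  | cross x y r => obtain rfl | rfl := Piece.ends_cases h <;> cases b <;> revert x y r <;> decide

lemma _root_.Piece.lab_broken {p : Piece} {A : Bool} (hA : p.Broken A) {j : ℕ} (h : j < (p.ends b).length)
    {h' : Bool × ℕ} (e : (p.smooth A).mate (b, j) = h') :
    (p.lab h' != h'.1) = (p.lab (b, j) != b) ∧ (p.lab h' != h'.2.bodd) = !(p.lab (b, j) != j.bodd) ∧
      (p.smooth (decide (p.sign = 1))).mate ((p.smooth A).mate ((p.smooth (decide (p.sign = 1))).mate (b, j))) = h' ∧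
      h' ≠ (b, j) := by
  subst e
  cases p with
  | cup o => exact hA.elim
  | cap o => exact hA.elim
  | cross x y r =>
    obtain rfl | rfl := Piece.ends_cases h <;> cases b <;> cases x <;> cases y <;> cases r <;> cases A <;>
      first | decide | (exact absurd hA (by simp [Piece.Broken]))

lemma smooth_of_not_broken {A : Bool} (hA : ¬ l.piece.Broken A) : l.smooth A = l.seifert := by
  rcases l with ⟨u, p, v⟩
  cases p with
  | cup o => rfl
  | cap o => rfl
  | cross x y r =>
    cases x <;> cases y <;> cases r <;> cases A <;> first | rfl | exact absurd (by simp [Piece.Broken]) hA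

lemma lab_seifert {h : Bool × ℕ} (hh : h.2 < (l.ends h.1).length) :
    (l.lab (l.seifert.mate h) != (l.seifert.mate h).1) = !(l.lab h != h.1) ∧
      (l.lab (l.seifert.mate h) != (l.seifert.mate h).2.bodd) = (l.lab h != h.2.bodd) := by
  rcases h with ⟨b, i⟩
  rw [← ends_smooth l (decide (l.piece.sign = 1))] at hh
  have e : ∀ b, (l.smooth (decide (l.piece.sign = 1))).shape.ends b = (l.piece.ends b).length := Piece.ends_smooth _ _
  rcases Slice.end_cases (b := b) (i := i) hh with h1 | ⟨j, hj, rfl⟩ | ⟨j, hj, rfl⟩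
  · rw [seifert, Slice.mate_left h1]
    have h1' : i < l.left.length := h1
    rw [lab_left h1', lab_left h1']
    simp
  · have hj' := Shape.mate_lt hj
    rw [seifert, Slice.mate_mid hj]
    rw [e] at hj hj'
    rw [show (l.smooth (decide (l.piece.sign = 1))).left = l.left.length from rfl, lab_mid hj, lab_mid hj', Nat.bodd_add,
      Nat.bodd_add]
    obtain ⟨h1, h2⟩ := Piece.lab_seifert l.piece hj rfl
    exact ⟨h1, bne_xor_congr _ h2⟩
  · rw [seifert, Slice.mate_right, e, e]
    rw [show (l.smooth (decide (l.piece.sign = 1))).left = l.left.length from rfl, lab_right, lab_right]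
    simp [Nat.bodd_add, bodd_ends]

/-- The end lies at a crossing that is smoothed against the orientation. -/
def Cut (l : Layer) (A : Bool) (h : Bool × ℕ) : Prop :=
  l.piece.Broken A ∧ ∃ j < (l.piece.ends h.1).length, h.2 = l.left.length + j

lemma lab_cut {A : Bool} {h : Bool × ℕ} (hh : l.Cut A h) :
    l.Cut A ((l.smooth A).mate h) ∧
    (l.lab ((l.smooth A).mate h) != ((l.smooth A).mate h).1) = (l.lab h != h.1) ∧
      (l.lab ((l.smooth A).mate h) != ((l.smooth A).mate h).2.bodd) = !(l.lab h != h.2.bodd) ∧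
      l.seifert.mate ((l.smooth A).mate (l.seifert.mate h)) = (l.smooth A).mate h ∧ (l.smooth A).mate h ≠ h := by
  rcases h with ⟨b, i⟩
  obtain ⟨hA, j, hj, rfl⟩ := hh
  change j < (l.piece.ends b).length at hj
  have e : ∀ A b, (l.smooth A).shape.ends b = (l.piece.ends b).length := Piece.ends_smooth _
  have m : ∀ A b j, j < (l.piece.ends b).length → (l.smooth A).mate (b, l.left.length + j) =
      (((l.piece.smooth A).mate (b, j)).1, l.left.length + ((l.piece.smooth A).mate (b, j)).2) ∧
        ((l.piece.smooth A).mate (b, j)).2 < (l.piece.ends ((l.piece.smooth A).mate (b, j)).1).length :=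
    fun A b j hj => by
      rw [← e A] at hj
      exact ⟨Slice.mate_mid hj, e A _ ▸ Shape.mate_lt hj⟩
  have hm := m A b j hj
  have hm' := m (decide (l.piece.sign = 1)) b j hj
  obtain ⟨h1, h2, h3, h4⟩ := Piece.lab_broken hA hj rfl
  rw [seifert, hm.1]
  refine ⟨⟨hA, _, hm.2, rfl⟩, ?_, ?_, ?_, ?_⟩
  · rw [lab_mid hm.2, lab_mid hj]; exact h1
  · rw [lab_mid hm.2, lab_mid hj, Nat.bodd_add, Nat.bodd_add]
    exact bne_xor_congr_not _ h2
  · have hm2 := m A _ _ hm'.2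
    rw [hm'.1, hm2.1, (m _ _ _ hm2.2).1]
    have h5 := congrArg Prod.fst h3
    have h6 := congrArg (fun z => l.left.length + z.2) h3
    exact Prod.ext h5 h6
  grind

lemma mate_of_not_cut {A : Bool} {h : Bool × ℕ} (hl : h.2 < (l.ends h.1).length) (hh : ¬ l.Cut A h) :
    (l.smooth A).mate h = l.seifert.mate h := by
  by_cases hA : l.piece.Broken A
  · rcases h with ⟨b, i⟩
    rw [← ends_smooth l A] at hl
    have e : ∀ A b, (l.smooth A).shape.ends b = (l.piece.ends b).length := Piece.ends_smooth _
    rcases Slice.end_cases (b := b) (i := i) hl with h1 | ⟨j, hj, rfl⟩ | ⟨j, hj, rfl⟩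
    · exact (Slice.mate_left h1).trans (Slice.mate_left (sl := l.seifert) h1).symm
    · rw [e] at hj; exact absurd ⟨hA, j, hj, rfl⟩ hh
    · have := Slice.mate_right (sl := l.smooth (decide (l.piece.sign = 1))) b j
      rw [e, e] at this
      rw [Slice.mate_right, e, e]
      exact this.symm
  · rw [smooth_of_not_broken hA]

lemma cut_seifert {A : Bool} {h : Bool × ℕ} (hh : l.Cut A h) : l.Cut A (l.seifert.mate h) := by
  rcases h with ⟨b, i⟩
  obtain ⟨hA, j, hj, rfl⟩ := hh
  change j < (l.piece.ends b).length at hj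
  rw [← Piece.ends_smooth _ (decide (l.piece.sign = 1))] at hj
  have := Slice.mate_mid (sl := l.seifert) hj
  change l.seifert.mate (b, l.left.length + j) = _ at this
  rw [this]
  have h2 := Shape.mate_lt hj
  rw [Piece.ends_smooth] at h2
  exact ⟨hA, _, h2, rfl⟩

/-- For an end that goes into a crossing that is smoothed against the orientation: it is continued on the left by the
oriented smoothing. -/
def isL (l : Layer) (h : Bool × ℕ) : Bool :=
  match l.piece with
  | .cross a b _ => if a = b then (decide (h.2 = l.left.length) == a) else (a == h.1)
  | _ => true

lemma isL_cut {A : Bool} {h : Bool × ℕ} (hh : l.Cut A h) : l.isL ((l.smooth A).mate h) = !l.isL h := by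
  rcases h with ⟨b, i⟩
  obtain ⟨hA, j, hj, rfl⟩ := hh
  change j < (l.piece.ends b).length at hj
  have hj' : j < (l.smooth A).shape.ends b := by rw [smooth, Piece.ends_smooth]; exact hj
  have := Slice.mate_mid (sl := l.smooth A) hj'
  change (l.smooth A).mate (b, l.left.length + j) = _ at this
  rw [this]
  clear this hj'
  rcases l with ⟨u, p, v⟩
  cases p with
  | cup o => exact hA.elim
  | cap o => exact hA.elim
  | cross x y r =>
    obtain rfl | rfl := Piece.ends_cases hj <;> cases x <;> cases y <;> cases r <;> cases A <;>
      first | (simp [isL, smooth, Piece.smooth, Shape.mate]; done) | exact absurd hA (by simp [Piece.Broken])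

end Layer

namespace Strands

variable (L : List Layer) (A : ℕ → Bool)

def lay (k : ℕ) : Layer := L.getD k ⟨[], .cup true, []⟩

def Pts : Set (ℕ × ℕ) := {p | p.1 < L.length ∧ p.2 < ((lay L p.1).ends false).length}

/-- An end of a strand in a layer: the layer, and the position at its top or bottom. -/
def Valid (h : ℕ × Bool × ℕ) : Prop := h.1 < L.length ∧ h.2.2 < ((lay L h.1).ends h.2.1).length

def pnt (h : ℕ × Bool × ℕ) : ℕ × ℕ := (h.1 + h.2.1.toNat, h.2.2)

def half (d : Bool) (p : ℕ × ℕ) : ℕ × Bool × ℕ := if d = true then (p.1, false, p.2) else (p.1 - 1, true, p.2)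

def labP (p : ℕ × ℕ) : Bool := (lay L p.1).lab (false, p.2)

/-- The end at which the strand through a point leaves it. -/
def outH (p : ℕ × ℕ) : ℕ × Bool × ℕ := half (labP L p) p

/-- The end at which the strand through a point arrives. -/
def inH (p : ℕ × ℕ) : ℕ × Bool × ℕ := half (!labP L p) p

def Out (h : ℕ × Bool × ℕ) : Prop := Valid L h ∧ labP L (pnt h) = !h.2.1

def In (h : ℕ × Bool × ℕ) : Prop := Valid L h ∧ labP L (pnt h) = h.2.1

/-- The other end of a strand when all crossings are smoothed with respect to the orientation. -/
def seif (h : ℕ × Bool × ℕ) : ℕ × Bool × ℕ := (h.1, (lay L h.1).seifert.mate h.2)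

/-- The other end of a strand in a state. -/
def sm (h : ℕ × Bool × ℕ) : ℕ × Bool × ℕ := (h.1, ((lay L h.1).smooth (A h.1)).mate h.2)

def Cut (h : ℕ × Bool × ℕ) : Prop := (lay L h.1).Cut (A h.1) h.2

def colP (p : ℕ × ℕ) : Bool := labP L p != p.2.bodd

variable {L A} {h : ℕ × Bool × ℕ} {p : ℕ × ℕ}

lemma lay_eq {k : ℕ} (hk : k < L.length) : L[k]? = some (lay L k) := by
  rw [lay, List.getD_eq_getElem?_getD, List.getElem?_eq_getElem hk]; rfl

lemma _root_.IsTangle.lay {s t : List Bool} (hL : IsTangle s L t) :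
    (0 < L.length → (lay L 0).ends false = s) ∧
      ∀ k < L.length, (k + 1 < L.length → (Strands.lay L (k + 1)).ends false = (Strands.lay L k).ends true) ∧
      (k + 1 = L.length → (Strands.lay L k).ends true = t) := by
  induction L generalizing s with
  | nil => exact ⟨fun h => absurd h (by simp), fun k h => absurd h (by simp)⟩
  | cons l L ih =>
    obtain ⟨h1, h2⟩ := ih hL.2
    refine ⟨fun _ => hL.1.symm, fun k hk => ?_⟩
    cases k with
    | zero =>
      refine ⟨fun h => h1 (by simpa using h), fun h => ?_⟩
      have : L = [] := List.length_eq_zero_iff.1 (by simpa using h)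
      subst this
      exact hL.2
    | succ k =>
      have := h2 k (by simpa using hk)
      exact ⟨fun h => this.1 (by simpa using h), fun h => this.2 (by simpa using h)⟩

lemma eq_not_of_bne {a b : Bool} (h : (a != b) = true) : a = !b := by
  revert a b; decide

lemma half_pnt (h : ℕ × Bool × ℕ) : half (!h.2.1) (pnt h) = h := by
  rcases h with ⟨k, b, i⟩; cases b <;> rfl

variable (hL : IsTangle [] L [])
include hL

lemma half_valid (hp : p ∈ Pts L) (d : Bool) : Valid L (half d p) ∧ pnt (half d p) = p := by
  rcases p with ⟨k, i⟩
  obtain ⟨h1, h2⟩ := hp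
  cases d with
  | true => exact ⟨⟨h1, h2⟩, rfl⟩
  | false =>
    cases k with
    | zero => rw [hL.lay.1 h1] at h2; exact absurd h2 (by simp)
    | succ k =>
      refine ⟨⟨Nat.lt_of_succ_lt h1, ?_⟩, rfl⟩
      rw [(hL.lay.2 k (Nat.lt_of_succ_lt h1)).1 h1] at h2
      exact h2

lemma pnt_mem (hh : Valid L h) : pnt h ∈ Pts L := by
  rcases h with ⟨k, b, i⟩
  cases b with
  | false => exact hh
  | true =>
    obtain ⟨h1, h2⟩ := hh
    have h1' : k < L.length := h1
    rcases (Nat.succ_le_of_lt h1').lt_or_eq with h | h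
    · refine ⟨h, ?_⟩
      have := (hL.lay.2 k h1').1 h
      change i < ((lay L (k + 1)).ends false).length
      rw [this]; exact h2
    · change i < ((lay L k).ends true).length at h2
      rw [(hL.lay.2 k h1').2 h] at h2; exact absurd h2 (by simp)

lemma labP_pnt (hh : Valid L h) : labP L (pnt h) = (lay L h.1).lab h.2 := by
  have hm := pnt_mem hL hh
  rcases h with ⟨k, b, i⟩
  cases b with
  | false => rfl
  | true =>
    have h1 : k + 1 < L.length := hm.1
    change ((lay L (k + 1)).ends false).getD i false = ((lay L k).ends true).getD i false
    rw [(hL.lay.2 k (Nat.lt_of_succ_lt h1)).1 h1]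

lemma out_outH (hp : p ∈ Pts L) : Out L (outH L p) ∧ pnt (outH L p) = p := by
  obtain ⟨h1, h2⟩ := half_valid hL hp (labP L p)
  refine ⟨⟨h1, ?_⟩, h2⟩
  rw [outH, h2]
  cases labP L p <;> rfl

lemma in_inH (hp : p ∈ Pts L) : In L (inH L p) ∧ pnt (inH L p) = p := by
  obtain ⟨h1, h2⟩ := half_valid hL hp (!labP L p)
  refine ⟨⟨h1, ?_⟩, h2⟩
  rw [inH, h2]
  cases labP L p <;> rfl

omit hL in
lemma outH_pnt (hh : Out L h) : outH L (pnt h) = h := by rw [outH, hh.2, half_pnt]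

omit hL in
lemma inH_pnt (hh : In L h) : inH L (pnt h) = h := by rw [inH, hh.2, half_pnt]

omit hL in
lemma seif_valid (hh : Valid L h) : Valid L (seif L h) := by
  refine ⟨hh.1, ?_⟩
  have := hh.2
  rw [← Layer.ends_smooth _ (decide ((lay L h.1).piece.sign = 1))] at this
  have := Slice.mate_lt this
  rw [Layer.ends_smooth] at this
  exact this

omit hL in
lemma seif_seif (hh : Valid L h) : seif L (seif L h) = h := by
  have := hh.2
  rw [← Layer.ends_smooth _ (decide ((lay L h.1).piece.sign = 1))] at this
  exact Prod.ext rfl (Slice.mate_mate this)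

omit hL in
lemma sm_valid (hh : Valid L h) : Valid L (sm L A h) := by
  refine ⟨hh.1, ?_⟩
  have := hh.2
  rw [← Layer.ends_smooth _ (A h.1)] at this
  have := Slice.mate_lt this
  rw [Layer.ends_smooth] at this
  exact this

omit hL in
lemma sm_sm (hh : Valid L h) : sm L A (sm L A h) = h := by
  have := hh.2
  rw [← Layer.ends_smooth _ (A h.1)] at this
  exact Prod.ext rfl (Slice.mate_mate this)

lemma colP_pnt (hh : Valid L h) : colP L (pnt h) = ((lay L h.1).lab h.2 != h.2.2.bodd) := by
  rw [colP, labP_pnt hL hh]; rfl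

lemma colP_seif (hh : Valid L h) : colP L (pnt (seif L h)) = colP L (pnt h) := by
  rw [colP_pnt hL hh, colP_pnt hL (seif_valid hh)]
  exact (Layer.lab_seifert hh.2).2

lemma Out.seif (hh : Out L h) : In L (seif L h) := by
  refine ⟨seif_valid hh.1, ?_⟩
  have h1 := hh.2
  have h2 := (Layer.lab_seifert hh.1.2).1
  rw [labP_pnt hL hh.1] at h1
  rw [labP_pnt hL (seif_valid hh.1)]
  rw [h1] at h2
  simpa [Strands.seif] using h2

lemma In.seif (hh : In L h) : Out L (seif L h) := by
  refine ⟨seif_valid hh.1, ?_⟩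
  have h1 := hh.2
  have h2 := (Layer.lab_seifert hh.1.2).1
  rw [labP_pnt hL hh.1] at h1
  rw [labP_pnt hL (seif_valid hh.1)]
  rw [h1] at h2
  rw [bne_self_eq_false] at h2
  exact eq_not_of_bne h2

omit hL in
lemma Cut.sm (hc : Cut L A h) : Cut L A (sm L A h) := (Layer.lab_cut hc).1

omit hL in
lemma Cut.seif (hc : Cut L A h) : Cut L A (seif L h) := Layer.cut_seifert hc

omit hL in
lemma cut_seif (hh : Valid L h) : Cut L A (Strands.seif L h) ↔ Cut L A h :=
  ⟨fun hc => by have := hc.seif; rwa [seif_seif hh] at this, fun hc => hc.seif⟩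

lemma In.sm (hh : In L h) (hc : Cut L A h) : In L (sm L A h) := by
  refine ⟨sm_valid hh.1, ?_⟩
  have h1 := hh.2
  have h2 := (Layer.lab_cut hc).2.1
  rw [labP_pnt hL hh.1] at h1
  rw [labP_pnt hL (sm_valid hh.1)]
  rw [h1] at h2
  simpa [Strands.sm] using h2

lemma colP_sm (hh : Valid L h) (hc : Cut L A h) : colP L (pnt (sm L A h)) = !colP L (pnt h) := by
  rw [colP_pnt hL hh, colP_pnt hL (sm_valid hh)]
  exact (Layer.lab_cut hc).2.2.1

omit hL in
lemma seif_sm_seif (hc : Cut L A h) : Strands.seif L (Strands.sm L A (Strands.seif L h)) = Strands.sm L A h :=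
  Prod.ext rfl (Layer.lab_cut hc).2.2.2.1

omit hL in
lemma sm_ne (hc : Cut L A h) : Strands.sm L A h ≠ h := fun e => (Layer.lab_cut hc).2.2.2.2 (congrArg Prod.snd e)

omit hL in
lemma sm_of_not_cut (hh : Valid L h) (hc : ¬ Cut L A h) : Strands.sm L A h = Strands.seif L h :=
  Prod.ext rfl (Layer.mate_of_not_cut hh.2 hc)

end Strands

open Classical Strands in
/-- The graph of a diagram, with the crossings that are not smoothed according to the orientation. -/
noncomputable def Strands.flatMap {L : List Layer} (hL : IsTangle [] L []) (A : ℕ → Bool) : FlatMap (Pts L) where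
  σ :=
    { toFun := fun p => ⟨pnt (seif L (outH L p.1)), pnt_mem hL (seif_valid (out_outH hL p.2).1.1)⟩
      invFun := fun p => ⟨pnt (seif L (inH L p.1)), pnt_mem hL (seif_valid (in_inH hL p.2).1.1)⟩
      left_inv := fun p => by
        obtain ⟨h1, h2⟩ := out_outH hL p.2
        refine Subtype.ext ?_
        show pnt (seif L (inH L (pnt (seif L (outH L p.1))))) = p.1
        rw [inH_pnt (Out.seif hL h1), seif_seif h1.1, h2]
      right_inv := fun p => by
        obtain ⟨h1, h2⟩ := in_inH hL p.2
        refine Subtype.ext ?_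
        show pnt (seif L (outH L (pnt (seif L (inH L p.1))))) = p.1
        rw [outH_pnt (In.seif hL h1), seif_seif h1.1, h2] }
  τ p := if Cut L A (inH L p.1) then ⟨pnt (sm L A (inH L p.1)), pnt_mem hL (sm_valid (in_inH hL p.2).1.1)⟩ else p
  col p := colP L p.1
  isL p := (lay L (inH L p.1).1).isL (inH L p.1).2
  τ_τ p := by
    by_cases hc : Cut L A (inH L p.1)
    · obtain ⟨h1, h2⟩ := in_inH hL p.2
      have e := inH_pnt (In.sm hL h1 hc)
      simp only [if_pos hc, e, if_pos hc.sm, sm_sm h1.1, h2]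
    · simp only [if_neg hc]
  col_σ p := by
    show colP L (pnt (seif L (outH L p.1))) = _
    rw [colP_seif hL (out_outH hL p.2).1.1, (out_outH hL p.2).2]
  col_τ p hp := by
    by_cases hc : Cut L A (inH L p.1)
    · simp only [if_pos hc]
      rw [colP_sm hL (in_inH hL p.2).1.1 hc, (in_inH hL p.2).2]
    · exact absurd (if_neg hc) hp
  isL_τ p hp := by
    by_cases hc : Cut L A (inH L p.1)
    · simp only [if_pos hc]
      rw [inH_pnt (In.sm hL (in_inH hL p.2).1 hc)]
      exact Layer.isL_cut hc
    · exact absurd (if_neg hc) hp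

namespace Layer

/-- The sum of the values of `J` at the first `g` ends at the top (`b = true`) or at the bottom. -/
def part (J : Bool × ℕ → ZMod 2) (b : Bool) (g : ℕ) : ZMod 2 := ∑ i ∈ Finset.range g, J (b, i)

lemma part_succ (J : Bool × ℕ → ZMod 2) (b : Bool) (g : ℕ) : part J b (g + 1) = part J b g + J (b, g) :=
  Finset.sum_range_succ _ _

variable {l : Layer} {A : Bool} {J : Bool × ℕ → ZMod 2}

/-- The mod 2 cycles at a layer. -/
def IsFlow (l : Layer) (A : Bool) (J : Bool × ℕ → ZMod 2) : Prop :=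
  ∀ h : Bool × ℕ, h.2 < (l.ends h.1).length → (¬ l.Cut A h → J (l.seifert.mate h) = J h) ∧
    (l.Cut A h → J (l.seifert.mate h) + J (l.seifert.mate ((l.smooth A).mate h)) = J h + J ((l.smooth A).mate h))

lemma mate_mid (l : Layer) (A : Bool) {b : Bool} {j : ℕ} (hj : j < (l.piece.ends b).length) :
    (l.smooth A).mate (b, l.left.length + j) =
      (((l.piece.smooth A).mate (b, j)).1, l.left.length + ((l.piece.smooth A).mate (b, j)).2) := by
  have : j < (l.smooth A).shape.ends b := by rw [smooth, Piece.ends_smooth]; exact hj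
  exact Slice.mate_mid this

lemma cut_iff {b : Bool} {j : ℕ} (hj : j < (l.piece.ends b).length) :
    l.Cut A (b, l.left.length + j) ↔ l.piece.Broken A :=
  ⟨fun h => h.1, fun h => ⟨h, j, hj, rfl⟩⟩

lemma lt_of_mid {b : Bool} {j : ℕ} (hj : j < (l.piece.ends b).length) :
    l.left.length + j < (l.ends b).length := by
  simp only [ends, List.length_append]; omega

lemma IsFlow.left (hJ : l.IsFlow A J) {i : ℕ} (hi : i < l.left.length) (b : Bool) : J (!b, i) = J (b, i) := by
  have h1 := (hJ (b, i) (by simp only [ends, List.length_append]; omega)).1 (by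
    rintro ⟨-, j, -, h⟩
    change i = _ at h; omega)
  have h2 : l.seifert.mate (b, i) = (!b, i) := Slice.mate_left hi
  rwa [h2] at h1

lemma IsFlow.right (hJ : l.IsFlow A J) {j : ℕ} (hj : j < l.right.length) (b : Bool) :
    J (!b, l.left.length + (l.piece.ends (!b)).length + j) = J (b, l.left.length + (l.piece.ends b).length + j) := by
  have h1 := (hJ (b, l.left.length + (l.piece.ends b).length + j) (by simp only [ends, List.length_append]; omega)).1 (by
    rintro ⟨-, j, h', h⟩
    grind)
  have h2 := Slice.mate_right (sl := l.seifert) b j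
  have e : ∀ b, l.seifert.shape.ends b = (l.piece.ends b).length := Piece.ends_smooth _ _
  rw [e, e] at h2
  change l.seifert.mate (b, l.left.length + (l.piece.ends b).length + j) = _ at h2
  rwa [h2] at h1

lemma IsFlow.mid (hJ : l.IsFlow A J) {b : Bool} {j : ℕ} (hj : j < (l.piece.ends b).length) :
    (¬ l.piece.Broken A → J (((l.piece.smooth (decide (l.piece.sign = 1))).mate (b, j)).1,
      l.left.length + ((l.piece.smooth (decide (l.piece.sign = 1))).mate (b, j)).2) = J (b, l.left.length + j)) ∧
    (l.piece.Broken A → J (false, l.left.length) + J (false, l.left.length + 1) + J (true, l.left.length) +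
      J (true, l.left.length + 1) = 0) := by
  have h := hJ (b, l.left.length + j) (lt_of_mid hj)
  rw [cut_iff hj, seifert, mate_mid l _ hj] at h
  refine ⟨h.1, fun hA => ?_⟩
  have h2 := h.2 hA
  clear h
  rcases l with ⟨u, p, v⟩
  cases p with
  | cup o | cap o => exact hA.elim
  | cross x y r =>
    obtain rfl | rfl := Piece.ends_cases hj <;> cases b <;> cases x <;> cases y <;> cases r <;> cases A <;>
      first
      | (simp [Piece.smooth, Shape.mate, smooth, Piece.sign, Slice.mate, Shape.ends, Shape.src, Shape.tgt] at h2 ⊢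
         grind)
      | exact absurd hA (by simp [Piece.Broken])

lemma IsFlow.sum_cross (hJ : l.IsFlow A J) {x y r : Bool} (hp : l.piece = .cross x y r) :
    J (false, l.left.length) + J (false, l.left.length + 1) + J (true, l.left.length) +
      J (true, l.left.length + 1) = 0 := by
  have h0 := fun b j => hJ.mid (b := b) (j := j)
  clear hJ
  rcases l with ⟨u, p, v⟩
  change p = _ at hp
  subst hp
  have g : ∀ b j, j < 2 → j < ((Piece.cross x y r).ends b).length := fun b j h => by
    cases b <;> simpa [Piece.ends, Piece.src, Piece.tgt] using h
  by_cases hA : (Piece.cross x y r).Broken A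
  · exact (h0 false 0 (g _ _ (by norm_num))).2 hA
  · have e1 := (h0 false 0 (g _ _ (by norm_num))).1 hA
    have e2 := (h0 true 1 (g _ _ (by norm_num))).1 hA
    clear h0
    revert e1 e2
    grind [Piece.smooth, Shape.mate]

lemma IsFlow.part_left (hJ : l.IsFlow A J) {g : ℕ} (hg : g ≤ l.left.length) (b : Bool) :
    part J (!b) g = part J b g :=
  Finset.sum_congr rfl fun i hi => hJ.left (by have := Finset.mem_range.1 hi; omega) b

lemma IsFlow.part_mid (hJ : l.IsFlow A J) (b : Bool) :
    part J (!b) (l.left.length + (l.piece.ends (!b)).length) = part J b (l.left.length + (l.piece.ends b).length) := by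
  have hl := hJ.part_left le_rfl b
  have key : ∀ b, part J b (l.left.length + (l.piece.ends b).length) = part J b l.left.length +
      if (l.piece.ends b).length = 2 then J (b, l.left.length) + J (b, l.left.length + 1) else 0 := fun b => by
    have : (l.piece.ends b).length = 0 ∨ (l.piece.ends b).length = 2 := by
      cases l.piece <;> cases b <;> simp [Piece.ends, Piece.src, Piece.tgt]
    rcases this with h | h
    · rw [h]; simp
    · rw [h, if_pos rfl, ← add_assoc, ← part_succ, ← part_succ]
  rw [key, key, hl]
  congr 1
  have h0 := fun b j => hJ.mid (b := b) (j := j)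
  clear key hl
  rcases l with ⟨u, p, v⟩
  cases p with
  | cup o | cap o =>
    have := fun b h => (h0 b 0 h).1 (by simp [Piece.Broken])
    simp [Piece.ends, Piece.src, Piece.tgt, Piece.smooth, Shape.mate] at this
    cases b <;> simp [Piece.ends, Piece.src, Piece.tgt, this, CharTwo.add_self_eq_zero]
  | cross x y r =>
    have h4 := hJ.sum_cross rfl
    have g : ∀ b, ((Piece.cross x y r).ends b).length = 2 := fun b => by
      cases b <;> simp [Piece.ends, Piece.src, Piece.tgt]
    simp only [g, if_true]
    revert h4
    cases b <;> grind

lemma IsFlow.part_right (hJ : l.IsFlow A J) {j : ℕ} (hj : j ≤ l.right.length) (b : Bool) :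
    part J (!b) (l.left.length + (l.piece.ends (!b)).length + j) = part J b (l.left.length + (l.piece.ends b).length + j) := by
  induction j with
  | zero => exact hJ.part_mid b
  | succ j ih => rw [← add_assoc, ← add_assoc, part_succ, part_succ, ih (by omega), hJ.right (by omega)]

/-- The value on the left of an edge that begins, or ends, at the given end. -/
def sideIn (J : Bool × ℕ → ZMod 2) (h : Bool × ℕ) : ZMod 2 := part J h.1 (h.2 + (!h.1).toNat)

def sideOut (J : Bool × ℕ → ZMod 2) (h : Bool × ℕ) : ZMod 2 := part J h.1 (h.2 + h.1.toNat)

lemma IsFlow.side (hJ : l.IsFlow A J) {h : Bool × ℕ} (hh : h.2 < (l.ends h.1).length) (hin : l.lab h = h.1) :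
    (¬ l.Cut A h ∨ l.isL h = true → sideOut J (l.seifert.mate h) = sideIn J h) ∧
    (l.Cut A h → l.isL h = true →
      sideOut J (l.seifert.mate ((l.smooth A).mate h)) = sideOut J (l.seifert.mate h) + J (l.seifert.mate h) ∧
      sideIn J ((l.smooth A).mate h) = sideIn J h + J h) := by
  rcases h with ⟨b, i⟩
  change i < _ at hh
  have e : ∀ b, l.seifert.shape.ends b = (l.piece.ends b).length := Piece.ends_smooth _ _
  have hh' : i < l.seifert.ends b := by rw [seifert, ends_smooth]; exact hh
  rcases Slice.end_cases hh' with h1 | ⟨j, hj, rfl⟩ | ⟨j, hj, rfl⟩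
  · have h1' : i < l.left.length := h1
    refine ⟨fun _ => ?_, ?_⟩
    · rw [Slice.mate_left h1, sideOut, sideIn]
      exact hJ.part_left (by simp only; cases b <;> simp <;> omega) b
    · rintro ⟨-, j, -, h⟩
      change i = _ at h; omega
  · have hl := hJ.part_left le_rfl true
    have hm := hJ.part_mid true
    have h0 := fun b j => hJ.mid (b := b) (j := j)
    rw [e] at hj
    have hs : l.seifert.left = l.left.length := rfl
    simp only [hs] at hin ⊢
    rw [cut_iff hj]
    rw [lab_mid hj] at hin
    clear hh' hh e
    rcases l with ⟨u, p, v⟩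
    cases p with
    | cup o | cap o =>
      refine ⟨fun _ => ?_, fun h => h.elim⟩
      have h1 := (h0 b 0 (by omega)).1 (by simp [Piece.Broken])
      cases b <;> simp [Piece.ends, Piece.src, Piece.tgt] at hj
      simp [Piece.smooth, Shape.mate] at h1
      obtain rfl | rfl : j = 0 ∨ j = 1 := by omega
      all_goals
        simp [seifert, smooth, Piece.smooth, Shape.mate, Slice.mate, Shape.ends, Shape.src, Shape.tgt, sideOut, sideIn,
          part_succ, h1, add_assoc, CharTwo.add_self_eq_zero]
    | cross x y r =>
      have g : ∀ b j, j < 2 → j < ((Piece.cross x y r).ends b).length := fun b j h => by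
        cases b <;> simpa [Piece.ends, Piece.src, Piece.tgt] using h
      have e1 := fun hA => (h0 false 0 (g _ _ (by norm_num))).1 hA
      have e2 := fun hA => (h0 true 1 (g _ _ (by norm_num))).1 hA
      clear h0
      have h4 := hJ.sum_cross rfl
      clear hm hJ
      change part J false u.length = part J true u.length at hl
      obtain rfl | rfl := Piece.ends_cases hj <;> cases b <;> cases x <;> cases y <;> first
        | (exfalso; revert hin; simp [Piece.ends, Piece.src, Piece.tgt]; done)
        | (revert h4 e1 e2
           simp only [part_succ, hl, sideOut, sideIn]
           cases r <;> cases A <;>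
             simp [seifert, smooth, Piece.smooth, Piece.sign, Shape.mate, Slice.mate, Shape.ends, Shape.src, Shape.tgt,
               part_succ, isL, Piece.Broken, hl] <;>
             grind)
  · have := Slice.mate_right (sl := l.seifert) b j
    rw [e, e] at this
    have hj' : j < l.right.length := hj
    simp only [e]
    refine ⟨fun _ => ?_, ?_⟩
    · rw [this, sideOut, sideIn]
      have := hJ.part_right (j := j + (!b).toNat) (by cases b <;> simp <;> omega) b
      rw [← add_assoc, ← add_assoc] at this
      exact this
    · rintro ⟨-, j', h', h⟩
      change j' < (l.piece.ends b).length at h'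
      change l.left.length + (l.piece.ends b).length + j = _ at h; omega

end Layer

namespace Strands

variable {L : List Layer} (hL : IsTangle [] L []) (A : ℕ → Bool)

open Classical in
noncomputable instance : DecidableEq (Pts L) := inferInstance

instance finite_pts : Finite (Pts L) := by
  have : (Pts L) ⊆ ⋃ k ∈ Finset.range L.length, (fun i => (k, i)) '' Set.Iio ((lay L k).ends false).length := by
    rintro ⟨k, i⟩ ⟨h1, h2⟩
    simp_all
  exact (Set.Finite.subset (Set.Finite.biUnion (Finset.finite_toSet _) fun k _ => (Set.finite_Iio _).image _) this).to_subtype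

variable {A} {h : ℕ × Bool × ℕ}

def vtx (hh : Valid L h) : Pts L := ⟨pnt h, pnt_mem hL hh⟩

lemma vtx_congr {h h' : ℕ × Bool × ℕ} {hh : Valid L h} {hh' : Valid L h'} (e : h = h') :
    vtx hL hh = vtx hL hh' := by subst e; rfl

lemma σ_vtx (hh : Out L h) : (flatMap hL A).σ (vtx hL hh.1) = vtx hL (seif_valid hh.1) := by
  refine Subtype.ext ?_
  show pnt (seif L (outH L (pnt h))) = _
  rw [outH_pnt hh]; rfl

lemma σ_symm_vtx (hh : In L h) : (flatMap hL A).σ.symm (vtx hL hh.1) = vtx hL (seif_valid hh.1) := by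
  refine Subtype.ext ?_
  show pnt (seif L (inH L (pnt h))) = _
  rw [inH_pnt hh]; rfl

open Classical in
lemma τ_vtx (hh : In L h) (hc : Cut L A h) : (flatMap hL A).τ (vtx hL hh.1) = vtx hL (sm_valid (A := A) hh.1) := by
  have e : (flatMap hL A).τ (vtx hL hh.1) = if Cut L A (inH L (pnt h)) then
      ⟨pnt (sm L A (inH L (pnt h))), pnt_mem hL (sm_valid (in_inH hL (pnt_mem hL hh.1)).1.1)⟩ else vtx hL hh.1 := rfl
  rw [e, if_pos (by rwa [inH_pnt hh])]
  refine Subtype.ext ?_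
  show pnt (sm L A (inH L (pnt h))) = _
  rw [inH_pnt hh]; rfl

open Classical in
lemma τ_vtx_of_not (hh : In L h) (hc : ¬ Cut L A h) : (flatMap hL A).τ (vtx hL hh.1) = vtx hL hh.1 := by
  have e : (flatMap hL A).τ (vtx hL hh.1) = if Cut L A (inH L (pnt h)) then
      ⟨pnt (sm L A (inH L (pnt h))), pnt_mem hL (sm_valid (in_inH hL (pnt_mem hL hh.1)).1.1)⟩ else vtx hL hh.1 := rfl
  rw [e, if_neg (by rwa [inH_pnt hh])]

lemma τ_vtx_ne (hh : In L h) (hc : Cut L A h) : (flatMap hL A).τ (vtx hL hh.1) ≠ vtx hL hh.1 := by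
  rw [τ_vtx hL hh hc]
  intro e
  have e1 := congrArg (fun p : Pts L => inH L p.1) e
  change inH L (pnt (sm L A h)) = inH L (pnt h) at e1
  grind [inH_pnt, In.sm, sm_ne]

lemma cut_iff (hh : In L h) : (flatMap hL A).τ (vtx hL hh.1) ≠ vtx hL hh.1 ↔ Cut L A h :=
  ⟨fun h' => by by_contra hc; exact h' (τ_vtx_of_not hL hh hc), τ_vtx_ne hL hh⟩

lemma exists_in (p : Pts L) : ∃ h, ∃ hh : In L h, p = vtx hL hh.1 := by
  obtain ⟨h1, h2⟩ := in_inH hL p.2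
  exact ⟨_, h1, Subtype.ext h2.symm⟩

lemma exists_out (p : Pts L) : ∃ h, ∃ hh : Out L h, p = vtx hL hh.1 := by
  obtain ⟨h1, h2⟩ := out_outH hL p.2
  exact ⟨_, h1, Subtype.ext h2.symm⟩

lemma in_or_out (hh : Valid L h) : In L h ∨ Out L h := by
  cases h1 : labP L (pnt h) <;> cases h2 : h.2.1
  · exact Or.inl ⟨hh, by rw [h1, h2]⟩
  · exact Or.inr ⟨hh, by rw [h1, h2]; rfl⟩
  · exact Or.inr ⟨hh, by rw [h1, h2]; rfl⟩
  · exact Or.inl ⟨hh, by rw [h1, h2]⟩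

lemma seif_sm (hh : Valid L h) (hc : Cut L A h) : seif L (sm L A h) = sm L A (seif L h) := by
  have := seif_sm_seif (h := seif L h) hc.seif
  rwa [seif_seif hh] at this

open Classical in
/-- A function on the points of a diagram, extended by zero. -/
noncomputable def ext (J : Pts L → ZMod 2) (p : ℕ × ℕ) : ZMod 2 := if hp : p ∈ Pts L then J ⟨p, hp⟩ else 0

lemma ext_pnt (J : Pts L → ZMod 2) (hh : Valid L h) : ext J (pnt h) = J (vtx hL hh) := dif_pos _

lemma isFlow_layer {J : Pts L → ZMod 2} (hJ : (flatMap hL A).Flow J) {k : ℕ} (hk : k < L.length) :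
    (lay L k).IsFlow (A k) fun e => ext J (pnt (k, e)) := by
  have key : ∀ h : ℕ × Bool × ℕ, In L h → (¬ Cut L A h → ext J (pnt (seif L h)) = ext J (pnt h)) ∧
      (Cut L A h → ext J (pnt (seif L h)) + ext J (pnt (seif L (sm L A h))) = ext J (pnt h) + ext J (pnt (sm L A h))) := by
    intro h hh
    obtain ⟨h1, h2⟩ := hJ (vtx hL hh.1)
    grind [τ_vtx_of_not, σ_symm_vtx, ext_pnt, τ_vtx, In.sm]
  intro e he
  have hh : Valid L (k, e) := ⟨hk, he⟩
  rcases in_or_out hh with h | h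
  · exact key _ h
  · obtain ⟨h1, h2⟩ := key _ (Out.seif hL h)
    rw [cut_seif hh, seif_seif hh] at h1 h2
    refine ⟨fun hc => (h1 hc).symm, fun hc => ?_⟩
    have hc' : Cut L A (k, e) := hc
    have := h2 hc
    rw [← seif_sm hh hc', seif_seif (sm_valid hh)] at this
    exact this.symm

lemma planar : (flatMap hL A).Planar := by
  intro J hJ
  set χ : Pts L → ZMod 2 := fun p => ∑ i ∈ Finset.range (p.1.2 + (!labP L p.1).toNat), ext J (p.1.1, i) with hχ
  have hin : ∀ {h} (hh : In L h), χ (vtx hL hh.1) = Layer.sideIn (fun e => ext J (pnt (h.1, e))) h.2 := fun {h} hh => by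
    have e : labP L (pnt h) = h.2.1 := hh.2
    simp only [hχ, vtx, e]
    rfl
  have hout : ∀ {h} (hh : Out L h), χ (vtx hL hh.1) = Layer.sideOut (fun e => ext J (pnt (h.1, e))) h.2 := fun {h} hh => by
    have e : labP L (pnt h) = !h.2.1 := hh.2
    simp only [hχ, vtx, e, Bool.not_not]
    rfl
  refine ⟨χ, fun n => ?_⟩
  obtain ⟨h, hh, rfl⟩ := exists_in hL n
  have hl : (lay L h.1).lab h.2 = h.2.1 := by rw [← labP_pnt hL hh.1, hh.2]
  have hs := (isFlow_layer hL hJ hh.1.1).side hh.1.2 hl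
  have hisL : (flatMap hL A).isL (vtx hL hh.1) = (lay L h.1).isL h.2 := by
    show (lay L (inH L (pnt h)).1).isL (inH L (pnt h)).2 = _
    rw [inH_pnt hh]
  rw [hisL]
  constructor
  · intro hc
    rw [σ_symm_vtx hL hh, hin hh, hout (In.seif hL hh)]
    refine hs.1 (hc.imp_left fun h' hc' => ?_)
    exact τ_vtx_ne hL hh hc' h'
  · intro hc hisl
    have hc' : Cut L A h := (cut_iff hL hh).1 hc
    have hh' := In.sm hL hh hc'
    obtain ⟨h1, h2⟩ := hs.2 hc' hisl
    rw [σ_symm_vtx hL hh, τ_vtx hL hh hc', σ_symm_vtx hL hh', hin hh, hin hh', hout (In.seif hL hh), hout (In.seif hL hh')]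
    refine ⟨?_, ?_⟩
    · rw [← ext_pnt hL J (seif_valid hh.1)]; exact h1
    · rw [← ext_pnt hL J hh.1]; exact h2

lemma sameCycle_sm (hh : Valid L h) : (flatMap hL A).fwd.SameCycle (vtx hL hh) (vtx hL (sm_valid (A := A) hh)) := by
  by_cases hc : Cut L A h
  · rcases in_or_out hh with h' | h'
    · have := FlatMap.sameCycle_out (τ_vtx_ne hL h' hc)
      rwa [τ_vtx hL h' hc] at this
    · have hs := Out.seif hL h'
      have := FlatMap.sameCycle_in (τ_vtx_ne hL hs hc.seif)
      rw [τ_vtx hL hs hc.seif, σ_symm_vtx hL hs, σ_symm_vtx hL (In.sm hL hs hc.seif)] at this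
      grind [seif_seif, seif_sm_seif]
  · rw [vtx_congr hL (hh := sm_valid (A := A) hh) (hh' := seif_valid hh) (sm_of_not_cut hh hc)]
    rcases in_or_out hh with h' | h'
    · have := FlatMap.sameCycle_plain (τ_vtx_of_not hL h' hc)
      rw [σ_symm_vtx hL h'] at this
      exact this.symm
    · have hs := Out.seif hL h'
      have := FlatMap.sameCycle_plain (τ_vtx_of_not hL hs (fun hc' => hc ((cut_seif hh).1 hc')))
      grind [σ_symm_vtx, seif_seif]

lemma fwd_eq (p : Pts L) : ∃ h, ∃ hh : Valid L h, p = vtx hL hh ∧ (flatMap hL A).fwd p = vtx hL (sm_valid (A := A) hh) := by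
  cases hcol : (flatMap hL A).col p with
  | true =>
    obtain ⟨h, hh, rfl⟩ := exists_out hL p
    refine ⟨h, hh.1, rfl, ?_⟩
    have hs := Out.seif hL hh
    by_cases hc : Cut L A h
    · rw [FlatMap.fwd_apply, FlatMap.step_black_cross hcol (by rw [σ_vtx hL hh]; exact τ_vtx_ne hL hs hc.seif),
        σ_vtx hL hh, τ_vtx hL hs hc.seif, σ_symm_vtx hL (In.sm hL hs hc.seif)]
      exact vtx_congr hL (seif_sm_seif hc)
    · rw [FlatMap.fwd_apply, FlatMap.step_black_plain hcol, σ_vtx hL hh]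
      · exact vtx_congr hL (sm_of_not_cut hh.1 hc).symm
      grind [σ_vtx, τ_vtx_of_not, cut_seif]
  | false =>
    obtain ⟨h, hh, rfl⟩ := exists_in hL p
    refine ⟨h, hh.1, rfl, ?_⟩
    by_cases hc : Cut L A h
    · grind [FlatMap.fwd_apply, FlatMap.step_white_cross, τ_vtx_ne, τ_vtx]
    · rw [FlatMap.fwd_apply, FlatMap.step_white_plain hcol (τ_vtx_of_not hL hh hc), σ_symm_vtx hL hh]
      exact vtx_congr hL (sm_of_not_cut hh.1 hc).symm

end Strands

namespace FlatMap

variable {E : Type} [DecidableEq E] [Finite E] (M : FlatMap E)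

lemma ncard_sinks (x : E) : (orb M.fwd x ∩ {e | M.col e = true ∧ M.τ (M.σ e) ≠ M.σ e}).ncard =
    (orb M.fwd x ∩ M.marks).ncard := by
  have h1 : (orb M.fwd x ∩ {e | M.col (M.fwd e) = true}).ncard = (orb M.fwd x ∩ {e | M.col e = true}).ncard := by
    refine Set.ncard_congr (fun e _ => M.fwd e) ?_ (fun _ _ _ _ h => M.fwd.injective h) ?_
    · rintro e ⟨h1, h2⟩; exact ⟨apply_mem_orb h1, h2⟩
    · rintro e ⟨h1, h2⟩
      refine ⟨M.fwd.symm e, ⟨?_, by simpa using h2⟩, by simp⟩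
      have := (Equiv.Perm.SameCycle.refl M.fwd (M.fwd.symm e)).apply_right
      rw [Equiv.apply_symm_apply] at this
      exact Equiv.Perm.SameCycle.trans h1 this.symm
  have h2 : orb M.fwd x ∩ {e | M.col e = true} = (orb M.fwd x ∩ {e | M.col e = true ∧ M.col (M.fwd e) = true}) ∪
      (orb M.fwd x ∩ {e | M.col e = true ∧ M.τ (M.σ e) ≠ M.σ e}) := by
    ext e
    simp only [Set.mem_inter_iff, Set.mem_ofPred_eq, Set.mem_union]
    by_cases hc : M.col e = true
    · by_cases hp : M.τ (M.σ e) = M.σ e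
      · rw [fwd_apply, step_black_plain hc hp, M.col_σ]; simp [hc, hp]
      · simp only [hc, hp, true_and, and_true, ne_eq, not_false_eq_true]; tauto
    · simp [hc]
  have h3 : orb M.fwd x ∩ {e | M.col (M.fwd e) = true} = (orb M.fwd x ∩ {e | M.col e = true ∧ M.col (M.fwd e) = true}) ∪
      (orb M.fwd x ∩ {e | M.col e = false ∧ M.τ e ≠ e}) := by
    ext e
    simp only [Set.mem_inter_iff, Set.mem_ofPred_eq, Set.mem_union]
    cases hc : M.col e with
    | true => simp
    | false =>
      by_cases hp : M.τ e = e
      · rw [fwd_apply, step_white_plain hc hp, col_symm]; simp [hc, hp]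
      · rw [fwd_apply, step_white_cross hc hp, M.col_τ e hp]; simp [hc, hp]
  have h4 := flip_marks_ncard (M := M) x
  rw [orb_fwd_symm] at h4
  have h5 : M.flip.marks = {e | M.col e = false ∧ M.τ e ≠ e} := by
    ext e; simp [marks, flip]
  rw [h5] at h4
  rw [h2, h3, Set.ncard_union_eq, Set.ncard_union_eq] at h1
  · omega
  · rw [Set.disjoint_left]; rintro e ⟨-, h1, h2⟩ ⟨-, -, h3⟩
    rw [fwd_apply, step_black_cross h1 h3, col_symm, M.col_τ _ h3, M.col_σ, h1] at h2
    exact absurd h2 (by simp)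
  grind

end FlatMap

lemma ncard_range_congr {E α β : Type} [Finite E] {f : E → α} {g : E → β} (h : ∀ a b, f a = f b ↔ g a = g b)
    {P : α → Prop} {Q : β → Prop} (hPQ : ∀ a, P (f a) ↔ Q (g a)) :
    {y ∈ Set.range f | P y}.ncard = {y ∈ Set.range g | Q y}.ncard := by
  refine Set.ncard_congr (fun y hy => g hy.1.choose) ?_ ?_ ?_
  · intro y hy
    refine ⟨⟨_, rfl⟩, (hPQ _).1 ?_⟩
    rw [hy.1.choose_spec]; exact hy.2
  · intro y z hy hz e
    rw [← hy.1.choose_spec, ← hz.1.choose_spec]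
    exact (h _ _).2 e
  · rintro _ ⟨⟨e, rfl⟩, hq⟩
    have hy : f e ∈ {y ∈ Set.range f | P y} := ⟨⟨e, rfl⟩, (hPQ e).2 hq⟩
    exact ⟨f e, hy, (h _ _).1 hy.1.choose_spec⟩

namespace Diagram.State

open Strands

variable {D : Diagram} (s : D.State)

/-- The smoothing of the layers, by their numbers. -/
def smoothing (k : ℕ) : Bool := if h : k < D.1.length then s.choice ⟨k, h⟩ else true

noncomputable def flatMap : FlatMap (Pts D.1) := Strands.flatMap D.2 s.smoothing

lemma lay_get (k : Fin D.1.length) : lay D.1 k = D.1.get k := by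
  have := lay_eq (L := D.1) k.2
  rw [List.getElem?_eq_getElem k.2] at this
  exact (Option.some.inj this).symm

lemma picture_getElem? (k : ℕ) (sl : Slice) : s.picture.1[k]? = some sl ↔
    k < D.1.length ∧ sl = (lay D.1 k).smooth (s.smoothing k) := by
  have hlen : s.picture.1.length = D.1.length := by simp [picture]
  by_cases hk : k < D.1.length
  · rw [List.getElem?_eq_getElem (by rw [hlen]; exact hk)]
    have : s.picture.1[k]'(by rw [hlen]; exact hk) = (lay D.1 k).smooth (s.smoothing k) := by
      rw [smoothing, dif_pos hk, lay_get ⟨k, hk⟩]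
      simp [picture]
    rw [this]
    simp [hk, eq_comm]
  · rw [List.getElem?_eq_none (by rw [hlen]; omega)]
    simp [hk]

lemma points_eq : points s.picture.1 = Pts D.1 := by
  ext ⟨k, i⟩
  simp only [points, Set.mem_ofPred_eq, picture_getElem?]
  have e : ∀ A, ((lay D.1 k).smooth A).src = ((lay D.1 k).ends false).length := fun A => by
    rw [← Layer.ends_smooth _ A]; simp [Slice.ends, Slice.src, Shape.ends]
  constructor
  · rintro ⟨_, ⟨hk, rfl⟩, hi⟩
    exact ⟨hk, by rwa [e] at hi⟩
  · rintro ⟨hk, hi⟩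
    exact ⟨_, ⟨hk, rfl⟩, by rw [e]; exact hi⟩

lemma comp_sm {h : ℕ × Bool × ℕ} (hh : Valid D.1 h) :
    comp s.picture.1 (pnt h) = comp s.picture.1 (pnt (sm D.1 s.smoothing h)) := by
  by_cases e : pnt h = pnt (sm D.1 s.smoothing h)
  · rw [e]
  refine SimpleGraph.ConnectedComponent.sound (SimpleGraph.Adj.reachable ?_)
  refine (SimpleGraph.fromRel_adj _ _ _).2 ⟨e, ?_⟩
  have h2 := hh.2
  rw [← Layer.ends_smooth _ (s.smoothing h.1)] at h2
  have hg := (s.picture_getElem? h.1 _).2 ⟨hh.1, rfl⟩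
  exact (Slice.arc_mate h.1 h2).imp (fun a => ⟨_, _, hg, a⟩) fun a => ⟨_, _, hg, a⟩

lemma comp_eq (p q : Pts D.1) : comp s.picture.1 p = comp s.picture.1 q ↔ s.flatMap.fwd.SameCycle p q := by
  constructor
  · intro h
    obtain ⟨w⟩ := SimpleGraph.ConnectedComponent.exact h
    have key : ∀ (a b : ℕ × ℕ) (_ : (arcGraph s.picture.1).Walk a b) (ha : a ∈ Pts D.1) (hb : b ∈ Pts D.1),
        s.flatMap.fwd.SameCycle ⟨a, ha⟩ ⟨b, hb⟩ := by
      intro a b w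
      induction w with
      | nil => intro _ _; exact Equiv.Perm.SameCycle.refl _ _
      | @cons a b c hadj w ih =>
        intro ha hc
        have step : ∀ p q : ℕ × ℕ, (∃ k sl, s.picture.1[k]? = some sl ∧ Arc k sl p q) →
            ∃ (hp : p ∈ Pts D.1) (hq : q ∈ Pts D.1), s.flatMap.fwd.SameCycle ⟨p, hp⟩ ⟨q, hq⟩ := by
          rintro p q ⟨k, sl, hsl, ha⟩
          obtain ⟨hk, rfl⟩ := (s.picture_getElem? k sl).1 hsl
          obtain ⟨e, he, rfl, rfl⟩ := Slice.mate_of_arc ha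
          rw [Layer.ends_smooth] at he
          have hv : Valid D.1 (k, e) := ⟨hk, he⟩
          exact ⟨pnt_mem D.2 hv, pnt_mem D.2 (sm_valid hv), sameCycle_sm D.2 hv⟩
        rcases ((SimpleGraph.fromRel_adj _ _ _).1 hadj).2 with h | h
        · obtain ⟨h1, h2, h3⟩ := step _ _ h
          exact h3.trans (ih h2 hc)
        · obtain ⟨h1, h2, h3⟩ := step _ _ h
          exact h3.symm.trans (ih h1 hc)
    exact key _ _ w p.2 q.2
  · intro h
    exact (orb_const (s := s.flatMap.fwd) (fun e => comp s.picture.1 e.1) (fun z _ => by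
      obtain ⟨e, he, h1, h2⟩ := fwd_eq (A := s.smoothing) D.2 z
      change comp _ ((Strands.flatMap D.2 s.smoothing).fwd z).1 = _
      rw [h2, h1]
      exact (s.comp_sm he).symm) h).symm

lemma circles_eq : circles s.picture.1 = Set.range fun p : Pts D.1 => comp s.picture.1 p.1 := by
  rw [circles, s.points_eq]
  ext c
  simp

lemma ncard_circles : (circles s.picture.1).ncard = orbCount s.flatMap.fwd := by
  have := ncard_range_congr (f := fun p : Pts D.1 => comp s.picture.1 p.1) (g := orb s.flatMap.fwd)
    (fun a b => (s.comp_eq a b).trans orb_eq_iff.symm) (P := fun _ => True) (Q := fun _ => True) (fun _ => Iff.rfl)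
  simp only [and_true] at this
  rw [circles_eq, orbCount, orbits]
  exact this

/-- The ends at the crossings that are not smoothed according to the orientation, on one circle and of the
colour `true`. -/
def cutEnds (p : Pts D.1) : Set (ℕ × Bool × ℕ) :=
  {h | ∃ hh : Valid D.1 h, Cut D.1 s.smoothing h ∧ colP D.1 (pnt h) = true ∧ vtx D.2 hh ∈ orb s.flatMap.fwd p}

lemma mem_marks (p : Pts D.1) : p ∈ s.flatMap.marks ↔ colP D.1 p.1 = true ∧ Cut D.1 s.smoothing (inH D.1 p.1) := by
  obtain ⟨h, hh, rfl⟩ := exists_in D.2 p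
  have e : inH D.1 (vtx D.2 hh.1).1 = h := inH_pnt hh
  rw [e, ← cut_iff D.2 hh]
  rfl

lemma mem_sinks (p : Pts D.1) : (s.flatMap.col p = true ∧ s.flatMap.τ (s.flatMap.σ p) ≠ s.flatMap.σ p) ↔
    colP D.1 p.1 = true ∧ Cut D.1 s.smoothing (outH D.1 p.1) := by
  obtain ⟨h, hh, rfl⟩ := exists_out D.2 p
  have e : outH D.1 (vtx D.2 hh.1).1 = h := outH_pnt hh
  have e2 : s.flatMap.σ (vtx D.2 hh.1) = vtx D.2 (seif_valid hh.1) := σ_vtx D.2 hh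
  have e3 := cut_iff (A := s.smoothing) D.2 (Out.seif D.2 hh)
  rw [e, e2, ← cut_seif hh.1]
  exact and_congr Iff.rfl e3

lemma ncard_cutEnds (p : Pts D.1) : (s.cutEnds p).ncard = 2 * (orb s.flatMap.fwd p ∩ s.flatMap.marks).ncard := by
  have i1 : Function.Injective fun q : Pts D.1 => inH D.1 q.1 := fun a b e =>
    Subtype.ext ((in_inH D.2 a.2).2.symm.trans ((congrArg pnt e).trans (in_inH D.2 b.2).2))
  have i2 : Function.Injective fun q : Pts D.1 => outH D.1 q.1 := fun a b e =>
    Subtype.ext ((out_outH D.2 a.2).2.symm.trans ((congrArg pnt e).trans (out_outH D.2 b.2).2))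
  have h1 : {h ∈ s.cutEnds p | In D.1 h}.ncard = (orb s.flatMap.fwd p ∩ s.flatMap.marks).ncard := by
    rw [← Set.ncard_image_of_injective _ i1]
    congr 1
    ext h
    constructor
    · rintro ⟨⟨hh, hc, hcol, hm⟩, hi⟩
      have e : inH D.1 (vtx D.2 hh).1 = h := inH_pnt hi
      exact ⟨vtx D.2 hh, ⟨hm, (s.mem_marks _).2 ⟨hcol, by rw [e]; exact hc⟩⟩, e⟩
    · rintro ⟨q, ⟨hm, hq⟩, rfl⟩
      obtain ⟨hcol, hc⟩ := (s.mem_marks q).1 hq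
      obtain ⟨a, b⟩ := in_inH D.2 q.2
      have e : vtx D.2 a.1 = q := Subtype.ext b
      exact ⟨⟨a.1, hc, by rw [b]; exact hcol, by rw [e]; exact hm⟩, a⟩
  have h2 : {h ∈ s.cutEnds p | Out D.1 h}.ncard = (orb s.flatMap.fwd p ∩ s.flatMap.marks).ncard := by
    rw [← FlatMap.ncard_sinks, ← Set.ncard_image_of_injective _ i2]
    congr 1
    ext h
    constructor
    · rintro ⟨⟨hh, hc, hcol, hm⟩, hi⟩
      have e : outH D.1 (vtx D.2 hh).1 = h := outH_pnt hi
      exact ⟨vtx D.2 hh, ⟨hm, (s.mem_sinks _).2 ⟨hcol, by rw [e]; exact hc⟩⟩, e⟩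
    · rintro ⟨q, ⟨hm, hq⟩, rfl⟩
      obtain ⟨hcol, hc⟩ := (s.mem_sinks q).1 hq
      obtain ⟨a, b⟩ := out_outH D.2 q.2
      have e : vtx D.2 a.1 = q := Subtype.ext b
      exact ⟨⟨a.1, hc, by rw [b]; exact hcol, by rw [e]; exact hm⟩, a⟩
  have h3 : s.cutEnds p = {h ∈ s.cutEnds p | In D.1 h} ∪ {h ∈ s.cutEnds p | Out D.1 h} := by
    ext h
    constructor
    · intro hh
      exact (in_or_out hh.1).imp (fun h' => ⟨hh, h'⟩) fun h' => ⟨hh, h'⟩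
    · rintro (hh | hh) <;> exact hh.1
  have hfin : (s.cutEnds p).Finite := by
    refine Set.Finite.subset (s := ⋃ q : Pts D.1, ⋃ d : Bool, {half d q.1}) (Set.finite_iUnion fun q =>
      Set.finite_iUnion fun d => Set.finite_singleton _) ?_
    rintro h ⟨hh, -⟩
    simp only [Set.mem_iUnion]
    exact ⟨vtx D.2 hh, !h.2.1, (half_pnt h).symm⟩
  rw [h3, Set.ncard_union_eq _ (hfin.subset fun h hh => hh.1) (hfin.subset fun h hh => hh.1), h1, h2, two_mul]
  rw [Set.disjoint_left]
  rintro h ⟨-, ha⟩ ⟨-, hb⟩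
  have := ha.2.symm.trans hb.2
  revert this; cases h.2.1 <;> simp

end Diagram.State

namespace Diagram.State

open Strands

variable {D : Diagram} (s : D.State)

/-- An end of the strand of a smoothing that carries one of the two break points. -/
def breakEnd (d : Bool) (x : D.Crossing) : ℕ × Bool × ℕ := (x.1, d, x.layer.left.length + d.toNat)

lemma lay_crossing (x : D.Crossing) : lay D.1 x.1 = x.layer := lay_get x.1

lemma smoothing_crossing (x : D.Crossing) : s.smoothing x.1 = s x := by
  rw [smoothing, dif_pos x.1.2]; exact s.choice_crossing x

lemma length_ends (x : D.Crossing) (b : Bool) : (x.layer.piece.ends b).length = 2 := by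
  have := x.2
  change x.layer.piece.isCross = true at this
  revert this
  cases x.layer.piece <;> cases b <;> simp [Piece.isCross, Piece.ends, Piece.src, Piece.tgt]

lemma valid_mid (x : D.Crossing) (b : Bool) {j : ℕ} (hj : j < 2) :
    Valid D.1 (x.1, b, x.layer.left.length + j) := by
  refine ⟨x.1.2, ?_⟩
  rw [lay_crossing]
  exact Layer.lt_of_mid (by rwa [length_ends])

lemma cut_mid (x : D.Crossing) (b : Bool) {j : ℕ} (hj : j < 2) :
    Cut D.1 s.smoothing (x.1, b, x.layer.left.length + j) ↔ x.layer.piece.Broken (s x) := by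
  grind [Cut, lay_crossing, smoothing_crossing, Layer.cut_iff, length_ends]

lemma sm_mid (x : D.Crossing) (b : Bool) {j : ℕ} (hj : j < 2) :
    sm D.1 s.smoothing (x.1, b, x.layer.left.length + j) = ((x.1 : ℕ),
      ((x.layer.piece.smooth (s x)).mate (b, j)).1, x.layer.left.length + ((x.layer.piece.smooth (s x)).mate (b, j)).2) := by
  grind [sm, lay_crossing, smoothing_crossing, Layer.mate_mid, length_ends]

lemma smooth_crossing (x : D.Crossing) (A : Bool) :
    x.layer.piece.smooth A = .vert ∨ x.layer.piece.smooth A = .horiz := by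
  have := x.2
  change x.layer.piece.isCross = true at this
  revert this
  cases x.layer.piece <;> simp [Piece.isCross, Piece.smooth]
  exact em _

lemma sm_breakEnd_ne (x : D.Crossing) : sm D.1 s.smoothing (breakEnd false x) ≠ breakEnd true x := by
  rw [breakEnd, s.sm_mid x false (by decide)]
  grind [smooth_crossing, Shape.mate, breakEnd]

lemma eq_breakEnd (x : D.Crossing) (b : Bool) {j : ℕ} (hj : j < 2) :
    ∃ d, ((x.1 : ℕ), b, x.layer.left.length + j) = breakEnd d x ∨
      ((x.1 : ℕ), b, x.layer.left.length + j) = sm D.1 s.smoothing (breakEnd d x) := by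
  obtain rfl | rfl : j = b.toNat ∨ j = 1 - b.toNat := by cases b <;> simp <;> omega
  · exact ⟨b, Or.inl rfl⟩
  · simp only [breakEnd]
    obtain h | h := smooth_crossing x (s x)
    · refine ⟨!b, Or.inr ?_⟩
      rw [s.sm_mid x _ (by cases b <;> decide), h]
      cases b <;> simp [Shape.mate]
    · refine ⟨b, Or.inr ?_⟩
      rw [s.sm_mid x _ (by cases b <;> decide), h]
      cases b <;> simp [Shape.mate]

/-- The end of colour `true` of the strand. -/
noncomputable def blackEnd (d : Bool) (x : D.Crossing) : ℕ × Bool × ℕ :=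
  if colP D.1 (pnt (breakEnd d x)) = true then breakEnd d x else sm D.1 s.smoothing (breakEnd d x)

lemma blackEnd_fst (d : Bool) (x : D.Crossing) : (s.blackEnd d x).1 = x.1 := by
  rw [blackEnd]; split_ifs <;> rfl

lemma blackEnd_injective (d : Bool) : Function.Injective (s.blackEnd (D := D) d) := fun x y h =>
  Subtype.ext (Fin.ext ((s.blackEnd_fst d x).symm.trans ((congrArg Prod.fst h).trans (s.blackEnd_fst d y))))

lemma blackEnd_ne (x : D.Crossing) : s.blackEnd false x ≠ s.blackEnd true x := by
  have h1 := s.sm_breakEnd_ne x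
  have v := valid_mid x false (j := 0) (by decide)
  have v' := valid_mid x true (j := 1) (by decide)
  rw [blackEnd, blackEnd]
  split_ifs
  · intro h; simp [breakEnd] at h
  · intro h; refine h1 ?_; rw [h]; exact sm_sm v'
  · exact h1
  · intro h
    have := congrArg (sm D.1 s.smoothing) h
    grind [sm_sm, breakEnd]

lemma blackEnd_spec (d : Bool) (x : D.Crossing) (hb : x.layer.piece.Broken (s x)) :
    Valid D.1 (s.blackEnd d x) ∧ Cut D.1 s.smoothing (s.blackEnd d x) ∧ colP D.1 (pnt (s.blackEnd d x)) = true ∧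
      comp s.picture.1 (pnt (s.blackEnd d x)) = comp s.picture.1 (pnt (breakEnd d x)) := by
  have hd : d.toNat < 2 := by cases d <;> decide
  have hv := valid_mid x d hd
  have hc := (s.cut_mid x d hd).2 hb
  rw [blackEnd]
  split_ifs with h
  · exact ⟨hv, hc, h, rfl⟩
  · exact ⟨sm_valid hv, hc.sm, (colP_sm D.2 hv hc).trans (by simpa [breakEnd] using h), (s.comp_sm hv).symm⟩

lemma exists_crossing {k : ℕ} (hk : k < D.1.length) {A : Bool} (hA : (lay D.1 k).piece.Broken A) :
    ∃ x : D.Crossing, (x.1 : ℕ) = k := by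
  refine ⟨⟨⟨k, hk⟩, ?_⟩, rfl⟩
  rw [← lay_get ⟨k, hk⟩]
  revert hA
  cases (lay D.1 k).piece <;> simp [Piece.Broken, Piece.isCross]

lemma breakPoints_eq_cutEnds (p : Pts D.1) : s.breakPoints (comp s.picture.1 p.1) = (s.cutEnds p).ncard := by
  have e : s.cutEnds p =
      s.blackEnd false '' {x | x.layer.piece.Broken (s x) ∧ comp s.picture.1 (pnt (breakEnd false x)) = comp s.picture.1 p.1} ∪
      s.blackEnd true '' {x | x.layer.piece.Broken (s x) ∧ comp s.picture.1 (pnt (breakEnd true x)) = comp s.picture.1 p.1} := by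
    ext h
    have key : (∃ d x, (x.layer.piece.Broken (s x) ∧ comp s.picture.1 (pnt (breakEnd d x)) = comp s.picture.1 p.1) ∧
        s.blackEnd d x = h) ↔ h ∈ s.cutEnds p := by
      constructor
      · rintro ⟨d, x, ⟨hb, hc⟩, rfl⟩
        obtain ⟨a1, a2, a3, a4⟩ := s.blackEnd_spec d x hb
        refine ⟨a1, a2, a3, ?_⟩
        refine (s.comp_eq p (vtx D.2 a1)).1 (hc.symm.trans a4.symm)
      · rintro ⟨hh, hc, hcol, hm⟩
        have hcomp := (s.comp_eq p (vtx D.2 hh)).2 hm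
        obtain ⟨k, b, i⟩ := h
        obtain ⟨hA, j, hj, hi⟩ := hc
        obtain ⟨x, rfl⟩ := exists_crossing hh.1 hA
        have hl : lay D.1 x.1 = x.layer := lay_crossing x
        simp only at hj hi
        have hj2 : j < 2 := by rw [hl] at hj; exact (length_ends x b) ▸ hj
        rw [hl] at hi
        subst hi
        have hb : x.layer.piece.Broken (s x) := (s.cut_mid x b hj2).1 ⟨hA, j, hj, by rw [hl]⟩
        obtain ⟨d, hd⟩ := s.eq_breakEnd x b hj2
        have hd2 : d.toNat < 2 := by cases d <;> decide
        have hv := valid_mid x d hd2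
        have hcut := (s.cut_mid x d hd2).2 hb
        refine ⟨d, x, ⟨hb, ?_⟩, ?_⟩
        · obtain hd | hd := hd
          · rw [← hd]; exact hcomp.symm
          · exact (s.comp_sm hv).trans ((congrArg (fun h => comp s.picture.1 (pnt h)) hd).symm.trans hcomp.symm)
        · rw [blackEnd]
          obtain hd | hd := hd
          · rw [← hd, if_pos hcol]
          · rw [hd] at hcol
            have := (colP_sm D.2 hv hcut).symm.trans hcol
            rw [if_neg, ← hd]
            intro h; simp only [breakEnd] at h; rw [h] at this; cases this
    simp_all
  rw [e, Set.ncard_union_eq ?_ (Set.toFinite _) (Set.toFinite _), Set.ncard_image_of_injective _ (s.blackEnd_injective _),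
    Set.ncard_image_of_injective _ (s.blackEnd_injective _)]
  · rfl
  · rw [Set.disjoint_left]
    rintro _ ⟨x, -, rfl⟩ ⟨y, -, h⟩
    have : y = x := Subtype.ext (Fin.ext ((s.blackEnd_fst _ y).symm.trans ((congrArg Prod.fst h).trans (s.blackEnd_fst _ x))))
    subst this
    exact s.blackEnd_ne y h.symm

lemma ncard_hCircles : s.hCircles.ncard = evenCount s.flatMap.fwd s.flatMap.marks := by
  rw [hCircles, s.circles_eq, evenCount, orbits]
  refine ncard_range_congr (fun a b => (s.comp_eq a b).trans orb_eq_iff.symm) fun p => ?_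
  rw [s.breakPoints_eq_cutEnds, s.ncard_cutEnds, Nat.mul_div_cancel_left _ two_pos]

lemma tau_of_not_broken (h : ∀ x : D.Crossing, ¬ x.layer.piece.Broken (s x)) (p : Pts D.1) : s.flatMap.τ p = p := by
  obtain ⟨h', hh, rfl⟩ := exists_in D.2 p
  by_contra hne
  obtain ⟨k, b, i⟩ := h'
  have hA := ((cut_iff D.2 hh).1 hne).1
  obtain ⟨x, rfl⟩ := exists_crossing hh.1.1 hA
  refine h x ?_
  rw [← lay_crossing, ← s.smoothing_crossing]
  exact hA

lemma exists_tau_ne {x : D.Crossing} (hb : x.layer.piece.Broken (s x)) : ∃ p, s.flatMap.τ p ≠ p := by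
  have hv := valid_mid x false (j := 0) (by decide)
  have hc := (s.cut_mid x false (j := 0) (by decide)).2 hb
  obtain hi | ho := in_or_out hv
  · exact ⟨_, τ_vtx_ne D.2 hi hc⟩
  · exact ⟨_, τ_vtx_ne D.2 (Out.seif D.2 ho) hc.seif⟩

lemma broken_iff (x : D.Crossing) : x.layer.piece.Broken (s x) ↔ s x ≠ D.seifertState x := by
  have := x.2
  change x.layer.piece.isCross = true at this
  rw [seifertState]
  revert this
  generalize x.layer.piece = p
  generalize s x = A
  cases p with
  | cup o => simp [Piece.isCross]
  | cap o => simp [Piece.isCross]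
  | cross a b r => grind [Piece.Broken, Piece.sign]

lemma ncard_circles_seifert : (circles D.seifertState.picture.1).ncard = orbCount s.flatMap.σ := by
  have ht := tau_of_not_broken D.seifertState fun x => by rw [broken_iff]; simp
  have h1 := FlatMap.evenCount_of_trivial ht
  rw [ncard_circles]
  have hm : (flatMap D.seifertState).marks = ∅ := by
    ext e; simp [FlatMap.marks, ht e]
  have h2 : evenCount (flatMap D.seifertState).fwd (flatMap D.seifertState).marks = orbCount (flatMap D.seifertState).fwd := by
    simp [hm, evenCount, orbCount]
  rw [← h2, h1]
  rfl

lemma ncard_hCircles_lt (hs : s ≠ D.seifertState) : s.hCircles.ncard < (circles D.seifertState.picture.1).ncard := by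
  obtain ⟨x, hx⟩ := Function.ne_iff.1 hs
  rw [s.ncard_circles_seifert, s.ncard_hCircles]
  exact FlatMap.evenCount_lt (planar D.2) (s.exists_tau_ne ((s.broken_iff x).2 hx))

end Diagram.State

section Size

variable {M : Type} [AddCommMonoid M] {Z : Type}

def Shape.kind (M : Type) [AddCommMonoid M] : Shape → Kind M
  | .cup => .cup
  | .cap => .cap
  | .vert => .vert 0
  | .horiz => .horiz 0

/-- A picture as a word without marks. -/
def letters (M : Type) [AddCommMonoid M] (W : List Slice) : List (Letter M) :=
  W.map fun sl => ⟨sl.left, sl.shape.kind M, sl.right⟩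

lemma slices_letters (W : List Slice) : slices (letters M W) = W := by
  rw [slices, letters, List.map_map]
  refine (List.map_congr_left fun sl _ => ?_).trans (List.map_id W)
  rcases sl with ⟨u, s, v⟩
  cases s <;> rfl

lemma letters_isShape (W : List Slice) : ∀ l ∈ letters M W, l.kind.IsShape := by
  simp only [letters, List.mem_map, forall_exists_index, and_imp]
  rintro _ ⟨u, s, v⟩ - rfl
  cases s <;> trivial

lemma Shape.kind_src (s : Shape) : (s.kind M).src = s.src := by cases s <;> rfl

lemma Shape.kind_tgt (s : Shape) : (s.kind M).tgt = s.tgt := by cases s <;> rfl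

lemma typed_letters {m n : ℕ} {W : List Slice} (h : IsFlat m W n) : Typed m (letters M W) n := by
  induction W generalizing m with
  | nil => exact h
  | cons sl W ih =>
    refine ⟨h.1.trans ?_, ?_⟩
    · rw [Letter.src, Shape.kind_src]; rfl
    · have := ih h.2
      rwa [Letter.tgt, Shape.kind_tgt]

lemma letters_append (X Y : List Slice) : letters M (X ++ Y) = letters M X ++ letters M Y := List.map_append

lemma FlatMove.equ {X Y : List Slice} (h : FlatMove X Y) : ∃ m n, Equ m n (letters M X) (letters M Y) := by
  cases h with
  | exchange u v w p p' =>
    have := exchange_equ u v w (p.kind M) (p'.kind M)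
    simp only [Shape.kind_src, Shape.kind_tgt] at this
    exact ⟨_, _, this⟩
  | zigzag u v => exact ⟨_, _, zigzag_equ u v⟩
  | zagzig u v => exact ⟨_, _, zagzig_equ u v⟩
  | vert u v => exact ⟨_, _, vert_zero u v⟩
  | horiz u v => exact ⟨_, _, horiz_zero u v⟩

lemma Equ.eqv_of_typed {m n : ℕ} {P X Y Q : List (Letter M)} (h : Equ m n X Y) (hX : Typed 0 (P ++ X ++ Q) 0)
    (hne : X ≠ []) : Eqv (P ++ X ++ Q) (P ++ Y ++ Q) := by
  obtain ⟨b, hab, hQ⟩ := typed_append.1 hX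
  obtain ⟨a, hP, hX'⟩ := typed_append.1 hab
  have e : ∀ {X : List (Letter M)} {a b m n : ℕ}, Typed a X b → Typed m X n → X ≠ [] → a = m ∧ b = n := by
    intro X
    induction X with
    | nil => intro _ _ _ _ _ _ h; exact absurd rfl h
    | cons l X ih =>
      intro a b m n h h' _
      refine ⟨h.1.trans h'.1.symm, ?_⟩
      cases X with
      | nil => exact h.2.symm.trans h'.2
      | cons l' X => exact (ih h.2 h'.2 (by simp)).2
  obtain ⟨rfl, rfl⟩ := e hX' h.1 hne
  exact h.2.2 P Q hP hQ

lemma numc_letters (P : Picture) : numc (fun _ => True) (letters M P.1) = (circles P.1).ncard :=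
  numc_eq (letters_isShape _) (typed_letters P.2) _ (slices_letters _).symm subset_rfl fun p hp =>
    ⟨fun _ => trivial, fun _ => ⟨p, hp, rfl⟩⟩

lemma size_mk (P : Picture) : Config.size (Quot.mk _ P) = (circles P.1).ncard := by
  have h : ∀ P P' : Picture, P.Related P' → (circles P.1).ncard = (circles P'.1).ncard := by
    rintro P P' ⟨W, X, Y, W', hm, e, e'⟩
    rw [← numc_letters (M := Unit), ← numc_letters (M := Unit)]
    obtain ⟨m, n, hE⟩ := hm.equ (M := Unit)
    have h1 := typed_letters (M := Unit) P.2
    rw [e, letters_append, letters_append] at h1 ⊢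
    rw [e', letters_append, letters_append]
    refine (hE.eqv_of_typed h1 ?_ _).1
    cases hm <;> exact List.cons_ne_nil _ _
  have key : ∀ c : Config, Config.size c = Quot.lift _ h c := fun c => by
    conv_rhs => rw [← Quot.out_eq c]
    rfl
  exact key _

open Classical in
/-- The colours `g` of the kept points. -/
noncomputable def pull (κ : ℕ → Prop) (g : ℕ → Z) (i : ℕ) : Option Z := if κ i then some (g (kc κ 0 i)) else none

lemma kc_lt {κ : ℕ → Prop} {j u : ℕ} (h : j < u) (hj : κ j) : kc κ 0 j < kc κ 0 u := by
  have e : u = j + (1 + (u - j - 1)) := by omega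
  rw [e, kc_add, kc_add, Nat.zero_add, kc_one, if_pos hj]
  omega

lemma kc_exists {κ : ℕ → Prop} {j m : ℕ} (h : j < kc κ 0 m) : ∃ i, κ i ∧ kc κ 0 i = j := by
  induction m with
  | zero => rw [kc_zero] at h; exact absurd h (Nat.not_lt_zero _)
  | succ m ih =>
    by_cases hm : j < kc κ 0 m
    · exact ih hm
    · rw [kc_add, Nat.zero_add, kc_one] at h
      grind

lemma pull_coloring {l : Letter M} {b t : ℕ → Prop} (h : l.Coloring b t) {g : ℕ → ℕ → Z}
    (hg : Coloring (letters M (l.res b t)) g) : l.Coloring (pull b (g 0)) (pull t (g (l.res b t).length)) ∧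
      (∀ j, (∃ i, t i ∧ kc t 0 i = j) ∨ ∃ j', g (l.res b t).length j = g 0 j') ∧
      ∀ k < (l.res b t).length, ∀ j, ∃ j', g k j = g 0 j' := by
  obtain ⟨u, k, v⟩ := l
  obtain ⟨h1, h2, h3⟩ := h
  have e1 : ∀ j ≤ u, kc b 0 j = kc t 0 j := fun j hj => kc_congr fun i hi => by simpa using h1 i (lt_of_lt_of_le hi hj)
  have e2 : ∀ j, kc b (u + k.src) j = kc t (u + k.tgt) j := fun j => kc_congr fun i hi => h2 i
  have red : ∀ e, (∀ j < kc b 0 u, g 0 j = g e j) →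
      (∀ j, g 0 (kc b 0 u + kc b u k.src + j) = g e (kc b 0 u + kc t u k.tgt + j)) →
      k.Const (fun j => pull b (g 0) (u + j)) (fun j => pull t (g e) (u + j)) →
      (⟨u, k, v⟩ : Letter M).Coloring (pull b (g 0)) (pull t (g e)) ∧
        ∀ j, (∃ i, t i ∧ kc t 0 i = j) ∨ ∃ j', g e j = g 0 j' := by
    intro e hl hr hc
    refine ⟨⟨fun j hj => ?_, fun j => ?_, hc⟩, fun j => ?_⟩
    · have := h1 j hj
      simp only at hj
      by_cases hb : b j
      · rw [pull, if_pos hb, pull, if_pos (this ▸ hb), hl _ (kc_lt hj hb), e1 j hj.le]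
      · rw [pull, if_neg hb, pull, if_neg (this ▸ hb)]
    · have := h2 j
      simp only at this
      by_cases hb : b (u + k.src + j)
      · rw [pull, if_pos hb, pull, if_pos (this ▸ hb)]
        rw [kc_add _ _ (u + k.src), kc_add _ _ u, kc_add _ _ (u + k.tgt), kc_add _ _ u, Nat.zero_add, Nat.zero_add,
          Nat.zero_add, hr, e1 u le_rfl, e2]
      · rw [pull, if_neg hb, pull, if_neg (this ▸ hb)]
    · by_cases h1 : j < kc b 0 u
      · exact Or.inr ⟨j, (hl j h1).symm⟩
      by_cases h2 : j < kc t 0 (u + k.tgt)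
      · exact Or.inl (kc_exists h2)
      · rw [kc_add, Nat.zero_add, ← e1 u le_rfl] at h2
        obtain ⟨i, rfl⟩ := Nat.exists_eq_add_of_le (Nat.not_lt.1 h2)
        exact Or.inr ⟨_, (hr i).symm⟩
  have two : ∀ κ : ℕ → Prop, ∀ i, kc κ i 2 = kc κ i 1 + kc κ (i + 1) 1 := fun κ i => kc_add κ i 1 1
  have s1 : ∀ κ : ℕ → Prop, kc κ 0 (u + 1) = kc κ 0 u + kc κ u 1 := fun κ => by rw [kc_add, Nat.zero_add]
  cases k with
  | mark z =>
    obtain rfl := (mark_isId u v z).coloring.1 ⟨h1, h2, h3⟩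
    exact ⟨(mark_isId u v z).coloring.2 rfl, fun j => Or.inr ⟨j, rfl⟩, fun k hk => absurd hk (Nat.not_lt_zero _)⟩
  | vert z =>
    obtain rfl := (vert_isId u v z).coloring.1 ⟨h1, h2, h3⟩
    exact ⟨(vert_isId u v z).coloring.2 rfl, fun j => Or.inr ⟨j, rfl⟩, fun k hk => absurd hk (Nat.not_lt_zero _)⟩
  | _ =>
    simp only [Kind.Const, Nat.add_zero] at h3
    by_cases hk : b u <;> by_cases hk' : t u <;>
    simp only [Letter.res, Kind.res, listIf, hk, hk', if_true, if_false, List.length_map, List.length_cons,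
      Nat.add_zero, List.map_cons, List.map_nil, letters, Shape.kind, coloring_cons, coloring_nil, cap_coloring,
      cup_coloring, and_true, List.length_nil, List.cons_append, List.nil_append, Nat.zero_add, Nat.reduceAdd] at hg ⊢ <;>
    first
    | refine and_assoc.1 ⟨red 0 (fun _ _ => rfl) (fun j => ?_) ?_, fun k hk => absurd hk (Nat.not_lt_zero _)⟩ <;>
      simp [Kind.src, Kind.tgt, kc_zero, two, kc_one, pull, ← h3, hk, hk', Kind.Const]
    | refine and_assoc.1 ⟨red 1 hg.1 (fun j => ?_) ?_, fun k hk j => ⟨j, by rw [Nat.lt_one_iff.1 hk]⟩⟩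
      · simpa [Kind.src, Kind.tgt, kc_zero, two, kc_one, ← h3, hk, hk'] using hg.2.1 j
      · simp [Kind.Const, pull, ← h3, hk, hk', s1, kc_one, ← e1 u le_rfl, hg.2.2]
    | obtain ⟨⟨a1, a2, a3⟩, b1, b2, b3⟩ := hg
      refine and_assoc.1 ⟨red 2 (fun j hj => (a1 j hj).trans (b1 j hj)) (fun j => ?_) ?_, fun k hk j => ?_⟩
      · simpa [Kind.src, Kind.tgt, two, kc_one, ← h3.1, ← h3.2, hk, hk'] using (a2 j).trans (b2 j)
      · simp [Kind.Const, pull, ← h3.1, ← h3.2, hk, hk', s1, kc_one, a3, ← e1 u le_rfl, b3]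
      · obtain rfl | rfl : k = 0 ∨ k = 1 := by omega
        · exact ⟨j, rfl⟩
        · by_cases hj : j < kc b 0 u
          · exact ⟨j, (a1 j hj).symm⟩
          · obtain ⟨i, rfl⟩ := Nat.exists_eq_add_of_le (Nat.not_lt.1 hj)
            exact ⟨_, (a2 i).symm⟩

end Size

section SizeBound

variable {M : Type} [AddCommMonoid M] {Z : Type}

lemma exists_pull {W : List (Letter M)} {κ : ℕ → ℕ → Prop} (hκ : Coloring W κ) {g : ℕ → ℕ → Z}
    (hg : Coloring (letters M (res W κ)) g) : ∃ f : ℕ → ℕ → Option Z, Coloring W f ∧ f 0 = pull (κ 0) (g 0) ∧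
      ∀ k ≤ (res W κ).length, ∀ j, (∃ i, g k j = g 0 i) ∨ ∃ k' ≤ W.length, ∃ i, κ k' i ∧ f k' i = some (g k j) := by
  induction W generalizing κ g with
  | nil =>
    refine ⟨fun _ => pull (κ 0) (g 0), trivial, rfl, fun k hk j => Or.inl ⟨j, ?_⟩⟩
    rw [Nat.le_zero.1 hk]
  | cons l W ih =>
    rw [res, letters_append, coloring_append] at hg
    obtain ⟨hl, hm, hs⟩ := pull_coloring hκ.1 hg.1
    obtain ⟨f, hf, h0, h1⟩ := ih hκ.2 hg.2
    have hlen : (letters M (l.res (κ 0) (κ 1))).length = (l.res (κ 0) (κ 1)).length := List.length_map _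
    rw [hlen] at h0 h1
    refine ⟨fun k => k.rec (pull (κ 0) (g 0)) fun k _ => f k, ⟨?_, hf⟩, rfl, fun k hk j => ?_⟩
    · change l.Coloring (pull (κ 0) (g 0)) (f 0)
      rw [h0]; exact hl
    · by_cases hkl : k < (l.res (κ 0) (κ 1)).length
      · exact Or.inl (hs k hkl j)
      · obtain ⟨i, rfl⟩ := Nat.exists_eq_add_of_le (Nat.not_lt.1 hkl)
        rw [res, List.length_append] at hk
        rcases h1 i (by omega) j with ⟨i0, e⟩ | ⟨k', hk', i', hi', e⟩
        · rw [e, Nat.add_zero]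
          rcases hm i0 with ⟨i', hi', rfl⟩ | ⟨j', e'⟩
          · refine Or.inr ⟨1, by simp, i', hi', ?_⟩
            change f 0 i' = _
            rw [h0, pull, if_pos hi', Nat.add_zero]
          · exact Or.inl ⟨j', e'⟩
        grind

lemma size_cfg_le {W : List (Letter M)} (ht : Typed 0 W 0) (R : M → Prop) : (cfg R W).size ≤ numc R W := by
  have hκ : Coloring W (fun k i => pt W k i ∈ circ W ∧ R (totc W (pt W k i))) :=
    (coloring_pt W).map fun c => c ∈ circ W ∧ R (totc W c)
  rw [cfg]
  generalize hκe : (fun k i => pt W k i ∈ circ W ∧ R (totc W (pt W k i))) = κ at hκ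
  have hfl : IsFlat 0 (res W κ) 0 := by
    have := res_isFlat ht hκ
    rwa [kc_zero, kc_zero] at this
  rw [cfgL_eq hfl, size_mk, ← numc_letters (M := M)]
  change numc _ (letters M (res W κ)) ≤ _
  obtain ⟨f, hf, -, h⟩ := exists_pull hκ (coloring_pt (letters M (res W κ)))
  have hlen : (letters M (res W κ)).length = (res W κ).length := List.length_map _
  rw [numc, numc, ← Set.ncard_image_of_injective _ (Option.some_injective _)]
  refine (Set.ncard_le_ncard ?_ (((circ_finite ht).subset fun c hc => hc.1).image hf.lift)).trans (Set.ncard_image_le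
    ((circ_finite ht).subset fun c hc => hc.1))
  rintro _ ⟨c, ⟨⟨⟨k, hk, j, rfl⟩, hc⟩, -⟩, rfl⟩
  rcases h k (hlen ▸ hk) j with ⟨i, e⟩ | ⟨k', hk', i, hi, e⟩
  · exact absurd e (hc i)
  · refine ⟨pt W k' i, ?_, e⟩
    rw [← hκe] at hi
    exact hi

open Classical in
lemma restrict_true {κ : ℕ × ℕ → Prop} {W : List Slice} {k m n : ℕ} (hW : IsFlat m W n)
    (h : ∀ j sl, W[j]? = some sl → (∀ i < sl.src, κ (k + j, i)) ∧ ∀ i < sl.tgt, κ (k + j + 1, i)) :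
    FEq m n (restrictFrom κ k W) W := by
  induction W generalizing m k with
  | nil => exact FEq.refl hW
  | cons sl W ih =>
    obtain ⟨rfl, hW'⟩ := hW
    have ih' := ih (k := k + 1) hW' fun j sl' hj => by
      have := h (j + 1) sl' (by simpa using hj)
      grind
    obtain ⟨h1, h2⟩ := h 0 sl rfl
    rw [Nat.add_zero] at h1 h2
    have full : ∀ {i m : ℕ}, (∀ j < m, κ (k, i + j)) → keptCount κ k i m = m := fun {i m} hh => by
      grind [keptCount, Finset.filter_true_of_mem]
    rw [restrictFrom]
    refine FEq.append (X := sl.restrict κ k) (Y := [sl]) ?_ ih'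
    rcases sl with ⟨u, s, v⟩
    have eu : keptCount κ k 0 u = u := full fun j hj => by
      rw [Nat.zero_add]; exact h1 j (by simp only [Slice.src]; omega)
    have ev : keptCount κ k (u + s.src) v = v := full fun j hj => h1 _ (by simp only [Slice.src]; omega)
    have one : ∀ s : Shape, IsFlat (Slice.src ⟨u, s, v⟩) [⟨u, s, v⟩] (Slice.tgt ⟨u, s, v⟩) := fun s => ⟨rfl, rfl⟩
    cases s with
    | cup =>
      rw [Slice.restrict, eu, ev]
      simp only [h2 u (by simp [Slice.tgt, Shape.tgt]; omega), if_true]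
      exact FEq.refl (one .cup)
    | cap =>
      rw [Slice.restrict, eu, ev]
      simp only [h1 u (by simp [Slice.src, Shape.src]; omega), if_true]
      exact FEq.refl (one .cap)
    | vert => exact (FEq.of_move (.vert u v) (one .vert) rfl).symm
    | horiz =>
      rw [Slice.restrict, eu, ev]
      simp only [h1 u (by simp [Slice.src, Shape.src]; omega), h2 u (by simp [Slice.tgt, Shape.tgt]; omega), if_true]
      exact (FEq.of_move (.horiz u v) (one .horiz) ⟨rfl, rfl, rfl⟩).symm

lemma sub_circles (P : Picture) : (Quot.mk _ (P.sub (circles P.1)) : Config) = Quot.mk _ P := by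
  have h := restrict_true (κ := fun p => comp P.1 p ∈ circles P.1) (k := 0) P.2 fun j sl hj => by
    have hl : (letters Unit P.1)[j]? = some ⟨sl.left, sl.shape.kind Unit, sl.right⟩ := by
      rw [letters, List.getElem?_map, hj]; rfl
    have e := slices_letters (M := Unit) P.1
    have h1 := fun i => mem_points_iff (letters_isShape (M := Unit) P.1) (k := j) (i := i)
    have h2 := fun i => mem_points_succ (letters_isShape (M := Unit) P.1) (typed_letters P.2) (i := i) hl
    rw [e] at h1 h2
    simp only [Letter.src, Letter.tgt, Shape.kind_src, Shape.kind_tgt] at h1 h2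
    rw [Nat.zero_add]
    exact ⟨fun i hi => ⟨_, (h1 i).2 ⟨_, hl, by rw [Shape.kind_src]; exact hi⟩, rfl⟩, fun i hi => ⟨_, (h2 i).2 hi, rfl⟩⟩
  have := h.2.2 [] [] rfl rfl
  simp only [List.nil_append, List.append_nil] at this
  rw [cfgL_eq h.1, cfgL_eq P.2] at this
  exact this

end SizeBound

section Leading

open LaurentPolynomial

variable {D : Diagram}

lemma Diagram.State.size_config_le (s : D.State) : s.config.size ≤ s.hCircles.ncard := by
  have hh : ∀ p ∈ points s.picture.1, comp _ p ∈ s.hCircles ↔ HType (totc s.word (pt s.word p.1 p.2)) := fun p hp => by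
    rw [← s.breakPoints_eq hp, hType_iff]
    exact ⟨fun h => h.2, fun h => ⟨⟨p, hp, rfl⟩, h⟩⟩
  have hK : s.hCircles ⊆ circles s.picture.1 := fun c hc => hc.1
  rw [config, ← cfg_eq s.word_isShape s.typed_word HType s.slices_word hK hh,
    ← numc_eq s.word_isShape s.typed_word HType s.slices_word hK hh]
  exact size_cfg_le s.typed_word _

lemma Diagram.breakPoints_seifertState (c : D.seifertState.Component) : D.seifertState.breakPoints c = 0 := by
  have : ∀ x : D.Crossing, ¬ x.layer.piece.Broken (D.seifertState x) := fun x => by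
    rw [State.broken_iff]; simp
  simp [State.breakPoints, this]

lemma Diagram.sigma_seifertState (D : Diagram) : D.seifertState.sigma = D.writhe := by
  rw [State.sigma_eq, writhe]
  have : ∀ k : Fin D.1.length, (D.1.get k).expo (D.seifertState.choice k) = (D.1.get k).piece.sign := fun k => by
    rw [Layer.expo]
    by_cases hk : (D.1.get k).piece.isCross = true
    · have : D.seifertState.choice k = decide ((D.1.get k).piece.sign = 1) := dif_pos hk
      rw [if_pos hk, this]
      revert hk
      cases (D.1.get k).piece with
      | cup o => simp [Piece.isCross]
      | cap o => simp [Piece.isCross]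
      | cross a b r => cases a <;> cases b <;> cases r <;> simp [Piece.sign]
    · rw [if_neg hk]
      revert hk
      cases (D.1.get k).piece <;> simp [Piece.isCross, Piece.sign]
  grind [List.ofFn_get, List.sum_ofFn]

lemma Diagram.exists_rest (D : Diagram) : ∃ rest : Gam, D.bracket = Finsupp.single D.seifert (T D.writhe) + rest ∧
    ∀ c ∈ rest.support, c.size < D.seifert.size := by
  classical
  have hs : D.seifertState.config = D.seifert := by
    have : D.seifertState.hCircles = circles D.seifertState.picture.1 := by
      ext c; simp [State.hCircles, breakPoints_seifertState]
    rw [State.config, this, sub_circles]; rfl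
  have hd : D.seifertState.dCircles = ∅ := by
    ext c; simp [State.dCircles, breakPoints_seifertState]
  refine ⟨∑ s ∈ Finset.univ.erase D.seifertState, Finsupp.single s.config (T s.sigma * loopValue ^ s.dCircles.ncard),
    (Finset.add_sum_erase Finset.univ _ (Finset.mem_univ D.seifertState)).symm.trans ?_, fun c hc => ?_⟩
  · rw [hs, hd, Set.ncard_empty, pow_zero, mul_one, sigma_seifertState]
  · obtain ⟨s, hs', hc'⟩ := Finsupp.mem_support_finsetSum c hc
    have e : c = s.config := by grind
    rw [e, seifert, size_mk]
    exact lt_of_le_of_lt s.size_config_le (s.ncard_hCircles_lt (Finset.ne_of_mem_erase hs'))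

end Leading

namespace Diagram

/-- `m` pairs of crossings of two strands of opposite directions that cancel, closed at the top. -/
def twists : ℕ → List Layer
  | 0 => [⟨[], .cap true, []⟩]
  | m + 1 => ⟨[], .cross true false true, []⟩ :: ⟨[], .cross false true false, []⟩ :: twists m

lemma twists_isTangle (m : ℕ) : IsTangle [true, false] (twists m) [] := by
  induction m with
  | zero => exact ⟨rfl, rfl⟩
  | succ m ih => exact ⟨rfl, rfl, ih⟩

def twistedCircle (m : ℕ) : Diagram := ⟨⟨[], .cup true, []⟩ :: twists m, rfl, twists_isTangle m⟩

lemma twistedCircle_isotopic (m : ℕ) : (twistedCircle m).RegularlyIsotopic roundCircle := by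
  induction m with
  | zero => exact .refl _
  | succ m ih =>
    refine .trans _ _ _ (.rel _ _ ⟨[⟨[], .cup true, []⟩], _, _, twists m, .moveII true false (.mk [] [] true false true),
      rfl, rfl⟩) ih

lemma picture_seifertState (D : Diagram) : D.seifertState.picture.1 = D.1.map Layer.seifert := by
  conv_rhs => rw [← List.ofFn_get D.1, List.map_ofFn]
  refine congrArg List.ofFn (funext fun k => ?_)
  change (D.1.get k).smooth _ = (D.1.get k).smooth _
  by_cases hk : (D.1.get k).piece.isCross = true
  · have : D.seifertState.choice k = decide ((D.1.get k).piece.sign = 1) := dif_pos hk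
    rw [this]
  · revert hk
    rw [Layer.smooth, Layer.smooth]
    cases (D.1.get k).piece <;> simp [Piece.isCross, Piece.smooth]

lemma numc_cup_cap {Q : List (Letter Unit)} (hQ : Typed 0 Q 0) :
    numc (fun _ => True) (⟨0, .cup, 0⟩ :: ⟨0, .cap, 0⟩ :: Q) = numc (fun _ => True) Q + 1 := by
  have h := (mark_zero (M := Unit) 0 1).2.2 [⟨0, .cup, 0⟩] (⟨0, .cap, 0⟩ :: Q) ⟨rfl, rfl⟩ ⟨rfl, hQ⟩ fun _ => True
  have h2 := numc_loop (P := []) (Q := Q) (u := 0) (v := 0) (v' := 1) (z := ()) rfl hQ fun _ => True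
  rw [if_pos trivial] at h2
  exact h.1.symm.trans h2

lemma numc_cup_horiz {Q : List (Letter Unit)} (hQ : Typed 2 Q 0) :
    numc (fun _ => True) (⟨0, .cup, 0⟩ :: ⟨0, .horiz (), 0⟩ :: Q) = numc (fun _ => True) (⟨0, .cup, 0⟩ :: Q) + 1 := by
  have h := (horiz_zero (M := Unit) 0 0).2.2 [⟨0, .cup, 0⟩] Q ⟨rfl, rfl⟩ hQ fun _ => True
  exact h.1.trans (numc_cup_cap ⟨rfl, hQ⟩)

lemma size_twistedCircle (m : ℕ) : (twistedCircle m).seifert.size = 2 * m + 1 := by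
  rw [seifert, size_mk, ← numc_letters (M := Unit), picture_seifertState]
  have ht : ∀ m, Typed 2 (letters Unit ((twists m).map Layer.seifert)) 0 := fun m => by
    induction m with
    | zero => exact ⟨rfl, rfl⟩
    | succ m ih => exact ⟨rfl, rfl, ih⟩
  induction m with
  | zero =>
    refine (numc_cup_cap (Q := []) rfl).trans ?_
    have : circ ([] : List (Letter Unit)) = ∅ := by
      refine Set.eq_empty_iff_forall_notMem.2 fun c hc => ?_
      obtain ⟨⟨k, hk, i, rfl⟩, h⟩ := hc
      obtain rfl := Nat.le_zero.1 hk
      exact h i rfl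
    rw [numc, this]; simp
  | succ m ih =>
    refine (numc_cup_horiz (Q := ⟨0, .horiz (), 0⟩ :: _) ⟨rfl, ht m⟩).trans ?_
    rw [numc_cup_horiz (ht m)]
    refine (congrArg (· + 1 + 1) ih).trans ?_
    omega

lemma isUnit_negAPow (n : ℤ) : negAPow n ≠ 0 := fun h => by
  have := negAPow_add n (-n)
  rw [h, zero_mul, add_neg_cancel] at this
  simp [negAPow] at this

open LaurentPolynomial in
lemma seifert_mem_support (D : Diagram) : D.seifert ∈ D.normalized.support ∧
    ∀ c ∈ D.normalized.support, c.size ≤ D.seifert.size := by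
  classical
  obtain ⟨rest, h, hlt⟩ := D.exists_rest
  have h0 : rest D.seifert = 0 := by
    by_contra h0
    exact lt_irrefl _ (hlt _ (Finsupp.mem_support_iff.2 h0))
  constructor
  · rw [Finsupp.mem_support_iff, normalized, h, Finsupp.smul_apply, Finsupp.add_apply, h0, Finsupp.single_eq_same,
      add_zero, smul_eq_mul]
    exact mul_ne_zero (isUnit_negAPow _) (fun h => by
      have : (T D.writhe : ℤ[T;T⁻¹]) * T (-D.writhe) = 1 := by rw [← T_add, add_neg_cancel, T_zero]
      rw [h, zero_mul] at this
      exact zero_ne_one this)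
  · intro c hc
    have hc' := Finsupp.support_smul hc
    rw [h] at hc'
    rcases Finset.mem_union.1 (Finsupp.support_add hc') with hc | hc
    · rw [Finset.mem_singleton.1 (Finsupp.support_single_subset hc)]
    · exact (hlt c hc).le

lemma infinite_values : {V : Gam | ∃ D : Diagram, D.RegularlyIsotopic roundCircle ∧ D.normalized = V}.Infinite := by
  refine Set.infinite_of_injective_forall_mem (f := fun m => (twistedCircle m).normalized) (fun m n h => ?_) fun m =>
    ⟨_, twistedCircle_isotopic m, rfl⟩
  simp only at h
  have h1 := (seifert_mem_support (twistedCircle m)).1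
  have h2 := (seifert_mem_support (twistedCircle n)).1
  rw [h] at h1
  rw [← h] at h2
  have h3 := (seifert_mem_support (twistedCircle n)).2 _ h1
  have h4 := (seifert_mem_support (twistedCircle m)).2 _ h2
  rw [size_twistedCircle, size_twistedCircle] at h3 h4
  omega

end Diagram

section Skeleton

variable {M : Type} [AddCommMonoid M]

/-- The sum of the marks on a strand of the skeleton. -/
noncomputable def skelTot (W : List (Letter M)) (c : Cp (skel W)) : M := tot W fun k i => pt (skel W) (skelLevel W k) i = c

lemma exists_skelLevel {W : List (Letter M)} {k : ℕ} (hk : k ≤ (skel W).length) : ∃ k' ≤ W.length, skelLevel W k' = k := by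
  induction W generalizing k with
  | nil => exact ⟨0, le_rfl, (Nat.le_zero.1 hk).symm⟩
  | cons l W ih =>
    rcases k with _ | k
    · exact ⟨0, Nat.zero_le _, skelLevel_zero _⟩
    · cases h : l.kind.isId
      · simp only [skel, h, cond_false, List.length_cons, Nat.add_le_add_iff_right] at hk
        obtain ⟨k', hk', e⟩ := ih hk
        exact ⟨k' + 1, by simpa using hk', by simp [skelLevel, h, e]⟩
      · simp only [skel, h, cond_true] at hk
        obtain ⟨k', hk', e⟩ := ih hk
        exact ⟨k' + 1, by simpa using hk', by simp [skelLevel, h, e]⟩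

lemma exists_skel_strand (W : List (Letter M)) : ∃ F : Cp W → Cp (skel W),
    (∀ k i, F (pt W k i) = pt (skel W) (skelLevel W k) i) ∧ Set.InjOn F {c | ∃ k ≤ W.length, ∃ i, c = pt W k i} ∧
      F '' circ W = circ (skel W) := by
  have hf : Coloring W fun k => pt (skel W) (skelLevel W k) := coloring_skel.2 (coloring_pt _)
  obtain ⟨g, hg, hfg⟩ := exists_skel (coloring_pt W)
  have inj : Set.InjOn hf.lift {c | ∃ k ≤ W.length, ∃ i, c = pt W k i} := by
    rintro _ ⟨k, hk, i, rfl⟩ _ ⟨k', hk', i', rfl⟩ h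
    rw [hf.lift_pt, hf.lift_pt] at h
    rw [hfg k hk, hfg k' hk']
    exact congrArg hg.lift h
  refine ⟨hf.lift, fun _ _ => rfl, inj, ?_⟩
  ext c
  constructor
  · rintro ⟨_, ⟨⟨k, hk, i, rfl⟩, hc⟩, rfl⟩
    refine ⟨⟨_, skelLevel_le _ _, i, rfl⟩, fun j e => hc j (inj ⟨k, hk, i, rfl⟩ ⟨0, Nat.zero_le _, j, rfl⟩ ?_)⟩
    rw [e, hf.lift_pt, skelLevel_zero]
  · rintro ⟨⟨k, hk, i, rfl⟩, hc⟩
    obtain ⟨k', hk', rfl⟩ := exists_skelLevel hk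
    refine ⟨pt W k' i, ⟨⟨k', hk', i, rfl⟩, fun j e => hc j ?_⟩, rfl⟩
    have := congrArg hf.lift e
    rwa [hf.lift_pt, hf.lift_pt, skelLevel_zero] at this

lemma skelTot_eq {W : List (Letter M)} {F : Cp W → Cp (skel W)}
    (h1 : ∀ k i, F (pt W k i) = pt (skel W) (skelLevel W k) i) (h2 : Set.InjOn F {c | ∃ k ≤ W.length, ∃ i, c = pt W k i})
    {c : Cp W} (hc : ∃ k ≤ W.length, ∃ i, c = pt W k i) : skelTot W (F c) = totc W c :=
  tot_congr fun k hk => funext fun i => by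
    rw [← h1]
    exact propext ⟨fun e => h2 ⟨k, hk, i, rfl⟩ hc e, fun e => congrArg F e⟩

lemma numc_skel (W : List (Letter M)) (R : M → Prop) : numc R W = {c ∈ circ (skel W) | R (skelTot W c)}.ncard := by
  obtain ⟨F, h1, h2, h3⟩ := exists_skel_strand W
  rw [numc, ← Set.InjOn.ncard_image (f := F) (h2.mono fun c hc => hc.1.1), ← h3]
  congr 1
  ext c
  constructor
  · rintro ⟨c, ⟨hc, hR⟩, rfl⟩
    exact ⟨⟨c, hc, rfl⟩, by rwa [skelTot_eq h1 h2 hc.1]⟩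
  · rintro ⟨⟨c, hc, rfl⟩, hR⟩
    exact ⟨c, ⟨hc, by rwa [skelTot_eq h1 h2 hc.1] at hR⟩, rfl⟩

lemma cfg_skel (W : List (Letter M)) (R : M → Prop) : cfg R W =
    cfgL (res (skel W) fun k i => pt (skel W) k i ∈ circ (skel W) ∧ R (skelTot W (pt (skel W) k i))) := by
  obtain ⟨F, h1, h2, h3⟩ := exists_skel_strand W
  rw [cfg, ← res_skel]
  congr 1
  refine res_congr fun k hk => funext fun i => ?_
  have hk' : ∃ k' ≤ W.length, ∃ i', pt W k i = pt W k' i' := ⟨k, hk, i, rfl⟩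
  rw [← h1, skelTot_eq h1 h2 hk', ← h3]
  refine propext (and_congr_left' ⟨fun h => ⟨_, h, rfl⟩, ?_⟩)
  rintro ⟨c, hc, e⟩
  exact h2 hc.1 hk' e ▸ hc

lemma numc_of_skel {W S : List (Letter M)} (hW : skel W = S) (R : M → Prop) :
    numc R W = {c ∈ circ S | R (tot W fun k i => pt S (skelLevel W k) i = c)}.ncard := by
  subst hW
  exact numc_skel W R

lemma eq_of_skel {U V S : List (Letter M)} (hU : skel U = S) (hV : skel V = S) {R R' : M → Prop}
    (h : ∀ c ∈ circ S, R (tot U fun k i => pt S (skelLevel U k) i = c) ↔ R' (tot V fun k i => pt S (skelLevel V k) i = c)) :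
    numc R U = numc R' V ∧ cfg R U = cfg R' V := by
  have g : ∀ (W) (Q : M → Prop), skel W = S → cfg Q W =
      cfgL (res S fun k i => pt S k i ∈ circ S ∧ Q (tot W fun k' i' => pt S (skelLevel W k') i' = pt S k i)) := by
    rintro W Q rfl
    exact cfg_skel W Q
  rw [numc_of_skel hU, numc_of_skel hV, g U R hU, g V R' hV]
  constructor
  · congr 1
    ext c
    exact and_congr_right (h c)
  · congr 2
    funext k i
    exact propext (and_congr_right (h _))

end Skeleton

section Blocks

variable {M : Type} [AddCommMonoid M]

/-- A minimum (if `b = true`) or a maximum, with a mark on it. -/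
def extr (b : Bool) (z : M) (u v : ℕ) : List (Letter M) :=
  bif b then [⟨u, .cup, v⟩, ⟨u, .mark z, v + 1⟩] else [⟨u, .mark z, v + 1⟩, ⟨u, .cap, v⟩]

lemma typed_extr {b : Bool} {z : M} {u v m n : ℕ} :
    Typed m (extr b z u v) n ↔ (bif b then m = u + v ∧ n = u + 2 + v else m = u + 2 + v ∧ n = u + v) := by
  cases b <;> simp only [extr, cond_true, cond_false, Typed, Letter.src, Letter.tgt, Kind.src, Kind.tgt] <;> omega

lemma extr_refl {b : Bool} {z : M} {u v m n : ℕ}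
    (h : bif b then m = u + v ∧ n = u + 2 + v else m = u + 2 + v ∧ n = u + v := by
      simp only [cond_true, cond_false, true_and, and_true] <;> omega) : Equ m n (extr b z u v) (extr b z u v) := .refl (typed_extr.2 h)

lemma extr_exch_letter (b : Bool) (z : M) (p : Kind M) {i a a' j j' w m n : ℕ}
    (h : i + (bif b then 2 else 0) ≤ j ∧ j' + (bif b then 2 else 0) = j + (bif b then 0 else 2) ∧
      i + (bif b then 2 else 0) + a = j + p.src + w ∧ i + (bif b then 2 else 0) + a' = j + p.tgt + w ∧
      m = i + (bif b then 0 else 2) + a ∧ n = j + p.tgt + w) :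
    Equ m n (extr b z i a ++ [⟨j, p, w⟩]) (⟨j', p, w⟩ :: extr b z i a') := by
  obtain ⟨h1, h2, h3, h4, rfl, rfl⟩ := h
  simp only [Kind.src, Kind.tgt] at h1 h2 h3 h4
  cases b <;> simp only [cond_true, cond_false, add_zero] at *
  · exact .step [⟨i, .mark z, a + 1⟩] [] (exch (p := .cap) (p' := p) (i := i) (a := a) (j := j) (b := w) (j' := j') (a' := a'))
      (.ctx [] [⟨i, .cap, a'⟩] (exch (p := .mark z) (p' := p) (i := i) (a := a + 1) (j := j') (b := w) (j' := j') (a' := a' + 1)))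
  · exact .step [⟨i, .cup, a⟩] [] (exch (p := .mark z) (p' := p) (i := i) (a := a + 1) (j := j) (b := w) (j' := j) (a' := a' + 1))
      (.ctx [] [⟨i, .mark z, a' + 1⟩] (exch (p := .cup) (p' := p) (i := i) (a := a) (j := j) (b := w) (j' := j') (a' := a')))

lemma extr_exch (b c : Bool) (z z' : M) {i a a' j j' w m n : ℕ}
    (h : i + (bif b then 2 else 0) ≤ j ∧ j' + (bif b then 2 else 0) = j + (bif b then 0 else 2) ∧
      i + (bif b then 2 else 0) + a = j + (bif c then 0 else 2) + w ∧
      i + (bif b then 2 else 0) + a' = j + (bif c then 2 else 0) + w ∧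
      m = i + (bif b then 0 else 2) + a ∧ n = j + (bif c then 2 else 0) + w := by
        simp only [cond_true, cond_false, true_and, and_true] <;> omega) :
    Equ m n (extr b z i a ++ extr c z' j w) (extr c z' j' w ++ extr b z i a') := by
  have t : ∀ {p : Kind M} {j w m n}, m = j + p.src + w → n = j + p.tgt + w → Equ m n [⟨j, p, w⟩] [⟨j, p, w⟩] :=
    fun hm hn => .refl ⟨hm, hn.symm⟩
  cases c <;> simp only [cond_true, cond_false] at h
  · have x := (extr_exch_letter b z (.mark z') (i := i) (a := a) (j := j) (w := w + 1) (j' := j') (a' := a)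
      (m := m) (n := n + 2) (by simp only [Kind.src, Kind.tgt]; omega)).append
      (t (p := .cap) (j := j) (w := w) (n := n) (by simp only [Kind.src]; omega) (by simp only [Kind.tgt]; omega))
    have y := (t (p := .mark z') (j := j') (w := w + 1) (m := m) (n := m) (by simp only [Kind.src]; omega)
      (by simp only [Kind.tgt]; omega)).append (extr_exch_letter b z .cap (i := i) (a := a) (j := j) (w := w) (j' := j')
      (a' := a') (n := n) (by simp only [Kind.src, Kind.tgt]; omega))
    simp only [List.append_assoc] at x
    exact x.trans y
  · have x := (extr_exch_letter b z .cup (i := i) (a := a) (j := j) (w := w) (j' := j') (a' := a')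
      (m := m) (n := n) (by simp only [Kind.src, Kind.tgt]; omega)).append
      (t (p := .mark z') (j := j) (w := w + 1) (n := n) (by simp only [Kind.src]; omega) (by simp only [Kind.tgt]; omega))
    have y := (t (p := .cup) (j := j') (w := w) (m := m) (n := m + 2) (by simp only [Kind.src]; omega)
      (by simp only [Kind.tgt]; omega)).append (extr_exch_letter b z (.mark z') (i := i) (a := a') (j := j) (w := w + 1)
      (j' := j') (a' := a') (n := n) (by simp only [Kind.src, Kind.tgt]; omega))
    simp only [List.append_assoc] at x
    exact x.trans y

lemma loop_equ (u v : ℕ) (x y : M) :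
    Equ (u + v) (u + v) (extr true x u v ++ extr false y u v) (loopWord u v (v + 1) (x + y)) :=
  (mark_add u (v + 1) x y).ctx [⟨u, .cup, v⟩] [⟨u, .cap, v⟩]

lemma extr_mark (u v : ℕ) (x y : M) :
    Equ (u + v) (u + 2 + v) (extr true x u v ++ [⟨u, .mark y, v + 1⟩]) (extr true (x + y) u v) :=
  (mark_add u (v + 1) x y).ctx [⟨u, .cup, v⟩] []

lemma mark_extr (u v : ℕ) (x y : M) :
    Equ (u + 2 + v) (u + v) (⟨u + 1, .mark y, v⟩ :: extr false x u v) (extr false (y + x) u v) :=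
  .step [⟨u + 1, .mark y, v⟩] [] (mark_cap u v x) <|
    .step [] [⟨u, .cap, v⟩] (mark_add (u + 1) v y x) (mark_cap u v _).symm

lemma extr_zigzag (u v : ℕ) (x y : M) : Equ (u + 1 + v) (u + 1 + v)
    (extr true x u (v + 1) ++ extr false y (u + 1) v) [⟨u, .mark (x + y), v⟩] :=
  .step [] (extr false y (u + 1) v) (cup_mark u (v + 1) x) (hQ := typed_extr.2 ⟨by omega, by omega⟩) <|
  .step [⟨u, .cup, v + 1⟩] [⟨u + 1, .cap, v⟩] (mark_add (u + 1) (v + 1) x y) <|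
  .step [] [⟨u + 1, .cap, v⟩] (cup_mark u (v + 1) (x + y)).symm <|
  .step [⟨u, .cup, v + 1⟩] [] (exch (p := .mark (x + y)) (p' := .cap) (i := u) (a := v + 2) (j := u + 1) (b := v)
    (j' := u + 1) (a' := v)) <|
  .ctx [] [⟨u, .mark (x + y), v⟩] zigzag

lemma extr_zagzig (u v : ℕ) (x y : M) : Equ (u + 1 + v) (u + 1 + v)
    (extr true x (u + 1) v ++ extr false y u (v + 1)) [⟨u, .mark (x + y), v⟩] :=
  .step (extr true x (u + 1) v) [] (mark_cap u (v + 1) y) (hP := typed_extr.2 ⟨by omega, by omega⟩) <|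
  .step [⟨u + 1, .cup, v⟩] [⟨u, .cap, v + 1⟩] (mark_add (u + 1) (v + 1) x y) <|
  .step [⟨u + 1, .cup, v⟩] [] (mark_cap u (v + 1) (x + y)).symm <|
  .step [] [⟨u, .cap, v + 1⟩] (exch (p := .mark (x + y)) (p' := .cup) (i := u) (a := v) (j := u + 1) (b := v)
    (j' := u + 1) (a' := v + 2)).symm <|
  .ctx [⟨u, .mark (x + y), v⟩] [] zagzig

def cups (e : M) : ℕ → List (Letter M)
  | 0 => []
  | n + 1 => cups e n ++ extr true e n n

def caps (M : Type) [AddCommMonoid M] : ℕ → List (Letter M)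
  | 0 => []
  | n + 1 => extr false 0 n n ++ caps M n

lemma typed_cups (e : M) (n : ℕ) : Typed 0 (cups e n) (n + n) := by
  induction n with
  | zero => rfl
  | succ n ih => exact ih.append (typed_extr.2 ⟨rfl, by omega⟩)

lemma typed_caps (n : ℕ) : Typed (n + n) (caps M n) 0 := by
  induction n with
  | zero => rfl
  | succ n ih => exact Typed.append (typed_extr.2 ⟨by omega, rfl⟩) ih

lemma cups_extr {e : M} (he : e + e = 0) (z : M) (i m : ℕ) : Equ 0 (i + m + (i + m) + 2)
    (cups e (i + m + 2) ++ extr false z i (i + m + m + 2)) (cups e (i + m) ++ extr true z (i + m + m) i) := by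
  induction m with
  | zero =>
    have x := (Equ.refl (typed_cups e i)).append ((extr_refl (z := e) (u := i) (v := i) (b := true) (n := i + 2 + i)).append
      ((extr_zagzig i (i + 1) e z).cast (m' := i + 2 + i) (n' := i + 2 + i)))
    have y := (Equ.refl (typed_cups e i)).append ((extr_mark i i e (e + z)))
    rw [← add_assoc, he, zero_add] at y
    simpa only [cups, List.append_assoc, add_zero, add_assoc, Nat.reduceAdd] using
      (x.trans y).cast (n' := i + i + 2)
  | succ m ih =>
    have x := (Equ.refl (typed_cups e (i + m + 2))).append
      (extr_exch false true z e (i := i) (a := i + m + m + 2) (j := i + m) (w := i + m + 2) (j' := i + m + 2)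
        (a' := i + m + m + 4) (m := i + m + 2 + (i + m + 2)) (n := i + m + 2 + (i + m + 2))).symm
    have y := ih.append (extr_refl (b := true) (z := e) (u := i + m) (v := i + m + 2) (m := i + m + (i + m) + 2)
      (n := i + m + 2 + (i + m + 2)))
    have w := (Equ.refl (typed_cups e (i + m))).append
      (extr_exch true true e z (i := i + m) (a := i + m) (j := i + m + m + 2) (w := i) (j' := i + m + m)
        (a' := i + m + 2) (m := i + m + (i + m)) (n := i + m + 2 + (i + m + 2))).symm
    simp only [List.append_assoc] at x y w
    have := x.trans (y.trans w)
    simpa only [cups, List.append_assoc, add_assoc, Nat.reduceAdd, Nat.add_left_comm, Nat.add_comm, Nat.add_eq] using this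

lemma extr_caps (z : M) (i m : ℕ) : Equ (i + m + (i + m) + 2) 0
    (extr true z (i + m + m + 2) i ++ caps M (i + m + 2)) (extr false z i (i + m + m) ++ caps M (i + m)) := by
  induction m with
  | zero =>
    have x := ((extr_zagzig (i + 1) i z 0).cast (m' := i + 2 + i) (n' := i + 2 + i)).append
      ((extr_refl (b := false) (z := 0) (u := i) (v := i) (m := i + 2 + i) (n := i + i)).append
        (.refl (typed_caps (M := M) i)))
    have y := (mark_extr i i 0 z).append (.refl (typed_caps (M := M) i))
    rw [add_zero] at x y
    simpa only [caps, List.append_assoc, add_zero, add_assoc, Nat.reduceAdd, List.cons_append, List.nil_append] using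
      (x.trans y).cast (m' := i + i + 2)
  | succ m ih =>
    have x := (extr_exch false true 0 z (i := i + m + 2) (a := i + m) (j := i + m + m + 2) (w := i)
      (j' := i + m + m + 4) (a' := i + m + 2) (m := i + m + (i + m) + 4) (n := i + m + 2 + (i + m + 2))).symm.append
      (.refl (typed_caps (M := M) (i + m + 2)))
    have y := (extr_refl (b := false) (z := 0) (u := i + m + 2) (v := i + m) (m := i + m + (i + m) + 4)
      (n := i + m + (i + m) + 2)).append ih
    have w := (extr_exch false false z 0 (i := i) (a := i + m + m + 2) (j := i + m) (w := i + m) (j' := i + m + 2)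
      (a' := i + m + m) (m := i + m + (i + m) + 4) (n := i + m + (i + m))).symm.append (.refl (typed_caps (M := M) (i + m)))
    simp only [List.append_assoc] at x y w
    have := x.trans (y.trans w)
    simpa only [caps, List.append_assoc, add_assoc, Nat.reduceAdd, Nat.add_left_comm, Nat.add_comm, Nat.add_eq] using this

end Blocks

section Reduction

/-- The mark on an extremum with `i` strands to its left. -/
def sgn (i : ℕ) : ZMod 4 := 1 + 2 * i

lemma sgn_add_succ (i : ℕ) : sgn i + sgn (i + 1) = 0 := by
  rw [show sgn i + sgn (i + 1) = 4 * (1 + i) by simp only [sgn]; push_cast; ring, show (4 : ZMod 4) = 0 from rfl, zero_mul]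

lemma sgn_add_self (i : ℕ) : sgn i + sgn i = 2 := by
  rw [show sgn i + sgn i = 2 + 4 * i by simp only [sgn]; ring, show (4 : ZMod 4) = 0 from rfl, zero_mul, add_zero]

lemma sgn_add_two (i : ℕ) : sgn (i + 2) = sgn i := by
  rw [show sgn (i + 2) = sgn i + 4 by simp only [sgn]; push_cast; ring, show (4 : ZMod 4) = 0 from rfl, add_zero]

/-- A stack of minima and maxima, with `N` more strands on the right. -/
def stack (N : ℕ) (l : List (Bool × ℕ × ℕ)) : List (Letter (ZMod 4)) :=
  l.flatMap fun x => extr x.1 (sgn x.2.1) x.2.1 (x.2.2 + N)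

def StackTyped : ℕ → List (Bool × ℕ × ℕ) → ℕ → Prop
  | w, [], n => w = n
  | w, x :: l, n => w = x.2.1 + (bif x.1 then 0 else 2) + x.2.2 ∧
      StackTyped (x.2.1 + (bif x.1 then 2 else 0) + x.2.2) l n

lemma stackTyped_append {w n : ℕ} {l l' : List (Bool × ℕ × ℕ)} :
    StackTyped w (l ++ l') n ↔ ∃ k, StackTyped w l k ∧ StackTyped k l' n := by
  induction l generalizing w with
  | nil => simp [StackTyped]
  | cons x l ih => simp [StackTyped, ih, and_assoc]

lemma StackTyped.typed {w n : ℕ} {l : List (Bool × ℕ × ℕ)} (h : StackTyped w l n) (N : ℕ) :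
    Typed (w + N) (stack N l) (n + N) := by
  induction l generalizing w with
  | nil => exact congrArg (· + N) h
  | cons x l ih =>
    refine Typed.append (typed_extr.2 ?_) (ih h.2)
    have := h.1
    grind

lemma stack_append (N : ℕ) (l l' : List (Bool × ℕ × ℕ)) : stack N (l ++ l') = stack N l ++ stack N l' :=
  List.flatMap_append

lemma stack_slide {w w' : ℕ} {l : List (Bool × ℕ × ℕ)} (h : StackTyped w l w') (z : ZMod 4) (q i : ℕ) :
    Equ (w + q + i) (w' + q + 2 + i) (extr true z (w + q) i ++ stack (q + 2 + i) l)
      (stack (q + i) l ++ extr true z (w' + q) i) := by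
  induction l generalizing w with
  | nil =>
    obtain rfl := h
    grind [stack, extr_refl]
  | cons x l ih =>
    obtain ⟨b, u, v⟩ := x
    obtain ⟨rfl, h⟩ := h
    have x := (extr_exch b true (sgn u) z (i := u) (a := v + (q + i)) (a' := v + (q + 2 + i))
      (j := u + (bif b then 2 else 0) + v + q) (w := i) (j' := u + (bif b then 0 else 2) + v + q)
      (m := u + (bif b then 0 else 2) + v + q + i) (n := u + (bif b then 2 else 0) + v + (q + 2 + i))
      (by grind)).symm.append (.refl (h.typed (q + 2 + i)))
    have y := (extr_refl (b := b) (z := sgn u) (u := u) (v := v + (q + i))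
      (m := u + (bif b then 0 else 2) + v + q + i) (n := u + (bif b then 2 else 0) + v + q + i)
      (by grind)).append (ih h)
    simp only [List.append_assoc] at x y
    simpa only [stack, List.flatMap_cons, List.append_assoc] using (x.cast (n' := w' + q + 2 + i)).trans y

/-- A stack between nested minima and nested maxima. -/
def closedStack (e : ZMod 4) (n : ℕ) (l : List (Bool × ℕ × ℕ)) : List (Letter (ZMod 4)) :=
  cups e n ++ (stack n l ++ caps (ZMod 4) n)

lemma closedStack_rotate {e : ZMod 4} (he : e + e = 0) {i m : ℕ} {l : List (Bool × ℕ × ℕ)}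
    (h : StackTyped (i + m) l (i + m + 2)) :
    Eqv (closedStack e (i + m + 2) ((false, i, m) :: l)) (closedStack e (i + m) (l ++ [(false, i, m)])) := by
  have c := (Equ.refl (typed_caps (M := ZMod 4) (i + m + 2))).cast (m' := i + m + 2 + (m + 2 + i)) (n' := 0)
  have x := (cups_extr he (sgn i) i m).append
    (((Equ.refl (h.typed (m + 2 + i))).cast (m' := i + m + (i + m) + 2) (n' := i + m + 2 + (m + 2 + i))).append c)
  have y := (Equ.refl (typed_cups e (i + m))).append (((stack_slide h (sgn i) m i).cast (m' := i + m + (i + m))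
    (n' := i + m + 2 + (m + 2 + i))).append c)
  have w := (Equ.refl (typed_cups e (i + m))).append (((Equ.refl (h.typed (m + i))).cast (m' := i + m + (i + m))
    (n' := i + m + (i + m) + 2)).append (extr_caps (M := ZMod 4) (sgn i) i m))
  rw [show i + m + m + 2 = i + m + 2 + m by omega] at w x
  simp only [List.append_assoc] at x y w
  have := (x.trans (y.trans w)).eqv
  grind [closedStack, stack]

/-- Words that agree up to isotopy and circles with total `2`. -/
def Eqd (U V : List (Letter (ZMod 4))) : Prop := ∀ R : ZMod 4 → Prop, ¬ R 2 → numc R U = numc R V ∧ cfg R U = cfg R V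

lemma Eqd.trans {U V W : List (Letter (ZMod 4))} (h : Eqd U V) (h' : Eqd V W) : Eqd U W :=
  fun R hR => ⟨(h R hR).1.trans (h' R hR).1, (h R hR).2.trans (h' R hR).2⟩

lemma exists_cups_cap (l : List (Bool × ℕ × ℕ)) : (∀ x ∈ l, x.1 = true) ∨
    ∃ r i v l', (∀ x ∈ r, x.1 = true) ∧ l = r ++ (false, i, v) :: l' := by
  induction l with
  | nil => simp
  | cons x l ih =>
    obtain ⟨b, u, v⟩ := x
    cases b
    · exact .inr ⟨[], u, v, l, by simp⟩
    grind

lemma StackTyped.eq_add {w n : ℕ} {l : List (Bool × ℕ × ℕ)} (h : StackTyped w l n) (hl : ∀ x ∈ l, x.1 = true) :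
    n = w + 2 * l.length := by
  induction l generalizing w with
  | nil => exact h.symm
  | cons x l ih =>
    have e := h.1
    have := ih h.2 fun y hy => hl y (List.mem_cons_of_mem _ hy)
    grind

lemma closedStack_congr {e : ZMod 4} {n k k' : ℕ} {r p p' l : List (Bool × ℕ × ℕ)} (hr : StackTyped n r k)
    (hl : StackTyped k' l n) (h : Equ (k + n) (k' + n) (stack n p) (stack n p')) :
    Eqv (closedStack e n (r ++ (p ++ l))) (closedStack e n (r ++ (p' ++ l))) := by
  have := h.2.2 _ _ ((typed_cups e n).append (hr.typed n)) ((hl.typed n).append (typed_caps n))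
  grind [closedStack, stack_append]

lemma closedStack_loop {e : ZMod 4} {n j u k : ℕ} {r l : List (Bool × ℕ × ℕ)} (hr : StackTyped n r k)
    (hl : StackTyped k l n) (h : k = j + u) :
    Eqd (closedStack e n (r ++ ([(true, j, u), (false, j, u)] ++ l))) (closedStack e n (r ++ l)) := by
  intro R hR
  subst h
  have hP := (typed_cups e n).append (hr.typed n)
  have hQ := (hl.typed n).append (typed_caps (M := ZMod 4) n)
  have x := ((loop_equ j (u + n) (sgn j) (sgn j)).cast (m' := j + u + n) (n' := j + u + n)).2.2 _ _ hP hQ R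
  rw [sgn_add_self] at x
  have y := numc_loop (u := j) (v := u + n) (v' := u + n + 1) (z := 2) hP hQ R
  have w := cfg_loop (u := j) (v := u + n) (v' := u + n + 1) (cups e n ++ stack n r) (stack n l ++ caps (ZMod 4) n) hR
  rw [if_neg hR, add_zero] at y
  rw [y, w] at x
  simpa [closedStack, stack] using x

lemma closedStack_reduce {e : ZMod 4} (he : e + e = 0) (l : List (Bool × ℕ × ℕ)) (n : ℕ) (h : StackTyped n l n) :
    ∃ m, Eqd (closedStack e n l) (cups e m ++ caps (ZMod 4) m) := by
  induction hL : l.length using Nat.strong_induction_on generalizing l n with | _ L ihL =>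
  induction n using Nat.strong_induction_on generalizing l with | _ n ihn =>
  rcases exists_cups_cap l with hl | ⟨r, i, v, l', hr, rfl⟩
  · have := h.eq_add hl
    obtain rfl : l = [] := List.length_eq_zero_iff.1 (by omega)
    exact ⟨n, fun R _ => ⟨rfl, rfl⟩⟩
  induction r using List.reverseRecOn generalizing i v l' with
  | nil =>
    obtain ⟨rfl, h⟩ := h
    simp only [cond_false, add_zero] at h
    obtain ⟨m, hm⟩ := ihn (i + v) (by simp only [cond_false]; omega) (l' ++ [(false, i, v)])
      (stackTyped_append.2 ⟨i + v + 2, by rwa [Nat.add_right_comm] at h, by simp [StackTyped, Nat.add_right_comm]⟩) (by simpa using hL)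
    refine ⟨m, Eqd.trans (fun R _ => ?_) hm⟩
    have := closedStack_rotate he (i := i) (m := v) (l := l') (by rwa [Nat.add_right_comm] at h)
    simpa only [Nat.add_right_comm, cond_false, List.nil_append] using this R
  | append_singleton r x ihr =>
    obtain ⟨b, j, u⟩ := x
    obtain rfl : b = true := hr (b, j, u) (by simp)
    replace hr : ∀ x ∈ r, x.1 = true := fun x hx => hr x (by simp [hx])
    obtain ⟨k', h', h3, h4⟩ := stackTyped_append.1 h
    obtain ⟨k, h1, h2, h5⟩ := stackTyped_append.1 h'
    simp only [StackTyped, cond_true, cond_false, add_zero] at h2 h3 h4 h5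
    have hs : StackTyped n (r ++ l') n := stackTyped_append.2 ⟨k, h1, by rwa [show k = i + v by omega]⟩
    simp only [List.length_append, List.length_cons, List.length_nil] at hL
    rw [List.append_assoc]
    have step : ∀ p', Equ (k + n) (i + v + n) (stack n [(true, j, u), (false, i, v)]) (stack n p') →
        (∃ m, Eqd (closedStack e n (r ++ (p' ++ l'))) (cups e m ++ caps (ZMod 4) m)) →
        ∃ m, Eqd (closedStack e n (r ++ ([(true, j, u)] ++ (false, i, v) :: l'))) (cups e m ++ caps (ZMod 4) m) :=
      fun p' hp ⟨m, hm⟩ => ⟨m, Eqd.trans (fun R _ => closedStack_congr h1 h4 hp R) hm⟩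
    have short := ihL (r ++ l').length (by simp only [List.length_append]; omega) (r ++ l') n hs rfl
    rcases (by omega : i = j ∨ i = j + 1 ∨ j = i + 1 ∨ j + 2 ≤ i ∨ i + 2 ≤ j) with rfl | rfl | rfl | hij | hij
    · obtain rfl : u = v := by omega
      obtain ⟨m, hm⟩ := short
      exact ⟨m, (closedStack_loop h1 (by rwa [h2]) h2).trans hm⟩
    · exact step [] (by
        have := extr_zigzag j (v + n) (sgn j) (sgn (j + 1))
        rw [sgn_add_succ] at this
        simpa [stack, show u = v + 1 by omega, Nat.add_right_comm] using
          (this.trans (mark_zero _ _)).cast (m' := k + n) (n' := j + 1 + v + n)) short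
    · exact step [] (by
        have := extr_zagzig i (u + n) (sgn (i + 1)) (sgn i)
        rw [add_comm (sgn _), sgn_add_succ] at this
        simpa [stack, show v = u + 1 by omega, Nat.add_right_comm] using
          (this.trans (mark_zero _ _)).cast (m' := k + n) (n' := i + v + n)) short
    · obtain ⟨c, rfl⟩ := Nat.exists_eq_add_of_le hij
      refine step [(false, j + c, v), (true, j, c + v)] ?_ ?_
      · have := extr_exch true false (sgn j) (sgn (j + 2 + c)) (i := j) (a := u + n) (j := j + 2 + c) (w := v + n)
          (j' := j + c) (a' := c + v + n) (m := k + n) (n := j + 2 + c + v + n)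
        grind [sgn_add_two, stack]
      · refine ihr _ _ _ hr ?_ ?_
        · exact stackTyped_append.2 ⟨k, h1, by simp only [cond_false]; omega, by grind, by
            simp only [cond_true]
            rwa [show j + 2 + (c + v) = j + 2 + c + v by omega]⟩
        · change (r ++ (false, j + c, v) :: (true, j, c + v) :: l').length = L
          grind
    · obtain ⟨c, rfl⟩ := Nat.exists_eq_add_of_le hij
      refine step [(false, i, c + u), (true, i + c, u)] ?_ ?_
      · have := (extr_exch false true (sgn i) (sgn (i + 2 + c)) (i := i) (a := c + u + n) (j := i + c) (w := u + n)
          (j' := i + 2 + c) (a' := v + n) (m := k + n) (n := i + v + n)).symm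
        grind [sgn_add_two, stack]
      · refine ihr _ _ _ hr ?_ ?_
        · exact stackTyped_append.2 ⟨k, h1, by simp only [cond_false]; omega, by grind, by
            simp only [cond_true]
            rwa [show i + c + 2 + u = i + v by omega]⟩
        · change (r ++ (false, i, c + u) :: (true, i + c, u) :: l').length = L
          grind

end Reduction

section SkelSum

variable {M : Type} [AddCommMonoid M]

/-- The sum of the marks where a coloring of the skeleton holds. -/
noncomputable def stot (W : List (Letter M)) (g : ℕ → ℕ → Prop) : M := tot W fun k => g (skelLevel W k)

lemma stot_cons (l : Letter M) (W : List (Letter M)) (g : ℕ → ℕ → Prop) : stot (l :: W) g =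
    l.tot (g 0) (g (bif l.kind.isId then 0 else 1)) + stot W fun k => g (bif l.kind.isId then k else k + 1) := by
  cases h : l.kind.isId <;> simp [stot, tot, skelLevel, h, skelLevel_zero]

lemma skel_append (U V : List (Letter M)) : skel (U ++ V) = skel U ++ skel V := by
  induction U with
  | nil => rfl
  | cons l U ih => cases h : l.kind.isId <;> simp [skel, h, ih]

lemma stot_append (U V : List (Letter M)) (g : ℕ → ℕ → Prop) :
    stot (U ++ V) g = stot U g + stot V fun k => g ((skel U).length + k) := by
  induction U generalizing g with
  | nil => simp [stot, tot, skel]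
  | cons l U ih =>
    rw [List.cons_append, stot_cons, stot_cons, ih, add_assoc]
    cases h : l.kind.isId <;> simp [skel, h, Nat.add_right_comm]

/-- Words with the same skeleton and the same sums of marks. -/
def SameSkel (U V : List (Letter M)) : Prop := skel U = skel V ∧ ∀ g, stot U g = stot V g

lemma SameSkel.append {U V U' V' : List (Letter M)} (h : SameSkel U V) (h' : SameSkel U' V') :
    SameSkel (U ++ U') (V ++ V') :=
  ⟨by rw [skel_append, skel_append, h.1, h'.1], fun g => by rw [stot_append, stot_append, h.2, h'.2, h.1]⟩

lemma sameSkel_extr (b : Bool) (n : ℕ) :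
    SameSkel (extr b (0 : M) n n) [⟨n, bif b then .cup else .cap, n⟩] := by
  cases b <;> refine ⟨rfl, fun g => ?_⟩ <;> simp [extr, stot, tot, Letter.tot, Kind.tot, valIf]

/-- Nested minima without marks. -/
def cupWord (M : Type) (n : ℕ) : List (Letter M) := (List.range n).map fun k => ⟨k, .cup, k⟩

def capWord (M : Type) (n : ℕ) : List (Letter M) := (List.range n).reverse.map fun k => ⟨k, .cap, k⟩

lemma sameSkel_cups (n : ℕ) : SameSkel (cups (0 : M) n) (cupWord M n) := by
  induction n with
  | zero => exact ⟨rfl, fun _ => rfl⟩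
  | succ n ih => simpa [cups, cupWord, List.range_succ] using ih.append (sameSkel_extr true n)

lemma sameSkel_caps (n : ℕ) : SameSkel (caps M n) (capWord M n) := by
  induction n with
  | zero => exact ⟨rfl, fun _ => rfl⟩
  | succ n ih => simpa [caps, capWord, List.range_succ] using (sameSkel_extr false n).append ih

lemma letters_nested (m n : ℕ) : letters M (nested m n) = ((List.range n).map fun k => ⟨m + k, .cup, m + k⟩) ++
    (List.range n).reverse.map fun k => ⟨m + k, .cap, m + k⟩ := by
  induction n generalizing m with
  | zero => rfl
  | succ n ih =>
    rw [nested, letters, List.map_cons, List.map_append, ← letters, ih, List.range_succ_eq_map]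
    simp [Shape.kind, Function.comp_def, Nat.add_assoc, Nat.add_comm 1]

lemma skel_of_plain {W : List (Letter M)} (h : ∀ l ∈ W, l.kind = .cup ∨ l.kind = .cap) :
    skel W = W ∧ (∀ g, stot W g = 0) ∧ ∀ V, skelLevel (W ++ V) W.length = W.length := by
  induction W with
  | nil => exact ⟨rfl, fun _ => rfl, skelLevel_zero⟩
  | cons l W ih =>
    obtain ⟨h1, h2, h3⟩ := ih fun x hx => h x (List.mem_cons_of_mem _ hx)
    obtain ⟨u, k, v⟩ := l
    rcases h _ (List.mem_cons_self ..) with rfl | rfl <;>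
      exact ⟨congrArg (List.cons _) h1, fun g => by rw [stot_cons, h2]; simp [Letter.tot, Kind.tot],
        fun V => congrArg (· + 1) (h3 V)⟩

lemma cfg_nested (m : ℕ) : cfg (· = 0) (cups (0 : M) m ++ caps M m) = concentric m := by
  have e : letters M (nested 0 m) = cupWord M m ++ capWord M m := by simpa [cupWord, capWord] using letters_nested (M := M) 0 m
  have p := skel_of_plain (W := cupWord M m ++ capWord M m) (by simp [cupWord, capWord]; aesop)
  have s := (sameSkel_cups (M := M) m).append (sameSkel_caps m)
  rw [(eq_of_skel (U := cups (0 : M) m ++ caps M m) (V := letters M (nested 0 m)) (R := (· = 0)) (R' := fun _ => True)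
    s.1 (by rw [e]) fun c _ => iff_true_intro ((s.2 fun k i => pt _ k i = c).trans (p.2.1 _))).2]
  exact (cfg_eq (letters_isShape (M := M) _) (typed_letters (nested_isFlat 0 m)) _ (P := ⟨nested 0 m, nested_isFlat 0 m⟩)
    (slices_letters _).symm subset_rfl fun p hp => ⟨fun _ => trivial, fun _ => ⟨p, hp, rfl⟩⟩).trans (sub_circles _)

lemma numc_nested (e : M) (R : M → Prop) [Decidable (R e)] (m : ℕ) :
    numc R (cups e m ++ caps M m) = if R e then m else 0 := by
  induction m with
  | zero =>
    rw [ite_self, numc, show {c ∈ circ (cups e 0 ++ caps M 0) | R (totc _ c)} = ∅ from ?_, Set.ncard_empty]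
    refine Set.eq_empty_of_forall_notMem ?_
    rintro _ ⟨⟨⟨k, hk, i, rfl⟩, hc⟩, -⟩
    obtain rfl : k = 0 := Nat.le_zero.1 hk
    exact hc i rfl
  | succ m ih =>
    have x := ((loop_equ m m e 0).2.2 _ _ (typed_cups e m) (typed_caps m) R).1
    have y := numc_loop (u := m) (v := m) (v' := m + 1) (z := e) (typed_cups e m) (typed_caps m) R
    rw [add_zero] at x
    rw [y, ih] at x
    simp only [List.append_assoc, cups, caps] at x ⊢
    rw [x]
    split_ifs <;> rfl

end SkelSum

section ClosedBraids

lemma skel_cups {M : Type} [AddCommMonoid M] (e : M) (n : ℕ) : skel (cups e n) = cupWord M n := by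
  induction n with
  | zero => rfl
  | succ n ih => rw [cups, skel_append, ih, cupWord, cupWord, List.range_succ, List.map_append]; rfl

lemma skel_cups_length {M : Type} [AddCommMonoid M] (e : M) (n : ℕ) : (skel (cups e n)).length = n := by
  rw [skel_cups, cupWord, List.length_map, List.length_range]

lemma cups_coloring {M : Type} [AddCommMonoid M] {e : M} {n : ℕ} {g : ℕ → ℕ → Prop} (h : Coloring (skel (cups e n)) g) :
    (∀ i j, i + j + 1 = n + n → i < n → g n i = g n j) ∧ (∀ j, g n (n + n + j) = g 0 j) ∧
      stot (cups e n) g = ∑ j ∈ Finset.range n, valIf (g n (n + j)) e := by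
  induction n with
  | zero => aesop
  | succ n ih =>
    rw [cups, skel_append, coloring_append, skel_cups_length] at h
    obtain ⟨h1, h2, h3⟩ := ih h.1
    obtain ⟨e1, e2, e3⟩ := cup_coloring.1 h.2.1
    simp only [add_zero] at e1 e2 e3
    refine ⟨fun i j hij hi => ?_, fun j => ?_, ?_⟩
    · rcases Nat.lt_succ_iff_lt_or_eq.1 hi with hi | rfl
      · obtain ⟨c, rfl⟩ : ∃ c, j = n + 2 + c := ⟨j - (n + 2), by omega⟩
        grind
      · rwa [show j = i + 1 by omega]
    · rw [← h2, show n + 1 + (n + 1) + j = n + 2 + (n + j) by omega, ← e2, add_assoc]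
    · rw [cups, stot_append, h3, Finset.sum_range_succ', skel_cups_length]
      refine congrArg₂ (· + ·) (Finset.sum_congr rfl fun j _ => ?_) ?_
      · grind
      · simp [extr, stot, tot, Letter.tot, Kind.tot, skelLevel, Kind.isId, e3]

lemma caps_coloring {n : ℕ} {g : ℕ → ℕ → Prop} (h : Coloring (skel (caps (ZMod 4) n)) g) :
    ∀ i j, i + j + 1 = n + n → i < n → g 0 i = g 0 j := by
  induction n generalizing g with
  | zero => omega
  | succ n ih =>
    rw [caps, skel_append, coloring_append] at h
    have h1 := ih h.2
    obtain ⟨e1, e2, e3⟩ := cap_coloring.1 h.1.1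
    intro i j hij hi
    rcases Nat.lt_succ_iff_lt_or_eq.1 hi with hi | rfl
    · obtain ⟨c, rfl⟩ : ∃ c, j = n + 2 + c := ⟨j - (n + 2), by omega⟩
      rw [e1 i hi, e2]
      exact h1 i (n + c) (by omega) hi
    · rwa [show j = i + 1 by omega]

def hooks (z : ℕ → ZMod 4) (N : ℕ) (γ : List (ℕ × ℕ)) : List (Letter (ZMod 4)) :=
  γ.map fun x => ⟨x.1, .horiz (z x.1), x.2 + N⟩

lemma skel_hooks (z : ℕ → ZMod 4) (N : ℕ) (γ : List (ℕ × ℕ)) : skel (hooks z N γ) = hooks 0 N γ := by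
  induction γ with
  | nil => rfl
  | cons x γ ih => exact congrArg (List.cons _) ih

/-- The difference between two ways to put marks on smoothings. -/
noncomputable def gaugeSum (n : ℕ) (f : ℕ → Prop) : ZMod 4 := ∑ j ∈ Finset.range n, valIf (f j) (2 * (j / 2 : ℕ))

lemma valIf_add_self (p : Prop) (k : ℕ) : valIf p (2 * k : ZMod 4) + valIf p (2 * k : ZMod 4) = 0 := by
  rw [valIf]
  grind

lemma gaugeSum_add_self (n : ℕ) (f : ℕ → Prop) : gaugeSum n f + gaugeSum n f = 0 := by
  rw [gaugeSum, ← Finset.sum_add_distrib]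
  exact Finset.sum_eq_zero fun j _ => valIf_add_self _ _

lemma gaugeSum_hook {i v : ℕ} {b t : ℕ → Prop} (h1 : ∀ j < i, b j = t j) (h2 : ∀ j, b (i + 2 + j) = t (i + 2 + j))
    (h3 : b i = b (i + 1)) (h4 : t i = t (i + 1)) : valIf (b i) (sgn i) + valIf (t (i + 1)) (sgn i) =
      valIf (b i) 1 + valIf (t (i + 1)) 1 + (gaugeSum (i + 2 + v) b + gaugeSum (i + 2 + v) t) := by
  rw [gaugeSum, gaugeSum, ← Finset.sum_add_distrib, Finset.sum_eq_add i (i + 1) (by omega)]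
  · have e : (2 * (i / 2 : ℕ) + 2 * ((i + 1) / 2 : ℕ) : ZMod 4) = 2 * i := by
      rw [← mul_add, ← Nat.cast_add, show i / 2 + (i + 1) / 2 = i by omega]
    rw [← h3, ← h4, sgn]
    simp only [valIf]
    split_ifs <;> first | rfl | linear_combination -e | linear_combination -2 * e
  · intro j _ hj
    have : b j = t j := by
      rcases Nat.lt_or_ge j i with h | h
      · exact h1 j h
      · obtain ⟨c, rfl⟩ : ∃ c, j = i + 2 + c := ⟨j - (i + 2), by omega⟩
        exact h2 c
    rw [this]
    exact valIf_add_self _ _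
  · exact fun h => absurd (Finset.mem_range.2 (by omega)) h
  grind

lemma hooks_coloring {n : ℕ} {γ : List (ℕ × ℕ)} (hγ : ∀ x ∈ γ, x.1 + 2 + x.2 = n) {g : ℕ → ℕ → Prop}
    (h : Coloring (hooks 0 n γ) g) : (∀ j, g γ.length (n + j) = g 0 (n + j)) ∧ stot (hooks sgn n γ) g =
      stot (hooks 1 n γ) g + (gaugeSum n (g 0) + gaugeSum n (g γ.length)) := by
  induction γ generalizing g with
  | nil => exact ⟨fun _ => rfl, ((congrArg (_ + ·) (gaugeSum_add_self n (g 0))).trans (add_zero _)).symm⟩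
  | cons x γ ih =>
    obtain ⟨i, v⟩ := x
    obtain rfl : i + 2 + v = n := hγ _ (List.mem_cons_self ..)
    obtain ⟨e1, e2, e3, e4⟩ := horiz_coloring.1 h.1
    obtain ⟨h1, h2⟩ := ih (fun x hx => hγ x (List.mem_cons_of_mem _ hx)) h.2
    refine ⟨fun j => (h1 j).trans ?_, ?_⟩
    · rw [zero_add, add_assoc, e2]
    · have k := gaugeSum_hook (v := v) e1 e2 e3 e4
      have s := gaugeSum_add_self (i + 2 + v) (g 1)
      simp only [hooks, List.map_cons, stot_cons, Kind.isId, cond_false, Letter.tot, Kind.tot, add_zero] at h2 ⊢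
      rw [k, h2]
      simp only [zero_add, List.length_cons, Pi.one_apply]
      linear_combination s

/-- The word of a state of a closed braid, with marks where the circles pass the axis. -/
def closedHooks (e : ZMod 4) (z : ℕ → ZMod 4) (n : ℕ) (γ : List (ℕ × ℕ)) : List (Letter (ZMod 4)) :=
  cups e n ++ (hooks z n γ ++ caps (ZMod 4) n)

lemma stot_closedHooks {e : ZMod 4} {n : ℕ} {γ : List (ℕ × ℕ)} (hγ : ∀ x ∈ γ, x.1 + 2 + x.2 = n)
    {g : ℕ → ℕ → Prop} (h : Coloring (skel (closedHooks e sgn n γ)) g) : stot (closedHooks e sgn n γ) g =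
      stot (closedHooks 0 1 n γ) g + ∑ j ∈ Finset.range n, valIf (g n (n + j)) e := by
  rw [closedHooks, skel_append, coloring_append, skel_append, coloring_append, skel_hooks, skel_cups_length] at h
  obtain ⟨h1, -, h2⟩ := cups_coloring h.1
  obtain ⟨h3, h4⟩ := hooks_coloring hγ h.2.1
  have h5 := caps_coloring h.2.2
  have h0 : stot (cups (0 : ZMod 4) n) g = 0 := ((sameSkel_cups n).2 g).trans ((skel_of_plain (by simp [cupWord])).2.1 g)
  have e : gaugeSum n (g (n + 0)) = gaugeSum n (g (n + γ.length)) := Finset.sum_congr rfl fun j hj => by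
    obtain ⟨c, hc⟩ : ∃ c, j + (n + c) + 1 = n + n := ⟨n - 1 - j, by have := Finset.mem_range.1 hj; omega⟩
    have k1 := h1 j (n + c) hc (Finset.mem_range.1 hj)
    grind [hooks]
  rw [closedHooks, closedHooks, stot_append, stot_append, stot_append, stot_append, h0, h2,
    skel_cups_length, skel_cups_length, skel_hooks, skel_hooks, h4, e, gaugeSum_add_self]
  ring

lemma skel_closedHooks (e : ZMod 4) (z : ℕ → ZMod 4) (n : ℕ) (γ : List (ℕ × ℕ)) :
    skel (closedHooks e z n γ) = cupWord _ n ++ (hooks 0 n γ ++ capWord _ n) := by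
  rw [closedHooks, skel_append, skel_append, skel_hooks, skel_cups, (sameSkel_caps n).1,
    (skel_of_plain (W := capWord _ n) (by simp [capWord])).1]

lemma closedHooks_reduce {e : ZMod 4} (he : e + e = 0) {n : ℕ} {γ : List (ℕ × ℕ)} (hγ : ∀ x ∈ γ, x.1 + 2 + x.2 = n) :
    ∃ m, Eqd (closedHooks e sgn n γ) (cups e m ++ caps (ZMod 4) m) := by
  have key : ∃ l, StackTyped n l n ∧ Equ (n + n) (n + n) (hooks sgn n γ) (stack n l) := by
    induction γ with
    | nil => exact ⟨[], rfl, .refl rfl⟩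
    | cons x γ ih =>
      obtain ⟨i, v⟩ := x
      obtain ⟨l, hl, h⟩ := ih fun x hx => hγ x (List.mem_cons_of_mem _ hx)
      obtain rfl : i + 2 + v = n := hγ _ (List.mem_cons_self ..)
      refine ⟨(false, i, v) :: (true, i, v) :: l, ⟨rfl, rfl, hl⟩, ?_⟩
      have x := (horiz_equ i (v + (i + 2 + v)) (sgn i)).trans
        ((cup_mark i (v + (i + 2 + v)) (sgn i)).symm.ctx (k := i + 2 + (v + (i + 2 + v))) (extr false (sgn i) i _) []
          (hP := typed_extr.2 ⟨rfl, rfl⟩))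
      exact (x.cast (m' := i + 2 + v + (i + 2 + v)) (n' := i + 2 + v + (i + 2 + v))).append h
  obtain ⟨l, hl, h⟩ := key
  obtain ⟨m, hm⟩ := closedStack_reduce he l n hl
  refine ⟨m, Eqd.trans (fun R _ => ?_) hm⟩
  simpa only [closedHooks, closedStack, List.append_assoc] using h.2.2 _ _ (typed_cups e n) (typed_caps n) R

end ClosedBraids

section Annulus

lemma forall₂_append_left {α β : Type} {R : α → β → Prop} {L₁ L₂ : List α} {W : List β} (h : List.Forall₂ R (L₁ ++ L₂) W) :
    ∃ W₁ W₂, W = W₁ ++ W₂ ∧ List.Forall₂ R L₁ W₁ ∧ List.Forall₂ R L₂ W₂ := by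
  induction L₁ generalizing W with
  | nil => exact ⟨[], W, rfl, .nil, h⟩
  | cons a L ih =>
    obtain ⟨h1, h2⟩ | ⟨h1, h2⟩ := h
    obtain ⟨W₁, W₂, rfl, h3, h4⟩ := ih h2
    exact ⟨_ :: W₁, W₂, rfl, .cons h1 h3, h4⟩

lemma eq_map_of_forall₂ {α β δ : Type} {R : α → β → Prop} {f : δ → α} {g : δ → β} {l : List δ} {W : List β}
    (h : List.Forall₂ R (l.map f) W) (hg : ∀ k x, R (f k) x → x = g k) : W = l.map g := by
  induction l generalizing W with
  | nil => cases h; rfl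
  | cons k l ih =>
    obtain ⟨h1, h2⟩ | ⟨h1, h2⟩ := h
    rw [List.map_cons, ih h2, hg _ _ h1]

variable {n : ℕ} {β : List (Fin (n - 1) × Bool)}

lemma exists_hooks {W : List (Letter (ZMod 4))} (h : List.Forall₂ (fun l x => ∃ A, x = Layer.letter A l)
    (β.map fun g => (⟨List.replicate g.1 true, .cross true true g.2,
      List.replicate (n - 2 - g.1) true ++ List.replicate n false⟩ : Layer)) W) :
    ∃ γ : List (ℕ × ℕ), (∀ x ∈ γ, x.1 + 2 + x.2 = n) ∧ SameSkel W (hooks 1 n γ) := by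
  induction β generalizing W with
  | nil => cases h; exact ⟨[], by simp, rfl, fun _ => rfl⟩
  | cons g β ih =>
    obtain ⟨h1, h2⟩ | ⟨⟨A, rfl⟩, h2⟩ := h
    obtain ⟨γ, hγ, hW⟩ := ih h2
    by_cases hA : A = g.2
    · refine ⟨γ, hγ, SameSkel.append (U := [_]) (V := []) ⟨?_, fun f => ?_⟩ hW⟩
      · simp [Layer.letter, hA, skel, Kind.isId]
      · rw [stot_cons]
        simp [Layer.letter, hA, stot, tot, Letter.tot, Kind.tot, markOf, valIf_zero]
    · refine ⟨(g.1, n - 2 - g.1) :: γ, fun x hx => ?_, SameSkel.append (U := [_]) (V := [_]) ?_ hW⟩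
      · rcases List.mem_cons.1 hx with rfl | hx
        · omega
        · exact hγ x hx
      · simp [Layer.letter, hA, SameSkel, markOf]

lemma word_closedBraid (s : (closedBraid n β).State) : ∃ (γ : List (ℕ × ℕ)) (T : List (Letter (ZMod 4))),
    (∀ x ∈ γ, x.1 + 2 + x.2 = n) ∧ s.word = cupWord _ n ++ T ∧ SameSkel s.word (closedHooks 0 1 n γ) := by
  have h : List.Forall₂ (fun l x => ∃ A, x = Layer.letter A l) (closedBraidWord n β) s.word := by
    refine List.forall₂_iff_get.2 ⟨(List.length_ofFn ..).symm, fun i h1 h2 => ⟨s.choice ⟨i, h1⟩, ?_⟩⟩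
    simp [Diagram.State.word]
    rfl
  rw [closedBraidWord] at h
  obtain ⟨W, W₃, e, h, h3⟩ := forall₂_append_left h
  obtain ⟨W₁, W₂, rfl, h1, h2⟩ := forall₂_append_left h
  obtain ⟨γ, hγ, hW⟩ := exists_hooks h2
  have e1 : W₁ = cupWord _ n := eq_map_of_forall₂ h1 fun k x ⟨A, hA⟩ => by simp [hA, Layer.letter]
  have e3 : W₃ = capWord _ n := eq_map_of_forall₂ h3 fun k x ⟨A, hA⟩ => by simp [hA, Layer.letter]
  subst e1 e3
  rw [List.append_assoc] at e
  have symm : ∀ {U V : List (Letter (ZMod 4))}, SameSkel U V → SameSkel V U := fun h => ⟨h.1.symm, fun g => (h.2 g).symm⟩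
  exact ⟨γ, _, hγ, e, e ▸ (symm (sameSkel_cups n)).append (hW.append (symm (sameSkel_caps n)))⟩

lemma closedBraid_state (s : (closedBraid n β).State) :
    s.hCircles = s.essential n n ∧ s.config = concentric (s.essential n n).ncard := by
  classical
  obtain ⟨γ, T, hγ, hT, hs⟩ := word_closedBraid s
  have sk : ∀ e, skel (closedHooks e sgn n γ) = skel s.word := fun e => by
    rw [hs.1, skel_closedHooks, skel_closedHooks]
  obtain ⟨F, F1, F2, F3⟩ := exists_skel_strand s.word
  have fin : (circ (skel s.word)).Finite := F3 ▸ (circ_finite s.typed_word).image F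
  have tot_eq : ∀ (e : ZMod 4) (c : Cp (skel s.word)),
      (tot (closedHooks e sgn n γ) fun k i => pt (skel s.word) (skelLevel (closedHooks e sgn n γ) k) i = c) =
      skelTot s.word c + ∑ j ∈ Finset.range n, valIf (pt (skel s.word) n (n + j) = c) e := by
    intro e c
    have h := stot_closedHooks hγ (e := e) (g := fun k i => pt (skel s.word) k i = c)
      (by rw [sk]; exact (coloring_pt (skel s.word)).map (· = c))
    rwa [← hs.2] at h
  have all : ∀ (e : ZMod 4), e + e = 0 → ∀ c ∈ circ (skel s.word),
      skelTot s.word c + ∑ j ∈ Finset.range n, valIf (pt (skel s.word) n (n + j) = c) e = 2 ∨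
      skelTot s.word c + ∑ j ∈ Finset.range n, valIf (pt (skel s.word) n (n + j) = c) e = e := by
    intro e he c hc
    obtain ⟨m, hm⟩ := closedHooks_reduce he hγ
    by_contra h
    have h1 := (hm (fun z => z ≠ 2 ∧ z ≠ e) (by simp)).1
    rw [numc_of_skel (sk e), numc_nested, if_neg (by simp), Set.ncard_eq_zero (fin.subset fun c h => h.1)] at h1
    refine (Set.eq_empty_iff_forall_notMem.1 h1) c ⟨hc, ?_⟩
    rwa [tot_eq, ← not_or]
  have zero : ∀ c ∈ circ (skel s.word), skelTot s.word c = 2 ∨ skelTot s.word c = 0 := fun c hc => by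
    simpa [valIf] using all 0 (add_zero 0) c hc
  have odd : ∀ c ∈ circ (skel s.word),
      (skelTot s.word c = 0 ↔ Odd {i | n ≤ i ∧ pt (skel s.word) n i = c}.ncard) := by
    intro c hc
    have h := all 2 rfl c hc
    have e : {i | n ≤ i ∧ pt (skel s.word) n i = c} =
        ((Finset.range n).filter fun j => pt (skel s.word) n (n + j) = c).map (addLeftEmbedding n) := by
      ext i
      simp only [Finset.coe_map, Finset.coe_filter, Finset.mem_range, Set.mem_image, Set.mem_ofPred_eq, addLeftEmbedding_apply]
      constructor
      · rintro ⟨hi, h⟩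
        obtain ⟨j, rfl⟩ := Nat.exists_eq_add_of_le hi
        refine ⟨j, ⟨Nat.lt_of_not_le fun hj => ?_, h⟩, rfl⟩
        obtain ⟨j, rfl⟩ := Nat.exists_eq_add_of_le hj
        have h0 : Coloring (skel (closedHooks 0 1 n γ)) fun k i => pt (skel s.word) k i = c := by
          rw [← hs.1]; exact (coloring_pt (skel s.word)).map (· = c)
        rw [closedHooks, skel_append, coloring_append] at h0
        rw [← add_assoc] at h
        exact hc.2 j (((cups_coloring h0.1).2.1 j).mp h).symm
      · rintro ⟨j, ⟨hj, h⟩, rfl⟩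
        exact ⟨Nat.le_add_right _ _, h⟩
    rw [e, Set.ncard_coe_finset, Finset.card_map]
    simp only [or_self, valIf, Finset.sum_ite, Finset.sum_const_zero, add_zero, Finset.sum_const] at h
    have two : ∀ k : ℕ, (2 * k) • (2 : ZMod 4) = 0 := fun k => by
      rw [mul_comm, mul_smul, show 2 • (2 : ZMod 4) = 0 from rfl, smul_zero]
    rcases Nat.even_or_odd' (((Finset.range n).filter fun j => pt (skel s.word) n (n + j) = c).card) with ⟨k, hk | hk⟩ <;>
      rw [hk] at h ⊢
    · rw [two, add_zero] at h
      simp [h, show (2 : ZMod 4) ≠ 0 by decide]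
    · rw [add_smul, two, zero_add, one_smul, add_eq_right] at h
      simp [h]
  have htype : ∀ c ∈ circ (skel s.word), (HType (skelTot s.word c) ↔ skelTot s.word c = 0) := fun c hc => by
    rcases zero c hc with h | h <;> rw [h, HType] <;> decide
  have tc : ∀ p ∈ points s.picture.1, ((s.breakPoints (comp _ p) : ℕ) : ZMod 4) = skelTot s.word (F (pt s.word p.1 p.2)) ∧
      F (pt s.word p.1 p.2) ∈ circ (skel s.word) ∧ p.1 ≤ s.word.length := by
    intro p hp
    have hp' := s.slices_word ▸ hp
    obtain ⟨l, hl, -⟩ := (mem_points_iff s.word_isShape).1 hp'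
    have hk : p.1 ≤ s.word.length := (List.getElem?_eq_some_iff.1 hl).1.le
    exact ⟨(s.breakPoints_eq hp).trans (skelTot_eq F1 F2 ⟨p.1, hk, p.2, rfl⟩).symm, F3 ▸ ⟨_,
      (pt_mem_circ_iff s.word_isShape s.typed_word hk).2 hp', rfl⟩, hk⟩
  have hess : s.hCircles = s.essential n n := by
    ext c
    refine and_congr_right ?_
    rintro ⟨p, hp, rfl⟩
    obtain ⟨h1, h2, hk⟩ := tc p hp
    have hn : skelLevel s.word n = n := by
      have := (skel_of_plain (W := cupWord (ZMod 4) n) (by simp [cupWord])).2.2 T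
      grind [cupWord]
    have hn' : n ≤ s.word.length := by simp [hT, cupWord]
    rw [← hType_iff, h1, htype _ h2, odd _ h2]
    refine iff_of_eq (congrArg (fun x : Set ℕ => Odd x.ncard) (Set.ext fun i => and_congr_right fun _ => ?_))
    have e1 := comp_eq_iff s.word_isShape s.typed_word (p := p) (q := (n, i)) (s.slices_word ▸ hp)
    have e2 := mem_points_of_sameStrand s.word_isShape s.typed_word (p := p) (q := (n, i))
    rw [← s.slices_word] at e1 e2
    have e3 := F1 n i
    rw [hn] at e3
    rw [← e3, eq_comm (a := comp _ _), e1, ← pt_eq_iff]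
    refine ⟨fun h => ?_, fun h => congrArg F h.2.symm⟩
    have := F2 ⟨n, hn', i, rfl⟩ ⟨_, hk, _, rfl⟩ h
    exact ⟨(e2 (pt_eq_iff.1 this.symm)).1 hp, this.symm⟩
  refine ⟨hess, ?_⟩
  obtain ⟨m, hm⟩ := closedHooks_reduce (add_zero 0) hγ
  obtain ⟨h1, h2⟩ := hm (· = 0) (by decide)
  have h3 := eq_of_skel (sk 0) rfl (R := (· = 0)) (R' := HType) fun c hc => by
    rw [tot_eq]
    simpa [valIf, skelTot] using (htype c hc).symm
  have hp : ∀ p ∈ points s.picture.1, (comp _ p ∈ s.hCircles ↔ HType (totc s.word (pt s.word p.1 p.2))) := fun p hp => by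
    rw [← s.breakPoints_eq hp, hType_iff]
    exact ⟨fun h => h.2, fun h => ⟨⟨p, hp, rfl⟩, h⟩⟩
  rw [h3.1, numc_nested, if_pos rfl, numc_eq s.word_isShape s.typed_word HType s.slices_word (K := s.hCircles) (fun c hc => hc.1)
    hp] at h1
  rw [h3.2, cfg_nested, cfg_eq s.word_isShape s.typed_word HType s.slices_word (K := s.hCircles) (fun c hc => hc.1)
    hp] at h2
  rw [← hess, h1, ← h2]
  rfl

lemma ofPolynomial_sum {ι : Type} (t : Finset ι) (f : ι → Polynomial ℤ[T;T⁻¹]) :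
    ofPolynomial (∑ i ∈ t, f i) = ∑ i ∈ t, ofPolynomial (f i) := by
  classical
  induction t using Finset.induction_on with
  | empty => exact Polynomial.sum_zero_index _
  | insert i t hi ih =>
    rw [Finset.sum_insert hi, Finset.sum_insert hi, ← ih]
    exact Polynomial.sum_add_index _ _ _ (fun _ => Finsupp.single_zero _) fun _ _ _ => Finsupp.single_add ..

lemma normalized_closedBraid (n : ℕ) (β : List (Fin (n - 1) × Bool)) :
    (closedBraid n β).normalized = ofPolynomial ((closedBraid n β).hostePrzytycki n n) := by
  rw [Diagram.normalized, Diagram.bracket, Diagram.hostePrzytycki, Finset.smul_sum, Finset.smul_sum, ofPolynomial_sum]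
  refine Finset.sum_congr rfl fun s _ => ?_
  obtain ⟨h1, h2⟩ := closedBraid_state s
  have e : s.dCircles = s.contractible n n := by
    ext c
    rw [Diagram.State.contractible, ← h1]
    simp only [Diagram.State.dCircles, Diagram.State.hCircles, Set.mem_ofPred_eq, Set.mem_sdiff, not_and,
      Nat.not_even_iff_odd]
    tauto
  rw [Polynomial.smul_monomial, Finsupp.smul_single, h2, e, ofPolynomial]
  simp_all

end Annulus

open LaurentPolynomial in
theorem theorem1 :
    -- invariance under global reversal of the orientation
    (∀ D : Diagram, D.reverse.bracket = D.bracket) ∧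
    -- invariance under braid-like isotopy
    (∀ D D' : Diagram, D.BraidLikeIsotopic D' → D.bracket = D'.bracket) ∧
    -- (1) the skein relation of the Jones polynomial, with `t = A ^ 4`:
    -- `t V(Dp) - t⁻¹ V(Dm) = (t ^ (-1/2) - t ^ (1/2)) V(D0)`
    (∀ Dp Dm D0 : Diagram, Diagram.SkeinTriple Dp Dm D0 →
      (T 4 : ℤ[T;T⁻¹]) • Dp.normalized - (T (-4) : ℤ[T;T⁻¹]) • Dm.normalized =
        (T (-2) - T 2 : ℤ[T;T⁻¹]) • D0.normalized) ∧
    -- (1) infinitely many values on (regularly isotopic) diagrams of the trivial knot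
    {V : Gam | ∃ D : Diagram, D.RegularlyIsotopic Diagram.roundCircle ∧ D.normalized = V}.Infinite ∧
    -- (2) for closed braids, the Hoste–Przytycki invariant in the complement of the braid axis
    (∀ (n : ℕ) (β : List (Fin (n - 1) × Bool)),
      (closedBraid n β).normalized = ofPolynomial ((closedBraid n β).hostePrzytycki n n)) ∧
    -- (3) the leading term
    (∀ D : Diagram, ∃ rest : Gam,
      D.bracket = Finsupp.single D.seifert (T D.writhe) + rest ∧
        ∀ c ∈ rest.support, c.size < D.seifert.size) := by
  exact ⟨bracket_reverse, fun D D' h => bracket_of_braidLikeIsotopic h, fun Dp Dm D0 h => normalized_skein h,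
    Diagram.infinite_values, normalized_closedBraid, Diagram.exists_rest⟩
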